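/- **Setting.** Let $N=\mathbb Z^2$, $N_{\mathbb R}=\mathbb R^2$ with the Euclidean inner product. A *rational tropical curve* is a proper map $h:\Gamma\to\mathbb R^2$, up to isomorphism, where $\Gamma$ is obtained from a finite weighted tree without divalent vertices by removing the one-valent vertices (and has at least one vertex), such that $h$ embeds every edge into an affine line of rational slope and at each vertex $V$ of $\Gamma$ one has $\sum_{E\ni V} w(E)\,u_{(V,E)}=0$; here $w(E)\in\mathbb Z_{>0}$ is the weight and $u_{(V,E)}\in N$ the primitive vector from $V$ in the direction of $h(E)$. A rational tropical curve *with one stop* $h:\Gamma_s\to\mathbb R^2$ is defined in the same way, except that the one-valent vertex at the end of one unbounded edge (the *stopping edge*) is kept; this vertex is the *stop*, no balancing is required there, and the stopping edge is mapped to a segment ending at $h(\text{stop})$. An $l$-marking is a choice of $l$ distinct edges $\mathbf E=(E_1,\dots,E_l)$, none of them the stopping edge. The *degree* is the function $\Delta:N\setminus\{0\}\to\mathbb N$ for which $\Delta(x)$ is the number of unbounded edges $E$ (not counting the stopping edge), with vertex $V$, such that $w(E)u_{(V,E)}=x$; put $|\Delta|=\sum_x\Delta(x)$. An $l$-marked curve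 *matches* $\mathbf A=(A_1,\dots,A_l)$, $A_i\in\mathbb Q^2$, if $A_i\in h(E_i)$ for all $i$. For a curve with a stop put $E_0=$ the stopping edge, and let $\Gamma^{[0]}$ be the set of vertices other than the stop. For an edge $E$ let $\partial^-E\in\Gamma^{[0]}$ be one of its vertices, chosen arbitrarily if there are two; then let $\partial^+E$ be the other one. The curve is counted with weight $$\mathfrak W=\Big(\prod_{E\ \text{bounded or stopping}} w(E)\Big)\Big(\prod_{i=1}^l w(E_i)\Big)\cdot\mathfrak D\cdot\prod_{i=1}^l\delta_i ,$$ where $\mathfrak D$ is the index of the image of $$\mathrm{Map}(\Gamma^{[0]},N)\to\prod_{E\ \text{bounded, non-stopping}} N/\mathbb Zu_{(\partial^-E,E)}\times\prod_{i=0}^l N/(\mathbb Qu_{(\partial^-E_i,E_i)}\cap N),\quad h\mapsto\big((h(\partial^+E)-h(\partial^-E))_E,(h(\partial^-E_i))_i\big),$$ and $\delta_i=[\mathbb Qu_{(\partial^-E_i,E_i)}\cap N:\mathbb Zu_{(\partial^-E_i,E_i)}]$. Let $\Delta$ be a degree (of finite support) with $|\Delta|=l+1$, $l\ge1$, and suppose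 that $\sum_x\Delta(x)x=m v$ with an integer $m>0$ and a primitive $v\in N$; by balancing, $v$ is then the direction, from the stop into the curve, of the stopping edge of any rational curve with one stop of degree $\Delta$, and $m$ is its weight. Suppose that every direction $w$ of the other unbounded edges, oriented from infinity into the curve, satisfies $\langle v,w\rangle<0$; that is, $\langle v,-x\rangle<0$ whenever $\Delta(x)\neq0$. Fix $p\in\mathbb Q^2$. The points $(p,\mathbf A)$ are *general* for $\Delta$ if for every rational tropical curve $h'$ without stop, with $l+1$ distinct marked edges, of degree $\Delta'=\Delta\cup\{-mv\}$, that matches $(p,A_1,\dots,A_l)$: all vertices are trivalent, no vertex is mapped to one of the points $p,A_1,\dots,A_l$, and $h'$ is injective on vertices and has finite fibres. Let $\ell(a)=p+av$, and let $Y_{a,\theta}=\{x\in\mathbb R^2\mid 0\le\angle(x\,\ell(a)\,\ell(a+1))\le\theta\}$, including the apex $\ell(a)$. **Proposition 9.8.** There are $\eta>0$ and $0<\varepsilon<1$ and a natural number $n$ such that for all $a\ge\eta$, all $0<\theta\le\varepsilon$ and all $\mathbf A=(A_1,\dots,A_l)$, $A_i\in\mathbb Q^2$, with $(p,\mathbf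 A)$ general for $\Delta$ and $A_i\in Y_{a,\theta}$ for every $i$, there are only finitely many $l$-marked rational tropical curves with one stop of degree $\Delta$ that match $\mathbf A$ and satisfy $h(\text{stop})=p$, and their number, counted with the weights $\mathfrak W$, equals $n$. In particular it does not depend on $\mathbf A$. -/

import Mathlib

/-!
Rational (genus 0) tropical curves in the plane, with and without a stop.
The lattice is `N = ℤ²`, and `N_ℝ = ℝ²` carries the Euclidean structure.
-/

/-- The lattice `N = ℤ²`. -/
abbrev ZLat : Type := Fin 2 → ℤ

/-- The Euclidean plane `N_ℝ = ℝ²`. -/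
abbrev Plane : Type := EuclideanSpace ℝ (Fin 2)

/-- The inclusion `N → N_ℝ`. -/
noncomputable def ZLat.toPlane (x : ZLat) : Plane := WithLp.toLp 2 (fun i => (x i : ℝ))

/-- The inclusion `N_ℚ → N_ℝ`. -/
noncomputable def ratPoint (x : Fin 2 → ℚ) : Plane := WithLp.toLp 2 (fun i => (x i : ℝ))

/-- Primitive lattice vectors. -/
def ZLat.IsPrimitive (x : ZLat) : Prop := Int.gcd (x 0) (x 1) = 1

/-- The closed half line `x + ℝ_{≥ 0} u`. -/
noncomputable def halfLine (x : Plane) (u : ZLat) : Set Plane :=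
  {y | ∃ t : ℝ, 0 ≤ t ∧ y = x + t • u.toPlane}

/-- The graph `Γ` (one-valent vertices of the finite tree `Γ̄` removed) of a rational tropical
curve: a finite set `V` of vertices, the bounded edges, which form a simple graph on `V`, and a
finite set `U` of unbounded edges, each with exactly one vertex `foot e`. Genus zero means that
`Γ̄` is a tree, which is the same as the graph of bounded edges being a tree.
Every vertex has valence at least three: one-valent vertices of `Γ̄` have been removed, and there
are no divalent ones. -/
structure TropGraph where
  V : Type
  U : Type
  finV : Finite V
  finU : Finite U
  bdd : SimpleGraph V
  isTree : bdd.IsTree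
  foot : U → V
  valence_ge : ∀ x : V, 3 ≤ (bdd.neighborSet x).ncard + {e : U | foot e = x}.ncard

namespace TropGraph

variable (Γ : TropGraph)

/-- The edges of `Γ`: bounded edges and unbounded edges. -/
abbrev Edge : Type := Γ.bdd.edgeSet ⊕ Γ.U

/-- The flags `(x, E)`, `x` a vertex of the edge `E`. A flag whose edge is bounded is a dart
(the bounded edge, oriented away from its vertex `x`). -/
abbrev Flag : Type := Γ.bdd.Dart ⊕ Γ.U

/-- The vertex of a flag. -/
def Flag.vertex {Γ : TropGraph} : Γ.Flag → Γ.V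
  | Sum.inl d => d.fst
  | Sum.inr e => Γ.foot e

/-- The edge of a flag. -/
def Flag.edge {Γ : TropGraph} : Γ.Flag → Γ.Edge
  | Sum.inl d => Sum.inl ⟨d.edge, d.edge_mem⟩
  | Sum.inr e => Sum.inr e

/-- The valence of a vertex. -/
noncomputable def valence (x : Γ.V) : ℕ :=
  (Γ.bdd.neighborSet x).ncard + {e : Γ.U | Γ.foot e = x}.ncard

/-- An arbitrary orientation of a bounded edge, as a dart from `∂⁻E` to `∂⁺E`. -/
noncomputable def orient (e : Γ.bdd.edgeSet) : Γ.bdd.Dart :=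
  ⟨Quot.out e.1, by
    have h : s((Quot.out e.1).1, (Quot.out e.1).2) ∈ Γ.bdd.edgeSet := by
      have h1 : s((Quot.out e.1).1, (Quot.out e.1).2) = e.1 := Quot.out_eq e.1
      rw [h1]
      exact e.2
    exact h⟩

/-- The flag `(∂⁻E, E)`; for an unbounded edge, `∂⁻E` is its only vertex in `Γ`. -/
noncomputable def minusFlag : Γ.Edge → Γ.Flag
  | Sum.inl e => Sum.inl (Γ.orient e)
  | Sum.inr e => Sum.inr e

end TropGraph

/-- A `k`-marked parametrized rational tropical curve `h : Γ → ℝ²`. The map `h` is given by the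
images `pos` of the vertices and the primitive direction vectors `u` of all flags: a bounded edge
is mapped to the segment between the images of its vertices, an unbounded edge (by properness)
to a half line. -/
structure TropCurve (k : ℕ) where
  Γ : TropGraph
  /-- the weight function -/
  w : Γ.Edge → ℕ
  w_pos : ∀ e, 0 < w e
  pos : Γ.V → Plane
  u : Γ.Flag → ZLat
  u_primitive : ∀ f, (u f).IsPrimitive
  /-- a bounded edge is embedded, with the rational direction `u` -/
  bounded_edge : ∀ d : Γ.bdd.Dart,
    ∃ t : ℝ, 0 < t ∧ pos d.snd = pos d.fst + t • (u (Sum.inl d)).toPlane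
  /-- the balancing condition at each vertex -/
  balanced : ∀ x : Γ.V,
    ∑ᶠ (f : Γ.Flag) (_ : f.vertex = x), (w f.edge : ℤ) • u f = 0
  /-- the marked edges -/
  mark : Fin k → Γ.Edge
  mark_injective : Function.Injective mark

namespace TropCurve

variable {k : ℕ} (C : TropCurve k)

/-- The image `h(E)` of an edge. -/
noncomputable def image : C.Γ.Edge → Set Plane
  | Sum.inl e => segment ℝ (C.pos (C.Γ.orient e).fst) (C.pos (C.Γ.orient e).snd)
  | Sum.inr e => halfLine (C.pos (C.Γ.foot e)) (C.u (Sum.inr e))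

/-- The degree: the number of unbounded edges with `w(E) u_{(V,E)} = x`. -/
noncomputable def degree (x : ZLat) : ℕ :=
  {e : C.Γ.U | (C.w (Sum.inr e) : ℤ) • C.u (Sum.inr e) = x}.ncard

/-- The curve matches the point constraints `B`. -/
def Matches (B : Fin k → Plane) : Prop := ∀ i, B i ∈ C.image (C.mark i)

end TropCurve

/-- An `l`-marked parametrized rational tropical curve with one stop. The stopping edge `E` (in
`Γ` an unbounded edge) is mapped to the segment from the image of its vertex in `Γ` to the image
`stopPos` of the stop; the stopping edge is not marked. There is no balancing at the stop. -/
structure StopCurve (l : ℕ) extends TropCurve l where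
  stopEdge : Γ.U
  mark_ne : ∀ i, mark i ≠ Sum.inr stopEdge
  stopPos : Plane
  stop_edge : ∃ t : ℝ, 0 < t ∧ stopPos = pos (Γ.foot stopEdge) + t • (u (Sum.inr stopEdge)).toPlane

namespace StopCurve

variable {l : ℕ}

/-- The degree of a curve with a stop: the stopping edge does not contribute. -/
noncomputable def degree (C : StopCurve l) (x : ZLat) : ℕ :=
  {e : C.Γ.U | e ≠ C.stopEdge ∧ (C.w (Sum.inr e) : ℤ) • C.u (Sum.inr e) = x}.ncard

/-- The curve matches the point constraints `A` and its stop is mapped to `p`. As marked edges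
are not the stopping edge, their images are those in the underlying curve. -/
def Matches (C : StopCurve l) (p : Plane) (A : Fin l → Plane) : Prop :=
  (∀ i, A i ∈ C.image (C.mark i)) ∧ C.stopPos = p

/-- Isomorphism of parametrized marked tropical curves with a stop: an isomorphism of the graphs
that respects weights, marked edges, the stop, and the maps to the plane. -/
def Isom (C C' : StopCurve l) : Prop :=
  ∃ (φ : C.Γ.bdd ≃g C'.Γ.bdd) (ψ : C.Γ.U ≃ C'.Γ.U),
    (∀ e, C'.Γ.foot (ψ e) = φ (C.Γ.foot e)) ∧
    (∀ e, C'.w (Sum.map φ.mapEdgeSet ψ e) = C.w e) ∧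
    (∀ x, C'.pos (φ x) = C.pos x) ∧
    (∀ e, C'.u (Sum.inr (ψ e)) = C.u (Sum.inr e)) ∧
    (∀ i, C'.mark i = Sum.map φ.mapEdgeSet ψ (C.mark i)) ∧
    C'.stopEdge = ψ C.stopEdge ∧
    C'.stopPos = C.stopPos

theorem Isom.refl (C : StopCurve l) : Isom C C := by
  have key : ∀ e : C.Γ.Edge, Sum.map (SimpleGraph.Iso.refl (G := C.Γ.bdd)).mapEdgeSet
      (Equiv.refl C.Γ.U) e = e := by
    rintro (⟨e, he⟩ | e)
    · simp only [Sum.map_inl]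
      congr 1
      apply Subtype.ext
      induction e with
      | _ a b => rfl
    · rfl
  refine ⟨SimpleGraph.Iso.refl, Equiv.refl _, fun _ => rfl, fun e => by rw [key], fun _ => rfl,
    fun _ => rfl, fun i => by rw [key], rfl, rfl⟩

theorem Isom.symm {C C' : StopCurve l} (h : Isom C C') : Isom C' C := by
  obtain ⟨φ, ψ, h1, h2, h3, h4, h5, h6, h7⟩ := h
  have key : ∀ e : C'.Γ.Edge, Sum.map φ.mapEdgeSet ψ (Sum.map φ.symm.mapEdgeSet ψ.symm e) = e := by
    rintro (⟨e, he⟩ | e)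
    · simp only [Sum.map_inl]
      congr 1
      apply Subtype.ext
      induction e with
      | _ a b => simp
    · simp
  have key' : ∀ e : C.Γ.Edge, Sum.map φ.symm.mapEdgeSet ψ.symm (Sum.map φ.mapEdgeSet ψ e) = e := by
    rintro (⟨e, he⟩ | e)
    · simp only [Sum.map_inl]
      congr 1
      apply Subtype.ext
      induction e with
      | _ a b => simp
    · simp
  refine ⟨φ.symm, ψ.symm, fun e => ?_, fun e => ?_, fun x => ?_, fun e => ?_, fun i => ?_, ?_,
    h7.symm⟩
  · have := h1 (ψ.symm e)
    rw [Equiv.apply_symm_apply] at this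
    rw [this]; simp
  · rw [← h2, key]
  · rw [← h3]; simp
  · rw [← h4, Equiv.apply_symm_apply]
  · rw [h5, key']
  · rw [h6, Equiv.symm_apply_apply]

theorem Isom.trans {C C' C'' : StopCurve l} (h : Isom C C') (h' : Isom C' C'') : Isom C C'' := by
  obtain ⟨φ, ψ, h1, h2, h3, h4, h5, h6, h7⟩ := h
  obtain ⟨φ', ψ', k1, k2, k3, k4, k5, k6, k7⟩ := h'
  have key : ∀ e : C.Γ.Edge, Sum.map (SimpleGraph.Iso.comp φ' φ).mapEdgeSet (ψ.trans ψ') e =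
      Sum.map φ'.mapEdgeSet ψ' (Sum.map φ.mapEdgeSet ψ e) := by
    rintro (⟨e, he⟩ | e)
    · simp only [Sum.map_inl]
      congr 1
      apply Subtype.ext
      induction e with
      | _ a b => rfl
    · rfl
  refine ⟨SimpleGraph.Iso.comp φ' φ, ψ.trans ψ', fun e => ?_, fun e => ?_, fun x => ?_, fun e => ?_, fun i => ?_,
    ?_, k7.trans h7⟩
  · exact (k1 (ψ e)).trans (congrArg φ' (h1 e))
  · rw [key, k2, h2]
  · exact (k3 (φ x)).trans (h3 x)
  · exact (k4 (ψ e)).trans (h4 e)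
  · rw [key, k5, h5]
  · rw [k6, h6]; rfl

/-- Isomorphism as an equivalence relation. -/
instance setoid (l : ℕ) : Setoid (StopCurve l) :=
  ⟨Isom, Isom.refl, Isom.symm, Isom.trans⟩

/-- The marked total weight: the product of the weights of all edges that are not unbounded in
`Γ_s` (the stopping edge included), times the product of the weights of the marked edges. -/
noncomputable def totalWeight (C : StopCurve l) : ℕ :=
  (∏ᶠ e : C.Γ.bdd.edgeSet, C.w (Sum.inl e)) * C.w (Sum.inr C.stopEdge) * ∏ i, C.w (C.mark i)

/-- The subgroup `ℚu ∩ N` of `N`. -/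
def saturation (u : ZLat) : AddSubgroup ZLat where
  carrier := {x | ∃ q : ℚ, ∀ i, (x i : ℚ) = q * u i}
  zero_mem' := ⟨0, by simp⟩
  add_mem' := by
    rintro a b ⟨q, hq⟩ ⟨r, hr⟩
    exact ⟨q + r, fun i => by simp [hq i, hr i, add_mul]⟩
  neg_mem' := by
    rintro a ⟨q, hq⟩
    exact ⟨-q, fun i => by simp [hq i]⟩

/-- The edges `E_0, …, E_l`: the stopping edge, followed by the marked edges. -/
def allMark (C : StopCurve l) : Fin (l + 1) → C.Γ.Edge :=
  Fin.cons (Sum.inr C.stopEdge) C.mark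

/-- The lattice map
`Map(Γ^[0], N) → ∏_{E bounded in Γ} N / ℤu_(∂⁻E,E) × ∏_{0 ≤ i ≤ l} N / (ℚu_(∂⁻E_i,E_i) ∩ N)`,
`h ↦ ((h(∂⁺E) - h(∂⁻E))_E, (h(∂⁻E_i))_i)`. The constraints are points, so they contribute no
linear parts to the second factor. -/
noncomputable def latticeMap (C : StopCurve l) :
    (C.Γ.V → ZLat) →+
      ((e : C.Γ.bdd.edgeSet) → ZLat ⧸ AddSubgroup.zmultiples (C.u (Sum.inl (C.Γ.orient e)))) ×
      ((i : Fin (l + 1)) → ZLat ⧸ saturation (C.u (C.Γ.minusFlag (C.allMark i)))) where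
  toFun h :=
    (fun e => QuotientAddGroup.mk (h (C.Γ.orient e).snd - h (C.Γ.orient e).fst),
     fun i => QuotientAddGroup.mk (h (C.Γ.minusFlag (C.allMark i)).vertex))
  map_zero' := by
    ext i <;> simp
  map_add' h h' := by
    refine Prod.ext (funext fun e => ?_) (funext fun i => ?_)
    · simp only [Pi.add_apply, Prod.fst_add, ← QuotientAddGroup.mk_add]
      congr 1
      abel
    · simp only [Pi.add_apply, Prod.snd_add, ← QuotientAddGroup.mk_add]

/-- The lattice index of the curve. -/
noncomputable def latticeIndex (C : StopCurve l) : ℕ := C.latticeMap.range.index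

/-- The index of `ℤu_(∂⁻E_i,E_i)` in `ℚu_(∂⁻E_i,E_i) ∩ N`. -/
noncomputable def markIndex (C : StopCurve l) (i : Fin l) : ℕ :=
  (AddSubgroup.zmultiples (C.u (C.Γ.minusFlag (C.mark i)))).relIndex
    (saturation (C.u (C.Γ.minusFlag (C.mark i))))

/-- The weight with which a curve with a stop is counted. -/
noncomputable def weight (C : StopCurve l) : ℕ :=
  C.totalWeight * C.latticeIndex * ∏ i, C.markIndex i

/-- The set of isomorphism classes of `l`-marked rational tropical curves with one stop, of
degree `Δ`, that match `A` and whose stop is mapped to `p`. -/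
def classes (Δ : ZLat →₀ ℕ) (p : Plane) (A : Fin l → Plane) : Set (Quotient (setoid l)) :=
  {c | ∃ C : StopCurve l, Quotient.mk (setoid l) C = c ∧ (∀ x, C.degree x = Δ x) ∧ C.Matches p A}

/-- The weighted number of rational tropical curves with one stop, of degree `Δ`, that match `A`
and whose stop is mapped to `p`. The weight of a class is that of a representative. -/
noncomputable def count (Δ : ZLat →₀ ℕ) (p : Plane) (A : Fin l → Plane) : ℕ :=
  ∑ᶠ c ∈ classes Δ p A, c.out.weight

end StopCurve

/-- `|Δ|`, the number of unbounded edges of a curve (with a stop) of degree `Δ`. -/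
noncomputable def degreeCard (Δ : ZLat →₀ ℕ) : ℕ := Δ.sum fun _ m => m

/-- `∑_x Δ(x) x`. By balancing, the stopping edge of a curve with one stop of degree `Δ`, oriented
from the stop into the curve, has this vector as weight times primitive direction. -/
noncomputable def degreeSum (Δ : ZLat →₀ ℕ) : ZLat := Δ.sum fun x m => m • x

/-- The degree `Δ'` of the curve without stop obtained by extending the stopping edge to infinity:
`Δ` together with one more unbounded edge, as determined by balancing. -/
noncomputable def extendedDegree (Δ : ZLat →₀ ℕ) : ZLat →₀ ℕ :=
  Δ + Finsupp.single (-degreeSum Δ) 1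

/-- The point constraints `A`, with `p` as constraint for the stop, are general for `Δ`: for every
`(l + 1)`-marked rational tropical curve of degree `Δ'` that matches `(p, A_1, …, A_l)`,
all vertices are trivalent, no vertex is mapped to one of the points `p, A_1, …, A_l`, and the
map is injective on the vertices.
(The fibres are finite for every curve, as each of the finitely many edges is embedded.) -/
def IsGeneral {l : ℕ} (Δ : ZLat →₀ ℕ) (p : Plane) (A : Fin l → Plane) : Prop :=
  ∀ C : TropCurve (l + 1), (∀ x, C.degree x = extendedDegree Δ x) →
    C.Matches (Fin.cons p A : Fin (l + 1) → Plane) →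
    (∀ x, C.Γ.valence x = 3) ∧
    (∀ x i, C.pos x ≠ (Fin.cons p A : Fin (l + 1) → Plane) i) ∧
    Function.Injective C.pos

/-- The point `ℓ(a) = p + a v`. -/
noncomputable def axisPoint (p : Plane) (v : ZLat) (a : ℝ) : Plane := p + a • v.toPlane

/-- The cone `Y_{a,θ}` of the points `x` with `0 ≤ ∠ (x ℓ(a) ℓ(a+1)) ≤ θ`, with its apex `ℓ(a)`
(where the angle is undefined) included. -/
noncomputable def coneY (p : Plane) (v : ZLat) (a θ : ℝ) : Set Plane :=
  {x | x = axisPoint p v a ∨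
    EuclideanGeometry.angle x (axisPoint p v a) (axisPoint p v (a + 1)) ≤ θ}

/-!
The number of curves is identified with the number of top-dimensional cones of a balanced fan that
contain a given point, and this number is locally constant.

*Types.* Number the unbounded edges other than the stopping edge, with weighted directions `d j`.
Attach a leaf to a curve at every marked point; then cutting an edge separates off, on the side away
from the stop, a set `S` of unbounded edges and marked points, a *clade*. By balancing, the cut edge
has weighted direction `± ∑ d j` over the unbounded edges in `S`, so the positions of the marked
points relative to the stop are `∑ lam S • cladeVecR d S`, where `lam S > 0` is the length of the
edge in multiples of that direction. The clades form a maximal laminar family `C`, of `2 l` members,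
and the positions that are realized by curves of type `C` are the open simplicial cone spanned by
the vectors `cladeVecR d S`. For points in general position a labelled curve is determined by its
type, it has no symmetries, and each maximal laminar family whose cone is full-dimensional and
contains the position of the points is the type of a curve (`labelledType_bijective`); here one has
to find the edges that carry the marked points (`exists_isMarking`). The weight of a curve is the
index of the lattice spanned by the vectors `cladeVec d S` (`IsModel.weight_eq`): if the vertices of
the curve are eliminated from the lattice map, then generators are left that differ from these
vectors by the weights of the edges and a unimodular transformation. Every curve has the same number
of labellings, so the count is a constant multiple of the number of cones, weighted by these
indices, around a point (`StopCurve.finite_classes_and_count_eq`).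

*Balancing.* A clade `S` other than the set of all leaves can be exchanged in exactly three ways
(the three resolutions of a four-valent vertex), and the three vectors satisfy one linear relation
modulo the common face (`cladeVec_exchange`). So the cones are balanced along all walls except those
where the edge of the stop has length zero (`treeCones`), and the weighted number of cones does not
change along a path that avoids these walls (`BalancedCones.count_eq_of_convex`).

*The thin cone.* It remains to see that the walls of the stop are not met if all points lie in a
sufficiently thin sector around the ray from the stop in the direction `v`. With respect to `v` all
edges point up. Suppose that the edge of the stop has length zero. One of the two edges at the stop
has as many marked points as unbounded edges above it. If it points to the right, then its upper end
is far from the axis, but the marked points above it, which determine its position, are close to the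
axis; this is impossible (`nodeForm_lt`), and so it is on the left. Hence both edges are parallel to
`v`, and then the cone is not full-dimensional (`lam_univ_ne_zero`). A slope that suffices for the
width of the sector is the reciprocal of the total height of the unbounded edges. The sector `coneY`
with small angle has its points in this cone (`mem_thinCone_of_mem_coneY`).
-/

set_option linter.unusedSectionVars false

/-! ### Balanced collections of simplicial cones -/

/-- The relatively open simplicial cone spanned by the vectors `vec S`, `S ∈ C`. -/
def InOpenCone {X W : Type*} [AddCommGroup W] [Module ℝ W] (vec : X → W) (C : Finset X)
    (w : W) : Prop :=
  ∃ lam : X → ℝ, (∀ S ∈ C, 0 < lam S) ∧ w = ∑ S ∈ C, lam S • vec S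

/-- A finite collection of simplicial cones in a real vector space with multiplicities, balanced
along the codimension one faces opposite to every ray except possibly `root`.
For a set `F` of all but one of the rays of a cone, `vol F w` is, up to a common sign, the
determinant of `w` and the rays in `F`. -/
structure BalancedCones (X W : Type*) [DecidableEq X] [Fintype X] [AddCommGroup W]
    [Module ℝ W] where
  vec : X → W
  cones : Finset (Finset X)
  mult : Finset X → ℕ
  vol : Finset X → W →ₗ[ℝ] ℝ
  root : X
  vol_eq_zero : ∀ C ∈ cones, ∀ S ∈ C, ∀ S' ∈ C.erase S, vol (C.erase S) (vec S') = 0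
  abs_vol : ∀ C ∈ cones, ∀ S ∈ C, |vol (C.erase S) (vec S)| = mult C
  span_eq_top : ∀ C ∈ cones, mult C ≠ 0 → Submodule.span ℝ (vec '' C) = ⊤
  balanced : ∀ C ∈ cones, ∀ S ∈ C, S ≠ root →
    ∑ S' : X with S' ∉ C.erase S ∧ insert S' (C.erase S) ∈ cones, vol (C.erase S) (vec S') = 0

namespace BalancedCones

section Algebra

variable {X W : Type*} [DecidableEq X] [Fintype X] [AddCommGroup W] [Module ℝ W]
  (𝓑 : BalancedCones X W)

/-- The coordinate belonging to the ray `S` of the cone `C` (Cramer's rule). -/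
noncomputable def coord (C : Finset X) (S : X) : W →ₗ[ℝ] ℝ :=
  (𝓑.vol (C.erase S) (𝓑.vec S))⁻¹ • 𝓑.vol (C.erase S)

variable {𝓑} {C : Finset X}

theorem vol_ne_zero (hC : C ∈ 𝓑.cones) (hm : 𝓑.mult C ≠ 0) {S : X} (hS : S ∈ C) :
    𝓑.vol (C.erase S) (𝓑.vec S) ≠ 0 := by
  intro h
  have := 𝓑.abs_vol C hC S hS
  rw [h, abs_zero] at this
  exact hm (by exact_mod_cast this.symm)

theorem coord_self (hC : C ∈ 𝓑.cones) (hm : 𝓑.mult C ≠ 0) {S : X} (hS : S ∈ C) :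
    𝓑.coord C S (𝓑.vec S) = 1 := by
  simp [coord, vol_ne_zero hC hm hS]

theorem coord_of_ne (hC : C ∈ 𝓑.cones) {S S' : X} (hS : S ∈ C) (hS' : S' ∈ C)
    (hne : S' ≠ S) : 𝓑.coord C S (𝓑.vec S') = 0 := by
  simp [coord, 𝓑.vol_eq_zero C hC S hS S' (Finset.mem_erase.2 ⟨hne, hS'⟩)]

theorem coord_sum (hC : C ∈ 𝓑.cones) (hm : 𝓑.mult C ≠ 0) {S : X} (hS : S ∈ C) (lam : X → ℝ) :
    𝓑.coord C S (∑ S' ∈ C, lam S' • 𝓑.vec S') = lam S := by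
  rw [_root_.map_sum, Finset.sum_eq_single S]
  · simp [coord_self hC hm hS]
  · intro S' hS' hne
    simp [coord_of_ne hC hS hS' hne]
  · exact fun h => absurd hS h

theorem sum_coord (hC : C ∈ 𝓑.cones) (hm : 𝓑.mult C ≠ 0) (w : W) :
    w = ∑ S ∈ C, 𝓑.coord C S w • 𝓑.vec S := by
  have hw : w ∈ Submodule.span ℝ (𝓑.vec '' C) := by
    rw [𝓑.span_eq_top C hC hm]; trivial
  induction hw using Submodule.span_induction with
  | mem x h =>
    obtain ⟨S, hS, rfl⟩ := h
    rw [Finset.sum_eq_single S]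
    · rw [coord_self hC hm hS, one_smul]
    · intro S' hS' hne
      rw [coord_of_ne hC hS' hS hne.symm, zero_smul]
    · exact fun h => absurd hS h
  | zero => simp
  | add x y _ _ hx hy =>
    conv_lhs => rw [hx, hy, ← Finset.sum_add_distrib]
    simp only [_root_.map_add, add_smul]
  | smul a x _ hx =>
    conv_lhs => rw [hx, Finset.smul_sum]
    simp only [map_smul, smul_eq_mul, mul_smul]

theorem inOpenCone_iff (hC : C ∈ 𝓑.cones) (hm : 𝓑.mult C ≠ 0) (w : W) :
    InOpenCone 𝓑.vec C w ↔ ∀ S ∈ C, 0 < 𝓑.coord C S w := by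
  constructor
  · rintro ⟨lam, hpos, rfl⟩ S hS
    rw [coord_sum hC hm hS]
    exact hpos S hS
  · intro h
    exact ⟨fun S => 𝓑.coord C S w, h, sum_coord hC hm w⟩

variable (𝓑)

open Classical in
/-- The number of open cones containing `w`, counted with multiplicities. -/
noncomputable def count (w : W) : ℝ :=
  ∑ C ∈ 𝓑.cones, if InOpenCone 𝓑.vec C w then (𝓑.mult C : ℝ) else 0

/-- No full-dimensional closed cone contains `w` in its boundary. -/
def Regular (w : W) : Prop :=
  ∀ C ∈ 𝓑.cones, 𝓑.mult C ≠ 0 → (∀ S ∈ C, 0 ≤ 𝓑.coord C S w) → ∀ S ∈ C, 0 < 𝓑.coord C S w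

/-- The points `x + t u` lie in the open cone `C` for all small positive `t`. -/
def Enters (C : Finset X) (x u : W) : Prop :=
  ∀ S ∈ C, 0 < 𝓑.coord C S x ∨ (𝓑.coord C S x = 0 ∧ 0 < 𝓑.coord C S u)

open Classical in
/-- The number of open cones, counted with multiplicities, that contain the points `x + t u` for
small positive `t`. -/
noncomputable def sideCount (x u : W) : ℝ :=
  ∑ C ∈ 𝓑.cones, if 𝓑.Enters C x u then (𝓑.mult C : ℝ) else 0

variable {𝓑}

theorem Regular.sideCount_eq {x : W} (hx : 𝓑.Regular x) (u : W) :
    𝓑.sideCount x u = 𝓑.count x := by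
  classical
  refine Finset.sum_congr rfl fun C hC => ?_
  by_cases hm : 𝓑.mult C = 0
  · simp [hm]
  · refine if_congr ?_ rfl rfl
    rw [inOpenCone_iff hC hm]
    constructor
    · intro h
      refine hx C hC hm fun S hS => ?_
      rcases h S hS with h | h
      exacts [h.le, h.1.ge]
    · exact fun h S hS => Or.inl (h S hS)

/-- Crossing a wall: along the relative interiors of codimension one faces, the multiplicities on
the two sides agree by balancing. -/
theorem sideCount_neg {x u : W}
    (hu : ∀ C ∈ 𝓑.cones, 𝓑.mult C ≠ 0 → ∀ S ∈ C, 𝓑.coord C S u ≠ 0)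
    (hx : ∀ C ∈ 𝓑.cones, 𝓑.mult C ≠ 0 → (∀ S ∈ C, 0 ≤ 𝓑.coord C S x) →
      ∀ S ∈ C, ∀ S' ∈ C, 𝓑.coord C S x = 0 → 𝓑.coord C S' x = 0 → S = S')
    (hroot : ∀ C ∈ 𝓑.cones, 𝓑.mult C ≠ 0 → (∀ S ∈ C, 0 ≤ 𝓑.coord C S x) →
      𝓑.root ∈ C → 𝓑.coord C 𝓑.root x ≠ 0) :
    𝓑.sideCount x u = 𝓑.sideCount x (-u) := by
  classical
  rw [← sub_eq_zero, sideCount, sideCount, ← Finset.sum_sub_distrib]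
  set f : Finset X → X → ℝ := fun F S =>
    if InOpenCone 𝓑.vec F x then 𝓑.vol F (𝓑.vec S) * SignType.sign (𝓑.vol F u) else 0 with hf
  -- On each full-dimensional cone, at most one coordinate of `x` vanishes.
  have key : ∀ C ∈ 𝓑.cones, ((if 𝓑.Enters C x u then (𝓑.mult C : ℝ) else 0) -
      if 𝓑.Enters C x (-u) then (𝓑.mult C : ℝ) else 0) = ∑ S ∈ C, f (C.erase S) S := by
    intro C hC
    by_cases hm : 𝓑.mult C = 0
    · rw [hm, Finset.sum_eq_zero]
      · simp
      · intro S hS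
        have : 𝓑.vol (C.erase S) (𝓑.vec S) = 0 := by
          have := 𝓑.abs_vol C hC S hS
          rwa [hm, Nat.cast_zero, abs_eq_zero] at this
        simp [hf, this]
    have hface : ∀ S ∈ C, InOpenCone 𝓑.vec (C.erase S) x ↔
        𝓑.coord C S x = 0 ∧ ∀ S' ∈ C.erase S, 0 < 𝓑.coord C S' x := by
      intro S hS
      constructor
      · rintro ⟨lam, hpos, hxl⟩
        have hx' : x = ∑ S' ∈ C, (if S' = S then 0 else lam S') • 𝓑.vec S' := by
          rw [hxl, ← Finset.add_sum_erase C _ hS]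
          simp only [if_true, zero_smul, zero_add]
          exact Finset.sum_congr rfl fun S' hS' => by rw [if_neg (Finset.ne_of_mem_erase hS')]
        constructor
        · rw [hx', coord_sum hC hm hS]; simp
        · intro S' hS'
          rw [hx', coord_sum hC hm (Finset.mem_of_mem_erase hS'),
            if_neg (Finset.ne_of_mem_erase hS')]
          exact hpos S' hS'
      · rintro ⟨h0, hpos⟩
        refine ⟨fun S' => 𝓑.coord C S' x, hpos, ?_⟩
        conv_lhs => rw [sum_coord hC hm x, ← Finset.add_sum_erase C _ hS, h0, zero_smul, zero_add]
    by_cases hex : ∃ S ∈ C, InOpenCone 𝓑.vec (C.erase S) x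
    · obtain ⟨S, hS, hSx⟩ := hex
      obtain ⟨h0, hpos⟩ := (hface S hS).1 hSx
      rw [Finset.sum_eq_single S]
      · have hE : ∀ u', 𝓑.Enters C x u' ↔ 0 < 𝓑.coord C S u' := by
          intro u'
          constructor
          · intro h
            rcases h S hS with h | h
            · exact absurd h0 h.ne'
            · exact h.2
          · intro h S' hS'
            by_cases hSS : S' = S
            · subst hSS; exact Or.inr ⟨h0, h⟩
            · exact Or.inl (hpos S' (Finset.mem_erase.2 ⟨hSS, hS'⟩))
        simp only [hE, map_neg, hf, if_pos hSx]
        have hv := vol_ne_zero hC hm hS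
        have hcu := hu C hC hm S hS
        have ha := 𝓑.abs_vol C hC S hS
        have hc : 𝓑.coord C S u = (𝓑.vol (C.erase S) (𝓑.vec S))⁻¹ * 𝓑.vol (C.erase S) u := rfl
        rw [hc] at hcu ⊢
        have hvu : 𝓑.vol (C.erase S) u ≠ 0 := right_ne_zero_of_mul hcu
        rw [← ha]
        rcases lt_or_gt_of_ne hv with h1 | h1 <;> rcases lt_or_gt_of_ne hvu with h2 | h2
        · have h3 : 0 < (𝓑.vol (C.erase S) (𝓑.vec S))⁻¹ * 𝓑.vol (C.erase S) u :=
            mul_pos_of_neg_of_neg (inv_lt_zero.2 h1) h2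
          simp [h3, sign_neg h2, abs_of_neg h1, not_lt.2 h3.le]
        · have h3 : (𝓑.vol (C.erase S) (𝓑.vec S))⁻¹ * 𝓑.vol (C.erase S) u < 0 :=
            mul_neg_of_neg_of_pos (inv_lt_zero.2 h1) h2
          simp [h3, sign_pos h2, abs_of_neg h1, h3.not_gt]
        · have h3 : (𝓑.vol (C.erase S) (𝓑.vec S))⁻¹ * 𝓑.vol (C.erase S) u < 0 :=
            mul_neg_of_pos_of_neg (inv_pos.2 h1) h2
          simp [h3, sign_neg h2, abs_of_pos h1, not_lt.2 h3.le]
        · have h3 : 0 < (𝓑.vol (C.erase S) (𝓑.vec S))⁻¹ * 𝓑.vol (C.erase S) u :=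
            mul_pos (inv_pos.2 h1) h2
          simp [h3, sign_pos h2, abs_of_pos h1, not_lt.2 h3.le]
      · intro S' hS' hne
        rw [hf]
        simp only
        rw [if_neg]
        intro h
        have h1 := ((hface S' hS').1 h).1
        have h2 := hpos S' (Finset.mem_erase.2 ⟨hne, hS'⟩)
        exact h2.ne' h1
      · exact fun h => absurd hS h
    · push Not at hex
      rw [Finset.sum_eq_zero fun S hS => by rw [hf]; simp only; rw [if_neg (hex S hS)]]
      have hE : ∀ u', 𝓑.Enters C x u' → ∀ S ∈ C, 0 < 𝓑.coord C S x := by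
        intro u' h S hS
        rcases h S hS with h' | ⟨h', -⟩
        · exact h'
        · exfalso
          have hnn : ∀ S' ∈ C, 0 ≤ 𝓑.coord C S' x := by
            intro S' hS'
            rcases h S' hS' with h'' | h''
            exacts [h''.le, h''.1.ge]
          refine hex S hS ((hface S hS).2 ⟨h', fun S' hS' => ?_⟩)
          have hS'C := Finset.mem_of_mem_erase hS'
          refine lt_of_le_of_ne (hnn S' hS'C) fun h0 => ?_
          exact Finset.ne_of_mem_erase hS' (hx C hC hm hnn S' hS'C S hS h0.symm h')
      have hiff : 𝓑.Enters C x u ↔ 𝓑.Enters C x (-u) :=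
        ⟨fun h S hS => Or.inl (hE u h S hS), fun h S hS => Or.inl (hE _ h S hS)⟩
      simp [hiff]
  rw [Finset.sum_congr rfl key, Finset.sum_sigma']
  -- Regroup the pairs (cone, ray) by the face opposite to the ray.
  have hre : ∑ q ∈ 𝓑.cones.sigma (fun C => C), f (q.1.erase q.2) q.2 =
      ∑ q ∈ (Finset.univ : Finset (Finset X)).sigma
        (fun F => {S' : X | S' ∉ F ∧ insert S' F ∈ 𝓑.cones}), f q.1 q.2 := by
    refine Finset.sum_bij' (fun q _ => ⟨q.1.erase q.2, q.2⟩) (fun q _ => ⟨insert q.2 q.1, q.2⟩)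
      ?_ ?_ ?_ ?_ ?_
    · rintro ⟨C, S⟩ h
      simp only [Finset.mem_sigma] at h
      simp [Finset.insert_erase h.2, h.1]
    · rintro ⟨F, S⟩ h
      simp only [Finset.mem_sigma, Finset.mem_univ, true_and, Finset.mem_filter] at h
      simp [h.2]
    · rintro ⟨C, S⟩ h
      simp only [Finset.mem_sigma] at h
      simp [Finset.insert_erase h.2]
    · rintro ⟨F, S⟩ h
      simp only [Finset.mem_sigma, Finset.mem_univ, true_and, Finset.mem_filter] at h
      simp [Finset.erase_insert h.1]
    · rintro ⟨C, S⟩ h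
      rfl
  rw [hre, ← Finset.sum_sigma' (Finset.univ : Finset (Finset X))
    (fun F => {S' : X | S' ∉ F ∧ insert S' F ∈ 𝓑.cones}) f]
  refine Finset.sum_eq_zero fun F _ => ?_
  by_cases hFx : InOpenCone 𝓑.vec F x
  · simp only [hf, if_pos hFx]
    rw [← Finset.sum_mul]
    by_cases hS : ∃ S, S ≠ 𝓑.root ∧ S ∉ F ∧ insert S F ∈ 𝓑.cones
    · obtain ⟨S, hne, hSF, hSC⟩ := hS
      have := 𝓑.balanced _ hSC S (Finset.mem_insert_self _ _) hne
      rw [Finset.erase_insert hSF] at this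
      rw [this, zero_mul]
    · push Not at hS
      rw [Finset.sum_eq_zero, zero_mul]
      intro S hSm
      simp only [Finset.mem_filter, Finset.mem_univ, true_and] at hSm
      have hSr : S = 𝓑.root := by
        by_contra h
        exact hS S h hSm.1 hSm.2
      have hSi : S ∈ insert S F := Finset.mem_insert_self _ _
      have hab := 𝓑.abs_vol _ hSm.2 S hSi
      rw [Finset.erase_insert hSm.1] at hab
      by_cases hm : 𝓑.mult (insert S F) = 0
      · rwa [hm, Nat.cast_zero, abs_eq_zero] at hab
      · exfalso
        obtain ⟨lam, hpos, hxl⟩ := hFx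
        have hx' : x = ∑ S' ∈ insert S F, (if S' = S then 0 else lam S') • 𝓑.vec S' := by
          rw [hxl, Finset.sum_insert hSm.1]
          simp only [if_true, zero_smul, zero_add]
          refine Finset.sum_congr rfl fun S' hS' => ?_
          have hne : S' ≠ S := fun h => hSm.1 (by rw [← h]; exact hS')
          rw [if_neg hne]
        refine hroot _ hSm.2 hm (fun S' hS' => ?_) (hSr ▸ hSi) ?_
        · rw [hx', coord_sum hSm.2 hm hS']
          split_ifs with h
          · exact le_rfl
          · exact (hpos S' ((Finset.mem_insert.1 hS').resolve_left h)).le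
        · rw [← hSr, hx', coord_sum hSm.2 hm hSi, if_pos rfl]
  · simp only [hf, if_neg hFx, Finset.sum_const_zero]

end Algebra

end BalancedCones

/-! ### The number of cones around a point is locally constant -/

/-- Finitely many nonzero linear forms are all nonzero at suitable arbitrarily small perturbations
of any vector. -/
theorem exists_direction_forall_ne_zero {W : Type*} [AddCommGroup W] [Module ℝ W]
    (Fs : Finset (W →ₗ[ℝ] ℝ)) (h : ∀ f ∈ Fs, f ≠ 0) (u₀ : W) :
    ∃ u₁ : W, ∀ ε : ℝ, 0 < ε → ∃ t : ℝ, 0 < t ∧ t < ε ∧ ∀ f ∈ Fs, f (u₀ + t • u₁) ≠ 0 := by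
  classical
  obtain ⟨u₁, hu₁⟩ := Module.Dual.exists_forall_ne_zero_of_forall_exists
    (fun f : Fs => (f.1 : Module.Dual ℝ W)) (fun f => by
      by_contra hc
      push Not at hc
      exact h f.1 f.2 (LinearMap.ext hc))
  refine ⟨u₁, fun ε hε => ?_⟩
  have hfin : (Set.range fun f : Fs => -(f.1 u₀) / f.1 u₁).Finite := Set.finite_range _
  obtain ⟨t, ht, htn⟩ := ((Set.Ioo_infinite hε).sdiff hfin).nonempty
  refine ⟨t, ht.1, ht.2, fun f hf h0 => htn ⟨⟨f, hf⟩, ?_⟩⟩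
  have h1 : f u₁ ≠ 0 := hu₁ ⟨f, hf⟩
  rw [_root_.map_add, map_smul, smul_eq_mul] at h0
  simp only
  field_simp
  linarith

namespace BalancedCones

variable {X W : Type*} [DecidableEq X] [Fintype X] [NormedAddCommGroup W] [NormedSpace ℝ W]
  [FiniteDimensional ℝ W] {𝓑 : BalancedCones X W}

theorem eventually_coord (x : W) :
    ∀ᶠ y in nhds x, ∀ C ∈ 𝓑.cones, ∀ S ∈ C,
      (0 < 𝓑.coord C S x → 0 < 𝓑.coord C S y) ∧ (𝓑.coord C S x < 0 → 𝓑.coord C S y < 0) := by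
  refine (Filter.eventually_all_finset _).2 fun C _ => (Filter.eventually_all_finset _).2
    fun S _ => ?_
  have hcont : Continuous (𝓑.coord C S) := LinearMap.continuous_of_finiteDimensional _
  refine Filter.Eventually.and ?_ ?_
  · by_cases h : 0 < 𝓑.coord C S x
    · filter_upwards [hcont.continuousAt.eventually (lt_mem_nhds h)] with y hy _ using hy
    · exact Filter.Eventually.of_forall fun y h' => absurd h' h
  · by_cases h : 𝓑.coord C S x < 0
    · filter_upwards [hcont.continuousAt.eventually (gt_mem_nhds h)] with y hy _ using hy
    · exact Filter.Eventually.of_forall fun y h' => absurd h' h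

theorem Regular.eventually {x : W} (hx : 𝓑.Regular x) :
    ∀ᶠ y in nhds x, 𝓑.Regular y ∧ 𝓑.count y = 𝓑.count x := by
  classical
  filter_upwards [eventually_coord (𝓑 := 𝓑) x] with y hy
  have key : ∀ C ∈ 𝓑.cones, 𝓑.mult C ≠ 0 → (∀ S ∈ C, 0 ≤ 𝓑.coord C S y) →
      ∀ S ∈ C, 0 < 𝓑.coord C S x := by
    intro C hC hm h
    refine hx C hC hm fun S hS => ?_
    by_contra hneg
    exact absurd ((hy C hC S hS).2 (not_le.1 hneg)) (not_lt.2 (h S hS))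
  refine ⟨fun C hC hm h S hS => (hy C hC S hS).1 (key C hC hm h S hS), ?_⟩
  refine Finset.sum_congr rfl fun C hC => ?_
  by_cases hm : 𝓑.mult C = 0
  · simp [hm]
  · refine if_congr ?_ rfl rfl
    rw [inOpenCone_iff hC hm, inOpenCone_iff hC hm]
    exact ⟨fun h => key C hC hm fun S hS => (h S hS).le,
      fun h S hS => (hy C hC S hS).1 (h S hS)⟩

/-- The number of cones containing a point, counted with multiplicities, is the same for all
regular points of a convex open set that avoids the unbalanced faces. -/
theorem count_eq_of_convex {Y : Set W} (hconv : Convex ℝ Y) (hopen : IsOpen Y)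
    (hroot : ∀ x ∈ Y, ∀ C ∈ 𝓑.cones, 𝓑.mult C ≠ 0 → (∀ S ∈ C, 0 ≤ 𝓑.coord C S x) →
      𝓑.root ∈ C → 𝓑.coord C 𝓑.root x ≠ 0)
    {A A' : W} (hA : A ∈ Y) (hA' : A' ∈ Y) (hrA : 𝓑.Regular A) (hrA' : 𝓑.Regular A') :
    𝓑.count A = 𝓑.count A' := by
  classical
  -- Linear forms whose non-vanishing makes the direction generic: the segment is transversal to
  -- all walls, and it meets faces of codimension two at most at its starting point.
  set Fs : Finset (W →ₗ[ℝ] ℝ) := (𝓑.cones.biUnion fun C => (C ×ˢ C).image fun q =>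
    𝓑.coord C q.1 A • 𝓑.coord C q.2 - 𝓑.coord C q.2 A • 𝓑.coord C q.1).filter (· ≠ 0) ∪
    (𝓑.cones.biUnion fun C => C.image fun S => 𝓑.coord C S).filter (· ≠ 0) with hFs
  obtain ⟨u₁, hu₁⟩ := exists_direction_forall_ne_zero Fs (by
    intro f hf
    rw [hFs, Finset.mem_union, Finset.mem_filter, Finset.mem_filter] at hf
    exact hf.elim (fun h => h.2) fun h => h.2) (A' - A)
  have hnear : ∀ᶠ t in nhds (0 : ℝ), (A' + t • u₁ ∈ Y ∧
      (𝓑.Regular (A' + t • u₁) ∧ 𝓑.count (A' + t • u₁) = 𝓑.count A')) := by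
    have hc : Filter.Tendsto (fun t : ℝ => A' + t • u₁) (nhds 0) (nhds A') := by
      have : Continuous fun t : ℝ => A' + t • u₁ := by fun_prop
      simpa using this.tendsto 0
    exact hc.eventually (Filter.Eventually.and (hopen.mem_nhds hA') hrA'.eventually)
  obtain ⟨ε, hε, hball⟩ := Metric.eventually_nhds_iff.1 hnear
  obtain ⟨t, ht0, htε, htF⟩ := hu₁ ε hε
  obtain ⟨htY, htR, htc⟩ := hball (y := t) (by
    rw [Real.dist_eq, sub_zero, abs_of_pos ht0]; exact htε)
  set u : W := A' - A + t • u₁ with hu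
  have hend : A + (1 : ℝ) • u = A' + t • u₁ := by rw [hu, one_smul]; abel
  have hu1 : ∀ C ∈ 𝓑.cones, 𝓑.mult C ≠ 0 → ∀ S ∈ C, 𝓑.coord C S u ≠ 0 := by
    intro C hC hm S hS
    refine htF _ ?_
    rw [hFs, Finset.mem_union, Finset.mem_filter, Finset.mem_filter]
    refine Or.inr ⟨Finset.mem_biUnion.2 ⟨C, hC, Finset.mem_image_of_mem _ hS⟩, fun h => ?_⟩
    have := coord_self hC hm hS
    rw [h] at this
    simp at this
  have hline : ∀ C S (s : ℝ), 𝓑.coord C S (A + s • u) = 𝓑.coord C S A + s * 𝓑.coord C S u := by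
    intro C S s
    rw [_root_.map_add, map_smul, smul_eq_mul]
  have hYs : ∀ s ∈ Set.Icc (0 : ℝ) 1, A + s • u ∈ Y := by
    intro s hs
    have h1 : A + s • u = (1 - s) • A + s • (A' + t • u₁) := by
      rw [hu, sub_smul, one_smul, smul_add, smul_add, smul_sub]; abel
    rw [h1]
    exact hconv hA htY (by linarith [hs.2]) hs.1 (by ring)
  have hwall : ∀ s ∈ Set.Icc (0 : ℝ) 1,
      𝓑.sideCount (A + s • u) u = 𝓑.sideCount (A + s • u) (-u) := by
    intro s hs
    refine sideCount_neg hu1 ?_ (hroot _ (hYs s hs))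
    intro C hC hm hnn S hS S' hS' h0 h0'
    by_contra hne
    rw [hline] at h0 h0'
    have hdet : 𝓑.coord C S A * 𝓑.coord C S' u - 𝓑.coord C S' A * 𝓑.coord C S u = 0 := by
      linear_combination 𝓑.coord C S' u * h0 - 𝓑.coord C S u * h0'
    set f := 𝓑.coord C S A • 𝓑.coord C S' - 𝓑.coord C S' A • 𝓑.coord C S with hf
    have hf0 : f = 0 := by
      by_contra hfne
      refine htF f ?_ (by rw [hf]; simpa using hdet)
      rw [hFs, Finset.mem_union, Finset.mem_filter, Finset.mem_filter]
      exact Or.inl ⟨Finset.mem_biUnion.2 ⟨C, hC, Finset.mem_image.2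
        ⟨(S, S'), Finset.mem_product.2 ⟨hS, hS'⟩, rfl⟩⟩, hfne⟩
    have hSA : 𝓑.coord C S A = 0 := by
      have := congrArg (fun g : W →ₗ[ℝ] ℝ => g (𝓑.vec S')) hf0
      simpa [hf, coord_self hC hm hS', coord_of_ne hC hS hS' (Ne.symm hne)] using this
    have hs0 : s = 0 := by
      rw [hSA, zero_add] at h0
      exact (mul_eq_zero.1 h0).resolve_right (hu1 C hC hm S hS)
    subst hs0
    simp only [zero_smul, add_zero] at hnn
    exact (hrA C hC hm hnn S hS).ne' hSA
  set g : ℝ → ℝ := fun s => 𝓑.sideCount (A + s • u) u with hg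
  have hloc : ∀ s ∈ Set.Icc (0 : ℝ) 1, ∀ᶠ s' in nhds s, g s' = g s := by
    intro s hs
    have hc : Filter.Tendsto (fun s' : ℝ => A + s' • u) (nhds s) (nhds (A + s • u)) := by
      have : Continuous fun s' : ℝ => A + s' • u := by fun_prop
      exact this.tendsto s
    filter_upwards [hc.eventually (eventually_coord (𝓑 := 𝓑) (A + s • u))] with s' hs'
    have hshift : ∀ C S, 𝓑.coord C S (A + s • u) = 0 →
        𝓑.coord C S (A + s' • u) = (s' - s) * 𝓑.coord C S u := by
      intro C S h
      rw [hline] at h ⊢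
      linear_combination h
    have aux : ∀ u' : W, (∀ C ∈ 𝓑.cones, 𝓑.mult C ≠ 0 → ∀ S ∈ C,
        𝓑.coord C S (A + s • u) = 0 →
        ((0 < 𝓑.coord C S (A + s' • u) ∨
          (𝓑.coord C S (A + s' • u) = 0 ∧ 0 < 𝓑.coord C S u)) ↔ 0 < 𝓑.coord C S u')) →
        g s' = 𝓑.sideCount (A + s • u) u' := by
      intro u' hu'
      refine Finset.sum_congr rfl fun C hC => ?_
      by_cases hm : 𝓑.mult C = 0
      · simp [hm]
      refine if_congr ?_ rfl rfl
      refine forall₂_congr fun S hS => ?_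
      rcases lt_trichotomy (𝓑.coord C S (A + s • u)) 0 with h | h | h
      · have h1 := (hs' C hC S hS).2 h
        exact iff_of_false (fun h' => h'.elim (fun h' => absurd h' h1.not_gt)
          fun h' => h1.ne h'.1) (fun h' => h'.elim (fun h' => absurd h' h.not_gt)
          fun h' => h.ne h'.1)
      · rw [hu' C hC hm S hS h]
        simp [h]
      · have h1 := (hs' C hC S hS).1 h
        exact iff_of_true (Or.inl h1) (Or.inl h)
    rcases lt_trichotomy s' s with h | h | h
    · rw [hg]
      simp only
      rw [hwall s hs]
      refine aux (-u) fun C hC hm S hS h0 => ?_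
      have hb := hu1 C hC hm S hS
      rw [hshift C S h0, map_neg]
      have hd : s' - s < 0 := by linarith
      rcases lt_or_gt_of_ne hb with hb | hb
      · exact iff_of_true (Or.inl (mul_pos_of_neg_of_neg hd hb)) (by linarith)
      · have := mul_neg_of_neg_of_pos hd hb
        refine iff_of_false (fun h' => ?_) (by linarith)
        rcases h' with h' | h'
        · linarith
        · linarith [h'.1]
    · rw [h]
    · refine aux u fun C hC hm S hS h0 => ?_
      have hb := hu1 C hC hm S hS
      rw [hshift C S h0]
      have hd : 0 < s' - s := by linarith
      rcases lt_or_gt_of_ne hb with hb | hb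
      · have := mul_neg_of_pos_of_neg hd hb
        refine iff_of_false (fun h' => ?_) (by linarith)
        rcases h' with h' | h'
        · linarith
        · linarith [h'.1]
      · exact iff_of_true (Or.inl (mul_pos hd hb)) hb
  have hconst : g 0 = g 1 := by
    refine isPreconnected_Icc.induction₂ (fun a b => g a = g b) (fun s hs => ?_)
      (fun a b c _ _ _ hab hbc => hab.trans hbc) (fun a b _ _ h => h.symm)
      (Set.left_mem_Icc.2 zero_le_one) (Set.right_mem_Icc.2 zero_le_one)
    exact nhdsWithin_le_nhds ((hloc s hs).mono fun _ h => h.symm)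
  rw [hg] at hconst
  simp only [zero_smul, add_zero] at hconst
  rw [hrA.sideCount_eq, hend, htR.sideCount_eq, htc] at hconst
  exact hconst

end BalancedCones

/-! ### Maximal laminar families -/

section LaminarFamilies

variable {α : Type*} [DecidableEq α]

/-- A family of finite sets is laminar if any two members are nested or disjoint. -/
def Laminar (C : Finset (Finset α)) : Prop :=
  ∀ S ∈ C, ∀ T ∈ C, S ⊆ T ∨ T ⊆ S ∨ Disjoint S T

/-- Members of a family and singletons: the possible children of a member. -/
def IsBlock (C : Finset (Finset α)) (S : Finset α) : Prop :=
  S ∈ C ∨ ∃ a, S = {a}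

theorem Laminar.isBlock {C : Finset (Finset α)} (hC : Laminar C) {S T : Finset α}
    (hS : IsBlock C S) (hT : IsBlock C T) : S ⊆ T ∨ T ⊆ S ∨ Disjoint S T := by
  rcases hS with hS | ⟨a, rfl⟩
  · rcases hT with hT | ⟨b, rfl⟩
    · exact hC S hS T hT
    · by_cases h : b ∈ S
      · exact Or.inr (Or.inl (Finset.singleton_subset_iff.2 h))
      · exact Or.inr (Or.inr (Finset.disjoint_singleton_right.2 h))
  · by_cases h : a ∈ T
    · exact Or.inl (Finset.singleton_subset_iff.2 h)
    · exact Or.inr (Or.inr (Finset.disjoint_singleton_left.2 h))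

/-- A laminar family of sets with at least two elements has fewer members than its ground set
has elements. -/
theorem Laminar.card_lt {U : Finset α} (hU : U.Nonempty) {C : Finset (Finset α)} (hC : Laminar C)
    (h2 : ∀ S ∈ C, 2 ≤ S.card) (hCU : ∀ S ∈ C, S ⊆ U) : C.card < U.card := by
  induction hn : U.card generalizing U C with
  | zero => simp [Finset.card_eq_zero.1 hn] at hU
  | succ n ih =>
    rcases C.eq_empty_or_nonempty with rfl | hne
    · simp
    -- Remove from the ground set an element of a minimal member.
    obtain ⟨S, hS, hmin⟩ := C.exists_min_image Finset.card hne
    obtain ⟨a, ha⟩ := Finset.card_pos.1 (lt_of_lt_of_le Nat.zero_lt_two (h2 S hS))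
    have hbig : ∀ T ∈ C, a ∈ T → S ⊆ T := by
      intro T hT haT
      rcases hC S hS T hT with h | h | h
      · exact h
      · exact (Finset.eq_of_subset_of_card_le h (hmin T hT)).ge
      · exact absurd haT (Finset.disjoint_left.1 h ha)
    have hSa : ((S.erase a).card) + 1 = S.card := Finset.card_erase_add_one ha
    obtain ⟨b, hb⟩ : (S.erase a).Nonempty := Finset.card_pos.1 (by have := h2 S hS; omega)
    have hbig' : ∀ T ∈ C, S.erase a ⊆ T → a ∈ T := by
      intro T hT hbT
      by_contra haT
      rcases hC S hS T hT with h | h | h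
      · exact haT (h ha)
      · exact haT (Finset.eq_of_subset_of_card_le h (hmin T hT) ▸ ha)
      · exact Finset.disjoint_left.1 h (Finset.mem_of_mem_erase hb) (hbT hb)
    have hinj : Set.InjOn (fun T : Finset α => T.erase a) (C.erase S : Finset (Finset α)) := by
      intro T hT T' hT' h
      have hT := Finset.mem_of_mem_erase (Finset.mem_coe.1 hT)
      have hT' := Finset.mem_of_mem_erase (Finset.mem_coe.1 hT')
      have h : T.erase a = T'.erase a := h
      have aux : ∀ T ∈ C, ∀ T' ∈ C, T.erase a = T'.erase a → a ∈ T → a ∈ T' := by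
        intro T hT T' hT' h haT
        refine hbig' T' hT' ?_
        exact (Finset.erase_subset_erase a (hbig T hT haT)).trans
          (h.trans_subset (Finset.erase_subset _ _))
      by_cases haT : a ∈ T
      · rw [← Finset.insert_erase haT, h, Finset.insert_erase (aux T hT T' hT' h haT)]
      · have haT' : a ∉ T' := fun h' => haT (aux T' hT' T hT h.symm h')
        rwa [Finset.erase_eq_of_notMem haT, Finset.erase_eq_of_notMem haT'] at h
    have haU : a ∈ U := hCU S hS ha
    have := ih (U := U.erase a) (C := (C.erase S).image fun T => T.erase a)
      ⟨b, Finset.mem_erase.2 ⟨Finset.ne_of_mem_erase hb, hCU S hS (Finset.mem_of_mem_erase hb)⟩⟩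
      (by
        intro T hT T' hT'
        obtain ⟨T, h₁, rfl⟩ := Finset.mem_image.1 hT
        obtain ⟨T', h₂, rfl⟩ := Finset.mem_image.1 hT'
        rcases hC T (Finset.mem_of_mem_erase h₁) T' (Finset.mem_of_mem_erase h₂) with h | h | h
        · exact Or.inl (Finset.erase_subset_erase a h)
        · exact Or.inr (Or.inl (Finset.erase_subset_erase a h))
        · exact Or.inr (Or.inr (h.mono (Finset.erase_subset _ _) (Finset.erase_subset _ _))))
      (by
        intro T hT
        obtain ⟨T, h₁, rfl⟩ := Finset.mem_image.1 hT
        have hTC := Finset.mem_of_mem_erase h₁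
        by_cases haT : a ∈ T
        · have h1 : S ⊂ T := lt_of_le_of_ne (hbig T hTC haT) (Finset.ne_of_mem_erase h₁).symm
          have h3 := Finset.card_lt_card h1
          have h4 := h2 S hS
          rw [Finset.card_erase_of_mem haT]
          omega
        · simpa only [Finset.erase_eq_of_notMem haT] using h2 T hTC)
      (by
        intro T hT
        obtain ⟨T, h₁, rfl⟩ := Finset.mem_image.1 hT
        exact Finset.erase_subset_erase a (hCU T (Finset.mem_of_mem_erase h₁)))
      (by rw [Finset.card_erase_of_mem haU, hn]; rfl)
    rw [Finset.card_image_of_injOn hinj, Finset.card_erase_of_mem hS] at this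
    omega

variable [Fintype α]

/-- The combinatorial types of rooted binary trees with leaf set `α`, encoded by the sets of leaves
above the inner vertices: laminar families of sets with at least two elements, containing the
whole set, and of the largest possible cardinality. -/
structure IsMaxLaminar (C : Finset (Finset α)) : Prop where
  laminar : Laminar C
  two_le : ∀ S ∈ C, 2 ≤ S.card
  univ_mem : Finset.univ ∈ C
  card_eq : C.card + 1 = Fintype.card α

namespace IsMaxLaminar

variable {C : Finset (Finset α)}

theorem nonempty (hC : IsMaxLaminar C) {S : Finset α} (hS : IsBlock C S) : S.Nonempty := by
  rcases hS with hS | ⟨a, rfl⟩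
  · exact Finset.card_pos.1 (lt_of_lt_of_le Nat.zero_lt_two (hC.two_le S hS))
  · exact Finset.singleton_nonempty a

theorem card_le_of_laminar [Nonempty α] {C : Finset (Finset α)} (hC : Laminar C)
    (h2 : ∀ S ∈ C, 2 ≤ S.card) : C.card + 1 ≤ Fintype.card α :=
  hC.card_lt Finset.univ_nonempty h2 fun S _ => S.subset_univ

/-- In a maximal laminar family every member has exactly two children. -/
theorem exists_split (hC : IsMaxLaminar C) {S : Finset α} (hS : S ∈ C) :
    ∃ P Q, IsBlock C P ∧ IsBlock C Q ∧ Disjoint P Q ∧ S = P ∪ Q := by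
  have hSc := hC.two_le S hS
  obtain ⟨a, ha⟩ := hC.nonempty (Or.inl hS)
  have : Nonempty α := ⟨a⟩
  classical
  -- A largest child of `S`; if its complement were not a child it could be added to the family.
  have hne : ((Finset.univ : Finset (Finset α)).filter fun P => IsBlock C P ∧ P ⊂ S).Nonempty := by
    refine ⟨{a}, Finset.mem_filter.2 ⟨Finset.mem_univ _, Or.inr ⟨a, rfl⟩, ?_⟩⟩
    refine ⟨Finset.singleton_subset_iff.2 ha, fun h => ?_⟩
    have := Finset.card_le_card h
    rw [Finset.card_singleton] at this
    omega
  obtain ⟨P, hP, hmax⟩ := Finset.exists_max_image _ Finset.card hne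
  obtain ⟨-, hPC, hPS⟩ := Finset.mem_filter.1 hP
  have hdisj : Disjoint P (S \ P) := Finset.disjoint_sdiff
  have hun : S = P ∪ (S \ P) := (Finset.union_sdiff_of_subset hPS.1).symm
  refine ⟨P, S \ P, hPC, ?_, hdisj, hun⟩
  by_contra hnb
  have hSP : (S \ P).Nonempty := Finset.sdiff_nonempty.2 hPS.2
  have h2 : 2 ≤ (S \ P).card := by
    by_contra h
    have h1 : (S \ P).card = 1 := by have := Finset.card_pos.2 hSP; omega
    exact hnb (Or.inr (Finset.card_eq_one.1 h1))
  have hnest : ∀ T ∈ C, T ⊆ S \ P ∨ (S \ P) ⊆ T ∨ Disjoint T (S \ P) := by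
    intro T hT
    rcases hC.laminar T hT S hS with h | h | h
    · by_cases hTS : T = S
      · exact Or.inr (Or.inl (hTS ▸ Finset.sdiff_subset))
      · rcases hC.laminar.isBlock (Or.inl hT) hPC with h' | h' | h'
        · exact Or.inr (Or.inr (hdisj.mono_left h'))
        · have := hmax T (Finset.mem_filter.2 ⟨Finset.mem_univ _, Or.inl hT,
            lt_of_le_of_ne h hTS⟩)
          have hTP : P = T := Finset.eq_of_subset_of_card_le h' this
          exact Or.inr (Or.inr (hTP ▸ hdisj))
        · exact Or.inl fun x hx => Finset.mem_sdiff.2 ⟨h hx, Finset.disjoint_left.1 h' hx⟩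
    · exact Or.inr (Or.inl (Finset.sdiff_subset.trans h))
    · exact Or.inr (Or.inr (h.mono_right Finset.sdiff_subset))
  have hlam : Laminar (insert (S \ P) C) := by
    intro T hT T' hT'
    rcases Finset.mem_insert.1 hT with rfl | hT <;> rcases Finset.mem_insert.1 hT' with rfl | hT'
    · exact Or.inl subset_rfl
    · rcases hnest T' hT' with h | h | h
      exacts [Or.inr (Or.inl h), Or.inl h, Or.inr (Or.inr h.symm)]
    · exact hnest T hT
    · exact hC.laminar T hT T' hT'
  have := card_le_of_laminar hlam (by
    intro T hT
    rcases Finset.mem_insert.1 hT with rfl | hT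
    exacts [h2, hC.two_le T hT])
  rw [Finset.card_insert_of_notMem fun h => hnb (Or.inl h)] at this
  have := hC.card_eq
  omega

/-- A block strictly inside a member lies in one of the two children. -/
theorem subset_or_subset (hC : IsMaxLaminar C) {P Q T : Finset α} (hP : IsBlock C P)
    (hQ : IsBlock C Q) (hT : IsBlock C T) (h : T ⊂ P ∪ Q) :
    T ⊆ P ∨ T ⊆ Q := by
  have hTne := hC.nonempty hT
  rcases hC.laminar.isBlock hT hP with h1 | h1 | h1
  · exact Or.inl h1
  · rcases hC.laminar.isBlock hT hQ with h2 | h2 | h2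
    · exact Or.inr h2
    · exact absurd (Finset.union_subset h1 h2) h.2
    · exact Or.inl fun x hx => (Finset.mem_union.1 (h.1 hx)).resolve_right
        (Finset.disjoint_left.1 h2 hx)
  · exact Or.inr fun x hx => (Finset.mem_union.1 (h.1 hx)).resolve_left
      (Finset.disjoint_left.1 h1 hx)

/-- Every proper member is a child of another member. -/
theorem exists_parent (hC : IsMaxLaminar C) {S : Finset α} (hS : IsBlock C S)
    (hSu : S ≠ Finset.univ) :
    ∃ R ∈ C, ∃ X, IsBlock C X ∧ Disjoint S X ∧ R = S ∪ X ∧ ∀ T ∈ C, S ⊂ T → R ⊆ T := by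
  have hne : (C.filter fun T => S ⊂ T).Nonempty :=
    ⟨Finset.univ, Finset.mem_filter.2 ⟨hC.univ_mem, lt_of_le_of_ne S.subset_univ hSu⟩⟩
  obtain ⟨R, hR, hmin⟩ := Finset.exists_min_image _ Finset.card hne
  obtain ⟨hRC, hSR⟩ := Finset.mem_filter.1 hR
  obtain ⟨a, ha⟩ := hC.nonempty hS
  have hleast : ∀ T ∈ C, S ⊂ T → R ⊆ T := by
    intro T hT hST
    rcases hC.laminar R hRC T hT with h | h | h
    · exact h
    · exact (Finset.eq_of_subset_of_card_le h (hmin T (Finset.mem_filter.2 ⟨hT, hST⟩))).ge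
    · exact absurd (hST.1 ha) (Finset.disjoint_left.1 h (hSR.1 ha))
  obtain ⟨P, Q, hP, hQ, hd, rfl⟩ := hC.exists_split hRC
  have key : ∀ P Q, IsBlock C P → IsBlock C Q → Disjoint P Q → P ∪ Q ∈ C →
      (∀ T ∈ C, S ⊂ T → P ∪ Q ⊆ T) → S ⊆ P → S = P := by
    intro P Q hP hQ hd hPQ hl h
    by_contra hne
    rcases hP with hP | ⟨b, rfl⟩
    · have := hl P hP (lt_of_le_of_ne h hne)
      obtain ⟨b, hb⟩ := hC.nonempty hQ
      exact Finset.disjoint_left.1 hd (this (Finset.mem_union_right _ hb)) hb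
    · rcases Finset.subset_singleton_iff.1 h with h | h
      · exact absurd h (Finset.nonempty_iff_ne_empty.1 ⟨a, ha⟩)
      · exact hne h
  rcases hC.subset_or_subset hP hQ hS hSR with h | h
  · have hSP := key P Q hP hQ hd hRC hleast h
    subst hSP
    exact ⟨_, hRC, Q, hQ, hd, rfl, hleast⟩
  · have hSQ := key Q P hQ hP hd.symm (by rwa [Finset.union_comm])
      (by rwa [Finset.union_comm]) h
    subst hSQ
    exact ⟨_, hRC, P, hP, hd.symm, Finset.union_comm _ _, hleast⟩

/-- Removing a proper member `P ∪ Q` whose parent is `P ∪ Q ∪ X` leaves a family that is completed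
to a maximal one in exactly three ways. -/
theorem exists_exchange (hC : IsMaxLaminar C) {S : Finset α} (hS : S ∈ C)
    (hSu : S ≠ Finset.univ) :
    ∃ P Q X, IsBlock (C.erase S) P ∧ IsBlock (C.erase S) Q ∧ IsBlock (C.erase S) X ∧
      P ∪ Q ∪ X ∈ C.erase S ∧ Disjoint P Q ∧ Disjoint P X ∧ Disjoint Q X ∧
      P.Nonempty ∧ Q.Nonempty ∧ X.Nonempty ∧
      ∀ S', (S' ∉ C.erase S ∧ IsMaxLaminar (insert S' (C.erase S))) ↔
        (S' = P ∪ Q ∨ S' = P ∪ X ∨ S' = Q ∪ X) := by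
  obtain ⟨R, hRC, X, hX, hSX, hR, hleast⟩ := hC.exists_parent (Or.inl hS) hSu
  obtain ⟨P, Q, hP, hQ, hPQ, hSPQ⟩ := hC.exists_split hS
  have hPne := hC.nonempty hP
  have hQne := hC.nonempty hQ
  have hXne := hC.nonempty hX
  have hPX : Disjoint P X := hSX.mono_left (hSPQ ▸ Finset.subset_union_left)
  have hQX : Disjoint Q X := hSX.mono_left (hSPQ ▸ Finset.subset_union_right)
  have hbl : ∀ T, IsBlock C T → T ≠ S → IsBlock (C.erase S) T := by
    intro T hT hne
    rcases hT with hT | hT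
    · exact Or.inl (Finset.mem_erase.2 ⟨hne, hT⟩)
    · exact Or.inr hT
  have hne_of : ∀ A B : Finset α, Disjoint A B → B.Nonempty → A ∪ B ≠ A := by
    intro A B hd hB h
    obtain ⟨b, hb⟩ := hB
    exact Finset.disjoint_left.1 hd (h ▸ Finset.mem_union_right _ hb) hb
  have hPS : P ≠ S := fun h => hne_of P Q hPQ hQne (hSPQ ▸ h.symm)
  have hQS : Q ≠ S := fun h => hne_of Q P hPQ.symm hPne (by rw [Finset.union_comm, ← hSPQ, h])
  have hXS : X ≠ S := by
    rintro rfl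
    exact hXne.ne_empty (Finset.disjoint_self_iff_empty _ |>.1 hSX)
  have hRS : R ≠ S := fun h => hne_of S X hSX hXne (hR ▸ h)
  have hP' := hbl P hP hPS
  have hQ' := hbl Q hQ hQS
  have hX' := hbl X hX hXS
  have hR' : R ∈ C.erase S := Finset.mem_erase.2 ⟨hRS, hRC⟩
  have hReq : R = P ∪ Q ∪ X := by rw [hR, hSPQ]
  have huniv : Finset.univ ∈ C.erase S := Finset.mem_erase.2 ⟨hSu.symm, hC.univ_mem⟩
  refine ⟨P, Q, X, hP', hQ', hX', hReq ▸ hR', hPQ, hPX, hQX, hPne, hQne, hXne, fun S' => ?_⟩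
  -- The unions of two of the three blocks `P, Q, X` are compatible with all other members.
  have hgood : ∀ A B D : Finset α, IsBlock (C.erase S) A → IsBlock (C.erase S) B →
      IsBlock (C.erase S) D → R = A ∪ B ∪ D → Disjoint A B → Disjoint A D → Disjoint B D →
      A.Nonempty → B.Nonempty → D.Nonempty → (∀ T ∈ C.erase S, T ⊂ R → T ⊆ A ∨ T ⊆ B ∨ T ⊆ D) →
      A ∪ B ∉ C.erase S ∧ IsMaxLaminar (insert (A ∪ B) (C.erase S)) := by
    intro A B D hA hB hD hRe hAB hAD hBD hAn hBn hDn hsub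
    have hnot : A ∪ B ∉ C.erase S := by
      intro h
      have hss : A ∪ B ⊂ R := by
        refine lt_of_le_of_ne (hRe ▸ Finset.subset_union_left) fun h' => ?_
        exact hne_of (A ∪ B) D (Finset.disjoint_union_left.2 ⟨hAD, hBD⟩) hDn (by rw [← hRe, h'])
      obtain ⟨x, hx⟩ := hAn
      obtain ⟨y, hy⟩ := hBn
      have hx' : x ∈ A ∪ B := Finset.mem_union_left _ hx
      have hy' : y ∈ A ∪ B := Finset.mem_union_right _ hy
      rcases hsub _ h hss with h1 | h1 | h1
      · exact Finset.disjoint_left.1 hAB (h1 hy') hy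
      · exact Finset.disjoint_left.1 hAB hx (h1 hx')
      · exact Finset.disjoint_left.1 hAD hx (h1 hx')
    have hnest : ∀ T ∈ C.erase S, A ∪ B ⊆ T ∨ T ⊆ A ∪ B ∨ Disjoint (A ∪ B) T := by
      intro T hT
      rcases hC.laminar T (Finset.mem_of_mem_erase hT) R hRC with h | h | h
      · by_cases hTR : T = R
        · exact Or.inl (hTR ▸ hRe ▸ Finset.subset_union_left)
        · rcases hsub T hT (lt_of_le_of_ne h hTR) with h | h | h
          · exact Or.inr (Or.inl (h.trans Finset.subset_union_left))
          · exact Or.inr (Or.inl (h.trans Finset.subset_union_right))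
          · exact Or.inr (Or.inr ((Finset.disjoint_union_left.2 ⟨hAD, hBD⟩).mono_right h))
      · exact Or.inl ((hRe ▸ Finset.subset_union_left : A ∪ B ⊆ R).trans h)
      · exact Or.inr (Or.inr (h.symm.mono_left (hRe ▸ Finset.subset_union_left)))
    refine ⟨hnot, ⟨?_, ?_, Finset.mem_insert_of_mem huniv, ?_⟩⟩
    · intro T hT T' hT'
      rcases Finset.mem_insert.1 hT with rfl | hT <;> rcases Finset.mem_insert.1 hT' with rfl | hT'
      · exact Or.inl subset_rfl
      · exact hnest T' hT'
      · rcases hnest T hT with h | h | h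
        exacts [Or.inr (Or.inl h), Or.inl h, Or.inr (Or.inr h.symm)]
      · exact hC.laminar T (Finset.mem_of_mem_erase hT) T' (Finset.mem_of_mem_erase hT')
    · intro T hT
      rcases Finset.mem_insert.1 hT with rfl | hT
      · rw [Finset.card_union_of_disjoint hAB]
        have := Finset.card_pos.2 hAn
        have := Finset.card_pos.2 hBn
        omega
      · exact hC.two_le T (Finset.mem_of_mem_erase hT)
    · rw [Finset.card_insert_of_notMem hnot, Finset.card_erase_add_one hS, hC.card_eq]
  have hsub : ∀ T ∈ C.erase S, T ⊂ R → T ⊆ P ∨ T ⊆ Q ∨ T ⊆ X := by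
    intro T hT hTR
    have hTC : IsBlock C T := Or.inl (Finset.mem_of_mem_erase hT)
    rcases hC.subset_or_subset (Or.inl hS) hX hTC (hR ▸ hTR) with h | h
    · have hTS : T ⊂ P ∪ Q := hSPQ ▸ lt_of_le_of_ne h (Finset.ne_of_mem_erase hT)
      rcases hC.subset_or_subset hP hQ hTC hTS with h | h
      exacts [Or.inl h, Or.inr (Or.inl h)]
    · exact Or.inr (Or.inr h)
  constructor
  · rintro ⟨hS'C, hS'⟩
    have hS'm : S' ∈ insert S' (C.erase S) := Finset.mem_insert_self _ _
    have hS'2 := hS'.two_le S' hS'm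
    have hnest : ∀ T, IsBlock (C.erase S) T → S' ⊆ T ∨ T ⊆ S' ∨ Disjoint S' T := by
      intro T hT
      refine hS'.laminar.isBlock (Or.inl hS'm) ?_
      rcases hT with hT | hT
      exacts [Or.inl (Finset.mem_insert_of_mem hT), Or.inr hT]
    have hS'u : S' ≠ Finset.univ := fun h => hS'C (h ▸ huniv)
    -- The smallest other member containing `S'` is `R`.
    have hne : ((C.erase S).filter fun T => S' ⊆ T).Nonempty :=
      ⟨Finset.univ, Finset.mem_filter.2 ⟨huniv, S'.subset_univ⟩⟩
    obtain ⟨T, hT, hmin⟩ := Finset.exists_min_image _ Finset.card hne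
    obtain ⟨hTC, hS'T⟩ := Finset.mem_filter.1 hT
    have hS'Tne : S' ≠ T := fun h => hS'C (h ▸ hTC)
    have hnotin : ∀ A, IsBlock (C.erase S) A → A ⊂ T → ¬ S' ⊆ A := by
      intro A hA hAT hSA
      rcases hA with hA | ⟨a, rfl⟩
      · have h1 := hmin A (Finset.mem_filter.2 ⟨hA, hSA⟩)
        have h3 := Finset.card_lt_card hAT
        omega
      · have := Finset.card_le_card hSA
        rw [Finset.card_singleton] at this
        omega
    have hcase : ∀ A, IsBlock (C.erase S) A → A ⊂ T → A ⊆ S' ∨ Disjoint S' A := by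
      intro A hA hAT
      rcases hnest A hA with h | h | h
      exacts [absurd h (hnotin A hA hAT), Or.inl h, Or.inr h]
    have hTR : T = R := by
      by_contra hTR
      obtain ⟨Y, Z, hY, hZ, hYZ, hTYZ⟩ := hC.exists_split (Finset.mem_of_mem_erase hTC)
      have hYne := hC.nonempty hY
      have hZne := hC.nonempty hZ
      have hYT : Y ⊂ T := hTYZ ▸ lt_of_le_of_ne Finset.subset_union_left
        (hne_of Y Z hYZ hZne).symm
      have hZT : Z ⊂ T := hTYZ ▸ lt_of_le_of_ne Finset.subset_union_right
        (by rw [Finset.union_comm]; exact (hne_of Z Y hYZ.symm hYne).symm)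
      have hchild : ∀ A B, IsBlock C A → IsBlock C B → Disjoint A B → A.Nonempty → B.Nonempty →
          T = A ∪ B → A ≠ S := by
        intro A B hA hB hAB hAn hBn hTAB hAS
        subst hAS
        have h1 : A ⊂ T := hTAB ▸ lt_of_le_of_ne Finset.subset_union_left
          (hne_of A B hAB hBn).symm
        have h2 : R ⊂ A ∪ B := hTAB ▸ lt_of_le_of_ne
          (hleast T (Finset.mem_of_mem_erase hTC) h1) (fun h => hTR h.symm)
        obtain ⟨x, hx⟩ := hAn
        rcases hC.subset_or_subset hA hB (Or.inl hRC) h2 with h | h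
        · obtain ⟨y, hy⟩ := hXne
          exact Finset.disjoint_left.1 hSX (h (hR ▸ Finset.mem_union_right _ hy)) hy
        · exact Finset.disjoint_left.1 hAB hx (h (hR ▸ Finset.mem_union_left _ hx))
      have hY' := hbl Y hY (hchild Y Z hY hZ hYZ hYne hZne hTYZ)
      have hZ' := hbl Z hZ (hchild Z Y hZ hY hYZ.symm hZne hYne
        (by rw [hTYZ, Finset.union_comm]))
      have hS'ne : S'.Nonempty := Finset.card_pos.1 (by omega)
      rcases hcase Y hY' hYT with h1 | h1 <;> rcases hcase Z hZ' hZT with h3 | h3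
      · exact hS'Tne (hS'T.antisymm (hTYZ ▸ Finset.union_subset h1 h3))
      · refine hnotin Y hY' hYT fun x hx => ?_
        exact (Finset.mem_union.1 (hTYZ ▸ hS'T hx)).resolve_right (Finset.disjoint_left.1 h3 hx)
      · refine hnotin Z hZ' hZT fun x hx => ?_
        exact (Finset.mem_union.1 (hTYZ ▸ hS'T hx)).resolve_left (Finset.disjoint_left.1 h1 hx)
      · obtain ⟨x, hx⟩ := hS'ne
        rcases Finset.mem_union.1 (hTYZ ▸ hS'T hx) with h | h
        · exact Finset.disjoint_left.1 h1 hx h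
        · exact Finset.disjoint_left.1 h3 hx h
    subst hTR
    obtain ⟨p, hp⟩ := hPne
    obtain ⟨q, hq⟩ := hQne
    obtain ⟨y, hy⟩ := hXne
    have hPT : P ⊂ T := ⟨hReq ▸ (Finset.subset_union_left.trans Finset.subset_union_left),
      fun h => Finset.disjoint_left.1 hPX (h (hReq ▸ Finset.mem_union_right _ hy)) hy⟩
    have hQT : Q ⊂ T := ⟨hReq ▸ (Finset.subset_union_right.trans Finset.subset_union_left),
      fun h => Finset.disjoint_left.1 hQX (h (hReq ▸ Finset.mem_union_right _ hy)) hy⟩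
    have hXT : X ⊂ T := ⟨hReq ▸ Finset.subset_union_right, fun h => Finset.disjoint_left.1 hPX hp
      (h (hReq ▸ Finset.mem_union_left _ (Finset.mem_union_left _ hp)))⟩
    have hmem : ∀ x ∈ S', x ∈ P ∨ x ∈ Q ∨ x ∈ X := by
      intro x hx
      have := hS'T hx
      rw [hReq, Finset.mem_union, Finset.mem_union] at this
      tauto
    have hPn := hnotin P hP' hPT
    have hQn := hnotin Q hQ' hQT
    have hXn := hnotin X hX' hXT
    rcases hcase P hP' hPT with h1 | h1 <;> rcases hcase Q hQ' hQT with h3 | h3 <;>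
      rcases hcase X hX' hXT with h5 | h5
    · exact absurd (hS'T.antisymm (hReq ▸ Finset.union_subset (Finset.union_subset h1 h3) h5))
        hS'Tne
    · refine Or.inl (Finset.Subset.antisymm (fun x hx => ?_) (Finset.union_subset h1 h3))
      have := Finset.disjoint_left.1 h5 hx
      have := hmem x hx
      rw [Finset.mem_union]; tauto
    · refine Or.inr (Or.inl (Finset.Subset.antisymm (fun x hx => ?_) (Finset.union_subset h1 h5)))
      have := Finset.disjoint_left.1 h3 hx
      have := hmem x hx
      rw [Finset.mem_union]; tauto
    · refine absurd (fun x hx => ?_) hPn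
      have := Finset.disjoint_left.1 h3 hx
      have := Finset.disjoint_left.1 h5 hx
      have := hmem x hx
      tauto
    · refine Or.inr (Or.inr (Finset.Subset.antisymm (fun x hx => ?_) (Finset.union_subset h3 h5)))
      have := Finset.disjoint_left.1 h1 hx
      have := hmem x hx
      rw [Finset.mem_union]; tauto
    · refine absurd (fun x hx => ?_) hQn
      have := Finset.disjoint_left.1 h1 hx
      have := Finset.disjoint_left.1 h5 hx
      have := hmem x hx
      tauto
    · refine absurd (fun x hx => ?_) hXn
      have := Finset.disjoint_left.1 h1 hx
      have := Finset.disjoint_left.1 h3 hx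
      have := hmem x hx
      tauto
    · refine absurd (fun x hx => ?_) hPn
      have := Finset.disjoint_left.1 h1 hx
      have := Finset.disjoint_left.1 h3 hx
      have := Finset.disjoint_left.1 h5 hx
      have := hmem x hx
      tauto
  · rintro (rfl | rfl | rfl)
    · exact hgood P Q X hP' hQ' hX' hReq hPQ hPX hQX hPne hQne hXne hsub
    · refine hgood P X Q hP' hX' hQ' ?_ hPX hPQ hQX.symm hPne hXne hQne ?_
      · rw [hReq, Finset.union_right_comm]
      · intro T hT h
        rcases hsub T hT h with h | h | h
        exacts [Or.inl h, Or.inr (Or.inr h), Or.inr (Or.inl h)]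
    · refine hgood Q X P hQ' hX' hP' ?_ hQX hPQ.symm hPX.symm hQne hXne hPne ?_
      · rw [hReq, Finset.union_assoc, Finset.union_comm]
      · intro T hT h
        rcases hsub T hT h with h | h | h
        exacts [Or.inr (Or.inr h), Or.inl h, Or.inr (Or.inl h)]

end IsMaxLaminar

end LaminarFamilies

/-! ### Indices and determinants -/

/-- The index of the lattice spanned by the rows of a square integer matrix. -/
theorem index_closure_range_eq_natAbs_det {κ : Type*} [Fintype κ] [DecidableEq κ]
    (M : Matrix κ κ ℤ) : (AddSubgroup.closure (Set.range fun k => M k)).index = M.det.natAbs := by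
  set H := AddSubgroup.closure (Set.range fun k => M k) with hH
  by_cases hdet : M.det = 0
  · rw [hdet, Int.natAbs_zero]
    by_contra hne
    obtain ⟨v, hv0, hv⟩ := Matrix.exists_mulVec_eq_zero_iff.2 hdet
    have hperp : ∀ x ∈ H, x ⬝ᵥ v = 0 := by
      intro x hx
      induction hx using AddSubgroup.closure_induction with
      | mem x hx =>
        obtain ⟨k, rfl⟩ := hx
        exact congrFun hv k
      | zero => simp
      | add x y _ _ hx hy => rw [add_dotProduct, hx, hy, add_zero]
      | neg x _ hx => rw [neg_dotProduct, hx, neg_zero]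
    refine hv0 (funext fun i => ?_)
    have := hperp _ (AddSubgroup.nsmul_index_mem H (Pi.single i (1 : ℤ)))
    rw [smul_dotProduct, single_dotProduct, one_mul, smul_eq_zero] at this
    exact this.resolve_left hne
  · have hli : LinearIndependent ℤ (fun k => M k) := by
      refine Matrix.linearIndependent_rows_of_det_ne_zero hdet
    have hspan : H.toIntSubmodule = Submodule.span ℤ (Set.range fun k => M k) := by
      rw [hH, ← Submodule.span_int_eq_addSubgroupClosure]
      ext; simp
    let b₀ := Module.Basis.span hli
    let b : Module.Basis κ ℤ H.toIntSubmodule := b₀.map (LinearEquiv.ofEq _ _ hspan.symm)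
    have hb : ∀ k, ((b k : H.toIntSubmodule) : κ → ℤ) = M k := by
      intro k
      simp only [b, Module.Basis.map_apply, LinearEquiv.coe_ofEq_apply, b₀]
      exact congrArg Subtype.val (Module.Basis.span_apply hli k)
    rw [AddSubgroup.index_eq_natAbs_det (Pi.basisFun ℤ κ) H b]
    congr 1
    rw [Module.Basis.det_apply, ← Matrix.det_transpose]
    congr 1
    ext i j
    simp only [Matrix.transpose_apply, Module.Basis.toMatrix_apply, Pi.basisFun_repr]
    exact congrFun (hb i) j

/-- The index of a lattice spanned by as many vectors as the rank, computed after arbitrary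
identifications of the index set and of the coordinates. -/
theorem index_closure_range_eq_abs_det {ι κ : Type*} [Fintype κ] [DecidableEq κ]
    (b : ι → κ → ℤ) (e : κ ≃ ι) :
    ((AddSubgroup.closure (Set.range b)).index : ℝ) =
      |(Matrix.of fun k j => ((b (e k) j : ℤ) : ℝ)).det| := by
  have h1 : Set.range b = Set.range fun k => (Matrix.of fun k j => b (e k) j) k := by
    rw [← e.surjective.range_comp b]; rfl
  rw [h1, index_closure_range_eq_natAbs_det, Nat.cast_natAbs, Int.cast_abs]
  congr 1
  exact Int.cast_det (M := Matrix.of fun k j => b (e k) j)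

/-- The determinant form of a square real matrix in the row `none`. -/
noncomputable def slotDet {ι κ : Type*} [Fintype κ] [DecidableEq κ] (e : κ ≃ Option ι)
    (f : ι → κ → ℝ) : (κ → ℝ) →ₗ[ℝ] ℝ :=
  (Matrix.detRowAlternating (R := ℝ) (n := κ)).toMultilinearMap.toLinearMap
    (fun k => (e k).elim 0 f) (e.symm none)

theorem slotDet_apply {ι κ : Type*} [Fintype κ] [DecidableEq κ] (e : κ ≃ Option ι)
    (f : ι → κ → ℝ) (w : κ → ℝ) :
    slotDet e f w = (Matrix.of fun k => (e k).elim w f).det := by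
  have : Function.update (fun k => (e k).elim (0 : κ → ℝ) f) (e.symm none) w =
      fun k => (e k).elim w f := by
    funext k
    by_cases h : k = e.symm none
    · subst h; simp
    · rw [Function.update_of_ne h]
      cases hk : e k with
      | none => exact absurd ((Equiv.symm_apply_eq e).2 hk.symm).symm h
      | some i => rfl
  simp only [slotDet, MultilinearMap.toLinearMap_apply]
  rw [this]
  rfl

theorem slotDet_self {ι κ : Type*} [Fintype κ] [DecidableEq κ] (e : κ ≃ Option ι)
    (f : ι → κ → ℝ) (i : ι) : slotDet e f (f i) = 0 := by
  rw [slotDet_apply]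
  refine Matrix.det_zero_of_row_eq (i := e.symm none) (j := e.symm (some i)) (by simp) ?_
  change (e (e.symm none)).elim (f i) f = (e (e.symm (some i))).elim (f i) f
  simp

/-! ### The cones of the types of trees -/

/-- The leaves of the trees: the `l + 1` unbounded edges and the `l` marked points. -/
abbrev Leaf (l : ℕ) : Type := Fin (l + 1) ⊕ Fin l

section Clades

variable {l : ℕ} (d : Fin (l + 1) → ZLat)

/-- The sum of the directions of a set of unbounded edges: the weighted direction of the edge
below them. -/
def endSum (F : Finset (Fin (l + 1))) : ZLat := ∑ j ∈ F, d j

/-- The displacement of the marked points caused by lengthening the edge with the set of leaves `S`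
above it: the marked points in `S` move by the weighted direction of that edge. -/
def cladeVec (S : Finset (Leaf l)) (q : Fin l × Fin 2) : ℤ :=
  if Sum.inr q.1 ∈ S then endSum d S.toLeft q.2 else 0

/-- The real version of `cladeVec`. -/
noncomputable def cladeVecR (S : Finset (Leaf l)) (q : Fin l × Fin 2) : ℝ := cladeVec d S q

/-- The multiplicity of a type: the index of the lattice spanned by its displacements. -/
noncomputable def cladeMult (C : Finset (Finset (Leaf l))) : ℕ :=
  (AddSubgroup.closure (cladeVec d '' C)).index

theorem endSum_union {F F' : Finset (Fin (l + 1))} (h : Disjoint F F') :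
    endSum d (F ∪ F') = endSum d F + endSum d F' := Finset.sum_union h

theorem disjoint_toLeft {S T : Finset (Leaf l)} (h : Disjoint S T) :
    Disjoint S.toLeft T.toLeft := by
  rw [Finset.disjoint_left] at h ⊢
  intro a ha hb
  exact h (Finset.mem_toLeft.1 ha) (Finset.mem_toLeft.1 hb)

theorem disjoint_toRight {S T : Finset (Leaf l)} (h : Disjoint S T) :
    Disjoint S.toRight T.toRight := by
  rw [Finset.disjoint_left] at h ⊢
  intro a ha hb
  exact h (Finset.mem_toRight.1 ha) (Finset.mem_toRight.1 hb)

theorem endSum_toLeft_union {S T : Finset (Leaf l)} (h : Disjoint S T) :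
    endSum d (S ∪ T).toLeft = endSum d S.toLeft + endSum d T.toLeft := by
  rw [Finset.toLeft_union, endSum_union d (disjoint_toLeft h)]

theorem cladeVec_singleton (a : Leaf l) : cladeVec d {a} = 0 := by
  funext q
  rcases a with j | i
  · simp [cladeVec]
  · have : ({Sum.inr i} : Finset (Leaf l)).toLeft = ∅ := by ext; simp
    simp [cladeVec, this, endSum]

/-- The balancing relation among the three resolutions of a four-valent vertex. -/
theorem cladeVec_exchange {P Q X : Finset (Leaf l)} (hPQ : Disjoint P Q) (hPX : Disjoint P X)
    (hQX : Disjoint Q X) :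
    cladeVec d (P ∪ Q) + cladeVec d (P ∪ X) + cladeVec d (Q ∪ X) =
      cladeVec d P + cladeVec d Q + cladeVec d X + cladeVec d (P ∪ Q ∪ X) := by
  funext q
  have h1 := congrFun (endSum_toLeft_union d hPQ) q.2
  have h2 := congrFun (endSum_toLeft_union d hPX) q.2
  have h3 := congrFun (endSum_toLeft_union d hQX) q.2
  have h4 := congrFun (endSum_toLeft_union d (Finset.disjoint_union_left.2 ⟨hPX, hQX⟩)) q.2
  rw [Pi.add_apply] at h1 h2 h3 h4
  have e1 : Sum.inr q.1 ∈ P → Sum.inr q.1 ∉ Q := fun h => Finset.disjoint_left.1 hPQ h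
  have e2 : Sum.inr q.1 ∈ P → Sum.inr q.1 ∉ X := fun h => Finset.disjoint_left.1 hPX h
  have e3 : Sum.inr q.1 ∈ Q → Sum.inr q.1 ∉ X := fun h => Finset.disjoint_left.1 hQX h
  simp only [Pi.add_apply, cladeVec, Finset.mem_union, h1, h2, h3, h4]
  by_cases hP : Sum.inr q.1 ∈ P
  · simp only [hP, e1 hP, e2 hP, or_false, if_true, if_false]; ring
  · by_cases hQ : Sum.inr q.1 ∈ Q
    · simp only [hP, hQ, e3 hQ, or_true, or_false, if_true, if_false]; ring
    · by_cases hX : Sum.inr q.1 ∈ X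
      · simp only [hP, hQ, hX, or_true, or_false, if_true, if_false]; ring
      · simp only [hP, hQ, hX, or_false, if_false]; ring

theorem card_of_isMaxLaminar {C : Finset (Finset (Leaf l))} (hC : IsMaxLaminar C) :
    C.card = Fintype.card (Fin l × Fin 2) := by
  have := hC.card_eq
  simp only [Fintype.card_sum, Fintype.card_fin, Fintype.card_prod] at this ⊢
  omega

theorem nonempty_equiv_option {C : Finset (Finset (Leaf l))} (hC : IsMaxLaminar C)
    {S : Finset (Leaf l)} (hS : S ∈ C) : Nonempty ((Fin l × Fin 2) ≃ Option (C.erase S)) := by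
  refine ⟨Fintype.equivOfCardEq ?_⟩
  rw [Fintype.card_option, Fintype.card_coe, Finset.card_erase_add_one hS,
    card_of_isMaxLaminar hC]

open Classical in
/-- The determinant form of a face. -/
noncomputable def faceVol (F : Finset (Finset (Leaf l))) : (Fin l × Fin 2 → ℝ) →ₗ[ℝ] ℝ :=
  if h : Nonempty ((Fin l × Fin 2) ≃ Option F) then
    slotDet h.some (fun S => cladeVecR d S.1) else 0

theorem faceVol_of_mem {C : Finset (Finset (Leaf l))} (hC : IsMaxLaminar C)
    {S S' : Finset (Leaf l)} (hS : S ∈ C) (hS' : S' ∈ C.erase S) :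
    faceVol d (C.erase S) (cladeVecR d S') = 0 := by
  rw [faceVol, dif_pos (nonempty_equiv_option hC hS)]
  exact slotDet_self _ (fun S : C.erase S => cladeVecR d S.1) ⟨S', hS'⟩

theorem range_elim_cladeVec {C : Finset (Finset (Leaf l))} {S : Finset (Leaf l)} (hS : S ∈ C) :
    (Set.range fun o : Option (C.erase S) => o.elim (cladeVec d S) fun T => cladeVec d T.1) =
      cladeVec d '' C := by
  ext x
  constructor
  · rintro ⟨o, rfl⟩
    cases o with
    | none => exact ⟨S, hS, rfl⟩
    | some T => exact ⟨T.1, Finset.mem_of_mem_erase T.2, rfl⟩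
  · rintro ⟨T, hT, rfl⟩
    by_cases h : T = S
    · exact ⟨none, by rw [h]; rfl⟩
    · exact ⟨some ⟨T, Finset.mem_erase.2 ⟨h, hT⟩⟩, rfl⟩

theorem elim_cladeVecR {C : Finset (Finset (Leaf l))} {S : Finset (Leaf l)}
    (o : Option (C.erase S)) :
    o.elim (cladeVecR d S) (fun T => cladeVecR d T.1) =
      fun q => ((o.elim (cladeVec d S) (fun T => cladeVec d T.1) q : ℤ) : ℝ) := by
  cases o <;> rfl

theorem abs_faceVol {C : Finset (Finset (Leaf l))} (hC : IsMaxLaminar C) {S : Finset (Leaf l)}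
    (hS : S ∈ C) : |faceVol d (C.erase S) (cladeVecR d S)| = cladeMult d C := by
  rw [faceVol, dif_pos (nonempty_equiv_option hC hS), slotDet_apply, cladeMult,
    ← range_elim_cladeVec d hS, index_closure_range_eq_abs_det _ (nonempty_equiv_option hC hS).some]
  congr 3
  ext k j
  exact congrFun (elim_cladeVecR d _) j

theorem span_cladeVecR {C : Finset (Finset (Leaf l))} (hC : IsMaxLaminar C)
    (hm : cladeMult d C ≠ 0) : Submodule.span ℝ (cladeVecR d '' C) = ⊤ := by
  have hS := hC.univ_mem
  set e := (nonempty_equiv_option hC hS).some with he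
  have h := abs_faceVol d hC hS
  rw [faceVol, dif_pos (nonempty_equiv_option hC hS), slotDet_apply] at h
  have hdet : (Matrix.of fun k => (e k).elim (cladeVecR d Finset.univ)
      (fun T : C.erase Finset.univ => cladeVecR d T.1)).det ≠ 0 := by
    intro h0
    rw [← he, h0, abs_zero] at h
    exact hm (by exact_mod_cast h.symm)
  have hli := Matrix.linearIndependent_rows_of_det_ne_zero hdet
  have htop := hli.span_eq_top_of_card_eq_finrank' (by simp)
  rw [eq_top_iff, ← htop]
  refine Submodule.span_mono ?_
  rintro _ ⟨k, rfl⟩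
  change (e k).elim (cladeVecR d Finset.univ) (fun T : C.erase Finset.univ => cladeVecR d T.1) ∈ _
  cases e k with
  | none => exact ⟨_, hS, rfl⟩
  | some T => exact ⟨T.1, Finset.mem_of_mem_erase T.2, rfl⟩

open Classical in
/-- The cones of all binary types of rooted trees: their images under evaluation at the marked
points, with the lengths of the edges as coordinates. -/
noncomputable def treeCones : BalancedCones (Finset (Leaf l)) (Fin l × Fin 2 → ℝ) where
  vec := cladeVecR d
  cones := {C | IsMaxLaminar C}
  mult := cladeMult d
  vol := faceVol d
  root := Finset.univ
  vol_eq_zero C hC S hS S' hS' :=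
    faceVol_of_mem d (Finset.mem_filter.1 hC).2 hS (by convert hS')
  abs_vol C hC S hS := by
    convert abs_faceVol d (Finset.mem_filter.1 hC).2 hS
  span_eq_top C hC hm := span_cladeVecR d (Finset.mem_filter.1 hC).2 hm
  balanced C hC S hS hSu := by
    have hC := (Finset.mem_filter.1 hC).2
    obtain ⟨P, Q, X, hP, hQ, hX, hR, hPQ, hPX, hQX, hPn, hQn, hXn, hiff⟩ :=
      hC.exists_exchange hS hSu
    have hfil : (Finset.univ.filter fun S' => S' ∉ C.erase S ∧
        insert S' (C.erase S) ∈ ({C | IsMaxLaminar C} : Finset (Finset (Finset (Leaf l))))) =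
        {P ∪ Q, P ∪ X, Q ∪ X} := by
      ext S'
      have := hiff S'
      simp only [Finset.mem_filter, Finset.mem_univ, true_and, Finset.mem_insert,
        Finset.mem_singleton]
      convert this
    obtain ⟨x, hx⟩ := hPn
    obtain ⟨y, hy⟩ := hQn
    have hxQ := Finset.disjoint_left.1 hPQ hx
    have hxX := Finset.disjoint_left.1 hPX hx
    have hyX := Finset.disjoint_left.1 hQX hy
    have hyP := Finset.disjoint_right.1 hPQ hy
    have h1 : P ∪ Q ≠ P ∪ X := fun h => by
      have : y ∈ P ∪ X := h ▸ Finset.mem_union_right _ hy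
      simp [hyP, hyX] at this
    have h2 : P ∪ Q ≠ Q ∪ X := fun h => by
      have : x ∈ Q ∪ X := h ▸ Finset.mem_union_left _ hx
      simp [hxQ, hxX] at this
    have h3 : P ∪ X ≠ Q ∪ X := fun h => by
      have : x ∈ Q ∪ X := h ▸ Finset.mem_union_left _ hx
      simp [hxQ, hxX] at this
    have hzero : ∀ T, IsBlock (C.erase S) T → faceVol d (C.erase S) (cladeVecR d T) = 0 := by
      intro T hT
      rcases hT with hT | ⟨a, rfl⟩
      · convert faceVol_of_mem d hC hS (by convert hT)
      · have : cladeVecR d {a} = 0 := by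
          funext q
          rw [cladeVecR, cladeVec_singleton]
          simp
        rw [this, map_zero]
    have hex : cladeVecR d (P ∪ Q) + (cladeVecR d (P ∪ X) + cladeVecR d (Q ∪ X)) =
        cladeVecR d P + cladeVecR d Q + cladeVecR d X + cladeVecR d (P ∪ Q ∪ X) := by
      funext q
      have := congrFun (cladeVec_exchange d hPQ hPX hQX) q
      simp only [Pi.add_apply] at this
      simp only [Pi.add_apply, cladeVecR]
      rw [← add_assoc]
      exact_mod_cast this
    have hsum : ∑ S' ∈ ({P ∪ Q, P ∪ X, Q ∪ X} : Finset (Finset (Leaf l))),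
        faceVol d (C.erase S) (cladeVecR d S') = 0 := by
      rw [Finset.sum_insert (by simp [h1, h2]), Finset.sum_insert (by simp [h3]),
        Finset.sum_singleton, ← map_add, ← map_add, hex, map_add, map_add, map_add,
        hzero P hP, hzero Q hQ, hzero X hX, hzero _ (Or.inl hR)]
      simp
    rw [← hfil] at hsum
    convert hsum
end Clades

/-! ### Types of nonzero multiplicity -/

namespace IsMaxLaminar

/-- The number of members contained in a given block. -/
theorem card_filter_subset {α : Type*} [DecidableEq α] [Fintype α] {C : Finset (Finset α)}
    (hC : IsMaxLaminar C) {S : Finset α} (hS : IsBlock C S) :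
    (C.filter fun T => T ⊆ S).card + 1 = S.card := by
  induction hn : S.card using Nat.strong_induction_on generalizing S with
  | _ n ih =>
    rcases em (S ∈ C) with hSC | hSC
    · obtain ⟨P, Q, hP, hQ, hd, rfl⟩ := hC.exists_split hSC
      have hPn := Finset.card_pos.2 (hC.nonempty hP)
      have hQn := Finset.card_pos.2 (hC.nonempty hQ)
      rw [Finset.card_union_of_disjoint hd] at hn
      have h1 := ih P.card (by omega) hP rfl
      have h2 := ih Q.card (by omega) hQ rfl
      have heq : (C.filter fun T => T ⊆ P ∪ Q) =
          insert (P ∪ Q) ((C.filter fun T => T ⊆ P) ∪ (C.filter fun T => T ⊆ Q)) := by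
        ext T
        simp only [Finset.mem_filter, Finset.mem_insert, Finset.mem_union]
        constructor
        · rintro ⟨hT, hTs⟩
          by_cases h : T = P ∪ Q
          · exact Or.inl h
          · rcases hC.subset_or_subset hP hQ (Or.inl hT) (lt_of_le_of_ne hTs h) with h | h
            exacts [Or.inr (Or.inl ⟨hT, h⟩), Or.inr (Or.inr ⟨hT, h⟩)]
        · rintro (rfl | ⟨hT, h⟩ | ⟨hT, h⟩)
          · exact ⟨hSC, subset_rfl⟩
          · exact ⟨hT, h.trans Finset.subset_union_left⟩
          · exact ⟨hT, h.trans Finset.subset_union_right⟩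
      have hdis : Disjoint (C.filter fun T => T ⊆ P) (C.filter fun T => T ⊆ Q) := by
        rw [Finset.disjoint_left]
        intro T hT hT'
        obtain ⟨a, ha⟩ := hC.nonempty (Or.inl (Finset.mem_filter.1 hT).1)
        exact Finset.disjoint_left.1 hd ((Finset.mem_filter.1 hT).2 ha)
          ((Finset.mem_filter.1 hT').2 ha)
      have hnot : P ∪ Q ∉ (C.filter fun T => T ⊆ P) ∪ (C.filter fun T => T ⊆ Q) := by
        simp only [Finset.mem_union, Finset.mem_filter, not_or, not_and]
        refine ⟨fun _ h => ?_, fun _ h => ?_⟩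
        · have := Finset.card_le_card h
          rw [Finset.card_union_of_disjoint hd] at this
          omega
        · have := Finset.card_le_card h
          rw [Finset.card_union_of_disjoint hd] at this
          omega
      rw [heq, Finset.card_insert_of_notMem hnot, Finset.card_union_of_disjoint hdis]
      omega
    · obtain ⟨a, rfl⟩ := hS.resolve_left hSC
      rw [Finset.card_singleton] at hn
      rw [Finset.filter_eq_empty_iff.2, Finset.card_empty, ← hn]
      intro T hT h
      have := Finset.card_le_card h
      have := hC.two_le T hT
      rw [Finset.card_singleton] at *
      omega

end IsMaxLaminar

section Types

variable {l : ℕ} {d : Fin (l + 1) → ZLat} {C : Finset (Finset (Leaf l))}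

theorem linearIndependent_cladeVecR (hC : IsMaxLaminar C) (hm : cladeMult d C ≠ 0) :
    LinearIndependent ℝ fun S : C => cladeVecR d S.1 := by
  refine linearIndependent_of_top_le_span_of_card_eq_finrank ?_ ?_
  · rw [← span_cladeVecR d hC hm]
    refine Submodule.span_mono ?_
    rintro _ ⟨S, hS, rfl⟩
    exact ⟨⟨S, hS⟩, rfl⟩
  · rw [Fintype.card_coe, card_of_isMaxLaminar hC, Module.finrank_pi]

theorem cladeVecR_ne_zero (hC : IsMaxLaminar C) (hm : cladeMult d C ≠ 0) {S : Finset (Leaf l)}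
    (hS : S ∈ C) : cladeVecR d S ≠ 0 :=
  (linearIndependent_cladeVecR hC hm).ne_zero (⟨S, hS⟩ : C)

theorem endSum_ne_zero (hC : IsMaxLaminar C) (hm : cladeMult d C ≠ 0) {S : Finset (Leaf l)}
    (hS : S ∈ C) : endSum d S.toLeft ≠ 0 := by
  intro h
  refine cladeVecR_ne_zero hC hm hS (funext fun q => ?_)
  simp [cladeVecR, cladeVec, h]

theorem card_eq_toLeft_add_toRight (S : Finset (Leaf l)) :
    S.card = S.toLeft.card + S.toRight.card := (Finset.card_toLeft_add_card_toRight).symm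

theorem card_coordinates (S : Finset (Leaf l)) :
    Fintype.card {q : Fin l × Fin 2 // Sum.inr q.1 ∈ S} = 2 * S.toRight.card := by
  rw [Fintype.card_subtype]
  have : (Finset.univ.filter fun q : Fin l × Fin 2 => (Sum.inr q.1 : Leaf l) ∈ S) =
      S.toRight ×ˢ Finset.univ := by
    ext q; simp
  rw [this, Finset.card_product, Finset.card_univ, Fintype.card_fin, mul_comm]

/-- In a type with nonzero multiplicity, the marked points above an edge are free to move
independently of each other as far as the edges above allow: the number of unbounded edges
exceeds the number of marked points by at most one. -/
theorem card_toLeft_le (hC : IsMaxLaminar C) (hm : cladeMult d C ≠ 0) {S : Finset (Leaf l)}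
    (hS : S ∈ C) : S.toLeft.card ≤ S.toRight.card + 1 := by
  set ι := {q : Fin l × Fin 2 // Sum.inr q.1 ∈ S} with hι
  set sub := C.filter fun T => T ⊆ S with hsub
  have hli := linearIndependent_cladeVecR hC hm
  have hli' : LinearIndependent ℝ (fun T : sub => cladeVecR d T.1) :=
    hli.comp (fun T : sub => (⟨T.1, (Finset.mem_filter.1 T.2).1⟩ : C)) (fun T T' h =>
      Subtype.ext (Subtype.mk.inj h))
  have hcomp : (fun T : sub => cladeVecR d T.1) =
      (Function.ExtendByZero.linearMap ℝ (Subtype.val : ι → Fin l × Fin 2)) ∘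
        fun T : sub => fun q : ι => cladeVecR d T.1 q.1 := by
    funext T q
    by_cases h : Sum.inr q.1 ∈ S
    · have := Subtype.val_injective.extend_apply (fun q : ι => cladeVecR d T.1 q.1) 0 (⟨q, h⟩ : ι)
      exact this.symm
    · have h1 : ¬ ∃ a : ι, a.1 = q := by
        rintro ⟨a, rfl⟩
        exact h a.2
      have := Function.extend_apply' (fun q : ι => cladeVecR d T.1 q.1) (0 : Fin l × Fin 2 → ℝ) q h1
      refine Eq.trans ?_ this.symm
      have h2 : Sum.inr q.1 ∉ T.1 := fun h' => h ((Finset.mem_filter.1 T.2).2 h')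
      simp [cladeVecR, cladeVec, h2]
  rw [hcomp] at hli'
  have hli'' := LinearIndependent.of_comp _ hli'
  have h1 := hli''.fintype_card_le_finrank
  rw [Module.finrank_pi, card_coordinates, Fintype.card_coe] at h1
  have h2 := hC.card_filter_subset (Or.inl hS)
  rw [card_eq_toLeft_add_toRight] at h2
  rw [hsub] at h1
  omega

/-- In a type with nonzero multiplicity there are at most as many marked points as unbounded
edges above any edge. -/
theorem card_toRight_le (hC : IsMaxLaminar C) (hm : cladeMult d C ≠ 0) {S : Finset (Leaf l)}
    (hS : S ∈ C) : S.toRight.card ≤ S.toLeft.card := by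
  classical
  set ι := {q : Fin l × Fin 2 // Sum.inr q.1 ∈ S} with hι
  set sub := C.filter fun T => T ⊆ S with hsub
  set ρ : (Fin l × Fin 2 → ℝ) →ₗ[ℝ] (ι → ℝ) := LinearMap.funLeft ℝ ℝ Subtype.val with hρ
  have hρs : Function.Surjective ρ :=
    LinearMap.funLeft_surjective_of_injective ℝ ℝ _ Subtype.val_injective
  have hne := endSum_ne_zero hC hm hS
  -- A common translation of all marked points, transversal to the edge of `S`.
  obtain ⟨a, ha⟩ : ∃ a : Fin 2, endSum d S.toLeft a ≠ 0 := by
    by_contra h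
    push Not at h
    exact hne (funext h)
  set c : ι → ℝ := fun q => if q.1.2 = a then 0 else 1 with hc
  have hmemS : S ∈ sub := Finset.mem_filter.2 ⟨hS, subset_rfl⟩
  have hρS : ∀ T, S ⊆ T → ∀ q : ι, ρ (cladeVecR d T) q = (endSum d T.toLeft q.1.2 : ℝ) := by
    intro T hT q
    have : Sum.inr q.1.1 ∈ T := hT q.2
    simp [hρ, LinearMap.funLeft_apply, cladeVecR, cladeVec, this]
  have hspan : Submodule.span ℝ (((insert c (sub.image fun T => ρ (cladeVecR d T))) :
      Finset (ι → ℝ)) : Set (ι → ℝ)) = ⊤ := by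
    rw [eq_top_iff]
    have h1 : (⊤ : Submodule ℝ (ι → ℝ)) = Submodule.span ℝ (ρ '' (cladeVecR d '' C)) := by
      rw [Submodule.span_image, span_cladeVecR d hC hm, Submodule.map_top,
        LinearMap.range_eq_top.2 hρs]
    rw [h1, Submodule.span_le]
    rintro _ ⟨_, ⟨T, hT, rfl⟩, rfl⟩
    rcases hC.laminar T hT S hS with h | h | h
    · refine Submodule.subset_span ?_
      rw [Finset.mem_coe, Finset.mem_insert]
      exact Or.inr (Finset.mem_image.2 ⟨T, Finset.mem_filter.2 ⟨hT, h⟩, rfl⟩)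
    · have hcm : c ∈ Submodule.span ℝ (((insert c (sub.image fun T => ρ (cladeVecR d T))) :
          Finset (ι → ℝ)) : Set (ι → ℝ)) := Submodule.subset_span (by simp)
      have hSm : ρ (cladeVecR d S) ∈ Submodule.span ℝ (((insert c (sub.image fun T =>
          ρ (cladeVecR d T))) : Finset (ι → ℝ)) : Set (ι → ℝ)) := by
        refine Submodule.subset_span ?_
        rw [Finset.mem_coe, Finset.mem_insert]
        exact Or.inr (Finset.mem_image.2 ⟨S, hmemS, rfl⟩)
      obtain ⟨b, hab, hb⟩ : ∃ b : Fin 2, a ≠ b ∧ ∀ x, x = a ∨ x = b := by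
        fin_cases a
        · exact ⟨1, by simp, fun x => by fin_cases x <;> simp⟩
        · exact ⟨0, by simp, fun x => by fin_cases x <;> simp⟩
      have haR : (endSum d S.toLeft a : ℝ) ≠ 0 := by exact_mod_cast ha
      have hTe : ρ (cladeVecR d T) = ((endSum d T.toLeft a : ℝ) / endSum d S.toLeft a) •
          ρ (cladeVecR d S) + ((endSum d T.toLeft b : ℝ) - (endSum d T.toLeft a : ℝ) /
            endSum d S.toLeft a * endSum d S.toLeft b) • c := by
        funext q
        rw [Pi.add_apply, Pi.smul_apply, Pi.smul_apply, hρS T h, hρS S subset_rfl, smul_eq_mul,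
          smul_eq_mul, hc]
        rcases hb q.1.2 with hq | hq
        · simp only [hq, if_true]; field_simp; ring
        · simp only [hq, if_neg hab.symm]; ring
      rw [SetLike.mem_coe, hTe]
      exact Submodule.add_mem _ (Submodule.smul_mem _ _ hSm) (Submodule.smul_mem _ _ hcm)
    · have : ρ (cladeVecR d T) = 0 := by
        funext q
        have : Sum.inr q.1.1 ∉ T := Finset.disjoint_right.1 h q.2
        simp [hρ, LinearMap.funLeft_apply, cladeVecR, cladeVec, this]
      rw [this]
      exact Submodule.zero_mem _
  have h1 := finrank_span_finset_le_card (R := ℝ)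
    (insert c (sub.image fun T => ρ (cladeVecR d T)) : Finset (ι → ℝ))
  rw [Set.finrank, hspan, finrank_top, Module.finrank_pi, card_coordinates] at h1
  have h2 := Finset.card_insert_le c (sub.image fun T => ρ (cladeVecR d T))
  have h3 := Finset.card_image_le (s := sub) (f := fun T => ρ (cladeVecR d T))
  have h4 := hC.card_filter_subset (Or.inl hS)
  rw [card_eq_toLeft_add_toRight] at h4
  rw [hsub] at h3
  have h5 := h1.trans h2
  simp only [hsub] at h5
  omega

/-- Blocks of nonzero types are unbounded edges, marked points, or contain as many marked points
as unbounded edges or one less. -/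
theorem block_cases (hC : IsMaxLaminar C) (hm : cladeMult d C ≠ 0) {S : Finset (Leaf l)}
    (hS : IsBlock C S) :
    (S ∈ C ∧ S.toLeft.card = S.toRight.card) ∨ S.toLeft.card = S.toRight.card + 1 ∨
      ∃ i, S = {Sum.inr i} := by
  rcases hS with hS | ⟨j | i, rfl⟩
  · have h1 := card_toLeft_le hC hm hS
    have h2 := card_toRight_le hC hm hS
    rcases h2.eq_or_lt with h | h
    · exact Or.inl ⟨hS, h.symm⟩
    · exact Or.inr (Or.inl (by omega))
  · refine Or.inr (Or.inl ?_)
    have h1 : ({Sum.inl j} : Finset (Leaf l)).toLeft = {j} := by ext; simp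
    have h2 : ({Sum.inl j} : Finset (Leaf l)).toRight = ∅ := by ext; simp
    rw [h1, h2]; rfl
  · exact Or.inr (Or.inr ⟨i, rfl⟩)

theorem card_toLeft_union {P Q : Finset (Leaf l)} (h : Disjoint P Q) :
    (P ∪ Q).toLeft.card = P.toLeft.card + Q.toLeft.card := by
  rw [Finset.toLeft_union, Finset.card_union_of_disjoint (disjoint_toLeft h)]

theorem card_toRight_union {P Q : Finset (Leaf l)} (h : Disjoint P Q) :
    (P ∪ Q).toRight.card = P.toRight.card + Q.toRight.card := by
  rw [Finset.toRight_union, Finset.card_union_of_disjoint (disjoint_toRight h)]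

theorem card_toLeft_singleton_inr (i : Fin l) :
    ({Sum.inr i} : Finset (Leaf l)).toLeft.card = 0 := by
  have h1 : ({Sum.inr i} : Finset (Leaf l)).toLeft = ∅ := by ext; simp
  rw [h1]; rfl

theorem card_toRight_singleton_inr (i : Fin l) :
    ({Sum.inr i} : Finset (Leaf l)).toRight.card = 1 := by
  have h1 : ({Sum.inr i} : Finset (Leaf l)).toRight = {i} := by ext; simp
  rw [h1]; rfl

/-- The smallest member `{i} ∪ U` containing a marked point `i`: there are equally many marked
points and unbounded edges in it. -/
theorem exists_markClade (hC : IsMaxLaminar C) (hm : cladeMult d C ≠ 0) (i : Fin l) :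
    ∃ U, IsBlock C U ∧ Sum.inr i ∉ U ∧ insert (Sum.inr i) U ∈ C ∧
      U.toLeft.card = U.toRight.card + 1 ∧ ∀ T ∈ C, Sum.inr i ∈ T → insert (Sum.inr i) U ⊆ T := by
  have hne : ({Sum.inr i} : Finset (Leaf l)) ≠ Finset.univ := by
    intro h
    have : (Sum.inl 0 : Leaf l) ∈ ({Sum.inr i} : Finset (Leaf l)) := h ▸ Finset.mem_univ _
    simp at this
  obtain ⟨R, hR, U, hU, hd, rfl, hmin⟩ := hC.exists_parent (Or.inr ⟨Sum.inr i, rfl⟩) hne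
  refine ⟨U, hU, Finset.disjoint_singleton_left.1 hd, hR, ?_, fun T hT hi => ?_⟩
  · have h1 := card_toRight_le hC hm hR
    rw [card_toLeft_union hd, card_toRight_union hd, card_toLeft_singleton_inr,
      card_toRight_singleton_inr] at h1
    rcases block_cases hC hm hU with h | h | ⟨k, rfl⟩
    · omega
    · exact h
    · rw [card_toLeft_singleton_inr, card_toRight_singleton_inr] at h1
      omega
  · refine hmin T hT (lt_of_le_of_ne (Finset.singleton_subset_iff.2 hi) fun h => ?_)
    have := hC.two_le T hT
    rw [← h, Finset.card_singleton] at this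
    omega

/-- The children of a member with one unbounded edge more than marked points. -/
theorem exists_split_of_card_eq_succ (hC : IsMaxLaminar C) (hm : cladeMult d C ≠ 0)
    {S : Finset (Leaf l)} (hS : S ∈ C) (hcard : S.toLeft.card = S.toRight.card + 1) :
    ∃ P Q, IsBlock C P ∧ P.toLeft.card = P.toRight.card + 1 ∧ Q ∈ C ∧
      Q.toLeft.card = Q.toRight.card ∧ Disjoint P Q ∧ S = P ∪ Q := by
  obtain ⟨P, Q, hP, hQ, hd, rfl⟩ := hC.exists_split hS
  rw [card_toLeft_union hd, card_toRight_union hd] at hcard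
  rcases block_cases hC hm hP with h1 | h1 | ⟨i, rfl⟩ <;>
    rcases block_cases hC hm hQ with h2 | h2 | ⟨k, rfl⟩ <;>
    (try simp only [card_toLeft_singleton_inr, card_toRight_singleton_inr] at hcard)
  · omega
  · exact ⟨Q, P, hQ, h2, h1.1, h1.2, hd.symm, Finset.union_comm _ _⟩
  · omega
  · exact ⟨P, Q, hP, h1, h2.1, h2.2, hd, rfl⟩
  all_goals omega

/-- The children of a member with equally many unbounded edges and marked points: either one of
them is a marked point, or both are of the same kind. -/
theorem exists_split_of_card_eq (hC : IsMaxLaminar C) (hm : cladeMult d C ≠ 0)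
    {S : Finset (Leaf l)} (hS : S ∈ C) (hcard : S.toLeft.card = S.toRight.card) :
    (∃ i, Sum.inr i ∈ S ∧ ∀ T ∈ C, Sum.inr i ∈ T → S ⊆ T) ∨
    ∃ P Q, P ∈ C ∧ P.toLeft.card = P.toRight.card ∧ Q ∈ C ∧
      Q.toLeft.card = Q.toRight.card ∧ Disjoint P Q ∧ S = P ∪ Q := by
  obtain ⟨P, Q, hP, hQ, hd, rfl⟩ := hC.exists_split hS
  rw [card_toLeft_union hd, card_toRight_union hd] at hcard
  have hmark : ∀ (i : Fin l) (A : Finset (Leaf l)), IsBlock C A → Disjoint {Sum.inr i} A →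
      {Sum.inr i} ∪ A ∈ C → ∀ T ∈ C, Sum.inr i ∈ T → {Sum.inr i} ∪ A ⊆ T := by
    intro i A hA hiA hAC T hT hi
    rcases hC.laminar T hT _ hAC with h | h | h
    · by_contra hn
      have h2 := hC.two_le T hT
      rcases hC.subset_or_subset (Or.inr ⟨_, rfl⟩) hA (Or.inl hT) ⟨h, hn⟩ with h' | h'
      · have := Finset.card_le_card h'
        rw [Finset.card_singleton] at this
        omega
      · exact Finset.disjoint_singleton_left.1 hiA (h' hi)
    · exact h
    · exact absurd (Finset.mem_union_left _ (Finset.mem_singleton_self _))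
        (Finset.disjoint_left.1 h hi)
  rcases block_cases hC hm hP with h1 | h1 | ⟨i, rfl⟩
  · rcases block_cases hC hm hQ with h2 | h2 | ⟨k, rfl⟩
    · exact Or.inr ⟨P, Q, h1.1, h1.2, h2.1, h2.2, hd, rfl⟩
    · omega
    · rw [card_toLeft_singleton_inr, card_toRight_singleton_inr] at hcard
      omega
  · rcases block_cases hC hm hQ with h2 | h2 | ⟨k, rfl⟩
    · omega
    · omega
    · refine Or.inl ⟨k, by simp, fun T hT hk => ?_⟩
      rw [Finset.union_comm] at hS ⊢
      exact hmark k P hP hd.symm hS T hT hk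
  · exact Or.inl ⟨i, by simp, hmark i Q hQ hd hS⟩

end Types

/-! ### Configurations in a thin cone -/

/-- The standard pairing on the lattice. -/
def latForm (a x : ZLat) : ℤ := a 0 * x 0 + a 1 * x 1

/-- The rotation by a right angle. -/
def latRot (v : ZLat) : ZLat := ![-(v 1), v 0]

theorem latForm_add (a x y : ZLat) : latForm a (x + y) = latForm a x + latForm a y := by
  simp only [latForm, Pi.add_apply]; ring

theorem latForm_neg_left (a x : ZLat) : latForm (-a) x = -latForm a x := by
  simp only [latForm, Pi.neg_apply]; ring

theorem latForm_sum {ι : Type*} (a : ZLat) (s : Finset ι) (f : ι → ZLat) :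
    latForm a (∑ j ∈ s, f j) = ∑ j ∈ s, latForm a (f j) := by
  classical
  induction s using Finset.induction_on with
  | empty => simp [latForm]
  | insert j s hj ih => rw [Finset.sum_insert hj, Finset.sum_insert hj, latForm_add, ih]

section Position

variable {l : ℕ} {d : Fin (l + 1) → ZLat} {C : Finset (Finset (Leaf l))}

/-- The pairing of `a` with the `i`-th of `l` points. -/
def markForm (a : ZLat) (w : Fin l × Fin 2 → ℝ) (i : Fin l) : ℝ := a 0 * w (i, 0) + a 1 * w (i, 1)

/-- The pairing of `a` with the position of the vertex with the set of leaves `S` above it, in the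
tree of type `C` with edge lengths `lam`, relative to the base point. -/
noncomputable def nodeForm (d : Fin (l + 1) → ZLat) (C : Finset (Finset (Leaf l)))
    (lam : Finset (Leaf l) → ℝ) (a : ZLat) (S : Finset (Leaf l)) : ℝ :=
  ∑ T ∈ C.filter fun T => S ⊆ T, lam T * latForm a (endSum d T.toLeft)

theorem markForm_sum (a : ZLat) (lam : Finset (Leaf l) → ℝ) (i : Fin l) :
    markForm a (∑ T ∈ C, lam T • cladeVecR d T) i =
      ∑ T ∈ C.filter fun T => Sum.inr i ∈ T, lam T * latForm a (endSum d T.toLeft) := by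
  rw [Finset.sum_filter]
  simp only [markForm, Finset.sum_apply, Finset.mul_sum]
  rw [← Finset.sum_add_distrib]
  refine Finset.sum_congr rfl fun T _ => ?_
  simp only [Pi.smul_apply, smul_eq_mul, cladeVecR, cladeVec, latForm]
  split_ifs
  · push_cast; ring
  · simp

theorem nodeForm_child (hC : IsMaxLaminar C) {P Q : Finset (Leaf l)} (hP : P ∈ C)
    (hQ : IsBlock C Q) (hd : Disjoint P Q) (hS : P ∪ Q ∈ C) (lam : Finset (Leaf l) → ℝ)
    (a : ZLat) :
    nodeForm d C lam a P = lam P * latForm a (endSum d P.toLeft) + nodeForm d C lam a (P ∪ Q) := by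
  have hPne := hC.nonempty (Or.inl hP)
  have hQne := hC.nonempty hQ
  have heq : (C.filter fun T => P ⊆ T) = insert P (C.filter fun T => P ∪ Q ⊆ T) := by
    ext T
    simp only [Finset.mem_filter, Finset.mem_insert]
    constructor
    · rintro ⟨hT, hPT⟩
      rcases hC.laminar T hT _ hS with h | h | h
      · by_cases hTS : T = P ∪ Q
        · exact Or.inr ⟨hT, hTS.ge⟩
        · rcases hC.subset_or_subset (Or.inl hP) hQ (Or.inl hT) (lt_of_le_of_ne h hTS) with h' | h'
          · exact Or.inl (h'.antisymm hPT)
          · obtain ⟨x, hx⟩ := hPne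
            exact absurd (h' (hPT hx)) (Finset.disjoint_left.1 hd hx)
      · exact Or.inr ⟨hT, h⟩
      · obtain ⟨x, hx⟩ := hPne
        exact absurd (Finset.mem_union_left _ hx) (Finset.disjoint_left.1 h (hPT hx))
    · rintro (rfl | ⟨hT, h⟩)
      · exact ⟨hP, subset_rfl⟩
      · exact ⟨hT, Finset.subset_union_left.trans h⟩
  have hnot : P ∉ C.filter fun T => P ∪ Q ⊆ T := by
    intro h
    obtain ⟨y, hy⟩ := hQne
    exact Finset.disjoint_right.1 hd hy ((Finset.mem_filter.1 h).2 (Finset.mem_union_right _ hy))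
  rw [nodeForm, heq, Finset.sum_insert hnot, nodeForm]

theorem latForm_endSum_pos {b : ZLat} (hb : ∀ j, 0 < latForm b (d j)) {F : Finset (Fin (l + 1))}
    (hF : F.Nonempty) : 0 < latForm b (endSum d F) := by
  rw [endSum, latForm_sum]
  exact Finset.sum_pos (fun j _ => hb j) hF

theorem latForm_endSum_nonneg {b : ZLat} (hb : ∀ j, 0 < latForm b (d j))
    (F : Finset (Fin (l + 1))) : 0 ≤ latForm b (endSum d F) := by
  rw [endSum, latForm_sum]
  exact Finset.sum_nonneg fun j _ => (hb j).le

/-- Suppose that all marked points lie on the left of a line of small slope through the base point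
(with `b` pointing up and `a` to the right). Edges with as many marked points as unbounded edges
above them are fixed by these marked points; if such an edge points to the right, then its upper end
lies on the left of that line. -/
theorem nodeForm_lt (hC : IsMaxLaminar C) (hm : cladeMult d C ≠ 0) {a b : ZLat} {δ : ℝ}
    (hδ1 : ∀ F : Finset (Fin (l + 1)), δ * latForm b (endSum d F) ≤ 1)
    {lam : Finset (Leaf l) → ℝ} (hlam : ∀ S ∈ C, 0 ≤ lam S)
    (hreg : ∀ i, markForm a (∑ T ∈ C, lam T • cladeVecR d T) i <
      δ * markForm b (∑ T ∈ C, lam T • cladeVecR d T) i)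
    {S : Finset (Leaf l)} (hS : S ∈ C) (hcard : S.toLeft.card = S.toRight.card)
    (hpos : 0 < latForm a (endSum d S.toLeft)) :
    nodeForm d C lam a S < δ * nodeForm d C lam b S := by
  induction hn : S.card using Nat.strong_induction_on generalizing S with
  | _ n ih =>
    rcases exists_split_of_card_eq hC hm hS hcard with ⟨i, hi, hmin⟩ | h
    · have hfil : (C.filter fun T => Sum.inr i ∈ T) = C.filter fun T => S ⊆ T := by
        ext T
        simp only [Finset.mem_filter]
        exact and_congr_right fun hT => ⟨hmin T hT, fun h => h hi⟩
      have := hreg i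
      rwa [markForm_sum, markForm_sum, hfil] at this
    · have key : ∀ P Q, P ∈ C → P.toLeft.card = P.toRight.card → Q ∈ C → Disjoint P Q →
          S = P ∪ Q → 0 < latForm a (endSum d P.toLeft) →
          nodeForm d C lam a S < δ * nodeForm d C lam b S := by
        intro P Q hP hPc hQ hd hSe hPpos
        have hQn := Finset.card_pos.2 (hC.nonempty (Or.inl hQ))
        have hc : S.card = P.card + Q.card := by rw [hSe, Finset.card_union_of_disjoint hd]
        have h1 := ih P.card (by omega) hP hPc hPpos rfl
        rw [nodeForm_child hC hP (Or.inl hQ) hd (hSe ▸ hS), ← hSe,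
          nodeForm_child hC hP (Or.inl hQ) hd (hSe ▸ hS), ← hSe] at h1
        have h2 : (1 : ℝ) ≤ latForm a (endSum d P.toLeft) := by exact_mod_cast hPpos
        have h3 := mul_nonneg (hlam P hP) (sub_nonneg.2 ((hδ1 P.toLeft).trans h2))
        linarith
      obtain ⟨P, Q, hP, hPc, hQ, hQc, hd, hSe⟩ := h
      have hsum : latForm a (endSum d S.toLeft) =
          latForm a (endSum d P.toLeft) + latForm a (endSum d Q.toLeft) := by
        rw [hSe, endSum_toLeft_union d hd, latForm_add]
      rcases lt_or_ge 0 (latForm a (endSum d P.toLeft)) with h | h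
      · exact key P Q hP hPc hQ hd hSe h
      · exact key Q P hQ hQc hP hd.symm (by rw [hSe, Finset.union_comm]) (by omega)

theorem mul_latForm_eq {v x : ZLat} (h : latForm (latRot v) x = 0) (i : Fin 2) :
    (v 0 ^ 2 + v 1 ^ 2) * x i = latForm v x * v i := by
  simp only [latForm, latRot, Matrix.cons_val_zero, Matrix.cons_val_one] at h ⊢
  fin_cases i
  · simp only [Fin.zero_eta]
    linear_combination (-(v 1)) * h
  · simp only [Fin.mk_one]
    linear_combination (v 0) * h

/-- If all marked points lie in a thin cone around the axis, with apex at the base point, then the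
edge at the base point cannot be contracted: one of the two edges above it would start at the base
point and be fixed by the marked points above it, which forces it to be parallel to the axis; then
so would be the other one, and the multiplicity would vanish. -/
theorem lam_univ_ne_zero (hC : IsMaxLaminar C) (hm : cladeMult d C ≠ 0) {v : ZLat} {δ : ℝ}
    (hv : ∀ j, 0 < latForm v (d j)) (hbal : latForm (latRot v) (endSum d Finset.univ) = 0)
    (hδ1 : ∀ F : Finset (Fin (l + 1)), δ * latForm v (endSum d F) ≤ 1)
    {lam : Finset (Leaf l) → ℝ} (hlam : ∀ S ∈ C, 0 ≤ lam S)
    (hreg : ∀ i, |markForm (latRot v) (∑ T ∈ C, lam T • cladeVecR d T) i| <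
      δ * markForm v (∑ T ∈ C, lam T • cladeVecR d T) i) :
    lam Finset.univ ≠ 0 := by
  intro h0
  have hul : (Finset.univ : Finset (Leaf l)).toLeft = Finset.univ := by ext; simp
  have hur : (Finset.univ : Finset (Leaf l)).toRight = Finset.univ := by ext; simp
  obtain ⟨P, Q, hP, hPc, hQ, hQc, hd, hu⟩ := exists_split_of_card_eq_succ hC hm hC.univ_mem
    (by rw [hul, hur, Finset.card_univ, Finset.card_univ, Fintype.card_fin, Fintype.card_fin])
  have hPQ : Q ∪ P ∈ C := by rw [Finset.union_comm, ← hu]; exact hC.univ_mem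
  have hroot : ∀ a, nodeForm d C lam a (Q ∪ P) = 0 := by
    intro a
    rw [Finset.union_comm, ← hu, nodeForm]
    refine Finset.sum_eq_zero fun T hT => ?_
    rw [Finset.univ_subset_iff.1 (Finset.mem_filter.1 hT).2, h0, zero_mul]
  have hQne : (Q.toLeft).Nonempty := by
    by_contra h
    rw [Finset.not_nonempty_iff_eq_empty] at h
    exact endSum_ne_zero hC hm hQ (by rw [h]; rfl)
  have hPne : (P.toLeft).Nonempty := by
    rw [← Finset.card_pos]; omega
  have hside : ∀ a : ZLat, (∀ i, markForm a (∑ T ∈ C, lam T • cladeVecR d T) i <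
      δ * markForm v (∑ T ∈ C, lam T • cladeVecR d T) i) → ¬ 0 < latForm a (endSum d Q.toLeft) := by
    intro a ha hpos
    have h1 := nodeForm_lt hC hm hδ1 hlam ha hQ hQc hpos
    rw [nodeForm_child hC hQ hP hd.symm hPQ, nodeForm_child hC hQ hP hd.symm hPQ, hroot,
      hroot] at h1
    have h2 : (1 : ℝ) ≤ latForm a (endSum d Q.toLeft) := by exact_mod_cast hpos
    have h3 := mul_nonneg (hlam Q hQ) (sub_nonneg.2 ((hδ1 Q.toLeft).trans h2))
    linarith
  have h1 := hside (latRot v) fun i => (le_abs_self _).trans_lt (hreg i)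
  have h2 := hside (-latRot v) fun i => by
    refine lt_of_le_of_lt ?_ (hreg i)
    have : markForm (-latRot v) (∑ T ∈ C, lam T • cladeVecR d T) i =
        -markForm (latRot v) (∑ T ∈ C, lam T • cladeVecR d T) i := by
      simp only [markForm, Pi.neg_apply, Int.cast_neg]; ring
    rw [this]
    exact neg_le_abs _
  rw [latForm_neg_left] at h2
  have hQ0 : latForm (latRot v) (endSum d Q.toLeft) = 0 := by omega
  have hsum : endSum d Finset.univ = endSum d P.toLeft + endSum d Q.toLeft := by
    rw [← hul, hu, endSum_toLeft_union d hd]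
  have hP0 : latForm (latRot v) (endSum d P.toLeft) = 0 := by
    rw [hsum, latForm_add] at hbal
    omega
  -- The displacements of the edge at the base point and of the two edges above are dependent.
  have hPp := latForm_endSum_pos hv hPne
  have hQp := latForm_endSum_pos hv hQne
  have hvv : 0 < v 0 ^ 2 + v 1 ^ 2 := by
    by_contra h
    have h0 : v 0 = 0 := by nlinarith [sq_nonneg (v 0), sq_nonneg (v 1)]
    have h1 : v 1 = 0 := by nlinarith [sq_nonneg (v 0), sq_nonneg (v 1)]
    simp [latForm, h0, h1] at hPp
  set p := latForm v (endSum d P.toLeft) with hp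
  set q := latForm v (endSum d Q.toLeft) with hq
  have hrel : ((p : ℝ) * q) • cladeVecR d Finset.univ =
      ((p + q : ℝ) * q) • cladeVecR d P + ((p + q : ℝ) * p) • cladeVecR d Q := by
    funext x
    have e1 := mul_latForm_eq hP0 x.2
    have e2 := mul_latForm_eq hQ0 x.2
    have hx : (Sum.inr x.1 : Leaf l) ∈ P ∪ Q := hu ▸ Finset.mem_univ _
    have e3 := congrFun hsum x.2
    rw [Pi.add_apply] at e3
    have goalZ : p * q * cladeVec d Finset.univ x =
        (p + q) * q * cladeVec d P x + (p + q) * p * cladeVec d Q x := by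
      refine mul_left_cancel₀ hvv.ne' ?_
      simp only [cladeVec, hul, Finset.mem_univ, if_true, e3]
      rw [← hp] at e1
      rw [← hq] at e2
      rcases Finset.mem_union.1 hx with h | h
      · simp only [h, Finset.disjoint_left.1 hd h, if_true, if_false]
        linear_combination (p * q - (p + q) * q) * e1 + p * q * e2
      · simp only [h, Finset.disjoint_right.1 hd h, if_true, if_false]
        linear_combination (p * q - (p + q) * p) * e2 + p * q * e1
    simp only [Pi.add_apply, Pi.smul_apply, smul_eq_mul, cladeVecR]
    exact_mod_cast goalZ
  classical
  have hCc : C ∈ (treeCones d).cones := Finset.mem_filter.2 ⟨Finset.mem_univ _, hC⟩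
  have hcoord := congrArg ((treeCones d).coord C Finset.univ) hrel
  have hne : ∀ {A B : Finset (Leaf l)}, Disjoint A B → B.Nonempty → Finset.univ = A ∪ B →
      A ≠ Finset.univ := by
    rintro A B hAB ⟨b, hb⟩ - rfl
    exact Finset.disjoint_right.1 hAB hb (Finset.mem_univ _)
  have hcQ : (treeCones d).coord C Finset.univ (cladeVecR d Q) = 0 :=
    BalancedCones.coord_of_ne hCc hC.univ_mem hQ
      (hne hd.symm (hC.nonempty hP) (by rw [hu, Finset.union_comm]))
  have hcP : (treeCones d).coord C Finset.univ (cladeVecR d P) = 0 := by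
    rcases hP with hP | ⟨x, rfl⟩
    · exact BalancedCones.coord_of_ne hCc hC.univ_mem hP (hne hd (hC.nonempty (Or.inl hQ)) hu)
    · have : cladeVecR d {x} = 0 := by
        funext y
        rw [cladeVecR, cladeVec_singleton]; simp
      rw [this, map_zero]
  have hcu : (treeCones d).coord C Finset.univ (cladeVecR d Finset.univ) = 1 :=
    BalancedCones.coord_self hCc hm hC.univ_mem
  rw [map_smul, map_add, map_smul, map_smul, hcP, hcQ, hcu] at hcoord
  simp only [smul_eq_mul, mul_zero, add_zero, mul_one, mul_eq_zero, Int.cast_eq_zero] at hcoord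
  omega

/-- The configurations of points in a thin cone around the direction `v`. -/
def thinCone (l : ℕ) (v : ZLat) (δ : ℝ) : Set (Fin l × Fin 2 → ℝ) :=
  {w | ∀ i, |markForm (latRot v) w i| < δ * markForm v w i}

theorem convex_thinCone (v : ZLat) (δ : ℝ) : Convex ℝ (thinCone l v δ) := by
  intro w hw w' hw' s t hs ht hst i
  have h1 := hw i
  have h2 := hw' i
  have hlin : ∀ a, markForm a (s • w + t • w') i = s * markForm a w i + t * markForm a w' i := by
    intro a
    simp only [markForm, Pi.add_apply, Pi.smul_apply, smul_eq_mul]; ring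
  rw [hlin, hlin]
  refine (abs_add_le _ _).trans_lt ?_
  rw [abs_mul, abs_mul, abs_of_nonneg hs, abs_of_nonneg ht]
  rcases hs.eq_or_lt with rfl | hs
  · have : t = 1 := by linarith
    subst this; simpa using h2
  · nlinarith [mul_lt_mul_of_pos_left h1 hs, mul_le_mul_of_nonneg_left h2.le ht]

theorem isOpen_thinCone (v : ZLat) (δ : ℝ) : IsOpen (thinCone l v δ) := by
  simp only [thinCone, Set.ofPred_forall]
  refine isOpen_iInter_of_finite fun i => isOpen_lt ?_ ?_
  · unfold markForm; fun_prop
  · unfold markForm; fun_prop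

/-- The number of types of trees realized at a regular configuration in the thin cone, counted with
multiplicities, does not depend on the configuration. -/
theorem treeCones_count_eq {v : ZLat} {δ : ℝ}
    (hv : ∀ j, 0 < latForm v (d j)) (hbal : latForm (latRot v) (endSum d Finset.univ) = 0)
    (hδ1 : ∀ F : Finset (Fin (l + 1)), δ * latForm v (endSum d F) ≤ 1)
    {w w' : Fin l × Fin 2 → ℝ} (hw : w ∈ thinCone l v δ) (hw' : w' ∈ thinCone l v δ)
    (hr : (treeCones d).Regular w) (hr' : (treeCones d).Regular w') :
    (treeCones d).count w = (treeCones d).count w' := by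
  classical
  refine BalancedCones.count_eq_of_convex (convex_thinCone v δ) (isOpen_thinCone v δ) ?_ hw hw'
    hr hr'
  intro x hx C hC hm hnn _
  have hCm : IsMaxLaminar C := (Finset.mem_filter.1 hC).2
  have hsum : x = ∑ T ∈ C, (treeCones d).coord C T x • cladeVecR d T :=
    BalancedCones.sum_coord hC hm x
  refine lam_univ_ne_zero (lam := fun T => (treeCones d).coord C T x) hCm hm hv hbal hδ1 hnn ?_
  rw [← hsum]
  exact hx

end Position

/-! ### Primitive vectors, rooted trees and balancing -/

section Primitive

theorem ZLat.IsPrimitive.ne_zero {x : ZLat} (hx : x.IsPrimitive) : x ≠ 0 := by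
  rintro rfl
  simp [ZLat.IsPrimitive] at hx

/-- Positively proportional primitive vectors are equal. -/
theorem ZLat.IsPrimitive.eq_of_proportional {x y : ZLat} (hx : x.IsPrimitive) (hy : y.IsPrimitive)
    {s t : ℝ} (hs : 0 < s) (ht : 0 < t) (h : ∀ i, s * x i = t * y i) : x = y := by
  have hcross : x 0 * y 1 = x 1 * y 0 := by
    have h0 := h 0
    have h1 := h 1
    have : (x 0 * y 1 : ℝ) = x 1 * y 0 := by
      have h2 : s * t * (x 0 * y 1 : ℝ) = s * t * (x 1 * y 0) := by
        linear_combination t * y 1 * h0 - t * y 0 * h1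
      exact mul_left_cancel₀ (mul_pos hs ht).ne' h2
    exact_mod_cast this
  have key : ∀ a b : ZLat, a.IsPrimitive → b.IsPrimitive → a 0 * b 1 = a 1 * b 0 →
      ∃ k : ℤ, b = k • a := by
    intro a b ha _ hab
    have hbez := Int.gcd_eq_gcd_ab (a 0) (a 1)
    rw [show Int.gcd (a 0) (a 1) = 1 from ha] at hbez
    push_cast at hbez
    refine ⟨Int.gcdA (a 0) (a 1) * b 0 + Int.gcdB (a 0) (a 1) * b 1, funext fun i => ?_⟩
    rw [Pi.smul_apply, smul_eq_mul]
    fin_cases i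
    · simp only [Fin.zero_eta]
      linear_combination b 0 * hbez - Int.gcdB (a 0) (a 1) * hab
    · simp only [Fin.mk_one]
      linear_combination b 1 * hbez + Int.gcdA (a 0) (a 1) * hab
  obtain ⟨k, hk⟩ := key x y hx hy hcross
  obtain ⟨m, hm⟩ := key y x hy hx (by linarith)
  obtain ⟨i, hi⟩ : ∃ i, x i ≠ 0 := by
    by_contra hc
    push Not at hc
    exact hx.ne_zero (funext hc)
  have hyi : y i = k * x i := by rw [hk]; rfl
  have hxi : x i = m * y i := by
    have := congrFun hm i
    rwa [Pi.smul_apply, smul_eq_mul] at this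
  have hmk : m * k = 1 := by
    have : m * k * x i = 1 * x i := by rw [mul_assoc, ← hyi, ← hxi, one_mul]
    exact mul_right_cancel₀ hi this
  have hkpos : 0 < k := by
    have h1 := h i
    rw [hyi] at h1
    push_cast at h1
    have hxR : (x i : ℝ) ≠ 0 := by exact_mod_cast hi
    have h2 : s = t * k := mul_right_cancel₀ hxR (by rw [h1]; ring)
    by_contra hneg
    have : (k : ℝ) ≤ 0 := by exact_mod_cast not_lt.1 hneg
    nlinarith
  have hk1 : k = 1 := by
    have := Int.isUnit_iff.1 (IsUnit.of_mul_eq_one m (by rw [mul_comm]; exact hmk))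
    omega
  rw [hk, hk1, one_smul]

theorem ZLat.toPlane_apply (x : ZLat) (i : Fin 2) : x.toPlane i = x i := rfl

theorem smul_toPlane_apply (t : ℝ) (x : ZLat) (i : Fin 2) : (t • x.toPlane) i = t * x i := rfl

end Primitive

section RootedTrees

variable {V : Type*} {G : SimpleGraph V}

/-- A finite tree with a root is described by a parent function. -/
theorem SimpleGraph.IsTree.exists_parent [Finite V] (hG : G.IsTree) (r : V) :
    ∃ (par : V → V) (dep : V → ℕ), (∀ x, x ≠ r → G.Adj x (par x) ∧ dep x = dep (par x) + 1) ∧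
      par r = r ∧ ∀ x y, G.Adj x y → (x ≠ r ∧ par x = y) ∨ (y ≠ r ∧ par y = x) := by
  classical
  have := Fintype.ofFinite V
  have hex : ∀ x, ∃ y, x ≠ r → G.Adj x y ∧ G.dist r x = G.dist r y + 1 := by
    intro x
    by_cases hx : x = r
    · exact ⟨x, fun h => absurd hx h⟩
    · obtain ⟨p, hp⟩ := (hG.connected.preconnected x r).exists_walk_length_eq_dist
      cases p with
      | nil => exact absurd rfl hx
      | @cons _ y _ h q =>
        refine ⟨y, fun _ => ⟨h, ?_⟩⟩
        rw [SimpleGraph.Walk.length_cons] at hp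
        have h1 : G.dist y r ≤ q.length := SimpleGraph.dist_le q
        rw [SimpleGraph.dist_comm, SimpleGraph.dist_comm (u := r) (v := y)]
        rcases hG.dist_eq_dist_add_one_of_adj r h with h2 | h2
        · rwa [SimpleGraph.dist_comm, SimpleGraph.dist_comm (u := r) (v := y)] at h2
        · rw [SimpleGraph.dist_comm, SimpleGraph.dist_comm (u := r) (v := x)] at h2
          omega
  choose par₀ hpar₀ using hex
  set par : V → V := fun x => if x = r then r else par₀ x with hpar
  have hp : ∀ x, x ≠ r → G.Adj x (par x) ∧ G.dist r x = G.dist r (par x) + 1 := by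
    intro x hx
    rw [hpar]
    simp only [if_neg hx]
    exact hpar₀ x hx
  refine ⟨par, G.dist r, hp, by simp [hpar], ?_⟩
  -- There are as many edges as vertices different from the root.
  let f : {x : V // x ≠ r} → G.edgeSet := fun x => ⟨s(x.1, par x.1), (hp x.1 x.2).1⟩
  have hinj : Function.Injective f := by
    rintro ⟨x, hx⟩ ⟨y, hy⟩ h
    have h' : s(x, par x) = s(y, par y) := congrArg Subtype.val h
    rcases Sym2.eq_iff.1 h' with h1 | h1
    · exact Subtype.ext h1.1
    · have h2 := (hp x hx).2
      have h3 := (hp y hy).2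
      rw [h1.2] at h2
      rw [← h1.1] at h3
      omega
  have hcard : Fintype.card {x : V // x ≠ r} = Fintype.card G.edgeSet := by
    have h1 := hG.card_edgeFinset
    rw [SimpleGraph.edgeFinset_card] at h1
    rw [Fintype.card_subtype_compl, Fintype.card_subtype_eq]
    omega
  have hbij := (Fintype.bijective_iff_injective_and_card f).2 ⟨hinj, hcard⟩
  intro x y hxy
  obtain ⟨⟨z, hz⟩, hfz⟩ := hbij.2 ⟨s(x, y), hxy⟩
  have h' : s(z, par z) = s(x, y) := congrArg Subtype.val hfz
  rcases Sym2.eq_iff.1 h' with ⟨h1, h2⟩ | ⟨h1, h2⟩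
  · subst h1; exact Or.inl ⟨hz, h2⟩
  · subst h1; exact Or.inr ⟨hz, h2⟩

end RootedTrees

noncomputable section Instances

instance (Γ : TropGraph) : Finite Γ.V := Γ.finV
instance (Γ : TropGraph) : Finite Γ.U := Γ.finU
instance (Γ : TropGraph) : Fintype Γ.V := Fintype.ofFinite _
instance (Γ : TropGraph) : Fintype Γ.U := Fintype.ofFinite _
instance (Γ : TropGraph) : DecidableEq Γ.V := Classical.decEq _
instance (Γ : TropGraph) : DecidableEq Γ.U := Classical.decEq _
instance (Γ : TropGraph) : DecidableRel Γ.bdd.Adj := Classical.decRel _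

end Instances

/-- A sum over the flags at a vertex, split into bounded and unbounded edges. -/
theorem finsum_flag_eq {M : Type*} [AddCommMonoid M] (Γ : TropGraph) (g : Γ.Flag → M) (x : Γ.V) :
    ∑ᶠ (f : Γ.Flag) (_ : f.vertex = x), g f =
      (∑ D : Γ.bdd.Dart, if D.fst = x then g (Sum.inl D) else 0) +
        ∑ e : Γ.U, if Γ.foot e = x then g (Sum.inr e) else 0 := by
  classical
  have : ∀ f : Γ.Flag, ∑ᶠ (_ : f.vertex = x), g f = if f.vertex = x then g f else 0 :=
    fun f => finsum_eq_if
  rw [finsum_congr this, finsum_eq_sum_of_fintype, Fintype.sum_sum_type]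
  rfl

namespace TropCurve

variable {k : ℕ} (C : TropCurve k)

theorem u_symm (D : C.Γ.bdd.Dart) : C.u (Sum.inl D.symm) = -C.u (Sum.inl D) := by
  obtain ⟨t, ht, h⟩ := C.bounded_edge D
  obtain ⟨t', ht', h'⟩ := C.bounded_edge D.symm
  have hneg : (-C.u (Sum.inl D)).IsPrimitive := by
    have := C.u_primitive (Sum.inl D)
    simpa [ZLat.IsPrimitive] using this
  refine ZLat.IsPrimitive.eq_of_proportional (C.u_primitive _) hneg ht' ht fun i => ?_
  have h1 : C.pos D.fst = C.pos D.snd + t' • (C.u (Sum.inl D.symm)).toPlane := h'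
  have h2 := congrArg (fun v : Plane => v i) h
  have h3 := congrArg (fun v : Plane => v i) h1
  simp only [PiLp.add_apply, smul_toPlane_apply] at h2 h3
  simp only [Pi.neg_apply, Int.cast_neg]
  linarith

/-- The weighted direction of a flag. -/
def wu (f : C.Γ.Flag) : ZLat := (C.w f.edge : ℤ) • C.u f

theorem edge_symm (D : C.Γ.bdd.Dart) : TropGraph.Flag.edge (Γ := C.Γ) (Sum.inl D.symm) =
    TropGraph.Flag.edge (Γ := C.Γ) (Sum.inl D) := by
  simp only [TropGraph.Flag.edge]
  congr 2
  exact SimpleGraph.Dart.edge_symm D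

theorem wu_symm (D : C.Γ.bdd.Dart) : C.wu (Sum.inl D.symm) = -C.wu (Sum.inl D) := by
  rw [wu, wu, u_symm, edge_symm, smul_neg]

/-- The balancing condition, summed over a set of vertices. -/
theorem sum_cut (B : Finset C.Γ.V) :
    (∑ D : C.Γ.bdd.Dart with D.fst ∈ B ∧ D.snd ∉ B, C.wu (Sum.inl D)) +
      ∑ e : C.Γ.U with C.Γ.foot e ∈ B, C.wu (Sum.inr e) = 0 := by
  have h1 : ∑ x ∈ B, ((∑ D : C.Γ.bdd.Dart, if D.fst = x then C.wu (Sum.inl D) else 0) +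
        ∑ e : C.Γ.U, if C.Γ.foot e = x then C.wu (Sum.inr e) else 0) = 0 := by
    refine Finset.sum_eq_zero fun x _ => ?_
    have := C.balanced x
    rw [finsum_flag_eq] at this
    exact this
  rw [Finset.sum_add_distrib, Finset.sum_comm, Finset.sum_comm (s := B)] at h1
  simp only [Finset.sum_ite_eq] at h1
  rw [← Finset.sum_filter, ← Finset.sum_filter] at h1
  have h2 : ∑ D : C.Γ.bdd.Dart with D.fst ∈ B ∧ D.snd ∈ B, C.wu (Sum.inl D) = 0 := by
    refine Finset.sum_involution (fun D _ => D.symm) ?_ ?_ ?_ ?_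
    · intro D _
      rw [wu_symm, add_neg_cancel]
    · intro D _ _
      exact SimpleGraph.Dart.symm_ne D
    · intro D hD
      simp only [Finset.mem_filter, Finset.mem_univ, true_and] at hD ⊢
      exact ⟨hD.2, hD.1⟩
    · intro D _
      exact SimpleGraph.Dart.symm_symm D
  rw [← Finset.sum_filter_add_sum_filter_not (Finset.univ.filter fun D : C.Γ.bdd.Dart => D.fst ∈ B)
    (fun D => D.snd ∈ B), Finset.filter_filter, Finset.filter_filter, h2, zero_add] at h1
  exact h1

end TropCurve

/-! ### Labelled curves and their models -/

section Models

variable {l : ℕ}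

/-- A labelling of the unbounded edges of a curve with a stop, other than the stopping edge, such
that the `j`-th one has weighted direction `d j`. -/
structure IsLabelling (d : Fin (l + 1) → ZLat) (c : StopCurve l) (σ : Fin (l + 1) → c.Γ.U) :
    Prop where
  injective : Function.Injective σ
  ne_stop : ∀ j, σ j ≠ c.stopEdge
  surj : ∀ e, e ≠ c.stopEdge → ∃ j, σ j = e
  dir : ∀ j, c.wu (Sum.inr (σ j)) = d j

/-- The map `E` assigns to every vertex `x` of a labelled curve with a stop the set of unbounded
edges that are separated from the stop by `x`. It is characterized by the properties listed
here: the tree of bounded edges is the Hasse diagram of the sets `E x`, and an unbounded edge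
starts at the smallest one of these sets that contains it. -/
structure IsModel (d : Fin (l + 1) → ZLat) (c : StopCurve l) (σ : Fin (l + 1) → c.Γ.U)
    (E : c.Γ.V → Finset (Fin (l + 1))) : Prop where
  injective : Function.Injective E
  root : E (c.Γ.foot c.stopEdge) = Finset.univ
  mem_iff : ∀ j x, j ∈ E x ↔ E (c.Γ.foot (σ j)) ⊆ E x
  nested : ∀ x y, E x ⊆ E y ∨ E y ⊆ E x ∨ Disjoint (E x) (E y)
  two_le : ∀ x, 2 ≤ (E x).card
  adj_iff : ∀ x y, c.Γ.bdd.Adj x y ↔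
    (E x ⊂ E y ∧ ∀ z, E x ⊂ E z → E y ⊆ E z) ∨ (E y ⊂ E x ∧ ∀ z, E y ⊂ E z → E x ⊆ E z)
  dir : ∀ D : c.Γ.bdd.Dart, E D.snd ⊂ E D.fst → c.wu (Sum.inl D) = endSum d (E D.snd)
  dir_stop : c.wu (Sum.inr c.stopEdge) = -endSum d Finset.univ

theorem IsLabelling.sum_eq {d : Fin (l + 1) → ZLat} {c : StopCurve l} {σ : Fin (l + 1) → c.Γ.U}
    (hσ : IsLabelling d c σ) {M : Type*} [AddCommMonoid M] (f : c.Γ.U → M) :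
    ∑ e, f e = f c.stopEdge + ∑ j, f (σ j) := by
  classical
  have huniv : (Finset.univ : Finset c.Γ.U) =
      insert c.stopEdge (Finset.univ.image σ) := by
    ext e
    simp only [Finset.mem_univ, Finset.mem_insert, Finset.mem_image, true_and, true_iff]
    by_cases h : e = c.stopEdge
    · exact Or.inl h
    · exact Or.inr (hσ.surj e h)
  rw [huniv, Finset.sum_insert, Finset.sum_image fun _ _ _ _ h => hσ.injective h]
  simp only [Finset.mem_image, Finset.mem_univ, true_and, not_exists]
  exact hσ.ne_stop

theorem TropCurve.wu_ne_zero {k : ℕ} (C : TropCurve k) (f : C.Γ.Flag) : C.wu f ≠ 0 := by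
  intro h
  rcases smul_eq_zero.1 h with h | h
  · exact (C.w_pos _).ne' (by exact_mod_cast h)
  · exact (C.u_primitive f).ne_zero h

theorem exists_isModel {d : Fin (l + 1) → ZLat} {c : StopCurve l} {σ : Fin (l + 1) → c.Γ.U}
    (hσ : IsLabelling d c σ) : ∃ E, IsModel d c σ E := by
  classical
  set r := c.Γ.foot c.stopEdge with hr
  obtain ⟨par, dep, hpar, -, hadj⟩ := c.Γ.isTree.exists_parent r
  -- `up z x`: the vertex `x` lies on the path from `z` to the stop.
  let step : c.Γ.V → c.Γ.V → Prop := fun z y => z ≠ r ∧ par z = y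
  let up : c.Γ.V → c.Γ.V → Prop := Relation.ReflTransGen step
  have hstep_unique : Relator.RightUnique step := fun _ _ _ h h' => h.2.symm.trans h'.2
  have hdep : ∀ {z x}, up z x → z = x ∨ dep x < dep z := by
    intro z x h
    induction h with
    | refl => exact Or.inl rfl
    | tail _ h ih =>
      obtain ⟨hne, rfl⟩ := h
      have := (hpar _ hne).2
      rcases ih with rfl | ih
      · exact Or.inr (by omega)
      · exact Or.inr (by omega)
  have hanti : ∀ {z x}, up z x → up x z → z = x := by
    intro z x h h'
    rcases hdep h with h | h
    · exact h
    · rcases hdep h' with h' | h'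
      · exact h'.symm
      · omega
  have hroot : ∀ z, up z r := by
    intro z
    induction hn : dep z using Nat.strong_induction_on generalizing z with
    | _ n ih =>
      by_cases hz : z = r
      · rw [hz]
      · have := (hpar z hz).2
        exact Relation.ReflTransGen.head ⟨hz, rfl⟩ (ih (dep (par z)) (by omega) _ rfl)
  have htotal : ∀ {z x y}, up z x → up z y → up x y ∨ up y x := fun h h' =>
    Relation.ReflTransGen.total_of_right_unique hstep_unique h h'
  let B : c.Γ.V → Finset c.Γ.V := fun x => Finset.univ.filter fun z => up z x
  let E : c.Γ.V → Finset (Fin (l + 1)) := fun x =>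
    Finset.univ.filter fun j => up (c.Γ.foot (σ j)) x
  have hE : ∀ j x, j ∈ E x ↔ up (c.Γ.foot (σ j)) x := fun j x => by simp [E]
  have hends : ∀ x, ∑ e : c.Γ.U with c.Γ.foot e ∈ B x, c.wu (Sum.inr e) =
      (if x = r then c.wu (Sum.inr c.stopEdge) else 0) + endSum d (E x) := by
    intro x
    rw [Finset.sum_filter, hσ.sum_eq, endSum, Finset.sum_filter]
    congr 1
    · refine if_congr ?_ rfl rfl
      simp only [B, Finset.mem_filter, Finset.mem_univ, true_and]
      constructor
      · exact fun h => hanti (hroot x) h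
      · rintro rfl; exact Relation.ReflTransGen.refl
    · refine Finset.sum_congr rfl fun j _ => ?_
      rw [hσ.dir]
      simp [B]
  have hcut : ∀ x (D : c.Γ.bdd.Dart), (D.fst ∈ B x ∧ D.snd ∉ B x) ↔
      D.fst = x ∧ x ≠ r ∧ par x = D.snd := by
    intro x D
    simp only [B, Finset.mem_filter, Finset.mem_univ, true_and]
    constructor
    · rintro ⟨h1, h2⟩
      rcases hadj _ _ D.adj with h | h
      · rcases Relation.ReflTransGen.cases_head h1 with h3 | ⟨y, h3, h4⟩
        · subst h3; exact ⟨rfl, h⟩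
        · exact absurd (by rw [← h.2, h3.2]; exact h4) h2
      · exact absurd (Relation.ReflTransGen.head (show step D.snd D.fst from h) h1) h2
    · rintro ⟨h1, h2, h3⟩
      rw [h1]
      refine ⟨Relation.ReflTransGen.refl, fun h => ?_⟩
      have h4 := (hpar x h2).2
      rw [h3] at h4
      rcases hdep h with h | h
      · rw [h] at h4; omega
      · omega
  have hflow : ∀ D : c.Γ.bdd.Dart, D.fst ≠ r → par D.fst = D.snd →
      c.wu (Sum.inl D) + endSum d (E D.fst) = 0 := by
    intro D h1 h2
    have h := c.sum_cut (B D.fst)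
    rw [hends, if_neg h1, zero_add] at h
    rw [← h]
    congr 1
    rw [Finset.sum_eq_single_of_mem D]
    · rw [Finset.mem_filter]
      exact ⟨Finset.mem_univ _, (hcut _ _).2 ⟨rfl, h1, h2⟩⟩
    · intro D' hD' hne
      have h3 := (hcut _ _).1 (Finset.mem_filter.1 hD').2
      refine absurd ?_ hne
      ext
      · exact h3.1
      · exact h3.2.2.symm.trans h2
  have hErr : E r = Finset.univ := by
    ext j
    simp only [hE, Finset.mem_univ, iff_true]
    exact hroot _
  have stop_eq : c.wu (Sum.inr c.stopEdge) = -endSum d Finset.univ := by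
    have h := c.sum_cut (B r)
    rw [hends, if_pos rfl, Finset.sum_eq_zero, zero_add, hErr] at h
    · exact eq_neg_of_add_eq_zero_left h
    · intro D hD
      exact absurd rfl ((hcut _ _).1 (Finset.mem_filter.1 hD).2).2.1
  have hne : ∀ x, (E x).Nonempty := by
    intro x
    by_cases hx : x = r
    · rw [hx, hErr]; exact Finset.univ_nonempty
    · by_contra h
      rw [Finset.not_nonempty_iff_eq_empty] at h
      have := hflow ⟨(x, par x), (hpar x hx).1⟩ hx rfl
      rw [h, endSum, Finset.sum_empty, add_zero] at this
      exact c.wu_ne_zero _ this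
  have hfoot_self : ∀ j, j ∈ E (c.Γ.foot (σ j)) := fun j => (hE _ _).2 Relation.ReflTransGen.refl
  have hnostep : ∀ {y x}, y ≠ r → par y = x → ¬ up x y := by
    intro y x hy hyx h
    have := (hpar y hy).2
    rw [hyx] at this
    rcases hdep h with h | h
    · rw [h] at this; omega
    · omega
  -- The valence condition provides an unbounded edge above `x` but not above a given child.
  have hextra : ∀ y x, y ≠ r → par y = x → ∃ j ∈ E x, ¬ up (c.Γ.foot (σ j)) y := by
    intro y x hy hyx
    by_contra hcon
    push Not at hcon
    have hends0 : {e : c.Γ.U | c.Γ.foot e = x} ⊆ {c.stopEdge} := by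
      intro e he
      by_contra hes
      obtain ⟨j, rfl⟩ := hσ.surj e hes
      have he : c.Γ.foot (σ j) = x := he
      have := hcon j (he ▸ hfoot_self j)
      rw [he] at this
      exact hnostep hy hyx this
    have hnb : c.Γ.bdd.neighborSet x ⊆ {y} ∪ {z | x ≠ r ∧ z = par x} := by
      intro z hz
      rcases hadj x z hz with h | h
      · exact Or.inr ⟨h.1, h.2.symm⟩
      · refine Or.inl ?_
        by_contra hzy
        obtain ⟨j, hj⟩ := hne z
        have hjz := (hE _ _).1 hj
        have hzx : up z x := Relation.ReflTransGen.single h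
        have hjy := hcon j ((hE _ _).2 (hjz.trans hzx))
        have aux : ∀ {a b}, a ≠ b → a ≠ r → par a = x → b ≠ r → par b = x → ¬ up a b := by
          intro a b hab ha hax hb hbx hup
          rcases Relation.ReflTransGen.cases_head hup with h | ⟨z', h3, h4⟩
          · exact hab h
          · rw [← h3.2, hax] at h4
            exact hnostep hb hbx h4
        rcases htotal hjz hjy with h' | h'
        · exact aux hzy h.1 h.2 hy hyx h'
        · exact aux (Ne.symm hzy) hy hyx h.1 h.2 h'
    have hval := c.Γ.valence_ge x
    by_cases hx : x = r
    · have h1 : (c.Γ.bdd.neighborSet x).ncard ≤ 1 := by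
        have : c.Γ.bdd.neighborSet x ⊆ {y} := fun z hz => (hnb hz).resolve_right fun h => h.1 hx
        simpa using Set.ncard_le_ncard this
      have h2 : {e : c.Γ.U | c.Γ.foot e = x}.ncard ≤ 1 := by
        simpa using Set.ncard_le_ncard hends0
      omega
    · have h1 : (c.Γ.bdd.neighborSet x).ncard ≤ 2 := by
        have : c.Γ.bdd.neighborSet x ⊆ {y, par x} := fun z hz => by
          rcases hnb hz with h | h
          · exact Or.inl h
          · exact Or.inr h.2
        refine (Set.ncard_le_ncard this).trans ((Set.ncard_insert_le _ _).trans ?_)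
        rw [Set.ncard_singleton]
      have h2 : {e : c.Γ.U | c.Γ.foot e = x} = ∅ := by
        rw [Set.eq_empty_iff_forall_notMem]
        intro e he
        have := hends0 he
        rw [Set.mem_singleton_iff] at this
        subst this
        exact hx (hr ▸ he.symm)
      rw [h2, Set.ncard_empty] at hval
      omega
  have hmono : ∀ {x y}, up x y → E x ⊆ E y := fun h j hj =>
    (hE _ _).2 (((hE _ _).1 hj).trans h)
  have hchild : ∀ {y x}, up y x → y ≠ x → ∃ y₁, y₁ ≠ r ∧ par y₁ = x ∧ up y y₁ := by
    intro y x h hyx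
    rcases Relation.ReflTransGen.cases_tail h with h | ⟨y₁, h1, h2⟩
    · exact absurd h.symm hyx
    · exact ⟨y₁, h2.1, h2.2, h1⟩
  have hiff : ∀ x y, E x ⊆ E y ↔ up x y := by
    intro x y
    refine ⟨fun h => ?_, hmono⟩
    obtain ⟨j, hj⟩ := hne x
    rcases htotal ((hE _ _).1 hj) ((hE _ _).1 (h hj)) with h' | h'
    · exact h'
    · by_cases hyx : y = x
      · rw [hyx]
      · obtain ⟨y₁, h1, h2, h3⟩ := hchild h' hyx
        obtain ⟨j', hj', hnj⟩ := hextra y₁ x h1 h2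
        exact absurd (((hE _ _).1 (h hj')).trans h3) hnj
  have hinj : Function.Injective E := fun x y h =>
    hanti ((hiff x y).1 h.subset) ((hiff y x).1 h.symm.subset)
  have hssub : ∀ x y, E x ⊂ E y ↔ up x y ∧ x ≠ y := by
    intro x y
    rw [Finset.ssubset_iff_subset_ne, hiff, hinj.ne_iff]
  have hcov : ∀ x y, (x ≠ r ∧ par x = y) ↔ (E x ⊂ E y ∧ ∀ z, E x ⊂ E z → E y ⊆ E z) := by
    intro x y
    constructor
    · rintro ⟨hx, hxy⟩
      refine ⟨(hssub _ _).2 ⟨Relation.ReflTransGen.single ⟨hx, hxy⟩, ?_⟩, fun z hz => ?_⟩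
      · rintro rfl
        exact hnostep hx hxy Relation.ReflTransGen.refl
      · obtain ⟨h1, h2⟩ := (hssub _ _).1 hz
        rcases Relation.ReflTransGen.cases_head h1 with h | ⟨z', h3, h4⟩
        · exact absurd h h2
        · rw [← h3.2, hxy] at h4
          exact hmono h4
    · rintro ⟨h1, h2⟩
      obtain ⟨h3, h4⟩ := (hssub _ _).1 h1
      rcases Relation.ReflTransGen.cases_head h3 with h | ⟨z, ⟨hx, rfl⟩, h6⟩
      · exact absurd h h4
      · refine ⟨hx, ?_⟩
        have h7 := h2 (par x) ((hssub _ _).2 ⟨Relation.ReflTransGen.single ⟨hx, rfl⟩, fun h =>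
          hnostep hx h.symm Relation.ReflTransGen.refl⟩)
        exact hanti h6 ((hiff _ _).1 h7)
  refine ⟨E, hinj, hErr, fun j x => ?_, fun x y => ?_, fun x => ?_, fun x y => ?_, fun D hD => ?_,
    stop_eq⟩
  · rw [hE, hiff]
  · rw [hiff, hiff]
    by_cases h : Disjoint (E x) (E y)
    · exact Or.inr (Or.inr h)
    · obtain ⟨j, hj, hj'⟩ := Finset.not_disjoint_iff.1 h
      rcases htotal ((hE _ _).1 hj) ((hE _ _).1 hj') with h | h
      exacts [Or.inl h, Or.inr (Or.inl h)]
  · by_cases hch : ∃ y, y ≠ r ∧ par y = x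
    · obtain ⟨y, hy, hyx⟩ := hch
      obtain ⟨j, hj⟩ := hne y
      obtain ⟨j', hj', hnj⟩ := hextra y x hy hyx
      have hjx : j ∈ E x := hmono (Relation.ReflTransGen.single ⟨hy, hyx⟩) hj
      refine Finset.one_lt_card.2 ⟨j, hjx, j', hj', ?_⟩
      rintro rfl
      exact hnj ((hE _ _).1 hj)
    · push Not at hch
      have hnb : c.Γ.bdd.neighborSet x ⊆ {z | x ≠ r ∧ z = par x} := by
        intro z hz
        rcases hadj x z hz with h | h
        · exact ⟨h.1, h.2.symm⟩
        · exact absurd h.2 (hch z h.1)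
      have hval := c.Γ.valence_ge x
      have h2 : 2 ≤ ({e : c.Γ.U | c.Γ.foot e = x} \ {c.stopEdge}).ncard := by
        by_cases hx : x = r
        · have h1 : c.Γ.bdd.neighborSet x = ∅ :=
            Set.eq_empty_iff_forall_notMem.2 fun z hz => (hnb hz).1 hx
          rw [h1, Set.ncard_empty, zero_add] at hval
          have := Set.ncard_sdiff_add_ncard_of_subset (s := {c.stopEdge})
            (t := {e : c.Γ.U | c.Γ.foot e = x}) (by simp [hx, hr])
          rw [Set.ncard_singleton] at this
          omega
        · have h1 : (c.Γ.bdd.neighborSet x).ncard ≤ 1 := by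
            have : c.Γ.bdd.neighborSet x ⊆ {par x} := fun z hz => (hnb hz).2
            simpa using Set.ncard_le_ncard this
          rw [Set.sdiff_singleton_eq_self (by
            intro h
            exact hx (hr ▸ h.symm))]
          omega
      obtain ⟨e, e', he, he', hee⟩ := (Set.one_lt_ncard_iff (Set.toFinite _)).1 h2
      obtain ⟨j, rfl⟩ := hσ.surj e he.2
      obtain ⟨j', rfl⟩ := hσ.surj e' he'.2
      have h3 : c.Γ.foot (σ j) = x := he.1
      have h4 : c.Γ.foot (σ j') = x := he'.1
      refine Finset.one_lt_card.2 ⟨j, h3 ▸ hfoot_self j, j', h4 ▸ hfoot_self j', ?_⟩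
      rintro rfl
      exact hee rfl
  · rw [← hcov, ← hcov]
    constructor
    · exact hadj x y
    · rintro (⟨h1, h2⟩ | ⟨h1, h2⟩)
      · exact h2 ▸ (hpar x h1).1
      · exact (h2 ▸ (hpar y h1).1).symm
  · rcases hadj _ _ D.adj with h | h
    · exact absurd (hmono (Relation.ReflTransGen.single h)) hD.2
    · have h1 := hflow D.symm h.1 h.2
      rw [c.wu_symm] at h1
      have h2 : D.symm.fst = D.snd := rfl
      rw [h2] at h1
      exact (neg_add_eq_zero.1 h1)

end Models

/-! ### Edges and isomorphisms in terms of models -/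

section ModelTheory

variable {l : ℕ} {d : Fin (l + 1) → ZLat} {c : StopCurve l} {σ : Fin (l + 1) → c.Γ.U}
  {E : c.Γ.V → Finset (Fin (l + 1))}

/-- Positive multiples of primitive vectors determine the vectors and the factors. -/
theorem eq_of_smul_primitive {a b : ℕ} (ha : 0 < a) (hb : 0 < b) {x y : ZLat}
    (hx : x.IsPrimitive) (hy : y.IsPrimitive) (h : (a : ℤ) • x = (b : ℤ) • y) : x = y ∧ a = b := by
  have hxy : x = y := by
    refine hx.eq_of_proportional hy (s := a) (t := b) (by exact_mod_cast ha) (by exact_mod_cast hb)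
      fun i => ?_
    have := congrFun h i
    simp only [Pi.smul_apply, smul_eq_mul] at this
    exact_mod_cast this
  refine ⟨hxy, ?_⟩
  subst hxy
  have := smul_left_injective ℤ hx.ne_zero h
  exact_mod_cast this

open Classical in
/-- The set of unbounded edges separated from the stop by an edge, as a marking is recorded
combinatorially. -/
noncomputable def edgeKey (σ : Fin (l + 1) → c.Γ.U) (E : c.Γ.V → Finset (Fin (l + 1))) :
    c.Γ.Edge → Finset (Fin (l + 1))
  | Sum.inl e => E (c.Γ.orient e).fst ∩ E (c.Γ.orient e).snd
  | Sum.inr e => Finset.univ.filter fun j => σ j = e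

theorem edgeKey_end (hσ : IsLabelling d c σ) (j : Fin (l + 1)) :
    edgeKey σ E (Sum.inr (σ j)) = {j} := by
  ext k
  simp [edgeKey, hσ.injective.eq_iff]

theorem TropGraph.orient_edge (Γ : TropGraph) (e : Γ.bdd.edgeSet) : (Γ.orient e).edge = e.1 :=
  Quot.out_eq e.1

namespace IsModel

variable (hE : IsModel d c σ E)
include hE

theorem nonempty (x : c.Γ.V) : (E x).Nonempty :=
  Finset.card_pos.1 (lt_of_lt_of_le Nat.zero_lt_two (hE.two_le x))

theorem mem_foot (j : Fin (l + 1)) : j ∈ E (c.Γ.foot (σ j)) := (hE.mem_iff _ _).2 subset_rfl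

theorem exists_cover {x : c.Γ.V} (hx : x ≠ c.Γ.foot c.stopEdge) :
    ∃ y, E x ⊂ E y ∧ ∀ z, E x ⊂ E z → E y ⊆ E z := by
  classical
  have hne : (Finset.univ.filter fun y => E x ⊂ E y).Nonempty := by
    refine ⟨c.Γ.foot c.stopEdge, Finset.mem_filter.2 ⟨Finset.mem_univ _, ?_⟩⟩
    refine lt_of_le_of_ne (by rw [hE.root]; exact (E x).subset_univ) fun h => hx (hE.injective h)
  obtain ⟨y, hy, hmin⟩ := Finset.exists_min_image _ (fun y => (E y).card) hne
  obtain ⟨-, hxy⟩ := Finset.mem_filter.1 hy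
  refine ⟨y, hxy, fun z hz => ?_⟩
  rcases hE.nested y z with h | h | h
  · exact h
  · exact (Finset.eq_of_subset_of_card_le h (hmin z (Finset.mem_filter.2
      ⟨Finset.mem_univ _, hz⟩))).ge
  · obtain ⟨j, hj⟩ := hE.nonempty x
    exact absurd (hz.1 hj) (Finset.disjoint_left.1 h (hxy.1 hj))

theorem ssubset_or_ssubset (D : c.Γ.bdd.Dart) : E D.snd ⊂ E D.fst ∨ E D.fst ⊂ E D.snd := by
  rcases (hE.adj_iff _ _).1 D.adj with h | h
  exacts [Or.inr h.1, Or.inl h.1]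

/-- Every bounded edge, oriented away from the stop. -/
theorem exists_dart (e : c.Γ.bdd.edgeSet) : ∃ D : c.Γ.bdd.Dart, D.edge = e.1 ∧
    E D.snd ⊂ E D.fst ∧ edgeKey σ E (Sum.inl e) = E D.snd ∧
    (D = c.Γ.orient e ∨ D = (c.Γ.orient e).symm) := by
  rcases hE.ssubset_or_ssubset (c.Γ.orient e) with h | h
  · exact ⟨_, c.Γ.orient_edge e, h, Finset.inter_eq_right.2 h.1, Or.inl rfl⟩
  · refine ⟨(c.Γ.orient e).symm, ?_, h, Finset.inter_eq_left.2 h.1, Or.inr rfl⟩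
    rw [SimpleGraph.Dart.edge_symm, c.Γ.orient_edge]

theorem edge_smul (e : c.Γ.bdd.edgeSet) : ∃ u : ZLat, u.IsPrimitive ∧
    (c.w (Sum.inl e) : ℤ) • u = endSum d (edgeKey σ E (Sum.inl e)) := by
  obtain ⟨D, hDe, hD, hk, -⟩ := hE.exists_dart e
  refine ⟨c.u (Sum.inl D), c.u_primitive _, ?_⟩
  rw [hk, ← hE.dir D hD, TropCurve.wu]
  congr 3
  exact congrArg Sum.inl (Subtype.ext hDe.symm)

theorem edgeKey_injective (hσ : IsLabelling d c σ) : Function.Injective (edgeKey σ E) := by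
  have hend : ∀ e : c.Γ.U, (edgeKey σ E (Sum.inr e)).card ≤ 1 := by
    intro e
    rw [Finset.card_le_one]
    intro a ha b hb
    simp only [edgeKey, Finset.mem_filter, Finset.mem_univ, true_and] at ha hb
    exact hσ.injective (ha.trans hb.symm)
  have hbdd : ∀ e : c.Γ.bdd.edgeSet, 2 ≤ (edgeKey σ E (Sum.inl e)).card := by
    intro e
    obtain ⟨D, -, -, hk, -⟩ := hE.exists_dart e
    rw [hk]
    exact hE.two_le _
  rintro (e | e) (e' | e') h
  · obtain ⟨D, hDe, hD, hk, -⟩ := hE.exists_dart e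
    obtain ⟨D', hDe', hD', hk', -⟩ := hE.exists_dart e'
    rw [hk, hk'] at h
    have h1 := hE.injective h
    have hcov : ∀ D : c.Γ.bdd.Dart, E D.snd ⊂ E D.fst → ∀ z, E D.snd ⊂ E z → E D.fst ⊆ E z := by
      intro D hD
      rcases (hE.adj_iff _ _).1 D.adj with h | h
      · exact absurd h.1.1 hD.2
      · exact h.2
    have h2 : D.fst = D'.fst := by
      refine hE.injective (Finset.Subset.antisymm (hcov D hD _ ?_) (hcov D' hD' _ ?_))
      · rw [h1]; exact hD'
      · rw [← h1]; exact hD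
    have hDD : D = D' := by ext <;> assumption
    rw [Sum.inl.injEq]
    exact Subtype.ext (by rw [← hDe, ← hDe', hDD])
  · have := hend e'
    have := hbdd e
    rw [h] at this
    omega
  · have := hend e
    have := hbdd e'
    rw [← h] at this
    omega
  · by_cases he : e = c.stopEdge
    · by_cases he' : e' = c.stopEdge
      · rw [he, he']
      · obtain ⟨j, rfl⟩ := hσ.surj e' he'
        rw [edgeKey_end hσ] at h
        have : j ∈ edgeKey σ E (Sum.inr e) := by rw [h]; exact Finset.mem_singleton_self j
        simp only [edgeKey, Finset.mem_filter, Finset.mem_univ, true_and] at this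
        exact absurd (this.trans he) (hσ.ne_stop j)
    · obtain ⟨j, rfl⟩ := hσ.surj e he
      rw [edgeKey_end hσ] at h
      have : j ∈ edgeKey σ E (Sum.inr e') := by rw [← h]; exact Finset.mem_singleton_self j
      simp only [edgeKey, Finset.mem_filter, Finset.mem_univ, true_and] at this
      rw [this]

/-- A labelled curve has only one model, as the weighted directions of its edges tell which of two
adjacent vertices is closer to the stop. -/
theorem unique {v : ZLat} (hv : ∀ j, 0 < latForm v (d j)) {E' : c.Γ.V → Finset (Fin (l + 1))}
    (hE' : IsModel d c σ E') : E = E' := by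
  have horient : ∀ {E₁ E₂ : c.Γ.V → Finset (Fin (l + 1))}, IsModel d c σ E₁ → IsModel d c σ E₂ →
      ∀ D : c.Γ.bdd.Dart, E₁ D.snd ⊂ E₁ D.fst → E₂ D.snd ⊂ E₂ D.fst := by
    intro E₁ E₂ h₁ h₂ D hD
    rcases h₂.ssubset_or_ssubset D with h | h
    · exact h
    · have e1 := h₁.dir D hD
      have e2 := h₂.dir D.symm h
      rw [c.wu_symm, e1] at e2
      have p1 := latForm_endSum_pos hv (h₁.nonempty D.snd)
      have p2 := latForm_endSum_pos hv (h₂.nonempty D.symm.snd)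
      rw [← e2] at p2
      have : latForm v (-endSum d (E₁ D.snd)) = -latForm v (endSum d (E₁ D.snd)) := by
        simp only [latForm, Pi.neg_apply]; ring
      omega
  have hsub : ∀ {E₁ E₂ : c.Γ.V → Finset (Fin (l + 1))}, IsModel d c σ E₁ → IsModel d c σ E₂ →
      ∀ a b, E₁ a ⊆ E₁ b → E₂ a ⊆ E₂ b := by
    intro E₁ E₂ h₁ h₂ a b hab
    induction hn : (E₁ b).card - (E₁ a).card using Nat.strong_induction_on generalizing a with
    | _ n ih =>
      by_cases hEab : E₁ a = E₁ b
      · rw [h₁.injective hEab]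
      · have hss : E₁ a ⊂ E₁ b := lt_of_le_of_ne hab hEab
        have ha : a ≠ c.Γ.foot c.stopEdge := by
          rintro rfl
          rw [h₁.root] at hss
          exact hss.2 (Finset.subset_univ _)
        obtain ⟨y, hy, hmin⟩ := h₁.exists_cover ha
        have hadj : c.Γ.bdd.Adj y a := ((h₁.adj_iff a y).2 (Or.inl ⟨hy, hmin⟩)).symm
        have h3 := horient h₁ h₂ ⟨(y, a), hadj⟩ hy
        have h4 := hmin b hss
        have c1 := Finset.card_lt_card hy
        have c2 := Finset.card_le_card h4
        exact h3.1.trans (ih _ (by omega) y h4 rfl)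
  have hle : ∀ {E₁ E₂ : c.Γ.V → Finset (Fin (l + 1))}, IsModel d c σ E₁ → IsModel d c σ E₂ →
      ∀ x, E₁ x ⊆ E₂ x := by
    intro E₁ E₂ h₁ h₂ x j hj
    exact (h₂.mem_iff j x).2 (hsub h₁ h₂ _ _ ((h₁.mem_iff j x).1 hj))
  exact funext fun x => (hle hE hE' x).antisymm (hle hE' hE x)

end IsModel

/-- Labelled curves with equal combinatorial data and equal positions of vertices are isomorphic,
by an isomorphism compatible with the labels. -/
theorem isom_of_models {c' : StopCurve l} {σ' : Fin (l + 1) → c'.Γ.U}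
    {E' : c'.Γ.V → Finset (Fin (l + 1))} (hσ : IsLabelling d c σ) (hσ' : IsLabelling d c' σ')
    (hE : IsModel d c σ E) (hE' : IsModel d c' σ' E')
    (hV : Set.range E = Set.range E') (hpos : ∀ x x', E x = E' x' → c.pos x = c'.pos x')
    (hm : ∀ i, edgeKey σ E (c.mark i) = edgeKey σ' E' (c'.mark i))
    (stop_eq : c.stopPos = c'.stopPos) : StopCurve.Isom c c' := by
  classical
  let φ₀ : c.Γ.V ≃ c'.Γ.V := (Equiv.ofInjective E hE.injective).trans
    ((Equiv.setCongr hV).trans (Equiv.ofInjective E' hE'.injective).symm)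
  have hφ₀ : ∀ x, E' (φ₀ x) = E x := by
    intro x
    have := Equiv.apply_ofInjective_symm hE'.injective
      ((Equiv.setCongr hV) (Equiv.ofInjective E hE.injective x))
    exact this
  have hall : ∀ P : Finset (Fin (l + 1)) → Prop, (∀ z, P (E z)) ↔ ∀ z, P (E' z) := by
    intro P
    constructor
    · intro h z
      have := h (φ₀.symm z)
      rwa [← hφ₀, Equiv.apply_symm_apply] at this
    · intro h z
      rw [← hφ₀]
      exact h _
  let φ : c.Γ.bdd ≃g c'.Γ.bdd := ⟨φ₀, by
    intro x y
    rw [hE.adj_iff, hE'.adj_iff, hφ₀, hφ₀, hall fun F => E x ⊂ F → E y ⊆ F,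
      hall fun F => E y ⊂ F → E x ⊆ F]⟩
  have hφ : ∀ x, E' (φ x) = E x := hφ₀
  -- Unbounded edges correspond by their labels.
  have hequiv : ∀ {b : StopCurve l} {τ : Fin (l + 1) → b.Γ.U}, IsLabelling d b τ →
      Function.Bijective fun o : Option (Fin (l + 1)) => o.elim b.stopEdge τ := by
    intro b τ hτ
    constructor
    · rintro (_ | j) (_ | k) h
      · rfl
      · exact absurd h.symm (hτ.ne_stop k)
      · exact absurd h (hτ.ne_stop j)
      · exact congrArg some (hτ.injective h)
    · intro e
      by_cases he : e = b.stopEdge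
      · exact ⟨none, he.symm⟩
      · obtain ⟨j, hj⟩ := hτ.surj e he
        exact ⟨some j, hj⟩
  let ψ : c.Γ.U ≃ c'.Γ.U :=
    (Equiv.ofBijective _ (hequiv hσ)).symm.trans (Equiv.ofBijective _ (hequiv hσ'))
  have ψ_stop_eq : ψ c.stopEdge = c'.stopEdge := by
    have : (Equiv.ofBijective _ (hequiv hσ)).symm c.stopEdge = none := by
      rw [Equiv.symm_apply_eq]; rfl
    simp only [ψ, Equiv.trans_apply, this]; rfl
  have hψ : ∀ j, ψ (σ j) = σ' j := by
    intro j
    have : (Equiv.ofBijective _ (hequiv hσ)).symm (σ j) = some j := by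
      rw [Equiv.symm_apply_eq]; rfl
    simp only [ψ, Equiv.trans_apply, this]; rfl
  have hcases : ∀ e : c.Γ.U, e = c.stopEdge ∨ ∃ j, e = σ j := by
    intro e
    by_cases he : e = c.stopEdge
    · exact Or.inl he
    · obtain ⟨j, hj⟩ := hσ.surj e he
      exact Or.inr ⟨j, hj.symm⟩
  have hwu : ∀ e, c'.wu (Sum.inr (ψ e)) = c.wu (Sum.inr e) := by
    intro e
    rcases hcases e with rfl | ⟨j, rfl⟩
    · rw [ψ_stop_eq, hE'.dir_stop, hE.dir_stop]
    · rw [hψ, hσ'.dir, hσ.dir]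
  have huw : ∀ e, c'.u (Sum.inr (ψ e)) = c.u (Sum.inr e) ∧
      c'.w (Sum.inr (ψ e)) = c.w (Sum.inr e) := fun e =>
    eq_of_smul_primitive (c'.w_pos _) (c.w_pos _) (c'.u_primitive _) (c.u_primitive _) (hwu e)
  have hkey : ∀ e, edgeKey σ' E' (Sum.map φ.mapEdgeSet ψ e) = edgeKey σ E e := by
    rintro (e | e)
    · obtain ⟨D, hDe, hD, hk, -⟩ := hE.exists_dart e
      obtain ⟨D', hDe', hD', hk', -⟩ := hE'.exists_dart (φ.mapEdgeSet e)
      have h1 : (φ.mapEdgeSet e).1 = s(φ D.fst, φ D.snd) := by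
        have : e.1 = s(D.fst, D.snd) := by rw [← hDe]; rfl
        have h2 : (φ.mapEdgeSet e).1 = Sym2.map φ e.1 := rfl
        rw [h2, this]; rfl
      have h2 : s(D'.fst, D'.snd) = s(φ D.fst, φ D.snd) := by
        rw [← h1, ← hDe']; rfl
      rw [Sum.map_inl, hk, hk']
      rcases Sym2.eq_iff.1 h2 with ⟨h3, h4⟩ | ⟨h3, h4⟩
      · rw [h4, hφ]
      · rw [h3, h4, hφ, hφ] at hD'
        exact absurd hD.1 hD'.2
    · rcases hcases e with rfl | ⟨j, rfl⟩
      · have hs : ∀ {b : StopCurve l} {τ : Fin (l + 1) → b.Γ.U}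
          {F : b.Γ.V → Finset (Fin (l + 1))}, IsLabelling d b τ →
          edgeKey τ F (Sum.inr b.stopEdge) = ∅ := by
          intro b τ F hτ
          ext j
          simp [edgeKey, hτ.ne_stop j]
        rw [Sum.map_inr, ψ_stop_eq, hs hσ, hs hσ']
      · rw [Sum.map_inr, hψ, edgeKey_end hσ, edgeKey_end hσ']
  refine ⟨φ, ψ, fun e => ?_, ?_, fun x => (hpos x (φ x) (hφ x).symm).symm, fun e => (huw e).1,
    fun i => ?_, ψ_stop_eq.symm, stop_eq.symm⟩
  · rcases hcases e with rfl | ⟨j, rfl⟩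
    · rw [ψ_stop_eq]
      exact hE'.injective (by rw [hE'.root, hφ, hE.root])
    · rw [hψ]
      refine hE'.injective (Finset.Subset.antisymm ?_ ?_)
      · rw [← hE'.mem_iff, hφ]
        exact hE.mem_foot j
      · rw [hφ]
        have h1 := hφ (φ₀.symm (c'.Γ.foot (σ' j)))
        have h2 : φ (φ₀.symm (c'.Γ.foot (σ' j))) = c'.Γ.foot (σ' j) := φ₀.apply_symm_apply _
        rw [h2] at h1
        rw [h1, ← hE.mem_iff, ← h1]
        exact hE'.mem_foot j
  · rintro (e | e)
    · obtain ⟨u, hu, h1⟩ := hE.edge_smul e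
      obtain ⟨u', hu', h2⟩ := hE'.edge_smul (φ.mapEdgeSet e)
      have hk := hkey (Sum.inl e)
      rw [Sum.map_inl] at hk ⊢
      rw [hk, ← h1] at h2
      exact (eq_of_smul_primitive (c'.w_pos _) (c.w_pos _) hu' hu h2).2
    · exact (huw e).2
  · refine hE'.edgeKey_injective hσ' ?_
    rw [← hm, hkey]

end ModelTheory

/-! ### Edge lengths and realizations -/

section Lengths

variable {l : ℕ} {d : Fin (l + 1) → ZLat} {c : StopCurve l} {σ : Fin (l + 1) → c.Γ.U}
  {E : c.Γ.V → Finset (Fin (l + 1))}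

theorem exists_smul_wu {k : ℕ} (C : TropCurve k) (f : C.Γ.Flag) {t : ℝ} (ht : 0 < t) :
    ∃ s : ℝ, 0 < s ∧ t • (C.u f).toPlane = s • (C.wu f).toPlane := by
  have hw : (0 : ℝ) < C.w f.edge := by exact_mod_cast C.w_pos _
  refine ⟨t / C.w f.edge, div_pos ht hw, ?_⟩
  ext i
  simp only [smul_toPlane_apply, TropCurve.wu, Pi.smul_apply, smul_eq_mul]
  push_cast
  field_simp

theorem neg_toPlane (x : ZLat) : (-x).toPlane = -x.toPlane := by
  ext i
  simp [ZLat.toPlane_apply]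

namespace IsModel

variable (hE : IsModel d c σ E)
include hE

theorem cover_fst {D : c.Γ.bdd.Dart} (hD : E D.snd ⊂ E D.fst) (z : c.Γ.V) :
    E D.snd ⊂ E z ↔ E D.fst ⊆ E z := by
  refine ⟨fun hz => ?_, fun hz => hD.trans_subset hz⟩
  rcases (hE.adj_iff _ _).1 D.adj with h | h
  · exact absurd h.1.1 hD.2
  · exact h.2 z hz

/-- The position of a vertex is the sum of the displacements along the edges that separate it from
the stop. The length of an edge is measured in multiples of its weighted direction, and is
recorded at the endpoint away from the stop. -/
theorem exists_len : ∃ len : Finset (Fin (l + 1)) → ℝ, (∀ x, 0 < len (E x)) ∧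
    ∀ x, c.pos x = c.stopPos + ∑ F ∈ Finset.univ.image E with E x ⊆ F,
      len F • (endSum d F).toPlane := by
  classical
  have hstep : ∀ x, ∃ s : ℝ, 0 < s ∧
      (x = c.Γ.foot c.stopEdge → c.pos x = c.stopPos + s • (endSum d (E x)).toPlane) ∧
      (x ≠ c.Γ.foot c.stopEdge → ∃ y, E x ⊂ E y ∧ (∀ z, E x ⊂ E z ↔ E y ⊆ E z) ∧
        c.pos x = c.pos y + s • (endSum d (E x)).toPlane) := by
    intro x
    by_cases hx : x = c.Γ.foot c.stopEdge
    · obtain ⟨t, ht, h⟩ := c.stop_edge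
      obtain ⟨s, hs, h'⟩ := exists_smul_wu c.toTropCurve (Sum.inr c.stopEdge) ht
      refine ⟨s, hs, fun _ => ?_, fun h => absurd hx h⟩
      rw [h, h', hE.dir_stop, neg_toPlane, ← hx]
      rw [show E x = Finset.univ from hx ▸ hE.root]
      simp
    · obtain ⟨y, hy, hmin⟩ := hE.exists_cover hx
      have hadj : c.Γ.bdd.Adj y x := ((hE.adj_iff x y).2 (Or.inl ⟨hy, hmin⟩)).symm
      obtain ⟨t, ht, h⟩ := c.bounded_edge ⟨(y, x), hadj⟩
      obtain ⟨s, hs, h'⟩ := exists_smul_wu c.toTropCurve (Sum.inl ⟨(y, x), hadj⟩) ht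
      refine ⟨s, hs, fun h => absurd h hx, fun _ => ⟨y, hy, hE.cover_fst (D := ⟨(y, x), hadj⟩) hy,
        ?_⟩⟩
      rw [h'] at h
      rw [hE.dir ⟨(y, x), hadj⟩ hy] at h
      exact h
  choose s hs hroot hnr using hstep
  have hext : ∀ x, Function.extend E s 0 (E x) = s x := fun x => hE.injective.extend_apply _ _ _
  refine ⟨Function.extend E s 0, fun x => by rw [hext]; exact hs x, fun x => ?_⟩
  induction hn : (Finset.univ : Finset (Fin (l + 1))).card - (E x).card
    using Nat.strong_induction_on generalizing x with
  | _ n ih =>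
    by_cases hx : x = c.Γ.foot c.stopEdge
    · have : (Finset.univ.image E).filter (fun F => E x ⊆ F) = {E x} := by
        have hEx : E x = Finset.univ := hx ▸ hE.root
        ext F
        simp only [Finset.mem_filter, Finset.mem_image, Finset.mem_univ, true_and,
          Finset.mem_singleton, hEx, Finset.univ_subset_iff]
        exact ⟨fun h => h.2, fun h => ⟨⟨x, hEx.trans h.symm⟩, h⟩⟩
      rw [this, Finset.sum_singleton, hext]
      exact hroot x hx
    · obtain ⟨y, hy, hc, hp⟩ := hnr x hx
      have : (Finset.univ.image E).filter (fun F => E x ⊆ F) =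
          insert (E x) ((Finset.univ.image E).filter (fun F => E y ⊆ F)) := by
        ext F
        simp only [Finset.mem_filter, Finset.mem_image, Finset.mem_univ, true_and,
          Finset.mem_insert]
        constructor
        · rintro ⟨⟨z, rfl⟩, h⟩
          rcases h.eq_or_ssubset with h | h
          · exact Or.inl h.symm
          · exact Or.inr ⟨⟨z, rfl⟩, (hc z).1 h⟩
        · rintro (rfl | ⟨h1, h2⟩)
          · exact ⟨⟨x, rfl⟩, subset_rfl⟩
          · exact ⟨h1, hy.1.trans h2⟩
      rw [this, Finset.sum_insert, hext, hp, ih _ _ y rfl]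
      · abel
      · have c1 := Finset.card_lt_card hy
        have c2 := Finset.card_le_univ (E y)
        rw [Finset.card_univ] at hn ⊢
        omega
      · simp only [Finset.mem_filter, not_and]
        exact fun _ h => hy.2 h

end IsModel

/-- The combinatorial type of a rooted tree with marked edges: a family `𝓥` of sets of ends, one
for each vertex, and for each marked edge the set `m i` of ends that it separates from the root.
An edge is recorded by its endpoint away from the root, an end by a singleton. -/
structure IsMarkedFamily (𝓥 : Finset (Finset (Fin (l + 1)))) (m : Fin l → Finset (Fin (l + 1))) :
    Prop where
  nested : ∀ F ∈ 𝓥, ∀ G ∈ 𝓥, F ⊆ G ∨ G ⊆ F ∨ Disjoint F G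
  univ_mem : Finset.univ ∈ 𝓥
  two_le : ∀ F ∈ 𝓥, 2 ≤ F.card
  mark_mem : ∀ i, m i ∈ 𝓥 ∨ ∃ j, m i = {j}
  mark_ne : ∀ i, m i ≠ Finset.univ
  mark_injective : Function.Injective m

/-- Edge lengths for a marked family, and positions `τ i` of the marked points on their edges, such
that the `i`-th marked point has the displacement `w i` from the stop. The length of the root edge
may vanish, and marked points may coincide with vertices. -/
structure IsRealization (d : Fin (l + 1) → ZLat) (𝓥 : Finset (Finset (Fin (l + 1))))
    (m : Fin l → Finset (Fin (l + 1))) (w : Fin l × Fin 2 → ℝ)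
    (len : Finset (Fin (l + 1)) → ℝ) (τ : Fin l → ℝ) : Prop where
  len_pos : ∀ F ∈ 𝓥, F ≠ Finset.univ → 0 < len F
  len_nonneg : 0 ≤ len Finset.univ
  nonneg : ∀ i, 0 ≤ τ i
  le_len : ∀ i, m i ∈ 𝓥 → τ i ≤ len (m i)
  eq : ∀ q, w q = ∑ F ∈ 𝓥 with m q.1 ⊂ F, len F * endSum d F q.2 + τ q.1 * endSum d (m q.1) q.2

/-- A realization of a trivalent tree with a root edge of positive length and with marked points
in the interior of edges. -/
structure IsGenericRealization (d : Fin (l + 1) → ZLat) (𝓥 : Finset (Finset (Fin (l + 1))))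
    (m : Fin l → Finset (Fin (l + 1))) (w : Fin l × Fin 2 → ℝ)
    (len : Finset (Fin (l + 1)) → ℝ) (τ : Fin l → ℝ) : Prop
    extends IsRealization d 𝓥 m w len τ where
  card_eq : 𝓥.card = l
  root_pos : 0 < len Finset.univ
  pos : ∀ i, 0 < τ i
  lt_len : ∀ i, m i ∈ 𝓥 → τ i < len (m i)

theorem IsModel.isMarkedFamily (hσ : IsLabelling d c σ) (hE : IsModel d c σ E) :
    IsMarkedFamily (Finset.univ.image E) fun i => edgeKey σ E (c.mark i) where
  nested := by
    simp only [Finset.mem_image, Finset.mem_univ, true_and]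
    rintro _ ⟨x, rfl⟩ _ ⟨y, rfl⟩
    exact hE.nested x y
  univ_mem := Finset.mem_image.2 ⟨_, Finset.mem_univ _, hE.root⟩
  two_le := by
    simp only [Finset.mem_image, Finset.mem_univ, true_and]
    rintro _ ⟨x, rfl⟩
    exact hE.two_le x
  mark_mem i := by
    rcases h : c.mark i with e | e
    · obtain ⟨D, -, -, hk, -⟩ := hE.exists_dart e
      exact Or.inl (Finset.mem_image.2 ⟨_, Finset.mem_univ _, hk.symm⟩)
    · obtain ⟨j, rfl⟩ := hσ.surj e fun he => c.mark_ne i (he ▸ h)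
      exact Or.inr ⟨j, edgeKey_end hσ j⟩
  mark_ne i := by
    rcases h : c.mark i with e | e
    · obtain ⟨D, -, hD, hk, -⟩ := hE.exists_dart e
      rw [hk]
      intro h
      rw [h] at hD
      exact hD.2 (Finset.subset_univ _)
    · obtain ⟨j, rfl⟩ := hσ.surj e fun he => c.mark_ne i (he ▸ h)
      rw [edgeKey_end hσ j]
      intro h1
      have := hE.two_le (c.Γ.foot c.stopEdge)
      rw [hE.root, ← h1, Finset.card_singleton] at this
      omega
  mark_injective := (hE.edgeKey_injective hσ).comp c.mark_injective

/-- The number of vertices of a trivalent tree. -/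
theorem TropGraph.card_add_two_of_trivalent (Γ : TropGraph) (h : ∀ x, Γ.valence x = 3) :
    Fintype.card Γ.V + 2 = Fintype.card Γ.U := by
  classical
  have h1 : ∑ x, Γ.valence x = 3 * Fintype.card Γ.V := by
    simp [h, mul_comm]
  have h2 : ∑ x, Γ.valence x = ∑ x, Γ.bdd.degree x + Fintype.card Γ.U := by
    simp only [valence]
    rw [Finset.sum_add_distrib]
    congr 1
    · refine Finset.sum_congr rfl fun x _ => ?_
      rw [Set.ncard_eq_toFinset_card', ← SimpleGraph.card_neighborFinset_eq_degree]
      rfl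
    · rw [← Finset.card_univ, Finset.card_eq_sum_card_fiberwise (f := Γ.foot) (t := Finset.univ)
        fun _ _ => Finset.mem_coe.2 (Finset.mem_univ _)]
      refine Finset.sum_congr rfl fun x _ => ?_
      rw [Set.ncard_eq_toFinset_card']
      congr 1
      ext e
      simp
  have h3 := Γ.bdd.sum_degrees_eq_twice_card_edges
  have h4 := Γ.isTree.card_edgeFinset
  omega

theorem IsLabelling.card_eq (hσ : IsLabelling d c σ) : Fintype.card c.Γ.U = l + 2 := by
  have := hσ.sum_eq fun _ => 1
  simp at this
  omega

/-- A matching trivalent curve in general position realizes its combinatorial type. -/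
theorem IsModel.exists_isGenericRealization (hσ : IsLabelling d c σ) (hE : IsModel d c σ E)
    {p : Plane} {A : Fin l → Plane} (hmatch : c.Matches p A) (hval : ∀ x, c.Γ.valence x = 3)
    (hA : ∀ x i, c.pos x ≠ A i) :
    ∃ len τ, IsGenericRealization d (Finset.univ.image E) (fun i => edgeKey σ E (c.mark i))
      (fun q => A q.1 q.2 - p q.2) len τ ∧
      ∀ x, c.pos x = p + ∑ F ∈ Finset.univ.image E with E x ⊆ F,
        len F • (endSum d F).toPlane := by
  classical
  obtain ⟨len, hlen, hpos⟩ := hE.exists_len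
  obtain ⟨hm, rfl⟩ := hmatch
  have hex : ∀ i, ∃ t : ℝ, 0 < t ∧ (edgeKey σ E (c.mark i) ∈ Finset.univ.image E →
      t < len (edgeKey σ E (c.mark i))) ∧
      A i = c.stopPos + (∑ F ∈ Finset.univ.image E with edgeKey σ E (c.mark i) ⊂ F,
        len F • (endSum d F).toPlane) + t • (endSum d (edgeKey σ E (c.mark i))).toPlane := by
    intro i
    have hmi := hm i
    rcases h : c.mark i with e | e
    · rw [h] at hmi
      obtain ⟨D, -, hD, hk, hor⟩ := hE.exists_dart e
      have hseg : A i ∈ segment ℝ (c.pos D.fst) (c.pos D.snd) := by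
        rcases hor with rfl | rfl
        · exact hmi
        · rw [segment_symm]; exact hmi
      rw [hk]
      have hfil : (Finset.univ.image E).filter (fun F => E D.snd ⊂ F) =
          (Finset.univ.image E).filter (fun F => E D.fst ⊆ F) := by
        refine Finset.filter_congr ?_
        simp only [Finset.mem_image, Finset.mem_univ, true_and]
        rintro _ ⟨z, rfl⟩
        exact hE.cover_fst hD z
      have hfil' : (Finset.univ.image E).filter (fun F => E D.snd ⊆ F) =
          insert (E D.snd) ((Finset.univ.image E).filter (fun F => E D.snd ⊂ F)) := by
        ext F
        simp only [Finset.mem_filter, Finset.mem_insert, subset_iff_ssubset_or_eq]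
        constructor
        · rintro ⟨h1, h2 | h2⟩
          · exact Or.inr ⟨h1, h2⟩
          · exact Or.inl h2.symm
        · rintro (rfl | h2)
          · exact ⟨Finset.mem_image.2 ⟨_, Finset.mem_univ _, rfl⟩, Or.inr rfl⟩
          · exact ⟨h2.1, Or.inl h2.2⟩
      have hsnd : c.pos D.snd = c.pos D.fst + len (E D.snd) • (endSum d (E D.snd)).toPlane := by
        rw [hpos, hpos, hfil', Finset.sum_insert, hfil]
        · abel
        · simp
      rw [segment_eq_image'] at hseg
      obtain ⟨s, ⟨hs0, hs1⟩, hs⟩ := hseg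
      simp only [hsnd, add_sub_cancel_left] at hs
      have hs0' : s ≠ 0 := by
        rintro rfl
        rw [zero_smul, add_zero] at hs
        exact hA _ i hs
      have hs1' : s ≠ 1 := by
        rintro rfl
        rw [one_smul, ← hsnd] at hs
        exact hA _ i hs
      refine ⟨s * len (E D.snd), mul_pos (lt_of_le_of_ne hs0 hs0'.symm) (hlen _), fun _ => ?_, ?_⟩
      · have := hlen D.snd
        have : s < 1 := lt_of_le_of_ne hs1 hs1'
        nlinarith
      · rw [← hs, hfil, ← hpos, smul_smul]
    · obtain ⟨j, rfl⟩ := hσ.surj e fun he => c.mark_ne i (he ▸ h)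
      rw [h] at hmi
      obtain ⟨t, ht, hAi⟩ := hmi
      have ht' : t ≠ 0 := by
        rintro rfl
        rw [zero_smul, add_zero] at hAi
        exact hA _ i hAi.symm
      obtain ⟨s, hs, h'⟩ := exists_smul_wu c.toTropCurve (Sum.inr (σ j))
        (lt_of_le_of_ne ht ht'.symm)
      rw [edgeKey_end hσ j]
      refine ⟨s, hs, fun hmem => ?_, ?_⟩
      · obtain ⟨x, -, hx⟩ := Finset.mem_image.1 hmem
        have := hE.two_le x
        rw [hx, Finset.card_singleton] at this
        omega
      · rw [hAi, h', hσ.dir, hpos]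
        congr 2
        · refine Finset.sum_congr (Finset.filter_congr ?_) fun _ _ => rfl
          simp only [Finset.mem_image, Finset.mem_univ, true_and]
          rintro _ ⟨z, rfl⟩
          rw [← hE.mem_iff, ← Finset.singleton_subset_iff]
          refine ⟨fun h => lt_of_le_of_ne h fun h1 => ?_, fun h => h.1⟩
          have := hE.two_le z
          rw [← h1, Finset.card_singleton] at this
          omega
        · simp [endSum]
  choose τ hτ hτlt hτeq using hex
  refine ⟨len, τ, ⟨⟨?_, ?_, fun i => (hτ i).le, fun i h => (hτlt i h).le, ?_⟩, ?_, ?_, hτ, hτlt⟩,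
    hpos⟩
  · simp only [Finset.mem_image, Finset.mem_univ, true_and]
    rintro _ ⟨x, rfl⟩ -
    exact hlen x
  · rw [← hE.root]; exact (hlen _).le
  · rintro ⟨i, j⟩
    have h1 := congrArg (fun v : Plane => v j) (hτeq i)
    simp only [PiLp.add_apply, smul_toPlane_apply, WithLp.ofLp_sum, Finset.sum_apply] at h1
    simp only
    linarith
  · rw [Finset.card_image_of_injective _ hE.injective, Finset.card_univ]
    have := c.Γ.card_add_two_of_trivalent hval
    rw [hσ.card_eq] at this
    omega
  · rw [← hE.root]; exact hlen _

end Lengths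

/-! ### Families of clades of marked trees -/

section CladeFamilies

variable {l : ℕ} {d : Fin (l + 1) → ZLat} {𝓥 : Finset (Finset (Fin (l + 1)))}
  {m : Fin l → Finset (Fin (l + 1))} {w : Fin l × Fin 2 → ℝ}
  {len : Finset (Fin (l + 1)) → ℝ} {τ : Fin l → ℝ}

namespace IsMarkedFamily

theorem mark_nonempty (h : IsMarkedFamily 𝓥 m) (i : Fin l) : (m i).Nonempty := by
  rcases h.mark_mem i with h1 | ⟨j, hj⟩
  · exact Finset.card_pos.1 (lt_of_lt_of_le Nat.zero_lt_two (h.two_le _ h1))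
  · rw [hj]; exact Finset.singleton_nonempty j

theorem two_le_of_ssubset (h : IsMarkedFamily 𝓥 m) {i : Fin l} {F : Finset (Fin (l + 1))}
    (hF : m i ⊂ F) : 2 ≤ F.card := by
  have h1 := Finset.card_lt_card hF
  have h2 := Finset.card_pos.2 (h.mark_nonempty i)
  omega

theorem mark_mem_of_ssubset (h : IsMarkedFamily 𝓥 m) {i k : Fin l} (hF : m i ⊂ m k) :
    m k ∈ 𝓥 := by
  rcases h.mark_mem k with h1 | ⟨j, hj⟩
  · exact h1
  · have := h.two_le_of_ssubset hF
    rw [hj, Finset.card_singleton] at this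
    omega

end IsMarkedFamily

/-- The leaves above the vertex `F`. A marked point on the edge below this vertex is not among
them. -/
def vertexClade (m : Fin l → Finset (Fin (l + 1))) (F : Finset (Fin (l + 1))) : Finset (Leaf l) :=
  F.disjSum {k | m k ⊂ F}

/-- The leaves above the `i`-th marked point, including that point. -/
def markClade (m : Fin l → Finset (Fin (l + 1))) (i : Fin l) : Finset (Leaf l) :=
  (m i).disjSum {k | m k ⊆ m i}

/-- The sets of leaves above the edges of a tree, after a leaf has been attached at every marked
point. -/
def cladeFamily (𝓥 : Finset (Finset (Fin (l + 1)))) (m : Fin l → Finset (Fin (l + 1))) :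
    Finset (Finset (Leaf l)) :=
  𝓥.image (vertexClade m) ∪ Finset.univ.image (markClade m)

theorem toLeft_vertexClade (F : Finset (Fin (l + 1))) : (vertexClade m F).toLeft = F := by
  ext; simp [vertexClade]

theorem toLeft_markClade (i : Fin l) : (markClade m i).toLeft = m i := by
  ext; simp [markClade]

theorem inr_mem_vertexClade {F : Finset (Fin (l + 1))} {k : Fin l} :
    Sum.inr k ∈ vertexClade m F ↔ m k ⊂ F := by simp [vertexClade]

theorem inr_mem_markClade {i k : Fin l} : Sum.inr k ∈ markClade m i ↔ m k ⊆ m i := by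
  simp [markClade]

theorem vertexClade_ne_markClade (F : Finset (Fin (l + 1))) (i : Fin l) :
    vertexClade m F ≠ markClade m i := by
  intro h
  have h1 : F = m i := by rw [← toLeft_vertexClade (m := m) F, h, toLeft_markClade]
  have h2 : Sum.inr i ∈ markClade m i := inr_mem_markClade.2 subset_rfl
  rw [← h, inr_mem_vertexClade, h1] at h2
  exact h2.2 subset_rfl

theorem vertexClade_injective : Function.Injective (vertexClade m) := fun F G h => by
  rw [← toLeft_vertexClade (m := m) F, h, toLeft_vertexClade]

theorem mem_cladeFamily {T : Finset (Leaf l)} : T ∈ cladeFamily 𝓥 m ↔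
    (∃ F ∈ 𝓥, vertexClade m F = T) ∨ ∃ i, markClade m i = T := by
  simp [cladeFamily]

theorem IsMarkedFamily.markClade_injective (h : IsMarkedFamily 𝓥 m) :
    Function.Injective (markClade m) := fun i k h' =>
  h.mark_injective (by rw [← toLeft_markClade (m := m) i, h', toLeft_markClade])

theorem IsMarkedFamily.sum_cladeFamily (h : IsMarkedFamily 𝓥 m) {M : Type*} [AddCommMonoid M]
    (f : Finset (Leaf l) → M) : ∑ T ∈ cladeFamily 𝓥 m, f T =
      ∑ F ∈ 𝓥, f (vertexClade m F) + ∑ i, f (markClade m i) := by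
  rw [cladeFamily, Finset.sum_union, Finset.sum_image fun _ _ _ _ h => vertexClade_injective h,
    Finset.sum_image fun _ _ _ _ h' => h.markClade_injective h']
  rw [Finset.disjoint_left]
  intro T hT hT'
  obtain ⟨F, -, rfl⟩ := Finset.mem_image.1 hT
  obtain ⟨i, -, h⟩ := Finset.mem_image.1 hT'
  exact vertexClade_ne_markClade F i h.symm

theorem IsMarkedFamily.card_cladeFamily (h : IsMarkedFamily 𝓥 m) :
    (cladeFamily 𝓥 m).card = 𝓥.card + l := by
  have := h.sum_cladeFamily fun _ => 1
  simpa only [Finset.sum_const, smul_eq_mul, mul_one, Finset.card_univ, Fintype.card_fin] using this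

theorem IsMarkedFamily.isMaxLaminar (h : IsMarkedFamily 𝓥 m) (hcard : 𝓥.card = l) :
    IsMaxLaminar (cladeFamily 𝓥 m) := by
  -- The shape shared by both kinds of clades.
  have hshape : ∀ T ∈ cladeFamily 𝓥 m, IsBlock 𝓥 T.toLeft ∧
      (∀ k, m k ⊂ T.toLeft → Sum.inr k ∈ T) ∧ (∀ k, Sum.inr k ∈ T → m k ⊆ T.toLeft) := by
    intro T hT
    rcases mem_cladeFamily.1 hT with ⟨F, hF, rfl⟩ | ⟨i, rfl⟩
    · rw [toLeft_vertexClade]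
      exact ⟨Or.inl hF, fun k hk => inr_mem_vertexClade.2 hk,
        fun k hk => (inr_mem_vertexClade.1 hk).1⟩
    · rw [toLeft_markClade]
      exact ⟨h.mark_mem i, fun k hk => inr_mem_markClade.2 hk.1,
        fun k hk => inr_mem_markClade.1 hk⟩
  have hss : ∀ S ∈ cladeFamily 𝓥 m, ∀ T ∈ cladeFamily 𝓥 m, S.toLeft ⊂ T.toLeft → S ⊆ T := by
    intro S hS T hT hST
    rintro (j | k) hj
    · exact Finset.mem_toLeft.1 (hST.1 (Finset.mem_toLeft.2 hj))
    · exact (hshape T hT).2.1 k (((hshape S hS).2.2 k hj).trans_ssubset hST)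
  have hvm : ∀ F i, F = m i → vertexClade m F ⊆ markClade m i := by
    rintro _ i rfl
    exact Finset.disjSum_mono subset_rfl fun k hk => by
      simp only [Finset.mem_filter, Finset.mem_univ, true_and] at hk ⊢
      exact hk.1
  have hlam : Laminar (cladeFamily 𝓥 m) := by
    intro S hS T hT
    have hVlam : Laminar 𝓥 := h.nested
    rcases hVlam.isBlock (hshape S hS).1 (hshape T hT).1 with h1 | h1 | h1
    · rcases h1.eq_or_ssubset with h1 | h1
      · rcases mem_cladeFamily.1 hS with ⟨F, hF, rfl⟩ | ⟨i, rfl⟩ <;>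
          rcases mem_cladeFamily.1 hT with ⟨G, hG, rfl⟩ | ⟨k, rfl⟩ <;>
          simp only [toLeft_vertexClade, toLeft_markClade] at h1
        · exact Or.inl (by rw [h1])
        · exact Or.inl (hvm _ _ h1)
        · exact Or.inr (Or.inl (hvm _ _ h1.symm))
        · exact Or.inl (by rw [h.mark_injective h1])
      · exact Or.inl (hss S hS T hT h1)
    · rcases h1.eq_or_ssubset with h1 | h1
      · rcases mem_cladeFamily.1 hS with ⟨F, hF, rfl⟩ | ⟨i, rfl⟩ <;>
          rcases mem_cladeFamily.1 hT with ⟨G, hG, rfl⟩ | ⟨k, rfl⟩ <;>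
          simp only [toLeft_vertexClade, toLeft_markClade] at h1
        · exact Or.inl (by rw [h1])
        · exact Or.inl (hvm _ _ h1.symm)
        · exact Or.inr (Or.inl (hvm _ _ h1))
        · exact Or.inl (by rw [h.mark_injective h1])
      · exact Or.inr (Or.inl (hss T hT S hS h1))
    · refine Or.inr (Or.inr (Finset.disjoint_left.2 ?_))
      rintro (j | k) hj hj'
      · exact Finset.disjoint_left.1 h1 (Finset.mem_toLeft.2 hj) (Finset.mem_toLeft.2 hj')
      · obtain ⟨j, hj1⟩ := h.mark_nonempty k
        exact Finset.disjoint_left.1 h1 ((hshape S hS).2.2 k hj hj1) ((hshape T hT).2.2 k hj' hj1)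
  refine ⟨hlam, fun T hT => ?_, ?_, ?_⟩
  · rcases mem_cladeFamily.1 hT with ⟨F, hF, rfl⟩ | ⟨i, rfl⟩
    · refine (h.two_le F hF).trans ?_
      rw [vertexClade, Finset.card_disjSum]
      omega
    · have h1 := Finset.card_pos.2 (h.mark_nonempty i)
      have h2 : 0 < (Finset.univ.filter fun k => m k ⊆ m i).card :=
        Finset.card_pos.2 ⟨i, by simp⟩
      rw [markClade, Finset.card_disjSum]
      omega
  · refine mem_cladeFamily.2 (Or.inl ⟨_, h.univ_mem, ?_⟩)
    ext (j | k)
    · simp [vertexClade]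
    · simp only [inr_mem_vertexClade, Finset.mem_univ, iff_true]
      exact Finset.ssubset_univ_iff.2 (h.mark_ne k)
  · rw [h.card_cladeFamily, hcard]
    simp only [Fintype.card_sum, Fintype.card_fin]
    omega

/-- A marked family can be recovered from its clades. -/
theorem IsMarkedFamily.eq_of_cladeFamily_eq {𝓥' : Finset (Finset (Fin (l + 1)))}
    {m' : Fin l → Finset (Fin (l + 1))} (h : IsMarkedFamily 𝓥 m) (h' : IsMarkedFamily 𝓥' m')
    (heq : cladeFamily 𝓥 m = cladeFamily 𝓥' m') : 𝓥 = 𝓥' ∧ m = m' := by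
  have key : ∀ {𝓥 𝓥' : Finset (Finset (Fin (l + 1)))} {m m' : Fin l → Finset (Fin (l + 1))},
      IsMarkedFamily 𝓥 m → IsMarkedFamily 𝓥' m' → cladeFamily 𝓥 m = cladeFamily 𝓥' m' →
      𝓥 ⊆ 𝓥' ∧ ∀ i, m i ⊆ m' i := by
    intro 𝓥 𝓥' m m' h h' heq
    constructor
    · intro F hF
      have h1 : vertexClade m F ∈ cladeFamily 𝓥' m' :=
        heq ▸ mem_cladeFamily.2 (Or.inl ⟨F, hF, rfl⟩)
      rcases mem_cladeFamily.1 h1 with ⟨G, hG, hGF⟩ | ⟨i, hi⟩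
      · have := congrArg Finset.toLeft hGF
        rw [toLeft_vertexClade, toLeft_vertexClade] at this
        exact this ▸ hG
      · have := congrArg Finset.toLeft hi
        rw [toLeft_vertexClade, toLeft_markClade] at this
        rcases h'.mark_mem i with h2 | ⟨j, h2⟩
        · exact this ▸ h2
        · have h3 := h.two_le F hF
          rw [← this, h2, Finset.card_singleton] at h3
          omega
    · intro i
      have h1 : markClade m' i ∈ cladeFamily 𝓥 m :=
        heq ▸ mem_cladeFamily.2 (Or.inr ⟨i, rfl⟩)
      have h2 : Sum.inr i ∈ markClade m' i := inr_mem_markClade.2 subset_rfl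
      rw [← toLeft_markClade (m := m') i]
      rcases mem_cladeFamily.1 h1 with ⟨G, hG, hGF⟩ | ⟨k, hi⟩
      · rw [← hGF] at h2 ⊢
        rw [toLeft_vertexClade]
        exact (inr_mem_vertexClade.1 h2).1
      · rw [← hi] at h2 ⊢
        rw [toLeft_markClade]
        exact inr_mem_markClade.1 h2
  have h1 := key h h' heq
  have h2 := key h' h heq.symm
  exact ⟨h1.1.antisymm h2.1, funext fun i => (h1.2 i).antisymm (h2.2 i)⟩

open Classical in
/-- The lengths of the edges after they have been divided by the marked points. -/
noncomputable def cladeLen (m : Fin l → Finset (Fin (l + 1))) (len : Finset (Fin (l + 1)) → ℝ)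
    (τ : Fin l → ℝ) (T : Finset (Leaf l)) : ℝ :=
  if ∃ i, T = markClade m i then ∑ k with m k = T.toLeft, τ k
  else len T.toLeft - ∑ k with m k = T.toLeft, τ k

theorem cladeLen_vertexClade (F : Finset (Fin (l + 1))) :
    cladeLen m len τ (vertexClade m F) = len F - ∑ k with m k = F, τ k := by
  rw [cladeLen, if_neg fun ⟨i, hi⟩ => vertexClade_ne_markClade F i hi, toLeft_vertexClade]

theorem IsMarkedFamily.cladeLen_markClade (h : IsMarkedFamily 𝓥 m) (i : Fin l) :
    cladeLen m len τ (markClade m i) = τ i := by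
  rw [cladeLen, if_pos ⟨i, rfl⟩, toLeft_markClade]
  simp [h.mark_injective.eq_iff, Finset.filter_eq']

theorem IsMarkedFamily.sum_cladeLen (h : IsMarkedFamily 𝓥 m) {F : Finset (Fin (l + 1))}
    (hF : F ∈ 𝓥) : ∑ T ∈ cladeFamily 𝓥 m with T.toLeft = F, cladeLen m len τ T = len F := by
  rw [Finset.sum_filter, h.sum_cladeFamily]
  simp only [toLeft_vertexClade, toLeft_markClade, cladeLen_vertexClade, h.cladeLen_markClade]
  rw [Finset.sum_ite_eq' 𝓥 F, if_pos hF, ← Finset.sum_filter]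
  ring

theorem IsRealization.eq_sum_cladeLen (h : IsMarkedFamily 𝓥 m) (hr : IsRealization d 𝓥 m w len τ) :
    w = ∑ T ∈ cladeFamily 𝓥 m, cladeLen m len τ T • cladeVecR d T := by
  funext q
  rw [hr.eq q, h.sum_cladeFamily, Pi.add_apply, Finset.sum_apply, Finset.sum_apply]
  simp only [Pi.smul_apply, smul_eq_mul, cladeLen_vertexClade, h.cladeLen_markClade, cladeVecR,
    cladeVec, inr_mem_vertexClade, inr_mem_markClade, toLeft_vertexClade, toLeft_markClade,
    Int.cast_ite, Int.cast_zero, mul_ite, mul_zero]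
  rw [← Finset.sum_filter, ← Finset.sum_filter]
  simp only [sub_mul]
  rw [Finset.sum_sub_distrib]
  have h1 : ∑ F ∈ 𝓥 with m q.1 ⊂ F, (∑ k with m k = F, τ k) * (endSum d F q.2 : ℝ) =
      ∑ k with m q.1 ⊂ m k, τ k * (endSum d (m k) q.2 : ℝ) := by
    have : ∀ F, (∑ k with m k = F, τ k) * (endSum d F q.2 : ℝ) =
        ∑ k, if F = m k then τ k * (endSum d (m k) q.2 : ℝ) else 0 := by
      intro F
      rw [Finset.sum_mul, Finset.sum_filter]
      refine Finset.sum_congr rfl fun k _ => ?_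
      by_cases hk : m k = F
      · rw [if_pos hk, if_pos hk.symm, hk]
      · rw [if_neg hk, if_neg (Ne.symm hk)]
    simp only [this]
    rw [Finset.sum_comm]
    simp only [Finset.sum_ite_eq', Finset.mem_filter]
    rw [← Finset.sum_filter]
    refine Finset.sum_congr (Finset.filter_congr fun k _ => ?_) fun _ _ => rfl
    exact ⟨fun h => h.2, fun h' => ⟨h.mark_mem_of_ssubset h', h'⟩⟩
  have h2 : (Finset.univ.filter fun k => m q.1 ⊆ m k) =
      insert q.1 (Finset.univ.filter fun k => m q.1 ⊂ m k) := by
    ext k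
    simp only [Finset.mem_filter, Finset.mem_univ, true_and, Finset.mem_insert,
      subset_iff_ssubset_or_eq]
    rw [or_comm, h.mark_injective.eq_iff, eq_comm]
  rw [h1, h2, Finset.sum_insert (by simp)]
  ring

theorem IsGenericRealization.cladeLen_pos (h : IsMarkedFamily 𝓥 m)
    (hr : IsGenericRealization d 𝓥 m w len τ) {T : Finset (Leaf l)} (hT : T ∈ cladeFamily 𝓥 m) :
    0 < cladeLen m len τ T := by
  rcases mem_cladeFamily.1 hT with ⟨F, hF, rfl⟩ | ⟨i, rfl⟩
  · rw [cladeLen_vertexClade]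
    by_cases hi : ∃ i, m i = F
    · obtain ⟨i, rfl⟩ := hi
      have := hr.lt_len i hF
      simp only [h.mark_injective.eq_iff, Finset.filter_eq', Finset.mem_univ, if_true,
        Finset.sum_singleton]
      linarith
    · rw [Finset.filter_false_of_mem fun k _ hk => hi ⟨k, hk⟩, Finset.sum_empty, sub_zero]
      by_cases hu : F = Finset.univ
      · rw [hu]; exact hr.root_pos
      · exact hr.len_pos F hF hu
  · rw [h.cladeLen_markClade]
    exact hr.pos i

section Marking

variable {C : Finset (Finset (Leaf l))} {lam : Finset (Leaf l) → ℝ}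

/-- The vertices of the tree that is obtained from a tree with marked leaves by contracting the
edges of length zero and forgetting the marked leaves. -/
noncomputable def supportFamily (C : Finset (Finset (Leaf l))) (lam : Finset (Leaf l) → ℝ) :
    Finset (Finset (Fin (l + 1))) :=
  open Classical in {F | F = Finset.univ ∨ (2 ≤ F.card ∧ ∃ S ∈ C, 0 < lam S ∧ S.toLeft = F)}

/-- A choice of edges that can carry the marked points after edges of length zero have been
contracted. -/
structure IsMarking (C : Finset (Finset (Leaf l))) (lam : Finset (Leaf l) → ℝ)
    (m : Fin l → Finset (Fin (l + 1))) : Prop where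
  subset : ∀ S ∈ C, 0 < lam S → ∀ i, Sum.inr i ∈ S → m i ⊆ S.toLeft
  mem : ∀ S ∈ C, 0 < lam S → ∀ i, m i ⊂ S.toLeft → Sum.inr i ∈ S
  mark_mem : ∀ i, m i ∈ supportFamily C lam ∨ ∃ j, m i = {j}
  mark_ne : ∀ i, m i ≠ Finset.univ
  mark_injective : Function.Injective m

theorem mem_supportFamily {F : Finset (Fin (l + 1))} : F ∈ supportFamily C lam ↔
    F = Finset.univ ∨ (2 ≤ F.card ∧ ∃ S ∈ C, 0 < lam S ∧ S.toLeft = F) := by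
  simp [supportFamily]

theorem toLeft_nested {S T : Finset (Leaf l)} (h : S ⊆ T ∨ T ⊆ S ∨ Disjoint S T) :
    S.toLeft ⊆ T.toLeft ∨ T.toLeft ⊆ S.toLeft ∨ Disjoint S.toLeft T.toLeft := by
  rcases h with h | h | h
  · exact Or.inl (Finset.toLeft_subset_toLeft h)
  · exact Or.inr (Or.inl (Finset.toLeft_subset_toLeft h))
  · exact Or.inr (Or.inr (disjoint_toLeft h))

theorem IsMarking.isMarkedFamily (hl : 1 ≤ l) (hC : Laminar C) (hm : IsMarking C lam m) :
    IsMarkedFamily (supportFamily C lam) m where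
  nested F hF G hG := by
    rcases mem_supportFamily.1 hF with rfl | ⟨-, S, hS, -, rfl⟩
    · exact Or.inr (Or.inl (Finset.subset_univ _))
    · rcases mem_supportFamily.1 hG with rfl | ⟨-, T, hT, -, rfl⟩
      · exact Or.inl (Finset.subset_univ _)
      · exact toLeft_nested (hC S hS T hT)
  univ_mem := mem_supportFamily.2 (Or.inl rfl)
  two_le F hF := by
    rcases mem_supportFamily.1 hF with rfl | ⟨h, -⟩
    · rw [Finset.card_univ, Fintype.card_fin]; omega
    · exact h
  mark_mem := hm.mark_mem
  mark_ne := hm.mark_ne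
  mark_injective := hm.mark_injective

/-- The length of an edge after contracting edges of length zero and forgetting marked leaves. -/
noncomputable def supportLen (C : Finset (Finset (Leaf l))) (lam : Finset (Leaf l) → ℝ)
    (F : Finset (Fin (l + 1))) : ℝ := ∑ S ∈ C with S.toLeft = F, lam S

/-- The position of a marked point on its edge. -/
noncomputable def supportMark (C : Finset (Finset (Leaf l))) (lam : Finset (Leaf l) → ℝ)
    (m : Fin l → Finset (Fin (l + 1))) (i : Fin l) : ℝ :=
  ∑ S ∈ C with S.toLeft = m i ∧ Sum.inr i ∈ S, lam S

theorem IsMarking.isRealization (hl : 1 ≤ l) (hC : Laminar C) (hm : IsMarking C lam m)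
    (hlam : ∀ S ∈ C, 0 ≤ lam S) :
    IsRealization d (supportFamily C lam) m (∑ S ∈ C, lam S • cladeVecR d S)
      (supportLen C lam) (supportMark C lam m) where
  len_pos F hF hu := by
    obtain ⟨-, S, hS, hpos, hSF⟩ := (mem_supportFamily.1 hF).resolve_left hu
    exact Finset.sum_pos' (fun T hT => hlam T (Finset.mem_filter.1 hT).1)
      ⟨S, Finset.mem_filter.2 ⟨hS, hSF⟩, hpos⟩
  len_nonneg := Finset.sum_nonneg fun T hT => hlam T (Finset.mem_filter.1 hT).1
  nonneg i := Finset.sum_nonneg fun T hT => hlam T (Finset.mem_filter.1 hT).1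
  le_len i _ := Finset.sum_le_sum_of_subset_of_nonneg
    (fun S hS => by
      simp only [Finset.mem_filter] at hS ⊢
      exact ⟨hS.1, hS.2.1⟩)
    fun T hT _ => hlam T (Finset.mem_filter.1 hT).1
  eq q := by
    have hmf := hm.isMarkedFamily hl hC
    have h1 : ∑ F ∈ supportFamily C lam with m q.1 ⊂ F,
        supportLen C lam F * (endSum d F q.2 : ℝ) =
        ∑ S ∈ C, if S.toLeft ∈ supportFamily C lam ∧ m q.1 ⊂ S.toLeft then
          lam S * (endSum d S.toLeft q.2 : ℝ) else 0 := by
      have : ∀ F, supportLen C lam F * (endSum d F q.2 : ℝ) =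
          ∑ S ∈ C, if S.toLeft = F then lam S * (endSum d S.toLeft q.2 : ℝ) else 0 := by
        intro F
        rw [supportLen, Finset.sum_mul, Finset.sum_filter]
        refine Finset.sum_congr rfl fun S _ => ?_
        by_cases h : S.toLeft = F
        · rw [if_pos h, if_pos h, h]
        · rw [if_neg h, if_neg h]
      simp only [this]
      rw [Finset.sum_comm]
      refine Finset.sum_congr rfl fun S _ => ?_
      simp only [Finset.sum_ite_eq, Finset.mem_filter]
    have h2 : supportMark C lam m q.1 * (endSum d (m q.1) q.2 : ℝ) =
        ∑ S ∈ C, if S.toLeft = m q.1 ∧ Sum.inr q.1 ∈ S then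
          lam S * (endSum d S.toLeft q.2 : ℝ) else 0 := by
      rw [supportMark, Finset.sum_mul, Finset.sum_filter]
      refine Finset.sum_congr rfl fun S _ => ?_
      by_cases h : S.toLeft = m q.1 ∧ Sum.inr q.1 ∈ S
      · rw [if_pos h, if_pos h, h.1]
      · rw [if_neg h, if_neg h]
    rw [h1, h2, ← Finset.sum_add_distrib, Finset.sum_apply]
    refine Finset.sum_congr rfl fun S hS => ?_
    rw [Pi.smul_apply, smul_eq_mul, cladeVecR, cladeVec]
    rcases (hlam S hS).eq_or_lt with h0 | hpos
    · simp [← h0]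
    by_cases hi : Sum.inr q.1 ∈ S
    · rcases (hm.subset S hS hpos _ hi).eq_or_ssubset with h | h
      · simp [hi, h.symm]
      · have hmem : S.toLeft ∈ supportFamily C lam :=
          mem_supportFamily.2 (Or.inr ⟨hmf.two_le_of_ssubset h, S, hS, hpos, rfl⟩)
        simp [hi, h, hmem, h.ne']
    · have h : ¬ m q.1 ⊂ S.toLeft := fun h => hi (hm.mem S hS hpos _ h)
      simp [hi, h]

/-- If a contracted tree is still trivalent and its marked points are in the interior of its edges,
then no edge has been contracted. -/
theorem IsMarking.pos_of_isGenericRealization (hC : IsMaxLaminar C) (hm : IsMarking C lam m)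
    (hr : IsGenericRealization d (supportFamily C lam) m w
      (supportLen C lam) (supportMark C lam m)) : ∀ S ∈ C, 0 < lam S := by
  classical
  have hsum : ∀ (s : Finset (Finset (Leaf l))), s ⊆ C → 0 < ∑ S ∈ s, lam S →
      ∃ S ∈ s, 0 < lam S := by
    intro s hs h
    by_contra hc
    push Not at hc
    exact absurd (Finset.sum_nonpos hc) (not_le.2 h)
  have hmark : ∀ i, ∃ S ∈ C, 0 < lam S ∧ S.toLeft = m i ∧ Sum.inr i ∈ S := by
    intro i
    obtain ⟨S, hS, hpos⟩ := hsum _ (Finset.filter_subset _ _) (hr.pos i)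
    have := Finset.mem_filter.1 hS
    exact ⟨S, this.1, hpos, this.2⟩
  have hvert : ∀ F : supportFamily C lam, ∃ S ∈ C, 0 < lam S ∧ S.toLeft = F.1 ∧
      ∀ i, m i = F.1 → Sum.inr i ∉ S := by
    rintro ⟨F, hF⟩
    have hlen : 0 < supportLen C lam F := by
      by_cases hu : F = Finset.univ
      · rw [hu]; exact hr.root_pos
      · exact hr.len_pos F hF hu
    by_cases hi : ∃ i, m i = F
    · obtain ⟨i, rfl⟩ := hi
      have hlt := hr.lt_len i hF
      have : ∑ S ∈ C with S.toLeft = m i ∧ Sum.inr i ∉ S, lam S =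
          supportLen C lam (m i) - supportMark C lam m i := by
        rw [supportLen, supportMark, ← Finset.filter_filter, ← Finset.filter_filter,
          ← Finset.sum_filter_add_sum_filter_not (C.filter fun S => S.toLeft = m i)
            (fun S => Sum.inr i ∈ S)]
        ring
      obtain ⟨S, hS, hpos⟩ := hsum (C.filter fun S => S.toLeft = m i ∧ Sum.inr i ∉ S)
        (Finset.filter_subset _ _) (by rw [this]; linarith)
      have := Finset.mem_filter.1 hS
      exact ⟨S, this.1, hpos, this.2.1, fun k hk => hm.mark_injective hk ▸ this.2.2⟩
    · obtain ⟨S, hS, hpos⟩ := hsum _ (Finset.filter_subset _ _) hlen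
      have := Finset.mem_filter.1 hS
      exact ⟨S, this.1, hpos, this.2, fun k hk => absurd ⟨k, hk⟩ hi⟩
  choose f hfC hfpos hfl hfr using hmark
  choose g hgC hgpos hgl hgr using hvert
  let s : Finset (Finset (Leaf l)) := C.filter fun S => 0 < lam S
  have hinj : Function.Injective (Sum.elim g f) := by
    rintro (F | i) (G | k) h
    · have h : g F = g G := h
      exact congrArg _ (Subtype.ext (by rw [← hgl, h, hgl]))
    · have h : g F = f k := h
      exact absurd (h ▸ hfr k) (hgr F k (by rw [← hfl, ← h, hgl]))
    · have h : f i = g G := h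
      exact absurd (h ▸ hfr i) (hgr G i (by rw [← hfl, h, hgl]))
    · have h : f i = f k := h
      exact congrArg _ (hm.mark_injective (by rw [← hfl, h, hfl]))
  have hle : (Finset.univ.image (Sum.elim g f)).card ≤ s.card := by
    refine Finset.card_le_card fun S hS => ?_
    obtain ⟨a, -, rfl⟩ := Finset.mem_image.1 hS
    rcases a with F | i
    · exact Finset.mem_filter.2 ⟨hgC F, hgpos F⟩
    · exact Finset.mem_filter.2 ⟨hfC i, hfpos i⟩
  rw [Finset.card_image_of_injective _ hinj, Finset.card_univ, Fintype.card_sum, Fintype.card_coe,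
    hr.card_eq, Fintype.card_fin] at hle
  have hcard := hC.card_eq
  simp only [Fintype.card_sum, Fintype.card_fin] at hcard
  have hs : s = C := Finset.eq_of_subset_of_card_le (Finset.filter_subset _ _) (by omega)
  intro S hS
  rw [← hs] at hS
  exact (Finset.mem_filter.1 hS).2

/-- If no edge has been contracted, then the clades of the contracted tree are the given ones. -/
theorem IsMarking.cladeFamily_eq (hl : 1 ≤ l) (hC : IsMaxLaminar C) (hm : IsMarking C lam m)
    (hpos : ∀ S ∈ C, 0 < lam S) (hcard : (supportFamily C lam).card = l) :
    cladeFamily (supportFamily C lam) m = C := by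
  have hmf := hm.isMarkedFamily hl hC.laminar
  have hsub : C ⊆ cladeFamily (supportFamily C lam) m := by
    intro S hS
    have h1 : S.toLeft.Nonempty := by
      obtain ⟨a | k, ha⟩ := hC.nonempty (Or.inl hS)
      · exact ⟨a, Finset.mem_toLeft.2 ha⟩
      · exact (hmf.mark_nonempty k).mono (hm.subset S hS (hpos S hS) k ha)
    by_cases hi : ∃ i, m i = S.toLeft ∧ Sum.inr i ∈ S
    · obtain ⟨i, hi, hiS⟩ := hi
      refine mem_cladeFamily.2 (Or.inr ⟨i, ?_⟩)
      ext (j | k)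
      · rw [← Finset.mem_toLeft, toLeft_markClade, hi, Finset.mem_toLeft]
      · rw [inr_mem_markClade, hi]
        refine ⟨fun h => ?_, hm.subset S hS (hpos S hS) k⟩
        rcases h.eq_or_ssubset with h | h
        · rwa [hm.mark_injective (h.trans hi.symm)]
        · exact hm.mem S hS (hpos S hS) k h
    · have hmem : ∀ k, Sum.inr k ∈ S ↔ m k ⊂ S.toLeft := fun k =>
        ⟨fun h => lt_of_le_of_ne (hm.subset S hS (hpos S hS) k h) fun h' => hi ⟨k, h', h⟩,
          hm.mem S hS (hpos S hS) k⟩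
      have htwo : 2 ≤ S.toLeft.card := by
        by_contra hlt
        have h2 := Finset.card_pos.2 h1
        obtain ⟨j, hj⟩ := Finset.card_eq_one.1 (show S.toLeft.card = 1 by omega)
        have h3 := hC.two_le S hS
        have h4 : S = {Sum.inl j} := by
          ext (j' | k)
          · rw [← Finset.mem_toLeft, hj]; simp
          · rw [hmem, hj]
            refine iff_of_false (fun h => ?_) (by simp)
            have := hmf.two_le_of_ssubset h
            rw [Finset.card_singleton] at this
            omega
        rw [h4, Finset.card_singleton] at h3
        omega
      refine mem_cladeFamily.2 (Or.inl ⟨S.toLeft,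
        mem_supportFamily.2 (Or.inr ⟨htwo, S, hS, hpos S hS, rfl⟩), ?_⟩)
      ext (j | k)
      · rw [← Finset.mem_toLeft, toLeft_vertexClade, Finset.mem_toLeft]
      · rw [inr_mem_vertexClade, hmem]
  refine (Finset.eq_of_subset_of_card_le hsub ?_).symm
  rw [hmf.card_cladeFamily, hcard]
  have hcard := hC.card_eq
  simp only [Fintype.card_sum, Fintype.card_fin] at hcard
  omega

end Marking

end CladeFamilies

/-! ### Choosing the marked edges -/

section ExistsMarking

variable {l : ℕ} {d : Fin (l + 1) → ZLat} {C : Finset (Finset (Leaf l))}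
  {lam : Finset (Leaf l) → ℝ}

/-- Descending from a block with one unbounded edge more than marked points, through blocks of the
same kind, to an edge of positive length or an unbounded edge. -/
theorem exists_pos_block (hC : IsMaxLaminar C) (hm : cladeMult d C ≠ 0) {U : Finset (Leaf l)}
    (hU : IsBlock C U) (hcard : U.toLeft.card = U.toRight.card + 1) :
    ∃ W, IsBlock C W ∧ W ⊆ U ∧ W.toLeft.card = W.toRight.card + 1 ∧
      ((W ∈ C ∧ 0 < lam W) ∨ ∃ j, W = {Sum.inl j}) ∧
      ∀ S ∈ C, W ⊂ S → S ⊆ U → ¬ 0 < lam S ∧ S.toLeft.card = S.toRight.card + 1 := by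
  induction hn : U.card using Nat.strong_induction_on generalizing U with
  | _ n ih =>
    by_cases hpos : (U ∈ C ∧ 0 < lam U) ∨ ∃ j, U = {Sum.inl j}
    · exact ⟨U, hU, subset_rfl, hcard, hpos, fun S _ h1 h2 => absurd h2 h1.2⟩
    · push Not at hpos
      have hUC : U ∈ C := by
        rcases hU with h | ⟨j | i, rfl⟩
        · exact h
        · exact absurd rfl (hpos.2 j)
        · rw [card_toLeft_singleton_inr, card_toRight_singleton_inr] at hcard
          omega
      obtain ⟨P, Q, hP, hPc, hQ, -, hd, rfl⟩ := exists_split_of_card_eq_succ hC hm hUC hcard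
      have hlt : P.card < (P ∪ Q).card := by
        rw [Finset.card_union_of_disjoint hd]
        have := hC.two_le Q hQ
        omega
      obtain ⟨W, hW, hWP, hWc, hWpos, hch⟩ := ih P.card (hn ▸ hlt) hP hPc rfl
      refine ⟨W, hW, hWP.trans Finset.subset_union_left, hWc, hWpos, fun S hS hWS hSU => ?_⟩
      rcases hSU.eq_or_ssubset with rfl | hSU
      · exact ⟨not_lt.2 (hpos.1 hUC), hcard⟩
      · rcases hC.subset_or_subset hP (Or.inl hQ) (Or.inl hS) hSU with h | h
        · exact hch S hS hWS h
        · obtain ⟨x, hx⟩ := hC.nonempty hW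
          exact absurd (h (hWS.1 hx)) (Finset.disjoint_left.1 hd (hWP hx))

/-- A nonzero type has a marking, whatever edges are contracted. -/
theorem exists_isMarking (hC : IsMaxLaminar C) (hm : cladeMult d C ≠ 0) :
    ∃ m, IsMarking C lam m := by
  choose U hU hiU hR hUc hleast using exists_markClade hC hm
  choose W hW hWU hWc hWpos hch using fun i =>
    exists_pos_block (lam := lam) hC hm (hU i) (hUc i)
  have hne : ∀ i, (W i).toLeft.Nonempty := fun i => Finset.card_pos.1 (by rw [hWc i]; omega)
  refine ⟨fun i => (W i).toLeft, ⟨fun S hS _ i hi => ?_, fun S hS hpos i hi => ?_, fun i => ?_,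
    fun i h => ?_, ?_⟩⟩
  · exact Finset.toLeft_subset_toLeft
      ((hWU i).trans ((Finset.subset_insert _ _).trans (hleast i S hS hi)))
  · have hWS : W i ⊂ S := by
      rcases hC.laminar.isBlock (Or.inl hS) (hW i) with h | h | h
      · exact absurd (Finset.toLeft_subset_toLeft h) hi.2
      · exact lt_of_le_of_ne h fun h' => hi.2 (h' ▸ subset_rfl)
      · obtain ⟨x, hx⟩ := hne i
        exact absurd (hi.1 hx) (Finset.disjoint_right.1 (disjoint_toLeft h) hx)
    have hnot : ¬ S ⊆ U i := fun h => (hch i S hS hWS h).1 hpos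
    obtain ⟨x, hx, hxU⟩ := Finset.not_subset.1 hnot
    rcases hC.laminar S hS _ (hR i) with h | h | h
    · rcases Finset.mem_insert.1 (h hx) with rfl | h'
      · exact hx
      · exact absurd h' hxU
    · exact h (Finset.mem_insert_self _ _)
    · obtain ⟨y, hy⟩ := hC.nonempty (hW i)
      exact absurd (Finset.mem_insert_of_mem (hWU i hy)) (Finset.disjoint_left.1 h (hWS.1 hy))
  · rcases hWpos i with ⟨h1, h2⟩ | ⟨j, hj⟩
    · by_cases h : 2 ≤ (W i).toLeft.card
      · exact Or.inl (mem_supportFamily.2 (Or.inr ⟨h, W i, h1, h2, rfl⟩))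
      · have := Finset.card_pos.2 (hne i)
        exact Or.inr (Finset.card_eq_one.1 (by omega))
    · refine Or.inr ⟨j, ?_⟩
      rw [hj]
      ext; simp
  · have h1 : (W i).toLeft.card ≤ (U i).toLeft.card :=
      Finset.card_le_card (Finset.toLeft_subset_toLeft (hWU i))
    have h2 : (U i).toRight.card < l := by
      refine lt_of_lt_of_eq (Finset.card_lt_card (Finset.ssubset_univ_iff.2 fun h => ?_))
        (Finset.card_fin l)
      exact hiU i (Finset.mem_toRight.1 (h ▸ Finset.mem_univ i))
    have h3 : (W i).toLeft = Finset.univ := h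
    rw [h3, Finset.card_univ, Fintype.card_fin, hUc] at h1
    omega
  · -- The smallest members containing two marked points are comparable, and the smaller one would
    -- be a step of the descent in the larger one.
    have hWW : ∀ i k, (W i).toLeft = (W k).toLeft → W i = W k := by
      intro i k h
      have hc : (W i).toRight.card = (W k).toRight.card := by
        have h1 := hWc i
        have h2 := hWc k
        rw [h] at h1
        omega
      have hext : (W i).toRight = (W k).toRight → W i = W k := by
        intro h'
        ext (j | j)
        · rw [← Finset.mem_toLeft, h, Finset.mem_toLeft]
        · rw [← Finset.mem_toRight, h', Finset.mem_toRight]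
      rcases hC.laminar.isBlock (hW i) (hW k) with h1 | h1 | h1
      · exact hext (Finset.eq_of_subset_of_card_le (Finset.toRight_subset_toRight h1) hc.ge)
      · exact hext (Finset.eq_of_subset_of_card_le (Finset.toRight_subset_toRight h1) hc.le).symm
      · obtain ⟨x, hx⟩ := hne i
        exact absurd (h ▸ hx) (Finset.disjoint_left.1 (disjoint_toLeft h1) hx)
    have key : ∀ i k, W i = W k → insert (Sum.inr i) (U i) ⊆ insert (Sum.inr k) (U k) → i = k := by
      intro i k h hsub
      by_contra hik
      have hWi : W i ⊂ insert (Sum.inr i) (U i) :=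
        ⟨(hWU i).trans (Finset.subset_insert _ _), fun h' =>
          hiU i (hWU i (h' (Finset.mem_insert_self _ _)))⟩
      by_cases hk : Sum.inr k ∈ insert (Sum.inr i) (U i)
      · have heq := hsub.antisymm (hleast k _ (hR i) hk)
        have hkU : Sum.inr k ∈ U i := by
          rcases Finset.mem_insert.1 hk with h' | h'
          · exact absurd (Sum.inr.inj h').symm hik
          · exact h'
        have hiUk : Sum.inr i ∈ U k := by
          have := hsub (Finset.mem_insert_self _ _)
          rcases Finset.mem_insert.1 this with h' | h'
          · exact absurd (Sum.inr.inj h') hik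
          · exact h'
        rcases hC.laminar.isBlock (hU i) (hU k) with h1 | h1 | h1
        · exact hiU k (h1 hkU)
        · exact hiU i (h1 hiUk)
        · obtain ⟨x, hx⟩ := hC.nonempty (hW i)
          exact Finset.disjoint_left.1 h1 (hWU i hx) (hWU k (h ▸ hx))
      · have hRU : insert (Sum.inr i) (U i) ⊆ U k := by
          intro x hx
          rcases Finset.mem_insert.1 (hsub hx) with rfl | h'
          · exact absurd hx hk
          · exact h'
        have h1 := (hch k _ (hR i) (h ▸ hWi) hRU).2
        have hd : Disjoint {Sum.inr i} (U i) := Finset.disjoint_singleton_left.2 (hiU i)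
        rw [Finset.insert_eq, card_toLeft_union hd, card_toRight_union hd,
          card_toLeft_singleton_inr, card_toRight_singleton_inr, hUc] at h1
        omega
    intro i k h
    have hW' := hWW i k h
    rcases hC.laminar _ (hR i) _ (hR k) with h1 | h1 | h1
    · exact key i k hW' h1
    · exact (key k i hW'.symm h1).symm
    · obtain ⟨x, hx⟩ := hC.nonempty (hW i)
      exact absurd (Finset.mem_insert_of_mem (hWU k (hW' ▸ hx)))
        (Finset.disjoint_left.1 h1 (Finset.mem_insert_of_mem (hWU i hx)))

end ExistsMarking

/-! ### Trees from laminar families -/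

/-- A graph whose edges join the vertices other than a root to their parents is a tree, if a rank
increases towards the root. -/
theorem SimpleGraph.isTree_of_parent {V : Type*} [Finite V] (G : SimpleGraph V) (r : V)
    (par : V → V) (rank : V → ℕ) (hrank : ∀ x, x ≠ r → rank x < rank (par x))
    (hle : ∀ x, rank x ≤ rank r)
    (hadj : ∀ x y, G.Adj x y ↔ (x ≠ r ∧ par x = y) ∨ (y ≠ r ∧ par y = x)) : G.IsTree := by
  classical
  have := Fintype.ofFinite V
  have hreach : ∀ x, G.Reachable x r := by
    intro x
    induction hn : rank r - rank x using Nat.strong_induction_on generalizing x with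
    | _ n ih =>
      by_cases hx : x = r
      · rw [hx]
      · have h1 := hrank x hx
        have h2 := hle (par x)
        have h3 : G.Adj x (par x) := (hadj _ _).2 (Or.inl ⟨hx, rfl⟩)
        exact h3.reachable.trans (ih _ (by omega) _ rfl)
  have hconn : G.Connected :=
    { preconnected := fun x y => (hreach x).trans (hreach y).symm, nonempty := ⟨r⟩ }
  rw [SimpleGraph.isTree_iff_connected_and_card]
  refine ⟨hconn, ?_⟩
  let f : {x : V // x ≠ r} → G.edgeSet :=
    fun x => ⟨s(x.1, par x.1), (hadj _ _).2 (Or.inl ⟨x.2, rfl⟩)⟩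
  have hf : Function.Bijective f := by
    constructor
    · rintro ⟨x, hx⟩ ⟨y, hy⟩ h
      have h' : s(x, par x) = s(y, par y) := congrArg Subtype.val h
      rcases Sym2.eq_iff.1 h' with h1 | h1
      · exact Subtype.ext h1.1
      · have h2 := hrank x hx
        have h3 := hrank y hy
        rw [h1.2] at h2
        rw [← h1.1] at h3
        omega
    · rintro ⟨e, he⟩
      induction e with
      | _ a b =>
        rcases (hadj a b).1 he with ⟨h1, h2⟩ | ⟨h1, h2⟩
        · exact ⟨⟨a, h1⟩, Subtype.ext (by simp only [f]; rw [h2])⟩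
        · exact ⟨⟨b, h1⟩, Subtype.ext (by simp only [f]; rw [h2, Sym2.eq_swap])⟩
  rw [← Nat.card_eq_of_bijective f hf, Nat.card_eq_fintype_card, Nat.card_eq_fintype_card,
    Fintype.card_subtype_compl, Fintype.card_subtype_eq]
  have : 0 < Fintype.card V := Fintype.card_pos_iff.2 ⟨r⟩
  omega

namespace IsMarkedFamily

variable {l : ℕ} {d : Fin (l + 1) → ZLat} {𝓥 : Finset (Finset (Fin (l + 1)))}
  {m : Fin l → Finset (Fin (l + 1))}

section Combinatorics

variable (h : IsMarkedFamily 𝓥 m)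
include h

theorem exists_least_above {X : Finset (Fin (l + 1))} (hX : X.Nonempty) (hXu : X ≠ Finset.univ) :
    ∃ G : 𝓥, X ⊂ G.1 ∧ ∀ H ∈ 𝓥, X ⊂ H → G.1 ⊆ H := by
  have hne : (𝓥.filter fun G => X ⊂ G).Nonempty :=
    ⟨Finset.univ, Finset.mem_filter.2 ⟨h.univ_mem, Finset.ssubset_univ_iff.2 hXu⟩⟩
  obtain ⟨G, hG, hmin⟩ := Finset.exists_min_image _ Finset.card hne
  obtain ⟨hG1, hG2⟩ := Finset.mem_filter.1 hG
  refine ⟨⟨G, hG1⟩, hG2, fun H hH hXH => ?_⟩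
  rcases h.nested G hG1 H hH with h1 | h1 | h1
  · exact h1
  · exact (Finset.eq_of_subset_of_card_le h1 (hmin H (Finset.mem_filter.2 ⟨hH, hXH⟩))).ge
  · obtain ⟨x, hx⟩ := hX
    exact absurd (hXH.1 hx) (Finset.disjoint_left.1 h1 (hG2.1 hx))

open Classical in
/-- The smallest member strictly containing a set: the vertex towards the root of the edge that
separates this set from the root. -/
noncomputable def above (X : Finset (Fin (l + 1))) : 𝓥 :=
  if hX : X.Nonempty ∧ X ≠ Finset.univ then (h.exists_least_above hX.1 hX.2).choose
  else ⟨Finset.univ, h.univ_mem⟩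

theorem ssubset_above {X : Finset (Fin (l + 1))} (hX : X.Nonempty) (hXu : X ≠ Finset.univ) :
    X ⊂ (h.above X).1 := by
  rw [above, dif_pos ⟨hX, hXu⟩]
  exact (h.exists_least_above hX hXu).choose_spec.1

theorem above_subset {X : Finset (Fin (l + 1))} (hX : X.Nonempty) {H : Finset (Fin (l + 1))}
    (hH : H ∈ 𝓥) (hXH : X ⊂ H) : (h.above X).1 ⊆ H := by
  have hXu : X ≠ Finset.univ := by rintro rfl; exact hXH.2 (Finset.subset_univ _)
  rw [above, dif_pos ⟨hX, hXu⟩]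
  exact (h.exists_least_above hX hXu).choose_spec.2 H hH hXH

theorem above_univ : h.above Finset.univ = ⟨Finset.univ, h.univ_mem⟩ := by
  rw [above, dif_neg fun h' => h'.2 rfl]

theorem block_nonempty {B : Finset (Fin (l + 1))} (hB : IsBlock 𝓥 B) : B.Nonempty := by
  rcases hB with hB | ⟨a, rfl⟩
  · exact Finset.card_pos.1 (lt_of_lt_of_le Nat.zero_lt_two (h.two_le B hB))
  · exact Finset.singleton_nonempty a

theorem above_eq {B : Finset (Fin (l + 1))} (hB : B.Nonempty) {x : 𝓥} (hx : B ⊂ x.1)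
    (hmin : ∀ H ∈ 𝓥, B ⊂ H → x.1 ⊆ H) : h.above B = x := by
  have hBu : B ≠ Finset.univ := by rintro rfl; exact hx.2 (Finset.subset_univ _)
  exact Subtype.ext ((h.above_subset hB x.2 hx).antisymm
    (hmin _ (h.above B).2 (h.ssubset_above hB hBu)))

/-- The children of a vertex, as sets of ends. -/
noncomputable def children (x : 𝓥) : Finset (Finset (Fin (l + 1))) :=
  open Classical in {B | IsBlock 𝓥 B ∧ B ≠ Finset.univ ∧ h.above B = x}

theorem mem_children {x : 𝓥} {B : Finset (Fin (l + 1))} : B ∈ h.children x ↔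
    IsBlock 𝓥 B ∧ B ≠ Finset.univ ∧ h.above B = x := by
  simp [children]

theorem ssubset_of_mem_children {x : 𝓥} {B : Finset (Fin (l + 1))} (hB : B ∈ h.children x) :
    B ⊂ x.1 := by
  obtain ⟨h1, h2, rfl⟩ := h.mem_children.1 hB
  exact h.ssubset_above (h.block_nonempty h1) h2

theorem exists_mem_children {x : 𝓥} {j : Fin (l + 1)} (hj : j ∈ x.1) :
    ∃ B ∈ h.children x, j ∈ B := by
  classical
  have hne : (Finset.univ.filter fun B => IsBlock 𝓥 B ∧ j ∈ B ∧ B ⊂ x.1).Nonempty := by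
    refine ⟨{j}, Finset.mem_filter.2 ⟨Finset.mem_univ _, Or.inr ⟨j, rfl⟩,
      Finset.mem_singleton_self j, ?_⟩⟩
    refine lt_of_le_of_ne (Finset.singleton_subset_iff.2 hj) fun h' => ?_
    have := h.two_le x.1 x.2
    rw [← h', Finset.card_singleton] at this
    omega
  obtain ⟨B, hB, hmax⟩ := Finset.exists_max_image _ Finset.card hne
  obtain ⟨-, hB1, hB2, hB3⟩ := Finset.mem_filter.1 hB
  refine ⟨B, h.mem_children.2 ⟨hB1, ?_, ?_⟩, hB2⟩
  · rintro rfl; exact hB3.2 (Finset.subset_univ _)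
  · have hBu : B ≠ Finset.univ := by rintro rfl; exact hB3.2 (Finset.subset_univ _)
    have h1 := h.above_subset ⟨j, hB2⟩ x.2 hB3
    have h2 := h.ssubset_above ⟨j, hB2⟩ hBu
    by_contra hne
    have h3 := hmax _ (Finset.mem_filter.2 ⟨Finset.mem_univ _, Or.inl (h.above B).2, h2.1 hB2,
      lt_of_le_of_ne h1 fun h' => hne (Subtype.ext h')⟩)
    have h4 := Finset.card_lt_card h2
    omega

theorem disjoint_children {x : 𝓥} {B B' : Finset (Fin (l + 1))} (hB : B ∈ h.children x)
    (hB' : B' ∈ h.children x) (hne : B ≠ B') : Disjoint B B' := by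
  have key : ∀ {B B'}, B ∈ h.children x → B' ∈ h.children x → B ≠ B' → ¬ B ⊆ B' := by
    intro B B' hB hB' hne hsub
    obtain ⟨h1, h2, h3⟩ := h.mem_children.1 hB
    have hss := lt_of_le_of_ne hsub hne
    rcases (h.mem_children.1 hB').1 with h4 | ⟨a, rfl⟩
    · have := h.above_subset (h.block_nonempty h1) h4 hss
      rw [h3] at this
      exact (h.ssubset_of_mem_children hB').2 this
    · rcases Finset.subset_singleton_iff.1 hsub with h5 | h5
      · exact absurd h5 (Finset.nonempty_iff_ne_empty.1 (h.block_nonempty h1))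
      · exact hne h5
  have hlam : Laminar 𝓥 := h.nested
  rcases hlam.isBlock (h.mem_children.1 hB).1 (h.mem_children.1 hB').1 with h1 | h1 | h1
  · exact absurd h1 (key hB hB' hne)
  · exact absurd h1 (key hB' hB hne.symm)
  · exact h1

theorem endSum_children (x : 𝓥) : ∑ B ∈ h.children x, endSum d B = endSum d x.1 := by
  classical
  have : x.1 = (h.children x).biUnion id := by
    ext j
    simp only [Finset.mem_biUnion, id]
    constructor
    · exact fun hj => h.exists_mem_children hj
    · rintro ⟨B, hB, hj⟩
      exact (h.ssubset_of_mem_children hB).1 hj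
  conv_rhs => rw [this]
  exact (Finset.sum_biUnion (t := id) fun B hB B' hB' hne => h.disjoint_children hB hB' hne).symm

theorem sum_children {M : Type*} [AddCommMonoid M] (f : Finset (Fin (l + 1)) → M) (x : 𝓥) :
    ∑ B ∈ h.children x, f B =
      (∑ y : 𝓥, if y.1 ≠ Finset.univ ∧ h.above y.1 = x then f y.1 else 0) +
        ∑ j, if h.above {j} = x then f {j} else 0 := by
  classical
  have hsingle : ∀ j, ({j} : Finset (Fin (l + 1))) ∉ 𝓥 := by
    intro j hj
    have := h.two_le _ hj
    rw [Finset.card_singleton] at this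
    omega
  have hsu : ∀ j, ({j} : Finset (Fin (l + 1))) ≠ Finset.univ := fun j h' =>
    hsingle j (h' ▸ h.univ_mem)
  have : h.children x = (𝓥.filter fun B => B ≠ Finset.univ ∧ h.above B = x) ∪
      (Finset.univ.filter fun j => h.above {j} = x).image fun j => {j} := by
    ext B
    simp only [h.mem_children, IsBlock, Finset.mem_union, Finset.mem_filter, Finset.mem_image,
      Finset.mem_univ, true_and]
    constructor
    · rintro ⟨h1 | ⟨j, rfl⟩, h2, h3⟩
      · exact Or.inl ⟨h1, h2, h3⟩
      · exact Or.inr ⟨j, h3, rfl⟩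
    · rintro (⟨h1, h2, h3⟩ | ⟨j, h1, rfl⟩)
      · exact ⟨Or.inl h1, h2, h3⟩
      · exact ⟨Or.inr ⟨j, rfl⟩, hsu j, h1⟩
  rw [this, Finset.sum_union, Finset.sum_image, Finset.sum_filter, Finset.sum_filter]
  · congr 1
    exact (Finset.sum_coe_sort 𝓥 fun y => if y ≠ Finset.univ ∧ h.above y = x then f y else 0).symm
  · exact fun _ _ _ _ h' => Finset.singleton_injective h'
  · rw [Finset.disjoint_left]
    intro B hB hB'
    obtain ⟨j, -, rfl⟩ := Finset.mem_image.1 hB'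
    exact hsingle j (Finset.mem_filter.1 hB).1

end Combinatorics

/-- The Hasse diagram of a marked family. -/
def hasse (𝓥 : Finset (Finset (Fin (l + 1)))) : SimpleGraph 𝓥 where
  Adj x y := (x.1 ⊂ y.1 ∧ ∀ z : 𝓥, x.1 ⊂ z.1 → y.1 ⊆ z.1) ∨
    (y.1 ⊂ x.1 ∧ ∀ z : 𝓥, y.1 ⊂ z.1 → x.1 ⊆ z.1)
  symm := ⟨fun _ _ h => h.symm⟩
  loopless := ⟨fun x h => by
    rcases h with h | h <;> exact h.1.2 subset_rfl⟩

theorem hasse_adj_iff (h : IsMarkedFamily 𝓥 m) (x y : 𝓥) : (hasse 𝓥).Adj x y ↔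
    (x ≠ ⟨Finset.univ, h.univ_mem⟩ ∧ h.above x.1 = y) ∨
      (y ≠ ⟨Finset.univ, h.univ_mem⟩ ∧ h.above y.1 = x) := by
  have key : ∀ x y : 𝓥, (x.1 ⊂ y.1 ∧ ∀ z : 𝓥, x.1 ⊂ z.1 → y.1 ⊆ z.1) ↔
      (x ≠ ⟨Finset.univ, h.univ_mem⟩ ∧ h.above x.1 = y) := by
    intro x y
    have hx := h.block_nonempty (Or.inl x.2)
    constructor
    · rintro ⟨h1, h2⟩
      refine ⟨?_, h.above_eq hx h1 fun H hH => h2 ⟨H, hH⟩⟩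
      rintro rfl
      exact h1.2 (Finset.subset_univ _)
    · rintro ⟨h1, rfl⟩
      exact ⟨h.ssubset_above hx fun h' => h1 (Subtype.ext h'),
        fun z hz => h.above_subset hx z.2 hz⟩
  change (_ ∨ _) ↔ _
  rw [key, key]

/-- The set of ends separated from the root by an unbounded edge; `none` is the root edge. -/
def endKey : Option (Fin (l + 1)) → Finset (Fin (l + 1))
  | none => Finset.univ
  | some j => {j}

theorem valence_ge (h : IsMarkedFamily 𝓥 m) (x : 𝓥) :
    3 ≤ ((hasse 𝓥).neighborSet x).ncard +
      {e : Option (Fin (l + 1)) | h.above (endKey e) = x}.ncard := by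
  classical
  rw [← Nat.card_coe_set_eq, ← Nat.card_coe_set_eq, ← Nat.card_sum, Nat.card_eq_fintype_card]
  -- The edges at `x` are told apart by the sets of ends in `x` that they separate from the root.
  let key : (hasse 𝓥).neighborSet x ⊕ {e : Option (Fin (l + 1)) | h.above (endKey e) = x} →
      Finset (Fin (l + 1)) :=
    Sum.elim (fun y => y.1.1 ∩ x.1) fun e => endKey e.1 ∩ x.1
  have hpar : ∃ f, key f = x.1 := by
    by_cases hx : x = ⟨Finset.univ, h.univ_mem⟩
    · refine ⟨Sum.inr ⟨none, ?_⟩, ?_⟩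
      · change h.above Finset.univ = x
        rw [h.above_univ, hx]
      · exact Finset.univ_inter _
    · refine ⟨Sum.inl ⟨h.above x.1, (h.hasse_adj_iff _ _).2 (Or.inl ⟨hx, rfl⟩)⟩, ?_⟩
      exact Finset.inter_eq_right.2 (h.ssubset_above (h.block_nonempty (Or.inl x.2))
        fun h' => hx (Subtype.ext h')).1
  have hchild : ∀ j ∈ x.1, ∃ f, j ∈ key f ∧ key f ≠ x.1 := by
    intro j hj
    obtain ⟨B, hB, hjB⟩ := h.exists_mem_children hj
    have hBx := h.ssubset_of_mem_children hB
    obtain ⟨h1 | ⟨a, rfl⟩, h2, h3⟩ := h.mem_children.1 hB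
    · refine ⟨Sum.inl ⟨⟨B, h1⟩, (h.hasse_adj_iff _ _).2 (Or.inr ⟨fun h' => h2 (congrArg
        Subtype.val h'), h3⟩)⟩, ?_⟩
      change j ∈ B ∩ x.1 ∧ B ∩ x.1 ≠ x.1
      rw [Finset.inter_eq_left.2 hBx.1]
      exact ⟨hjB, hBx.ne⟩
    · refine ⟨Sum.inr ⟨some a, h3⟩, ?_⟩
      change j ∈ {a} ∩ x.1 ∧ {a} ∩ x.1 ≠ x.1
      rw [Finset.inter_eq_left.2 hBx.1]
      exact ⟨hjB, hBx.ne⟩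
  have hsub : ∀ f, key f ⊆ x.1 := by
    rintro (f | f)
    · exact Finset.inter_subset_right
    · exact Finset.inter_subset_right
  obtain ⟨f, hf⟩ := hpar
  obtain ⟨j, hj⟩ := h.block_nonempty (Or.inl x.2)
  obtain ⟨f', hf', hne'⟩ := hchild j hj
  obtain ⟨k, hk, hk'⟩ := Finset.exists_of_ssubset (lt_of_le_of_ne (hsub f') hne')
  obtain ⟨f'', hf'', hne''⟩ := hchild k hk
  refine Fintype.two_lt_card_iff.2 ⟨f, f', f'', ?_, ?_, ?_⟩
  · rintro rfl; exact hne' hf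
  · rintro rfl; exact hne'' hf
  · rintro rfl; exact hk' hf''

/-- The graph of a marked family: the unbounded edge `none` is the root edge. -/
noncomputable abbrev graph (h : IsMarkedFamily 𝓥 m) : TropGraph where
  V := 𝓥
  U := Option (Fin (l + 1))
  finV := inferInstance
  finU := inferInstance
  bdd := hasse 𝓥
  isTree := by
    refine SimpleGraph.isTree_of_parent (hasse 𝓥) ⟨Finset.univ, h.univ_mem⟩ (fun x => h.above x.1)
      (fun x => x.1.card) (fun x hx => ?_) (fun x => Finset.card_le_univ _) h.hasse_adj_iff
    exact Finset.card_lt_card (h.ssubset_above (h.block_nonempty (Or.inl x.2))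
      fun h' => hx (Subtype.ext h'))
  foot e := h.above (endKey e)
  valence_ge := h.valence_ge

end IsMarkedFamily

/-! ### Weights and balancing of the curve of a family -/

section Content

/-- The largest integer dividing a lattice vector. -/
def ZLat.content (z : ZLat) : ℕ := Int.gcd (z 0) (z 1)

/-- The primitive vector in the direction of a nonzero lattice vector. -/
def ZLat.prim (z : ZLat) : ZLat := fun i => z i / z.content

variable {z : ZLat}

theorem ZLat.content_pos (hz : z ≠ 0) : 0 < z.content := by
  refine Nat.pos_of_ne_zero fun h => hz ?_
  obtain ⟨h0, h1⟩ := Int.gcd_eq_zero_iff.1 h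
  funext i
  fin_cases i
  · exact h0
  · exact h1

theorem ZLat.content_smul_prim (z : ZLat) : (z.content : ℤ) • z.prim = z := by
  funext i
  rw [Pi.smul_apply, smul_eq_mul, ZLat.prim]
  refine Int.mul_ediv_cancel' ?_
  fin_cases i
  · exact Int.gcd_dvd_left _ _
  · exact Int.gcd_dvd_right _ _

theorem ZLat.isPrimitive_prim (hz : z ≠ 0) : z.prim.IsPrimitive :=
  Int.gcd_ediv_gcd_ediv_gcd (ZLat.content_pos hz)

theorem ZLat.smul_toPlane_eq (z : ZLat) (t : ℝ) :
    t • z.toPlane = (t * z.content) • z.prim.toPlane := by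
  conv_lhs => rw [← z.content_smul_prim]
  ext i
  simp only [smul_toPlane_apply, Pi.smul_apply, smul_eq_mul]
  push_cast
  ring

end Content
theorem SimpleGraph.sum_dart_fst {V M : Type*} [Fintype V] [DecidableEq V] [AddCommMonoid M]
    (G : SimpleGraph V) [DecidableRel G.Adj] (x : V) (f : V → V → M) :
    (∑ D : G.Dart, if D.fst = x then f D.fst D.snd else 0) =
      ∑ y, if G.Adj x y then f x y else 0 := by
  rw [← Finset.sum_filter, ← Finset.sum_filter]
  refine Finset.sum_bij' (fun D _ => D.snd) (fun y hy => ⟨(x, y), (Finset.mem_filter.1 hy).2⟩)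
    ?_ ?_ ?_ ?_ ?_
  · intro D hD
    obtain rfl := (Finset.mem_filter.1 hD).2
    exact Finset.mem_filter.2 ⟨Finset.mem_univ _, D.adj⟩
  · intro y hy
    exact Finset.mem_filter.2 ⟨Finset.mem_univ _, rfl⟩
  · intro D hD
    obtain rfl := (Finset.mem_filter.1 hD).2
    rfl
  · intro y hy
    rfl
  · intro D hD
    obtain rfl := (Finset.mem_filter.1 hD).2
    rfl

namespace IsMarkedFamily

variable {l : ℕ} {d : Fin (l + 1) → ZLat} {𝓥 : Finset (Finset (Fin (l + 1)))}
  {m : Fin l → Finset (Fin (l + 1))} {len : Finset (Fin (l + 1)) → ℝ} {τ : Fin l → ℝ}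
  {k : ℕ} (h : IsMarkedFamily 𝓥 m)

theorem endKey_none : endKey (l := l) none = Finset.univ := rfl

theorem endKey_some (j : Fin (l + 1)) : endKey (some j) = {j} := rfl

include h in
theorem singleton_notMem (j : Fin (l + 1)) : ({j} : Finset (Fin (l + 1))) ∉ 𝓥 := by
  intro hj
  have := h.two_le _ hj
  rw [Finset.card_singleton] at this
  omega

include h in
theorem singleton_ne_univ (j : Fin (l + 1)) : ({j} : Finset (Fin (l + 1))) ≠ Finset.univ :=
  fun h' => h.singleton_notMem j (h' ▸ h.univ_mem)

/-- The set of ends separated from the root by an edge. -/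
noncomputable def graphKey : h.graph.Edge → Finset (Fin (l + 1))
  | Sum.inl e => (h.graph.orient e).fst.1 ∩ (h.graph.orient e).snd.1
  | Sum.inr e => endKey e

theorem graphKey_edge (D : h.graph.bdd.Dart) :
    h.graphKey (Sum.inl ⟨D.edge, D.edge_mem⟩) = D.fst.1 ∩ D.snd.1 := by
  have h1 := h.graph.orient_edge ⟨D.edge, D.edge_mem⟩
  rcases Sym2.eq_iff.1 (show s((h.graph.orient ⟨D.edge, D.edge_mem⟩).fst,
    (h.graph.orient ⟨D.edge, D.edge_mem⟩).snd) = s(D.fst, D.snd) from h1) with ⟨h2, h3⟩ | ⟨h2, h3⟩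
  · rw [graphKey, h2, h3]
  · rw [graphKey, h2, h3, Finset.inter_comm]

open Classical in
/-- The edge that separates a block from the root; the whole set stands for the root edge. -/
noncomputable def edgeOf (B : Finset (Fin (l + 1))) : h.graph.Edge :=
  if hB : ∃ _ : B ∈ 𝓥, B ≠ Finset.univ then
    Sum.inl ⟨s((⟨B, hB.1⟩ : 𝓥), h.above B), (h.hasse_adj_iff _ _).2
      (Or.inl ⟨fun h' => hB.2 (congrArg Subtype.val h'), rfl⟩)⟩
  else if hj : ∃ j, B = {j} then Sum.inr (some hj.choose) else Sum.inr none

theorem edgeOf_mem {B : Finset (Fin (l + 1))} (hB : B ∈ 𝓥) (hu : B ≠ Finset.univ) :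
    h.edgeOf B = Sum.inl ⟨s((⟨B, hB⟩ : 𝓥), h.above B), (h.hasse_adj_iff _ _).2
      (Or.inl ⟨fun h' => hu (congrArg Subtype.val h'), rfl⟩)⟩ := by
  rw [edgeOf, dif_pos ⟨hB, hu⟩]

theorem edgeOf_singleton (j : Fin (l + 1)) : h.edgeOf {j} = Sum.inr (some j) := by
  have hj : ∃ k, ({j} : Finset (Fin (l + 1))) = {k} := ⟨j, rfl⟩
  rw [edgeOf, dif_neg fun h' => h.singleton_notMem j h'.1, dif_pos hj]
  congr 2
  exact (Finset.singleton_injective hj.choose_spec).symm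

theorem edgeOf_univ : h.edgeOf Finset.univ = Sum.inr none := by
  rw [edgeOf, dif_neg fun h' => h'.2 rfl]
  exact dif_neg fun ⟨j, hj⟩ => h.singleton_ne_univ j hj.symm

theorem graphKey_edgeOf {B : Finset (Fin (l + 1))} (hB : IsBlock 𝓥 B) :
    h.graphKey (h.edgeOf B) = B := by
  by_cases hu : B = Finset.univ
  · rw [hu, edgeOf_univ]; rfl
  rcases hB with hB | ⟨j, rfl⟩
  · have hadj : h.graph.bdd.Adj (⟨B, hB⟩ : 𝓥) (h.above B) := (h.hasse_adj_iff _ _).2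
      (Or.inl ⟨fun h' => hu (congrArg Subtype.val h'), rfl⟩)
    rw [h.edgeOf_mem hB hu]
    refine (h.graphKey_edge ⟨((⟨B, hB⟩ : 𝓥), h.above B), hadj⟩).trans ?_
    exact Finset.inter_eq_left.2 (h.ssubset_above (h.block_nonempty (Or.inl hB)) hu).1
  · rw [edgeOf_singleton]; rfl

include h in
theorem isBlock_mark (i : Fin l) : IsBlock 𝓥 (m i) := h.mark_mem i

theorem dart_cases (D : h.graph.bdd.Dart) :
    (D.snd.1 ⊂ D.fst.1 ∧ D.snd.1 ≠ Finset.univ ∧ h.above D.snd.1 = D.fst) ∨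
      (D.fst.1 ⊂ D.snd.1 ∧ D.fst.1 ≠ Finset.univ ∧ h.above D.fst.1 = D.snd) := by
  have aux : ∀ x y : 𝓥, x ≠ ⟨Finset.univ, h.univ_mem⟩ → h.above x.1 = y →
      x.1 ⊂ y.1 ∧ x.1 ≠ Finset.univ ∧ h.above x.1 = y := by
    rintro x y hx rfl
    have hx' : x.1 ≠ Finset.univ := fun h' => hx (Subtype.ext h')
    exact ⟨h.ssubset_above (h.block_nonempty (Or.inl x.2)) hx', hx', rfl⟩
  rcases (h.hasse_adj_iff _ _).1 D.adj with h1 | h1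
  · exact Or.inr (aux _ _ h1.1 h1.2)
  · exact Or.inl (aux _ _ h1.1 h1.2)

/-- The position of a vertex. -/
noncomputable def position (d : Fin (l + 1) → ZLat) (𝓥 : Finset (Finset (Fin (l + 1))))
    (len : Finset (Fin (l + 1)) → ℝ) (p : Plane) (F : Finset (Fin (l + 1))) : Plane :=
  p + ∑ G ∈ 𝓥 with F ⊆ G, len G • (endSum d G).toPlane

theorem filter_ssubset {B : Finset (Fin (l + 1))} (hB : B.Nonempty) (hu : B ≠ Finset.univ) :
    𝓥.filter (fun G => B ⊂ G) = 𝓥.filter (fun G => (h.above B).1 ⊆ G) :=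
  Finset.filter_congr fun _ hG => ⟨fun h' => h.above_subset hB hG h',
    fun h' => (h.ssubset_above hB hu).trans_subset h'⟩

theorem position_eq (p : Plane) {F : Finset (Fin (l + 1))} (hF : F ∈ 𝓥) (hu : F ≠ Finset.univ) :
    position d 𝓥 len p F = position d 𝓥 len p (h.above F).1 + len F • (endSum d F).toPlane := by
  have : 𝓥.filter (fun G => F ⊆ G) = insert F (𝓥.filter (fun G => F ⊂ G)) := by
    ext G
    simp only [Finset.mem_filter, Finset.mem_insert, subset_iff_ssubset_or_eq]
    constructor
    · rintro ⟨h1, h2 | h2⟩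
      · exact Or.inr ⟨h1, h2⟩
      · exact Or.inl h2.symm
    · rintro (rfl | h2)
      · exact ⟨hF, Or.inr rfl⟩
      · exact ⟨h2.1, Or.inl h2.2⟩
  rw [position, position, this, Finset.sum_insert (by simp),
    h.filter_ssubset (h.block_nonempty (Or.inl hF)) hu]
  abel

include h in
theorem position_univ (p : Plane) : position d 𝓥 len p Finset.univ =
    p + len Finset.univ • (endSum d Finset.univ).toPlane := by
  have : 𝓥.filter (fun G => Finset.univ ⊆ G) = {Finset.univ} := by
    ext G
    simp only [Finset.mem_filter, Finset.univ_subset_iff, Finset.mem_singleton]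
    exact ⟨fun h' => h'.2, fun h' => ⟨h' ▸ h.univ_mem, h'⟩⟩
  rw [position, this, Finset.sum_singleton]

/-- The weighted direction of an unbounded edge. -/
def endDir (d : Fin (l + 1) → ZLat) : Option (Fin (l + 1)) → ZLat
  | none => -endSum d Finset.univ
  | some j => d j

open Classical in
/-- The weighted direction of a flag. -/
noncomputable def flagDir (d : Fin (l + 1) → ZLat) : h.graph.Flag → ZLat
  | Sum.inl D => if D.snd.1 ⊂ D.fst.1 then endSum d D.snd.1 else -endSum d D.fst.1
  | Sum.inr e => endDir d e

theorem content_neg (z : ZLat) : (-z).content = z.content := by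
  simp [ZLat.content]

theorem content_flagDir (f : h.graph.Flag) :
    (h.flagDir d f).content = (endSum d (h.graphKey f.edge)).content := by
  rcases f with D | (_ | j)
  · change _ = (endSum d (h.graphKey (Sum.inl ⟨D.edge, D.edge_mem⟩))).content
    rw [graphKey_edge, flagDir]
    rcases h.dart_cases D with h1 | h1
    · rw [if_pos h1.1, Finset.inter_eq_right.2 h1.1.1]
    · rw [if_neg fun h2 => h1.1.2 h2.1, Finset.inter_eq_left.2 h1.1.1, content_neg]
  · exact content_neg _
  · change (d j).content = (endSum d {j}).content
    simp [endSum]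

theorem flagDir_ne_zero (hd : ∀ F : Finset (Fin (l + 1)), F.Nonempty → endSum d F ≠ 0)
    (f : h.graph.Flag) : h.flagDir d f ≠ 0 := by
  rcases f with D | (_ | j)
  · rw [flagDir]
    split_ifs
    · exact hd _ (h.block_nonempty (Or.inl D.snd.2))
    · exact neg_ne_zero.2 (hd _ (h.block_nonempty (Or.inl D.fst.2)))
  · exact neg_ne_zero.2 (hd _ Finset.univ_nonempty)
  · have := hd {j} (Finset.singleton_nonempty j)
    rwa [endSum, Finset.sum_singleton] at this

theorem graphKey_nonempty (e : h.graph.Edge) : (h.graphKey e).Nonempty := by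
  rcases e with e | (_ | j)
  · have := h.dart_cases (h.graph.orient e)
    rw [graphKey]
    rcases this with h1 | h1
    · rw [Finset.inter_eq_right.2 h1.1.1]; exact h.block_nonempty (Or.inl (h.graph.orient e).snd.2)
    · rw [Finset.inter_eq_left.2 h1.1.1]; exact h.block_nonempty (Or.inl (h.graph.orient e).fst.2)
  · exact Finset.univ_nonempty
  · exact Finset.singleton_nonempty j

theorem sum_flagDir (x : 𝓥) :
    ∑ᶠ (f : h.graph.Flag) (_ : f.vertex = x), h.flagDir d f = 0 := by
  classical
  have h1 := SimpleGraph.sum_dart_fst h.graph.bdd x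
    fun a b => if b.1 ⊂ a.1 then endSum d b.1 else -endSum d a.1
  have h2 := h.sum_children (endSum d) x
  have h3 : ∀ y : 𝓥, (if h.graph.bdd.Adj x y then
      (if y.1 ⊂ x.1 then endSum d y.1 else -endSum d x.1) else 0) =
      (if y.1 ≠ Finset.univ ∧ h.above y.1 = x then endSum d y.1 else 0) +
      if h.above x.1 = y then (if x.1 ≠ Finset.univ then -endSum d x.1 else 0) else 0 := by
    intro y
    have hadj : h.graph.bdd.Adj x y ↔ (¬ x.1 = Finset.univ ∧ (h.above x.1).1 = y.1) ∨
        (¬ y.1 = Finset.univ ∧ (h.above y.1).1 = x.1) := by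
      have := h.hasse_adj_iff x y
      simpa only [ne_eq, Subtype.ext_iff] using this
    have hss : ∀ a b : 𝓥, a.1 ≠ Finset.univ → h.above a.1 = b → a.1 ⊂ b.1 := by
      rintro a b h1 rfl
      exact h.ssubset_above (h.block_nonempty (Or.inl a.2)) h1
    simp only [ne_eq, Subtype.ext_iff]
    by_cases hxy : ¬ x.1 = Finset.univ ∧ (h.above x.1).1 = y.1
    · have hs := hss x y hxy.1 (Subtype.ext hxy.2)
      have hn : ¬ (¬ y.1 = Finset.univ ∧ (h.above y.1).1 = x.1) := fun h' =>
        hs.2 (hss y x h'.1 (Subtype.ext h'.2)).1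
      rw [if_pos (hadj.2 (Or.inl hxy)), if_neg fun h' => hs.2 h'.1, if_neg hn, if_pos hxy.2,
        if_pos hxy.1, zero_add]
    · by_cases hyx : ¬ y.1 = Finset.univ ∧ (h.above y.1).1 = x.1
      · have hs := hss y x hyx.1 (Subtype.ext hyx.2)
        rw [if_pos (hadj.2 (Or.inr hyx)), if_pos hs, if_pos hyx]
        split_ifs <;> simp_all
      · rw [if_neg fun h' => (hadj.1 h').elim hxy hyx, if_neg hyx]
        split_ifs <;> simp_all
  have h4 : (∑ e : h.graph.U, if h.graph.foot e = x then h.flagDir d (Sum.inr e) else 0) =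
      (if x.1 = Finset.univ then -endSum d x.1 else 0) +
        ∑ j, if h.above {j} = x then endSum d {j} else 0 := by
    have : (∑ e : h.graph.U, if h.graph.foot e = x then h.flagDir d (Sum.inr e) else 0) =
        ∑ e : Option (Fin (l + 1)), if h.above (endKey e) = x then endDir d e else 0 :=
      Finset.sum_congr (by ext; simp) fun _ _ => rfl
    rw [this, Fintype.sum_option]
    congr 1
    · rw [endKey_none, above_univ]
      by_cases hx : x.1 = Finset.univ
      · rw [if_pos (Subtype.ext hx.symm), if_pos hx, hx]; rfl
      · rw [if_neg fun h' => hx (congrArg Subtype.val h').symm, if_neg hx]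
    · refine Finset.sum_congr rfl fun j _ => ?_
      rw [endKey_some]
      simp [endDir, endSum]
  have h5 : (∑ D : h.graph.bdd.Dart, if D.fst = x then h.flagDir d (Sum.inl D) else 0) =
      (∑ y : 𝓥, if y.1 ≠ Finset.univ ∧ h.above y.1 = x then endSum d y.1 else 0) +
        if x.1 ≠ Finset.univ then -endSum d x.1 else 0 := by
    refine Eq.trans ?_ (h1.trans ?_)
    · rfl
    · rw [show (Finset.univ : Finset h.graph.V) = (Finset.univ : Finset 𝓥) by ext; simp]
      refine (Finset.sum_congr rfl fun y _ => h3 y).trans ?_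
      rw [Finset.sum_add_distrib, Finset.sum_ite_eq]
      simp
  rw [h.endSum_children] at h2
  have h6 : ((if x.1 ≠ Finset.univ then -endSum d x.1 else 0) +
      if x.1 = Finset.univ then -endSum d x.1 else 0) = -endSum d x.1 := by
    by_cases hx : x.1 = Finset.univ <;> simp [hx]
  have h7 : ((∑ y : 𝓥, if y.1 ≠ Finset.univ ∧ h.above y.1 = x then endSum d y.1 else 0) +
      (if x.1 ≠ Finset.univ then -endSum d x.1 else 0)) +
      ((if x.1 = Finset.univ then -endSum d x.1 else 0) +
        ∑ j, if h.above {j} = x then endSum d {j} else 0) = 0 := by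
    rw [add_comm (if x.1 = Finset.univ then -endSum d x.1 else 0), add_add_add_comm, ← h2, h6,
      add_neg_cancel]
  refine (finsum_flag_eq h.graph (h.flagDir d) x).trans ((congrArg₂ (· + ·) ?_ ?_).trans h7)
  · convert h5
  · convert h4

end IsMarkedFamily

/-! ### The curve of a realization -/

namespace IsMarkedFamily

variable {l : ℕ} {d : Fin (l + 1) → ZLat} {𝓥 : Finset (Finset (Fin (l + 1)))}
  {m : Fin l → Finset (Fin (l + 1))} {len : Finset (Fin (l + 1)) → ℝ} {τ : Fin l → ℝ}
  {k : ℕ} (h : IsMarkedFamily 𝓥 m)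

/-- The tropical curve of a marked family with given lengths of edges. The stop is at `p`, but the
root edge is extended to infinity; the edges that carry markings are given by `M`. -/
noncomputable def curve (hd : ∀ F : Finset (Fin (l + 1)), F.Nonempty → endSum d F ≠ 0)
    (hlen : ∀ F ∈ 𝓥, F ≠ Finset.univ → 0 < len F) (p : Plane)
    (M : Fin k → Finset (Fin (l + 1))) (hM : ∀ i, IsBlock 𝓥 (M i)) (hinj : Function.Injective M) :
    TropCurve k where
  Γ := h.graph
  w e := (endSum d (h.graphKey e)).content
  w_pos e := ZLat.content_pos (hd _ (h.graphKey_nonempty e))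
  pos x := position d 𝓥 len p x.1
  u f := (h.flagDir d f).prim
  u_primitive f := ZLat.isPrimitive_prim (h.flagDir_ne_zero hd f)
  bounded_edge D := by
    have hc : ∀ F : Finset (Fin (l + 1)), F.Nonempty → (0 : ℝ) < (endSum d F).content :=
      fun F hF => by exact_mod_cast ZLat.content_pos (hd F hF)
    rcases h.dart_cases D with h1 | h1
    · refine ⟨len D.snd.1 * (endSum d D.snd.1).content, mul_pos (hlen _ D.snd.2 h1.2.1)
        (hc _ (h.block_nonempty (Or.inl D.snd.2))), ?_⟩
      rw [h.position_eq p D.snd.2 h1.2.1, h1.2.2, ZLat.smul_toPlane_eq, flagDir, if_pos h1.1]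
    · refine ⟨len D.fst.1 * (endSum d D.fst.1).content, mul_pos (hlen _ D.fst.2 h1.2.1)
        (hc _ (h.block_nonempty (Or.inl D.fst.2))), ?_⟩
      rw [h.position_eq p D.fst.2 h1.2.1, h1.2.2, flagDir, if_neg fun h2 => h1.1.2 h2.1,
        ← content_neg (endSum d D.fst.1), ← ZLat.smul_toPlane_eq, neg_toPlane]
      module
  balanced x := by
    rw [← h.sum_flagDir (d := d) x]
    refine finsum_congr fun f => finsum_congr fun _ => ?_
    rw [← h.content_flagDir, ZLat.content_smul_prim]
  mark i := h.edgeOf (M i)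
  mark_injective i j hij := hinj (by
    rw [← h.graphKey_edgeOf (hM i), ← h.graphKey_edgeOf (hM j)]
    exact congrArg h.graphKey hij)

section Curve

variable (hd : ∀ F : Finset (Fin (l + 1)), F.Nonempty → endSum d F ≠ 0)
  (hlen : ∀ F ∈ 𝓥, F ≠ Finset.univ → 0 < len F) (p : Plane)
  (M : Fin k → Finset (Fin (l + 1))) (hM : ∀ i, IsBlock 𝓥 (M i)) (hinj : Function.Injective M)

theorem wu_curve (f : h.graph.Flag) : (h.curve hd hlen p M hM hinj).wu f = h.flagDir d f := by
  change ((endSum d (h.graphKey f.edge)).content : ℤ) • (h.flagDir d f).prim = _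
  rw [← h.content_flagDir, ZLat.content_smul_prim]

theorem mem_image_edgeOf {B : Finset (Fin (l + 1))} (hB : IsBlock 𝓥 B) (hu : B ≠ Finset.univ)
    {t : ℝ} (ht : 0 ≤ t) (htl : B ∈ 𝓥 → t ≤ len B) :
    position d 𝓥 len p (h.above B).1 + t • (endSum d B).toPlane ∈
      (h.curve hd hlen p M hM hinj).image (h.edgeOf B) := by
  by_cases hBV : B ∈ 𝓥
  · rw [h.edgeOf_mem hBV hu]
    set e : h.graph.bdd.edgeSet := ⟨s((⟨B, hBV⟩ : 𝓥), h.above B), (h.hasse_adj_iff _ _).2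
      (Or.inl ⟨fun h' => hu (congrArg Subtype.val h'), rfl⟩)⟩ with he
    have hpos := hlen B hBV hu
    have hmem : position d 𝓥 len p (h.above B).1 + t • (endSum d B).toPlane ∈
        segment ℝ (position d 𝓥 len p (h.above B).1) (position d 𝓥 len p B) := by
      rw [segment_eq_image']
      refine ⟨t / len B, ⟨div_nonneg ht hpos.le, (div_le_one hpos).2 (htl hBV)⟩, ?_⟩
      simp only [h.position_eq p hBV hu, add_sub_cancel_left, smul_smul]
      rw [div_mul_cancel₀ _ hpos.ne']
    change _ ∈ segment ℝ (position d 𝓥 len p (h.graph.orient e).fst.1)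
      (position d 𝓥 len p (h.graph.orient e).snd.1)
    rcases Sym2.eq_iff.1 (show s((h.graph.orient e).fst, (h.graph.orient e).snd) =
      s((⟨B, hBV⟩ : 𝓥), h.above B) from h.graph.orient_edge e) with ⟨h1, h2⟩ | ⟨h1, h2⟩
    · rw [h1, h2, segment_symm]; exact hmem
    · rw [h1, h2]; exact hmem
  · obtain ⟨j, rfl⟩ := hB.resolve_left hBV
    rw [edgeOf_singleton]
    refine ⟨t * (d j).content, mul_nonneg ht (Nat.cast_nonneg _), ?_⟩
    change _ = position d 𝓥 len p (h.above {j}).1 + (t * (d j).content) • (d j).prim.toPlane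
    rw [← ZLat.smul_toPlane_eq, endSum, Finset.sum_singleton]

theorem stop_mem_image (hroot : 0 ≤ len Finset.univ) :
    p ∈ (h.curve hd hlen p M hM hinj).image (h.edgeOf Finset.univ) := by
  rw [edgeOf_univ]
  refine ⟨len Finset.univ * (endSum d Finset.univ).content,
    mul_nonneg hroot (Nat.cast_nonneg _), ?_⟩
  change p = position d 𝓥 len p (h.above Finset.univ).1 +
    (len Finset.univ * (endSum d Finset.univ).content) • (-endSum d Finset.univ).prim.toPlane
  rw [above_univ, h.position_univ, ← content_neg, ← ZLat.smul_toPlane_eq, neg_toPlane]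
  module

theorem degree_curve (x : ZLat) : (h.curve hd hlen p M hM hinj).degree x =
    {j | d j = x}.ncard + if -endSum d Finset.univ = x then 1 else 0 := by
  classical
  have h1 : (h.curve hd hlen p M hM hinj).degree x =
      {e : Option (Fin (l + 1)) | endDir d e = x}.ncard := by
    refine congrArg Set.ncard (Set.ext fun e => ?_)
    exact iff_of_eq (congrArg (· = x) (h.wu_curve hd hlen p M hM hinj (Sum.inr e)))
  rw [h1, Set.ncard_eq_toFinset_card', Set.ncard_eq_toFinset_card', Set.toFinset_ofPred,
    Set.toFinset_ofPred, Finset.card_filter, Finset.card_filter, Fintype.sum_option, add_comm]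
  rfl

end Curve

/-- The curve with a stop of a marked family with given lengths of edges. -/
noncomputable def stopCurve (hd : ∀ F : Finset (Fin (l + 1)), F.Nonempty → endSum d F ≠ 0)
    (hlen : ∀ F ∈ 𝓥, F ≠ Finset.univ → 0 < len F) (hroot : 0 < len Finset.univ) (p : Plane) :
    StopCurve l where
  toTropCurve := h.curve hd hlen p m h.isBlock_mark h.mark_injective
  stopEdge := (none : Option (Fin (l + 1)))
  mark_ne i hi := by
    have h1 : h.edgeOf (m i) = h.edgeOf Finset.univ := by rw [edgeOf_univ]; exact hi
    have h2 := h.graphKey_edgeOf (h.isBlock_mark i)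
    rw [h1, h.graphKey_edgeOf (Or.inl h.univ_mem)] at h2
    exact h.mark_ne i h2.symm
  stopPos := p
  stop_edge := by
    refine ⟨len Finset.univ * (endSum d Finset.univ).content, mul_pos hroot
      (by exact_mod_cast ZLat.content_pos (hd _ Finset.univ_nonempty)), ?_⟩
    change p = position d 𝓥 len p (h.above Finset.univ).1 +
      (len Finset.univ * (endSum d Finset.univ).content) • (-endSum d Finset.univ).prim.toPlane
    rw [above_univ, h.position_univ, ← content_neg, ← ZLat.smul_toPlane_eq, neg_toPlane]
    module

section StopCurve

variable (hd : ∀ F : Finset (Fin (l + 1)), F.Nonempty → endSum d F ≠ 0)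
  (hlen : ∀ F ∈ 𝓥, F ≠ Finset.univ → 0 < len F) (hroot : 0 < len Finset.univ) (p : Plane)

theorem isLabelling_stopCurve : IsLabelling d (h.stopCurve hd hlen hroot p)
    (some : Fin (l + 1) → Option (Fin (l + 1))) where
  injective := Option.some_injective _
  ne_stop j := Option.some_ne_none j
  surj _ he := Option.ne_none_iff_exists.1 he
  dir j := h.wu_curve hd hlen p m h.isBlock_mark h.mark_injective (Sum.inr (some j))

theorem isModel_stopCurve : IsModel d (h.stopCurve hd hlen hroot p)
    (some : Fin (l + 1) → Option (Fin (l + 1))) (Subtype.val : 𝓥 → Finset (Fin (l + 1))) where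
  injective := Subtype.val_injective
  root := congrArg Subtype.val h.above_univ
  mem_iff j x := by
    change j ∈ x.1 ↔ (h.above {j}).1 ⊆ x.1
    constructor
    · intro hj
      refine h.above_subset (Finset.singleton_nonempty j) x.2 ⟨Finset.singleton_subset_iff.2 hj,
        fun h' => ?_⟩
      have h1 := Finset.card_le_card h'
      have h2 := h.two_le x.1 x.2
      rw [Finset.card_singleton] at h1
      omega
    · intro h'
      exact h' ((h.ssubset_above (Finset.singleton_nonempty j) (h.singleton_ne_univ j)).1
        (Finset.mem_singleton_self j))
  nested x y := h.nested x.1 x.2 y.1 y.2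
  two_le x := h.two_le x.1 x.2
  adj_iff x y := Iff.rfl
  dir D hD := (h.wu_curve hd hlen p m h.isBlock_mark h.mark_injective (Sum.inl D)).trans
    (if_pos hD)
  dir_stop := h.wu_curve hd hlen p m h.isBlock_mark h.mark_injective (Sum.inr none)

theorem edgeKey_stopCurve (i : Fin l) : edgeKey (c := h.stopCurve hd hlen hroot p)
    (some : Fin (l + 1) → Option (Fin (l + 1))) (Subtype.val : 𝓥 → Finset (Fin (l + 1)))
      ((h.stopCurve hd hlen hroot p).mark i) = m i := by
  rcases h.mark_mem i with hB | ⟨j, hj⟩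
  · have h1 := h.graphKey_edgeOf (Or.inl hB)
    change edgeKey (c := h.stopCurve hd hlen hroot p) _ _ (h.edgeOf (m i)) = _
    rw [h.edgeOf_mem hB (h.mark_ne i)] at h1 ⊢
    exact h1
  · have h1 := edgeKey_end (E := (Subtype.val : 𝓥 → Finset (Fin (l + 1))))
      (h.isLabelling_stopCurve hd hlen hroot p) j
    rw [hj, ← h1]
    change edgeKey (c := h.stopCurve hd hlen hroot p) _ _ (h.edgeOf (m i)) = _
    rw [hj, edgeOf_singleton]
    rfl

end StopCurve

/-- A marked point of a realization, in terms of the vertex towards the root. -/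
theorem realization_eq {A : Fin l → Plane} {p : Plane}
    (hr : IsRealization d 𝓥 m (fun q => A q.1 q.2 - p q.2) len τ) (i : Fin l) :
    A i = position d 𝓥 len p (h.above (m i)).1 + τ i • (endSum d (m i)).toPlane := by
  ext j
  have h1 := hr.eq (i, j)
  simp only at h1
  rw [position, ← h.filter_ssubset (h.block_nonempty (h.isBlock_mark i)) (h.mark_ne i)]
  simp only [PiLp.add_apply, smul_toPlane_apply, WithLp.ofLp_sum, Finset.sum_apply]
  linarith

theorem matches_stopCurve (hd : ∀ F : Finset (Fin (l + 1)), F.Nonempty → endSum d F ≠ 0)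
    {A : Fin l → Plane} {p : Plane}
    (hr : IsRealization d 𝓥 m (fun q => A q.1 q.2 - p q.2) len τ)
    (hroot : 0 < len Finset.univ) : (h.stopCurve hd hr.len_pos hroot p).Matches p A := by
  refine ⟨fun i => ?_, rfl⟩
  rw [h.realization_eq hr i]
  exact h.mem_image_edgeOf hd hr.len_pos p m h.isBlock_mark h.mark_injective (h.isBlock_mark i)
    (h.mark_ne i) (hr.nonneg i) (hr.le_len i)

theorem extendedDegree_apply {Δ : ZLat →₀ ℕ} (hΔ : ∀ x, Δ x = {j | d j = x}.ncard)
    (hsum : degreeSum Δ = endSum d Finset.univ) (x : ZLat) :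
    extendedDegree Δ x = {j | d j = x}.ncard + if -endSum d Finset.univ = x then 1 else 0 := by
  classical
  rw [extendedDegree, Finsupp.add_apply, hΔ, hsum, Finsupp.single_apply]

include h in
/-- In general position, every realization of a marked family is generic. -/
theorem isGenericRealization
    (hd : ∀ F : Finset (Fin (l + 1)), F.Nonempty → endSum d F ≠ 0) {Δ : ZLat →₀ ℕ}
    (hΔ : ∀ x, Δ x = {j | d j = x}.ncard) (hsum : degreeSum Δ = endSum d Finset.univ)
    {A : Fin l → Plane} {p : Plane} (hgen : IsGeneral Δ p A)
    (hr : IsRealization d 𝓥 m (fun q => A q.1 q.2 - p q.2) len τ) :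
    IsGenericRealization d 𝓥 m (fun q => A q.1 q.2 - p q.2) len τ := by
  have hM : ∀ i, IsBlock 𝓥 ((Fin.cons Finset.univ m : Fin (l + 1) → _) i) := by
    intro i
    refine Fin.cases ?_ (fun i => ?_) i
    · exact Or.inl h.univ_mem
    · exact h.isBlock_mark i
  have hinj : Function.Injective (Fin.cons Finset.univ m : Fin (l + 1) → Finset (Fin (l + 1))) :=
    Fin.cons_injective_iff.2 ⟨fun ⟨i, hi⟩ => h.mark_ne i hi, h.mark_injective⟩
  set c := h.curve hd hr.len_pos p (Fin.cons Finset.univ m) hM hinj with hc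
  obtain ⟨hval, hne, -⟩ := hgen c
    (fun x => (h.degree_curve hd hr.len_pos p _ hM hinj x).trans
      (extendedDegree_apply hΔ hsum x).symm)
    (by
      intro i
      refine Fin.cases ?_ (fun i => ?_) i
      · exact h.stop_mem_image hd hr.len_pos p _ hM hinj hr.len_nonneg
      · change A i ∈ c.image (h.edgeOf (m i))
        rw [h.realization_eq hr i]
        exact h.mem_image_edgeOf hd hr.len_pos p _ hM hinj (h.isBlock_mark i) (h.mark_ne i)
          (hr.nonneg i) (hr.le_len i))
  have hpos : ∀ (x : 𝓥) i, position d 𝓥 len p x.1 ≠ A i := fun x i => hne x i.succ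
  refine ⟨hr, ?_, ?_, fun i => ?_, fun i hi => ?_⟩
  · have h1 := c.Γ.card_add_two_of_trivalent hval
    rw [← Nat.card_eq_fintype_card, ← Nat.card_eq_fintype_card] at h1
    have h2 : Nat.card c.Γ.V = 𝓥.card := Nat.card_eq_finsetCard 𝓥
    have h3 : Nat.card c.Γ.U = l + 2 := by
      change Nat.card (Option (Fin (l + 1))) = _
      simp
    omega
  · refine lt_of_le_of_ne hr.len_nonneg fun h0 => ?_
    refine hne (⟨Finset.univ, h.univ_mem⟩ : 𝓥) 0 ?_
    change position d 𝓥 len p Finset.univ = p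
    rw [h.position_univ, ← h0, zero_smul, add_zero]
  · refine lt_of_le_of_ne (hr.nonneg i) fun h0 => hpos (h.above (m i)) i ?_
    rw [h.realization_eq hr i, ← h0, zero_smul, add_zero]
  · refine lt_of_le_of_ne (hr.le_len i hi) fun h0 => hpos ⟨m i, hi⟩ i ?_
    rw [h.realization_eq hr i, h0, h.position_eq p hi (h.mark_ne i)]

end IsMarkedFamily

/-! ### Points in general position -/

section GeneralPosition

variable {l : ℕ} {d : Fin (l + 1) → ZLat} {𝓥 : Finset (Finset (Fin (l + 1)))}
  {m : Fin l → Finset (Fin (l + 1))} {len : Finset (Fin (l + 1)) → ℝ} {τ : Fin l → ℝ}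
  {C : Finset (Finset (Leaf l))} {lam : Finset (Leaf l) → ℝ}

/-- A matching curve with a stop extends to a matching curve without stop, so it inherits the
properties of curves through points in general position. -/
theorem IsModel.general {c : StopCurve l} {σ : Fin (l + 1) → c.Γ.U}
    {E : c.Γ.V → Finset (Fin (l + 1))} (hσ : IsLabelling d c σ) (hE : IsModel d c σ E)
    {Δ : ZLat →₀ ℕ} (hΔ : ∀ x, Δ x = {j | d j = x}.ncard)
    (hsum : degreeSum Δ = endSum d Finset.univ) {A : Fin l → Plane} {p : Plane}
    (hgen : IsGeneral Δ p A) (hmatch : c.Matches p A) :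
    (∀ x, c.Γ.valence x = 3) ∧ (∀ x i, c.pos x ≠ A i) ∧ Function.Injective c.pos := by
  classical
  let c' : TropCurve (l + 1) :=
    { c.toTropCurve with
      mark := Fin.cons (Sum.inr c.stopEdge) c.mark
      mark_injective := Fin.cons_injective_iff.2
        ⟨fun ⟨i, hi⟩ => c.mark_ne i hi, c.mark_injective⟩ }
  have hdeg : ∀ x, c'.degree x = extendedDegree Δ x := by
    intro x
    rw [IsMarkedFamily.extendedDegree_apply hΔ hsum]
    have h1 : c'.degree x = {e | c.wu (Sum.inr e) = x}.ncard := rfl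
    rw [h1, Set.ncard_eq_toFinset_card', Set.ncard_eq_toFinset_card', Set.toFinset_ofPred,
      Set.toFinset_ofPred, Finset.card_filter, Finset.card_filter, hσ.sum_eq, hE.dir_stop, add_comm]
    simp only [hσ.dir]
  obtain ⟨h1, h2, h3⟩ := hgen c' hdeg (by
    intro i
    refine Fin.cases ?_ (fun i => ?_) i
    · obtain ⟨t, ht, h⟩ := c.stop_edge
      rw [hmatch.2] at h
      exact ⟨t, ht.le, h⟩
    · have himage : ∀ e, c'.image e = c.image e := by rintro (e | e) <;> rfl
      change A i ∈ c'.image (c.mark i)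
      rw [himage]
      exact hmatch.1 i)
  exact ⟨h1, fun x i => h2 x i.succ, h3⟩

theorem markClade_subset {T : Finset (Leaf l)}
    (hT : T ∈ cladeFamily 𝓥 m) {k : Fin l} (hk : Sum.inr k ∈ T) : markClade m k ⊆ T := by
  have hsub : m k ⊆ T.toLeft ∧ ∀ i, m i ⊆ m k → Sum.inr i ∈ T := by
    rcases mem_cladeFamily.1 hT with ⟨F, -, rfl⟩ | ⟨i, rfl⟩
    · rw [inr_mem_vertexClade] at hk
      rw [toLeft_vertexClade]
      exact ⟨hk.1, fun i hi => inr_mem_vertexClade.2 (hi.trans_ssubset hk)⟩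
    · rw [inr_mem_markClade] at hk
      rw [toLeft_markClade]
      exact ⟨hk, fun i' hi => inr_mem_markClade.2 (hi.trans hk)⟩
  rintro (j | i) hi
  · rw [← Finset.mem_toLeft, toLeft_markClade] at hi
    exact Finset.mem_toLeft.1 (hsub.1 hi)
  · exact hsub.2 i (inr_mem_markClade.1 hi)

/-- A type of multiplicity zero has a linear relation among its displacements. -/
theorem exists_relation_of_cladeMult_eq_zero (hC : IsMaxLaminar C) (hm : cladeMult d C = 0) :
    ∃ μ : Finset (Leaf l) → ℝ, (∃ S ∈ C, μ S ≠ 0) ∧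
      ∀ q, ∑ S ∈ C, μ S * cladeVecR d S q = 0 := by
  classical
  have e : (Fin l × Fin 2) ≃ C := Fintype.equivOfCardEq (by
    rw [Fintype.card_coe, card_of_isMaxLaminar hC])
  have hdet := index_closure_range_eq_abs_det (fun S : C => cladeVec d S.1) e
  have hrange : (Set.range fun S : C => cladeVec d S.1) = cladeVec d '' C := by
    ext x; simp
  rw [hrange] at hdet
  change ((cladeMult d C : ℕ) : ℝ) = _ at hdet
  rw [hm, Nat.cast_zero, eq_comm, abs_eq_zero] at hdet
  obtain ⟨v, hv, hv0⟩ := Matrix.exists_vecMul_eq_zero_iff.2 hdet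
  obtain ⟨k, hk⟩ : ∃ k, v k ≠ 0 := by
    by_contra hc
    push Not at hc
    exact hv (funext hc)
  refine ⟨fun S => if hS : S ∈ C then v (e.symm ⟨S, hS⟩) else 0, ⟨(e k).1, (e k).2, ?_⟩,
    fun q => ?_⟩
  · simpa using hk
  · have h1 := congrFun hv0 q
    rw [Matrix.vecMul, dotProduct] at h1
    rw [← Finset.sum_coe_sort C, ← e.sum_comp, ← Pi.zero_apply (M := fun _ => ℝ) q, ← h1]
    refine Finset.sum_congr rfl fun k _ => ?_
    simp [cladeVecR]

/-- A linear relation among displacements restricts to the part of the tree above a marked point,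
because this part moves relative to the marked point only. -/
theorem IsMarkedFamily.relation_restrict (h : IsMarkedFamily 𝓥 m) (hcard : 𝓥.card = l)
    {μ : Finset (Leaf l) → ℝ} (hμ : ∀ q, ∑ S ∈ cladeFamily 𝓥 m, μ S * cladeVecR d S q = 0)
    (k : Fin l) (q : Fin l × Fin 2) : ∑ S ∈ cladeFamily 𝓥 m,
      (if S ⊂ markClade m k then μ S else 0) * cladeVecR d S q = 0 := by
  have hlam := (h.isMaxLaminar hcard).laminar
  have hmk : ∀ i, markClade m i ∈ cladeFamily 𝓥 m := fun i => mem_cladeFamily.2 (Or.inr ⟨i, rfl⟩)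
  by_cases hi : Sum.inr q.1 ∈ markClade m k
  · have h1 : ∀ S ∈ cladeFamily 𝓥 m, (if S ⊂ markClade m k then μ S else 0) * cladeVecR d S q =
        μ S * cladeVecR d S q - μ S * cladeVecR d S (k, q.2) := by
      intro S hS
      simp only [cladeVecR, cladeVec]
      by_cases hkS : Sum.inr k ∈ S
      · have hsub := markClade_subset hS hkS
        simp [hkS, hsub hi, not_ssubset_of_subset hsub]
      · by_cases hiS : Sum.inr q.1 ∈ S
        · have hkk : Sum.inr k ∈ markClade m k := inr_mem_markClade.2 subset_rfl
          have hss : S ⊂ markClade m k := by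
            rcases hlam S hS _ (hmk k) with h2 | h2 | h2
            · exact lt_of_le_of_ne h2 fun h3 => hkS (h3 ▸ hkk)
            · exact absurd (h2 hkk) hkS
            · exact absurd hi (Finset.disjoint_left.1 h2 hiS)
          simp [hkS, hiS, hss]
        · simp [hkS, hiS]
    rw [Finset.sum_congr rfl h1, Finset.sum_sub_distrib, hμ, hμ, sub_zero]
  · refine Finset.sum_eq_zero fun S _ => ?_
    by_cases hS : S ⊂ markClade m k
    · have : Sum.inr q.1 ∉ S := fun h' => hi (hS.1 h')
      simp [cladeVecR, cladeVec, this]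
    · rw [if_neg hS, zero_mul]

/-- Contracting edges of a tree through points in general position is impossible, if the marked
points keep their edges. -/
theorem IsMarking.pos_of_isGeneral (hl : 1 ≤ l) (hC : IsMaxLaminar C)
    (hd : ∀ F : Finset (Fin (l + 1)), F.Nonempty → endSum d F ≠ 0) {Δ : ZLat →₀ ℕ}
    (hΔ : ∀ x, Δ x = {j | d j = x}.ncard) (hsum : degreeSum Δ = endSum d Finset.univ)
    {A : Fin l → Plane} {p : Plane} (hgen : IsGeneral Δ p A) (hm : IsMarking C lam m)
    (hlam : ∀ S ∈ C, 0 ≤ lam S)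
    (hw : (fun q => A q.1 q.2 - p q.2) = ∑ S ∈ C, lam S • cladeVecR d S) :
    (∀ S ∈ C, 0 < lam S) ∧ IsGenericRealization d (supportFamily C lam) m
      (fun q => A q.1 q.2 - p q.2) (supportLen C lam) (supportMark C lam m) := by
  have hmf := hm.isMarkedFamily hl hC.laminar
  have hr := hm.isRealization (d := d) hl hC.laminar hlam
  rw [← hw] at hr
  have hgr := hmf.isGenericRealization hd hΔ hsum hgen hr
  exact ⟨hm.pos_of_isGenericRealization hC hgr, hgr⟩

/-- The type of a curve through points in general position has nonzero multiplicity: otherwise the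
curve would move in a family, until an edge is contracted. -/
theorem IsGenericRealization.cladeMult_ne_zero (hl : 1 ≤ l) (h : IsMarkedFamily 𝓥 m)
    (hd : ∀ F : Finset (Fin (l + 1)), F.Nonempty → endSum d F ≠ 0) {Δ : ZLat →₀ ℕ}
    (hΔ : ∀ x, Δ x = {j | d j = x}.ncard) (hsum : degreeSum Δ = endSum d Finset.univ)
    {A : Fin l → Plane} {p : Plane} (hgen : IsGeneral Δ p A)
    (hr : IsGenericRealization d 𝓥 m (fun q => A q.1 q.2 - p q.2) len τ) :
    cladeMult d (cladeFamily 𝓥 m) ≠ 0 := by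
  classical
  intro h0
  have hC := h.isMaxLaminar hr.card_eq
  set C := cladeFamily 𝓥 m with hCdef
  -- Among all relations, take one with minimal support.
  let P : Set (Finset (Leaf l) → ℝ) :=
    {μ | (∃ S ∈ C, μ S ≠ 0) ∧ ∀ q, ∑ S ∈ C, μ S * cladeVecR d S q = 0}
  obtain ⟨μ, ⟨⟨S₁, hS₁, hμS₁⟩, hμ⟩, hmin⟩ :=
    (measure fun μ : Finset (Leaf l) → ℝ => (C.filter fun S => μ S ≠ 0).card).wf.has_min P
      (exists_relation_of_cladeMult_eq_zero hC h0)
  have hsupp : ∀ k, ∀ S ∈ C, ∀ T ∈ C, μ S ≠ 0 → μ T ≠ 0 → S ⊂ markClade m k →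
      T ⊂ markClade m k := by
    intro k S hS T hT hμS hμT hSk
    by_contra hTk
    refine hmin (fun S => if S ⊂ markClade m k then μ S else 0) ⟨⟨S, hS, by simpa [hSk] using hμS⟩,
      h.relation_restrict hr.card_eq hμ k⟩ (Finset.card_lt_card ⟨fun U hU => ?_, fun hsub => ?_⟩)
    · simp only [Finset.mem_filter, ne_eq, ite_eq_right_iff, Classical.not_imp] at hU ⊢
      exact ⟨hU.1, hU.2.2⟩
    · have := hsub (Finset.mem_filter.2 ⟨hT, hμT⟩)
      simp [hTk] at this
  -- A relation with a negative coefficient.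
  obtain ⟨ν, hνμ, S₂, hS₂, hνS₂⟩ : ∃ ν : Finset (Leaf l) → ℝ, (ν = μ ∨ ν = -μ) ∧
      ∃ S ∈ C, ν S < 0 := by
    rcases lt_or_gt_of_ne hμS₁ with h1 | h1
    · exact ⟨μ, Or.inl rfl, S₁, hS₁, h1⟩
    · exact ⟨-μ, Or.inr rfl, S₁, hS₁, neg_lt_zero.2 h1⟩
  have hν : ∀ q, ∑ S ∈ C, ν S * cladeVecR d S q = 0 := by
    rcases hνμ with rfl | rfl
    · exact hμ
    · intro q
      simp [hμ q]
  have hνz : ∀ S, μ S = 0 → ν S = 0 := by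
    rcases hνμ with rfl | rfl <;> simp
  obtain ⟨S₀, hS₀, hs₀⟩ := (C.filter fun S => ν S < 0).exists_min_image
    (fun S => cladeLen m len τ S / -ν S) ⟨S₂, Finset.mem_filter.2 ⟨hS₂, hνS₂⟩⟩
  obtain ⟨hS₀C, hS₀ν⟩ := Finset.mem_filter.1 hS₀
  set s := cladeLen m len τ S₀ / -ν S₀ with hs
  have hspos : 0 < s := div_pos (hr.cladeLen_pos h hS₀C) (neg_pos.2 hS₀ν)
  let lam : Finset (Leaf l) → ℝ := fun S => cladeLen m len τ S + s * ν S
  have hlam0 : lam S₀ = 0 := by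
    have : ν S₀ ≠ 0 := hS₀ν.ne
    simp only [lam, hs]
    field_simp
    ring
  have hlam : ∀ S ∈ C, 0 ≤ lam S := by
    intro S hS
    by_cases hneg : ν S < 0
    · have h1 := hs₀ S (Finset.mem_filter.2 ⟨hS, hneg⟩)
      rw [le_div_iff₀ (neg_pos.2 hneg)] at h1
      simp only [lam]
      linarith
    · exact add_nonneg (hr.cladeLen_pos h hS).le (mul_nonneg hspos.le (not_lt.1 hneg))
  have hw : (fun q => A q.1 q.2 - p q.2) = ∑ S ∈ C, lam S • cladeVecR d S := by
    rw [hr.toIsRealization.eq_sum_cladeLen h]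
    funext q
    simp only [lam, Finset.sum_apply, Pi.smul_apply, smul_eq_mul, add_mul, Finset.sum_add_distrib,
      mul_assoc]
    rw [← Finset.mul_sum, hν q, mul_zero, add_zero]
  have hmark : IsMarking C lam m := by
    refine ⟨fun S hS _ i hi => ?_, fun S hS _ i hi => ?_, fun i => ?_, h.mark_ne,
      h.mark_injective⟩
    · have := Finset.toLeft_subset_toLeft (markClade_subset hS hi)
      rwa [toLeft_markClade] at this
    · rcases mem_cladeFamily.1 hS with ⟨F, -, rfl⟩ | ⟨k, rfl⟩
      · rw [toLeft_vertexClade] at hi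
        exact inr_mem_vertexClade.2 hi
      · rw [toLeft_markClade] at hi
        exact inr_mem_markClade.2 hi.1
    · rcases h.mark_mem i with hi | hi
      · have hv : vertexClade m (m i) ∈ C := mem_cladeFamily.2 (Or.inl ⟨_, hi, rfl⟩)
        have hk : markClade m i ∈ C := mem_cladeFamily.2 (Or.inr ⟨_, rfl⟩)
        have hss : vertexClade m (m i) ⊂ markClade m i := by
          refine lt_of_le_of_ne ?_ (vertexClade_ne_markClade _ _)
          rintro (j | k)
          · rw [← Finset.mem_toLeft, toLeft_vertexClade, ← Finset.mem_toLeft, toLeft_markClade]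
            exact id
          · rw [inr_mem_vertexClade, inr_mem_markClade]
            exact fun h' => h'.1
        refine Or.inl (mem_supportFamily.2 (Or.inr ⟨h.two_le _ hi, ?_⟩))
        by_cases h1 : μ (vertexClade m (m i)) = 0
        · refine ⟨_, hv, ?_, toLeft_vertexClade _⟩
          simp only [lam, hνz _ h1, mul_zero, add_zero]
          exact hr.cladeLen_pos h hv
        · have h2 : μ (markClade m i) = 0 := by
            by_contra h2
            exact ssubset_irrefl _ (hsupp i _ hv _ hk h1 h2 hss)
          refine ⟨_, hk, ?_, toLeft_markClade _⟩
          simp only [lam, hνz _ h2, mul_zero, add_zero]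
          exact hr.cladeLen_pos h hk
      · exact Or.inr hi
  exact (hlam0 ▸ (hmark.pos_of_isGeneral hl hC hd hΔ hsum hgen hlam hw).1 S₀ hS₀C).false

end GeneralPosition

/-! ### The lattice map of a curve -/

section Weights

/-- The index of the range of a homomorphism `π ∘ L`, computed in a quotient by the range of
`L`. -/
theorem index_range_comp {G Y Y' T : Type*} [AddCommGroup G] [AddCommGroup Y] [AddCommGroup Y']
    [AddCommGroup T] (L : G →+ Y') (π : Y' →+ Y) (hπ : Function.Surjective π) (Θ : Y' →+ T)
    (hΘ : Function.Surjective Θ) (hker : Θ.ker = L.range) {s : Set Y'}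
    (hs : π.ker = AddSubgroup.closure s) :
    (π.comp L).range.index = (AddSubgroup.closure (Θ '' s)).index := by
  rw [← AddSubgroup.index_comap_of_surjective _ hπ, ← AddMonoidHom.map_closure, ← hs,
    ← AddSubgroup.index_comap_of_surjective (π.ker.map Θ) hΘ, AddSubgroup.comap_map_eq, hker,
    AddMonoidHom.range_comp, AddSubgroup.comap_map_eq, sup_comm]

theorem StopCurve.saturation_eq_zmultiples {u : ZLat} (hu : u.IsPrimitive) :
    StopCurve.saturation u = AddSubgroup.zmultiples u := by
  ext x
  rw [AddSubgroup.mem_zmultiples_iff]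
  constructor
  · rintro ⟨q, hq⟩
    have hbez := Int.gcd_eq_gcd_ab (u 0) (u 1)
    rw [show Int.gcd (u 0) (u 1) = 1 from hu] at hbez
    -- By Bézout, the factor is an integer.
    have hqi : q = ((x 0 * Int.gcdA (u 0) (u 1) + x 1 * Int.gcdB (u 0) (u 1) : ℤ) : ℚ) := by
      have h1 : (1 : ℚ) = u 0 * Int.gcdA (u 0) (u 1) + u 1 * Int.gcdB (u 0) (u 1) := by
        exact_mod_cast hbez
      push_cast
      rw [hq 0, hq 1]
      linear_combination q * h1
    refine ⟨x 0 * Int.gcdA (u 0) (u 1) + x 1 * Int.gcdB (u 0) (u 1), funext fun i => ?_⟩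
    have := hq i
    rw [hqi] at this
    rw [Pi.smul_apply, smul_eq_mul]
    exact_mod_cast this.symm
  · rintro ⟨k, rfl⟩
    exact ⟨k, fun i => by simp⟩

theorem StopCurve.markIndex_eq_one {l : ℕ} (c : StopCurve l) (i : Fin l) : c.markIndex i = 1 := by
  rw [StopCurve.markIndex, StopCurve.saturation_eq_zmultiples (c.u_primitive _)]
  exact AddSubgroup.relIndex_self _

variable {l : ℕ} {d : Fin (l + 1) → ZLat} {c : StopCurve l} {σ : Fin (l + 1) → c.Γ.U}
  {E : c.Γ.V → Finset (Fin (l + 1))}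

namespace StopCurve

/-- Lattice vectors for all bounded edges and all edges `E_0, …, E_l`. -/
abbrev EdgeData (c : StopCurve l) : Type :=
  (c.Γ.bdd.edgeSet → ZLat) × (Fin (l + 1) → ZLat)

/-- The lift of `latticeMap` before passing to quotients. -/
noncomputable def latticeLift (c : StopCurve l) : (c.Γ.V → ZLat) →+ c.EdgeData where
  toFun h := (fun e => h (c.Γ.orient e).snd - h (c.Γ.orient e).fst,
    fun i => h (c.Γ.minusFlag (c.allMark i)).vertex)
  map_zero' := by ext <;> simp
  map_add' h h' := by
    refine Prod.ext (funext fun e => ?_) (funext fun i => ?_)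
    · simp only [Pi.add_apply, Prod.fst_add]
      abel
    · rfl

/-- The quotient map onto the target of `latticeMap`. -/
noncomputable def latticeQuot (c : StopCurve l) : c.EdgeData →+
    ((e : c.Γ.bdd.edgeSet) → ZLat ⧸ AddSubgroup.zmultiples (c.u (Sum.inl (c.Γ.orient e)))) ×
      ((i : Fin (l + 1)) → ZLat ⧸ saturation (c.u (c.Γ.minusFlag (c.allMark i)))) where
  toFun x := (fun e => QuotientAddGroup.mk (x.1 e), fun i => QuotientAddGroup.mk (x.2 i))
  map_zero' := rfl
  map_add' _ _ := rfl

theorem latticeMap_eq (c : StopCurve l) : c.latticeMap = c.latticeQuot.comp c.latticeLift := rfl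

theorem latticeQuot_surjective (c : StopCurve l) : Function.Surjective c.latticeQuot := by
  rintro ⟨x, y⟩
  choose x' hx using fun e => QuotientAddGroup.mk_surjective (x e)
  choose y' hy using fun i => QuotientAddGroup.mk_surjective (y i)
  exact ⟨(x', y'), Prod.ext (funext hx) (funext hy)⟩

open Classical in
/-- Generators of the kernel of `latticeQuot`. -/
noncomputable def kerGen (c : StopCurve l) : c.Γ.bdd.edgeSet ⊕ Fin (l + 1) → c.EdgeData
  | Sum.inl e => (Pi.single e (c.u (Sum.inl (c.Γ.orient e))), 0)
  | Sum.inr i => (0, Pi.single i (c.u (c.Γ.minusFlag (c.allMark i))))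

theorem ker_latticeQuot (c : StopCurve l) :
    c.latticeQuot.ker = AddSubgroup.closure (Set.range c.kerGen) := by
  classical
  refine le_antisymm ?_ ?_
  · rintro ⟨x, y⟩ h
    have h1 : c.latticeQuot (x, y) = 0 := h
    have hx : ∀ e, x e ∈ AddSubgroup.zmultiples (c.u (Sum.inl (c.Γ.orient e))) := fun e =>
      (QuotientAddGroup.eq_zero_iff _).1 (congrFun (congrArg Prod.fst h1) e)
    have hy : ∀ i, y i ∈ AddSubgroup.zmultiples (c.u (c.Γ.minusFlag (c.allMark i))) := fun i => by
      rw [← saturation_eq_zmultiples (c.u_primitive _)]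
      exact (QuotientAddGroup.eq_zero_iff _).1 (congrFun (congrArg Prod.snd h1) i)
    simp only [AddSubgroup.mem_zmultiples_iff] at hx hy
    choose s hs using hx
    choose t ht using hy
    have : (x, y) = ∑ e, s e • c.kerGen (Sum.inl e) + ∑ i, t i • c.kerGen (Sum.inr i) := by
      refine Prod.ext ?_ ?_
      · simp only [kerGen, Prod.fst_add, Prod.fst_sum, Prod.smul_fst, smul_zero,
          Finset.sum_const_zero, add_zero]
        funext e
        rw [Finset.sum_apply, Finset.sum_eq_single e]
        · simp [hs]
        · intro e' _ hne
          simp [hne.symm]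
        · intro h; exact absurd (Finset.mem_univ _) h
      · simp only [kerGen, Prod.snd_add, Prod.snd_sum, Prod.smul_snd, smul_zero,
          Finset.sum_const_zero, zero_add]
        funext i
        rw [Finset.sum_apply, Finset.sum_eq_single i]
        · simp [ht]
        · intro e' _ hne
          simp [hne.symm]
        · intro h; exact absurd (Finset.mem_univ _) h
    rw [this]
    have hgen : ∀ a, c.kerGen a ∈ AddSubgroup.closure (Set.range c.kerGen) := fun a =>
      AddSubgroup.subset_closure ⟨a, rfl⟩
    exact add_mem (sum_mem fun e _ => zsmul_mem (hgen _) _)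
      (sum_mem fun e _ => zsmul_mem (hgen _) _)
  · rw [AddSubgroup.closure_le]
    rintro _ ⟨e | i, rfl⟩
    · refine Prod.ext (funext fun e' => ?_) rfl
      refine (QuotientAddGroup.eq_zero_iff _).2 ?_
      by_cases h : e' = e
      · subst h
        simp [kerGen]
      · simp [kerGen, h]
    · refine Prod.ext rfl (funext fun i' => ?_)
      refine (QuotientAddGroup.eq_zero_iff _).2 ?_
      rw [saturation_eq_zmultiples (c.u_primitive _)]
      by_cases h : i' = i
      · subst h
        simp [kerGen]
      · simp [kerGen, h]

end StopCurve

open Classical in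
/-- The sign that compares the chosen orientation of a bounded edge with the one away from the
stop. -/
noncomputable def edgeSign (E : c.Γ.V → Finset (Fin (l + 1))) (e : c.Γ.bdd.edgeSet) : ℤ :=
  if E (c.Γ.orient e).snd ⊂ E (c.Γ.orient e).fst then 1 else -1

open Classical in
/-- The function on the vertices with given value at the vertex next to the stop and given
differences along the bounded edges. -/
noncomputable def potential (σ : Fin (l + 1) → c.Γ.U) (E : c.Γ.V → Finset (Fin (l + 1)))
    (x : c.EdgeData) (z : c.Γ.V) : ZLat :=
  x.2 0 + ∑ e, if E z ⊆ edgeKey σ E (Sum.inl e) then edgeSign E e • x.1 e else 0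

open Classical in
/-- The displacements of the marked points relative to their edges. -/
noncomputable def markDefect (σ : Fin (l + 1) → c.Γ.U) (E : c.Γ.V → Finset (Fin (l + 1))) :
    c.EdgeData →+ (Fin l × Fin 2 → ℤ) :=
  AddMonoidHom.mk' (fun x q =>
      x.2 q.1.succ q.2 - potential σ E x (c.Γ.minusFlag (c.mark q.1)).vertex q.2) (by
    intro x y
    funext q
    simp only [potential, Prod.snd_add, Prod.fst_add, Pi.add_apply, smul_add, Finset.sum_apply]
    have : ∀ e : c.Γ.bdd.edgeSet,
        (if E (c.Γ.minusFlag (c.mark q.1)).vertex ⊆ edgeKey σ E (Sum.inl e) then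
          edgeSign E e • x.1 e + edgeSign E e • y.1 e else 0) q.2 =
        (if E (c.Γ.minusFlag (c.mark q.1)).vertex ⊆ edgeKey σ E (Sum.inl e) then
          edgeSign E e • x.1 e else 0) q.2 +
        (if E (c.Γ.minusFlag (c.mark q.1)).vertex ⊆ edgeKey σ E (Sum.inl e) then
          edgeSign E e • y.1 e else 0) q.2 := by
      intro e
      split_ifs
      · rfl
      · simp
    rw [Finset.sum_congr rfl fun e _ => this e, Finset.sum_add_distrib]
    ring)

namespace IsModel

variable (hσ : IsLabelling d c σ) (hE : IsModel d c σ E)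
include hσ hE

theorem potential_root (x : c.EdgeData) : potential σ E x (c.Γ.foot c.stopEdge) = x.2 0 := by
  classical
  rw [potential, Finset.sum_eq_zero, add_zero]
  intro e _
  obtain ⟨D, -, hD, hk, -⟩ := hE.exists_dart e
  rw [if_neg]
  rw [hk, hE.root]
  exact fun h => hD.2 ((Finset.subset_univ _).trans h)

theorem potential_edge (x : c.EdgeData) (e : c.Γ.bdd.edgeSet) :
    potential σ E x (c.Γ.orient e).snd - potential σ E x (c.Γ.orient e).fst = x.1 e := by
  classical
  obtain ⟨D, hDe, hD, hk, hor⟩ := hE.exists_dart e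
  have hdiff : potential σ E x D.snd = potential σ E x D.fst + edgeSign E e • x.1 e := by
    have : ∀ e' : c.Γ.bdd.edgeSet,
        (if E D.snd ⊆ edgeKey σ E (Sum.inl e') then edgeSign E e' • x.1 e' else 0) =
        (if E D.fst ⊆ edgeKey σ E (Sum.inl e') then edgeSign E e' • x.1 e' else 0) +
          if e = e' then edgeSign E e' • x.1 e' else 0 := by
      intro e'
      by_cases hee : e = e'
      · subst hee
        rw [hk, if_pos subset_rfl, if_neg hD.2, if_pos rfl, zero_add]
      · obtain ⟨D', -, -, hk', -⟩ := hE.exists_dart e'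
        have hne : E D.snd ≠ edgeKey σ E (Sum.inl e') := fun h => hee (by
          have := hE.edgeKey_injective hσ (hk.trans h)
          exact Sum.inl.inj this)
        have hiff : E D.snd ⊆ edgeKey σ E (Sum.inl e') ↔ E D.fst ⊆ edgeKey σ E (Sum.inl e') := by
          rw [hk'] at hne ⊢
          rw [← hE.cover_fst hD]
          exact ⟨fun h => lt_of_le_of_ne h hne, fun h => h.1⟩
        rw [if_neg hee, add_zero]
        exact if_congr hiff rfl rfl
    rw [potential, potential, Finset.sum_congr rfl fun e' _ => this e', Finset.sum_add_distrib,
      Finset.sum_ite_eq, if_pos (Finset.mem_univ _)]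
    abel
  rcases hor with rfl | rfl
  · rw [hdiff, edgeSign, if_pos hD]
    simp
  · have h1 : potential σ E x (c.Γ.orient e).fst =
        potential σ E x (c.Γ.orient e).snd + edgeSign E e • x.1 e := hdiff
    rw [h1, edgeSign, if_neg fun h => hD.2 h.1]
    simp

theorem ker_markDefect : (markDefect σ E).ker = c.latticeLift.range := by
  classical
  ext x
  constructor
  · intro hx
    refine ⟨potential σ E x, Prod.ext (funext fun e => ?_) (funext fun i => ?_)⟩
    · exact hE.potential_edge hσ x e
    · refine Fin.cases ?_ (fun i => ?_) i
      · exact hE.potential_root hσ x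
      · funext j
        have h1 := congrFun (show markDefect σ E x = 0 from hx) (i, j)
        exact (sub_eq_zero.1 h1).symm
  · rintro ⟨h, rfl⟩
    -- The potential of the differences of a function is the function.
    have hpot : ∀ z, potential σ E (c.latticeLift h) z = h z := by
      have hstep : ∀ x y, c.Γ.bdd.Adj x y → potential σ E (c.latticeLift h) x = h x →
          potential σ E (c.latticeLift h) y = h y := by
        intro x y hxy hx
        have h1 := hE.potential_edge hσ (c.latticeLift h) ⟨s(x, y), hxy⟩
        change _ = h (c.Γ.orient ⟨s(x, y), hxy⟩).snd - h (c.Γ.orient ⟨s(x, y), hxy⟩).fst at h1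
        rcases Sym2.eq_iff.1 (show s((c.Γ.orient ⟨s(x, y), hxy⟩).fst,
          (c.Γ.orient ⟨s(x, y), hxy⟩).snd) = s(x, y) from c.Γ.orient_edge _) with
          ⟨h2, h3⟩ | ⟨h2, h3⟩
        · rw [h2, h3, hx] at h1
          exact sub_left_injective h1
        · rw [h2, h3, hx] at h1
          exact sub_right_injective h1
      intro z
      have hroot := hE.potential_root hσ (c.latticeLift h)
      change _ = h (c.Γ.foot c.stopEdge) at hroot
      obtain ⟨w⟩ := c.Γ.isTree.connected.preconnected (c.Γ.foot c.stopEdge) z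
      generalize c.Γ.foot c.stopEdge = r at w hroot
      induction w with
      | nil => exact hroot
      | cons hadj _ ih => exact ih (hstep _ _ hadj hroot)
    change markDefect σ E (c.latticeLift h) = 0
    funext q
    change h (c.Γ.minusFlag (c.mark q.1)).vertex q.2 -
      potential σ E (c.latticeLift h) (c.Γ.minusFlag (c.mark q.1)).vertex q.2 = 0
    rw [hpot, sub_self]

theorem markDefect_surjective : Function.Surjective (markDefect σ E) := by
  intro y
  refine ⟨(0, Fin.cons 0 fun i j => y (i, j)), funext fun q => ?_⟩
  change y (q.1, q.2) - potential σ E _ _ q.2 = _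
  simp [potential]

/-- The index of a curve is the index of a lattice spanned by displacements of marked points. -/
theorem latticeIndex_eq : c.latticeIndex =
    (AddSubgroup.closure (Set.range (markDefect σ E ∘ c.kerGen))).index := by
  rw [StopCurve.latticeIndex, StopCurve.latticeMap_eq, Set.range_comp]
  exact index_range_comp _ _ c.latticeQuot_surjective _ (hE.markDefect_surjective hσ)
    (hE.ker_markDefect hσ) c.ker_latticeQuot

end IsModel

end Weights

/-! ### The weight of a curve -/

section Weights

variable {l : ℕ} {d : Fin (l + 1) → ZLat} {c : StopCurve l} {σ : Fin (l + 1) → c.Γ.U}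
  {E : c.Γ.V → Finset (Fin (l + 1))}

namespace StopCurve

/-- The weight of the edge of a generator. -/
noncomputable def genWeight (c : StopCurve l) : c.Γ.bdd.edgeSet ⊕ Fin (l + 1) → ℕ
  | Sum.inl e => c.w (Sum.inl e)
  | Sum.inr i => c.w (c.allMark i)

theorem prod_genWeight (c : StopCurve l) : ∏ a, c.genWeight a = c.totalWeight := by
  rw [Fintype.prod_sum_type, Fin.prod_univ_succ, totalWeight, finprod_eq_prod_of_fintype, mul_assoc]
  rfl

end StopCurve

/-- The displacement of the `i`-th marked point only, along its edge. -/
def slotVec (d : Fin (l + 1) → ZLat) (m : Fin l → Finset (Fin (l + 1))) (i : Fin l)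
    (q : Fin l × Fin 2) : ℤ :=
  if q.1 = i then endSum d (m i) q.2 else 0

theorem cladeVec_markClade {𝓥 : Finset (Finset (Fin (l + 1)))} {m : Fin l → Finset (Fin (l + 1))}
    (h : IsMarkedFamily 𝓥 m) (i : Fin l) :
    cladeVec d (markClade m i) = cladeVec d (vertexClade m (m i)) + slotVec d m i := by
  funext q
  simp only [cladeVec, slotVec, Pi.add_apply, inr_mem_markClade, inr_mem_vertexClade,
    toLeft_markClade, toLeft_vertexClade]
  by_cases hq : q.1 = i
  · simp [hq]
  · have hne : m q.1 ≠ m i := fun h' => hq (h.mark_injective h')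
    have : m q.1 ⊆ m i ↔ m q.1 ⊂ m i := ⟨fun h' => lt_of_le_of_ne h' hne, fun h' => h'.1⟩
    simp [hq, this]

theorem cladeVec_vertexClade_singleton {𝓥 : Finset (Finset (Fin (l + 1)))}
    {m : Fin l → Finset (Fin (l + 1))} (h : IsMarkedFamily 𝓥 m) (j : Fin (l + 1)) :
    cladeVec d (vertexClade m {j}) = 0 := by
  funext q
  have : ¬ m q.1 ⊂ {j} := fun h' => by
    have := h.two_le_of_ssubset h'
    rw [Finset.card_singleton] at this
    omega
  simp [cladeVec, inr_mem_vertexClade, this]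

namespace IsModel

variable (hσ : IsLabelling d c σ) (hE : IsModel d c σ E)
include hσ hE

theorem markVertex_subset_iff (i : Fin l) (z : c.Γ.V) :
    E (c.Γ.minusFlag (c.mark i)).vertex ⊆ E z ↔ edgeKey σ E (c.mark i) ⊂ E z ∨
      (edgeKey σ E (c.mark i) = E z ∧
        E (c.Γ.minusFlag (c.mark i)).vertex = edgeKey σ E (c.mark i)) := by
  rcases h : c.mark i with e | e
  · obtain ⟨D, -, hD, hk, hor⟩ := hE.exists_dart e
    rw [hk]
    rcases hor with rfl | rfl
    · change E (c.Γ.orient e).fst ⊆ E z ↔ _ ∨ (_ ∧ E (c.Γ.orient e).fst = _)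
      rw [← hE.cover_fst hD]
      exact ⟨Or.inl, fun h => h.resolve_right fun h' => hD.ne h'.2.symm⟩
    · change E (c.Γ.orient e).symm.snd ⊆ E z ↔ _
      rw [subset_iff_ssubset_or_eq]
      exact ⟨fun h => h.imp_right fun h' => ⟨h', rfl⟩, fun h => h.imp_right fun h' => h'.1⟩
  · obtain ⟨j, rfl⟩ := hσ.surj e fun he => c.mark_ne i (he ▸ h)
    rw [edgeKey_end hσ]
    change E (c.Γ.foot (σ j)) ⊆ E z ↔ _
    have h2 := hE.two_le z
    have hne : ({j} : Finset (Fin (l + 1))) ≠ E z := fun h' => by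
      rw [← h', Finset.card_singleton] at h2
      omega
    rw [← hE.mem_iff, ← Finset.singleton_subset_iff]
    exact ⟨fun h => Or.inl (lt_of_le_of_ne h hne), fun h => (h.resolve_right fun h' => hne h'.1).1⟩

/-- The weighted direction of a bounded edge, oriented as chosen. -/
theorem weight_smul_edgeSign (e : c.Γ.bdd.edgeSet) :
    (c.w (Sum.inl e) : ℤ) • c.u (Sum.inl (c.Γ.orient e)) =
      edgeSign E e • endSum d (edgeKey σ E (Sum.inl e)) := by
  obtain ⟨D, hDe, hD, hk, hor⟩ := hE.exists_dart e
  have hedge : TropGraph.Flag.edge (Γ := c.Γ) (Sum.inl (c.Γ.orient e)) = Sum.inl e :=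
    congrArg Sum.inl (Subtype.ext (c.Γ.orient_edge e))
  have hwu : (c.w (Sum.inl e) : ℤ) • c.u (Sum.inl (c.Γ.orient e)) =
      c.wu (Sum.inl (c.Γ.orient e)) := by rw [TropCurve.wu, hedge]
  rw [hwu, hk]
  rcases hor with rfl | rfl
  · rw [edgeSign, if_pos hD, one_smul, hE.dir _ hD]
  · have h1 := hE.dir _ hD
    rw [c.wu_symm] at h1
    rw [edgeSign, if_neg fun h => hD.2 h.1, neg_one_smul, ← h1, neg_neg]

theorem edgeSign_mul_self (e : c.Γ.bdd.edgeSet) : edgeSign E e * edgeSign E e = 1 := by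
  rw [edgeSign]
  split_ifs <;> rfl

open Classical in
theorem genWeight_smul_inl (e : c.Γ.bdd.edgeSet) :
    (c.genWeight (Sum.inl e) : ℤ) • markDefect σ E (c.kerGen (Sum.inl e)) =
      -(cladeVec d (vertexClade (fun i => edgeKey σ E (c.mark i)) (edgeKey σ E (Sum.inl e))) +
        ∑ i, if edgeKey σ E (c.mark i) = edgeKey σ E (Sum.inl e) ∧
          E (c.Γ.minusFlag (c.mark i)).vertex = edgeKey σ E (c.mark i) then
          slotVec d (fun i => edgeKey σ E (c.mark i)) i else 0) := by
  obtain ⟨D, -, hD, hk, -⟩ := hE.exists_dart e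
  funext q
  have h1 := hE.markVertex_subset_iff hσ q.1 D.snd
  rw [← hk] at h1
  have hpot : potential σ E (c.kerGen (Sum.inl e)) (c.Γ.minusFlag (c.mark q.1)).vertex =
      if E (c.Γ.minusFlag (c.mark q.1)).vertex ⊆ edgeKey σ E (Sum.inl e) then
        edgeSign E e • c.u (Sum.inl (c.Γ.orient e)) else 0 := by
    rw [potential, Finset.sum_eq_single e]
    · simp [StopCurve.kerGen]
    · intro e' _ hne
      simp [StopCurve.kerGen, hne]
    · intro h; exact absurd (Finset.mem_univ _) h
  have hw : (c.w (Sum.inl e) : ℤ) * (edgeSign E e * c.u (Sum.inl (c.Γ.orient e)) q.2) =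
      endSum d (edgeKey σ E (Sum.inl e)) q.2 := by
    have h2 := congrFun (hE.weight_smul_edgeSign hσ e) q.2
    simp only [Pi.smul_apply, smul_eq_mul] at h2
    have h3 := hE.edgeSign_mul_self hσ e
    linear_combination edgeSign E e * h2 + endSum d (edgeKey σ E (Sum.inl e)) q.2 * h3
  have hslot : (∑ i, if edgeKey σ E (c.mark i) = edgeKey σ E (Sum.inl e) ∧
          E (c.Γ.minusFlag (c.mark i)).vertex = edgeKey σ E (c.mark i) then
          slotVec d (fun i => edgeKey σ E (c.mark i)) i else 0) q =
      if edgeKey σ E (c.mark q.1) = edgeKey σ E (Sum.inl e) ∧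
          E (c.Γ.minusFlag (c.mark q.1)).vertex = edgeKey σ E (c.mark q.1) then
          endSum d (edgeKey σ E (Sum.inl e)) q.2 else 0 := by
    rw [Finset.sum_apply, Finset.sum_eq_single q.1]
    · split_ifs with h
      · simp [slotVec, h.1]
      · rfl
    · intro i _ hne
      split_ifs
      · simp [slotVec, hne.symm]
      · rfl
    · intro h; exact absurd (Finset.mem_univ _) h
  have hL : ((c.genWeight (Sum.inl e) : ℤ) • markDefect σ E (c.kerGen (Sum.inl e))) q =
      -(if E (c.Γ.minusFlag (c.mark q.1)).vertex ⊆ edgeKey σ E (Sum.inl e) then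
        endSum d (edgeKey σ E (Sum.inl e)) q.2 else 0) := by
    change (c.w (Sum.inl e) : ℤ) * (0 - potential σ E _ _ q.2) = _
    rw [hpot, zero_sub, mul_neg]
    split_ifs
    · simp only [Pi.smul_apply, smul_eq_mul]
      rw [hw]
    · simp
  rw [hL, Pi.neg_apply, Pi.add_apply, hslot]
  simp only [cladeVec, inr_mem_vertexClade, toLeft_vertexClade, h1]
  by_cases ha : edgeKey σ E (c.mark q.1) ⊂ edgeKey σ E (Sum.inl e)
  · have hb : ¬ (edgeKey σ E (c.mark q.1) = edgeKey σ E (Sum.inl e) ∧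
          E (c.Γ.minusFlag (c.mark q.1)).vertex = edgeKey σ E (c.mark q.1)) := fun h => ha.ne h.1
    rw [if_pos (Or.inl ha), if_pos ha, if_neg hb, add_zero]
  · rw [if_neg ha, zero_add]
    simp only [ha, false_or]

theorem genWeight_smul_stop :
    (c.genWeight (Sum.inr 0) : ℤ) • markDefect σ E (c.kerGen (Sum.inr 0)) =
      cladeVec d (vertexClade (fun i => edgeKey σ E (c.mark i)) Finset.univ) := by
  classical
  funext q
  have hpot : potential σ E (c.kerGen (Sum.inr 0)) (c.Γ.minusFlag (c.mark q.1)).vertex =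
      c.u (Sum.inr c.stopEdge) := by
    rw [potential, Finset.sum_eq_zero, add_zero]
    · simp only [StopCurve.kerGen, Pi.single_eq_same]
      rfl
    · intro e _
      simp [StopCurve.kerGen]
  have h1 := congrFun hE.dir_stop q.2
  have h2 : c.wu (Sum.inr c.stopEdge) q.2 =
      (c.w (Sum.inr c.stopEdge) : ℤ) * c.u (Sum.inr c.stopEdge) q.2 := rfl
  rw [h2, Pi.neg_apply] at h1
  have hne : edgeKey σ E (c.mark q.1) ≠ Finset.univ :=
    (hE.isMarkedFamily hσ).mark_ne q.1
  simp only [cladeVec, inr_mem_vertexClade, toLeft_vertexClade,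
    if_pos (Finset.ssubset_univ_iff.2 hne)]
  change (c.w (Sum.inr c.stopEdge) : ℤ) *
    ((c.kerGen (Sum.inr 0)).2 q.1.succ q.2 - potential σ E _ _ q.2) = _
  rw [hpot]
  have h3 : (c.kerGen (Sum.inr 0)).2 q.1.succ q.2 = 0 := by
    simp [StopCurve.kerGen]
  rw [h3]
  linarith

theorem genWeight_smul_mark (i : Fin l) : ∃ s : ℤ, s * s = 1 ∧
    (c.genWeight (Sum.inr i.succ) : ℤ) • markDefect σ E (c.kerGen (Sum.inr i.succ)) =
      s • slotVec d (fun i => edgeKey σ E (c.mark i)) i := by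
  classical
  obtain ⟨s, hs, h⟩ : ∃ s : ℤ, s * s = 1 ∧
      (c.w (c.mark i) : ℤ) • c.u (c.Γ.minusFlag (c.mark i)) =
        s • endSum d (edgeKey σ E (c.mark i)) := by
    rcases h : c.mark i with e | e
    · exact ⟨edgeSign E e, hE.edgeSign_mul_self hσ e, hE.weight_smul_edgeSign hσ e⟩
    · obtain ⟨j, rfl⟩ := hσ.surj e fun he => c.mark_ne i (he ▸ h)
      refine ⟨1, rfl, ?_⟩
      rw [edgeKey_end hσ, one_smul, endSum, Finset.sum_singleton, ← hσ.dir]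
      rfl
  refine ⟨s, hs, funext fun q => ?_⟩
  have hpot : potential σ E (c.kerGen (Sum.inr i.succ)) (c.Γ.minusFlag (c.mark q.1)).vertex =
      0 := by
    rw [potential, Finset.sum_eq_zero, add_zero]
    · have : (0 : Fin (l + 1)) ≠ i.succ := (Fin.succ_ne_zero i).symm
      simp [StopCurve.kerGen, this]
    · intro e _
      simp [StopCurve.kerGen]
  change (c.w (c.mark i) : ℤ) *
    ((c.kerGen (Sum.inr i.succ)).2 q.1.succ q.2 - potential σ E _ _ q.2) = _
  rw [hpot, Pi.zero_apply, sub_zero]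
  by_cases hq : q.1 = i
  · have h1 := congrFun h q.2
    simp only [Pi.smul_apply, smul_eq_mul] at h1
    have h2 : (c.kerGen (Sum.inr i.succ)).2 q.1.succ = c.u (c.Γ.minusFlag (c.mark i)) := by
      rw [hq]
      simp only [StopCurve.kerGen, Pi.single_eq_same]
      rfl
    rw [h2, h1]
    simp [slotVec, hq]
  · have h2 : (c.kerGen (Sum.inr i.succ)).2 q.1.succ = 0 := by
      have : q.1.succ ≠ i.succ := fun h => hq (Fin.succ_injective _ h)
      simp [StopCurve.kerGen, this]
    rw [h2]
    simp [slotVec, hq]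

/-- Both lattices are spanned by the vectors `cladeVec (vertexClade F)` and `slotVec i`. -/
theorem closure_genWeight :
    AddSubgroup.closure (Set.range fun a => (c.genWeight a : ℤ) • markDefect σ E (c.kerGen a)) =
      AddSubgroup.closure (cladeVec d '' cladeFamily (Finset.univ.image E)
        fun i => edgeKey σ E (c.mark i)) := by
  classical
  have hmf := hE.isMarkedFamily hσ
  set m : Fin l → Finset (Fin (l + 1)) := fun i => edgeKey σ E (c.mark i) with hm
  set S₁ := AddSubgroup.closure
    (Set.range fun a => (c.genWeight a : ℤ) • markDefect σ E (c.kerGen a)) with hS₁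
  set S₂ := AddSubgroup.closure (cladeVec d '' cladeFamily (Finset.univ.image E) m) with hS₂
  have hgen₁ : ∀ a, (c.genWeight a : ℤ) • markDefect σ E (c.kerGen a) ∈ S₁ := fun a =>
    AddSubgroup.subset_closure ⟨a, rfl⟩
  have hgen₂ : ∀ T ∈ cladeFamily (Finset.univ.image E) m, cladeVec d T ∈ S₂ := fun T hT =>
    AddSubgroup.subset_closure ⟨T, hT, rfl⟩
  have hmark₂ : ∀ i, cladeVec d (vertexClade m (m i)) ∈ S₂ := by
    intro i
    rcases hmf.mark_mem i with h | ⟨j, hj⟩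
    · exact hgen₂ _ (mem_cladeFamily.2 (Or.inl ⟨_, h, rfl⟩))
    · rw [show m i = {j} from hj, cladeVec_vertexClade_singleton hmf]
      exact zero_mem _
  have hslot₂ : ∀ i, slotVec d m i ∈ S₂ := by
    intro i
    have h1 := hgen₂ _ (mem_cladeFamily.2 (Or.inr ⟨i, rfl⟩))
    rw [cladeVec_markClade hmf] at h1
    exact (add_mem_cancel_left (hmark₂ i)).1 h1
  have hslot₁ : ∀ i, slotVec d m i ∈ S₁ := by
    intro i
    obtain ⟨s, hs, h⟩ := hE.genWeight_smul_mark hσ i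
    have h1 := zsmul_mem (hgen₁ (Sum.inr i.succ)) s
    rwa [h, smul_smul, hs, one_smul] at h1
  have hroot : Finset.univ ∈ Finset.univ.image E := hmf.univ_mem
  have hvert₁ : ∀ x, cladeVec d (vertexClade m (E x)) ∈ S₁ := by
    intro x
    by_cases hx : x = c.Γ.foot c.stopEdge
    · rw [hx, hE.root, ← hE.genWeight_smul_stop hσ]
      exact hgen₁ _
    · obtain ⟨y, hy, hmin⟩ := hE.exists_cover hx
      have hadj : c.Γ.bdd.Adj y x := ((hE.adj_iff x y).2 (Or.inl ⟨hy, hmin⟩)).symm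
      obtain ⟨D, hDe, hD, hk, -⟩ := hE.exists_dart (σ := σ) ⟨s(y, x), hadj⟩
      have hDx : D.snd = x := by
        rcases Sym2.eq_iff.1 (show s(D.fst, D.snd) = s(y, x) from hDe) with h | h
        · exact h.2
        · rw [h.1, h.2] at hD
          exact absurd hD.1 hy.2
      have h1 := hgen₁ (Sum.inl ⟨s(y, x), hadj⟩)
      rw [hE.genWeight_smul_inl hσ, neg_mem_iff, hk, hDx] at h1
      refine (add_mem_cancel_right (sum_mem fun i _ => ?_)).1 h1
      split_ifs
      · exact hslot₁ i
      · exact zero_mem _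
  refine le_antisymm ?_ ?_
  · rw [hS₁, AddSubgroup.closure_le]
    rintro _ ⟨e | i, rfl⟩
    · simp only [SetLike.mem_coe]
      rw [hE.genWeight_smul_inl hσ, neg_mem_iff]
      refine add_mem ?_ (sum_mem fun i _ => ?_)
      · obtain ⟨D, -, -, hk, -⟩ := hE.exists_dart (σ := σ) e
        rw [hk]
        exact hgen₂ _ (mem_cladeFamily.2 (Or.inl
          ⟨_, Finset.mem_image.2 ⟨_, Finset.mem_univ _, rfl⟩, rfl⟩))
      · split_ifs
        · exact hslot₂ i
        · exact zero_mem _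
    · simp only [SetLike.mem_coe]
      refine Fin.cases ?_ (fun i => ?_) i
      · rw [hE.genWeight_smul_stop hσ]
        exact hgen₂ _ (mem_cladeFamily.2 (Or.inl ⟨_, hroot, rfl⟩))
      · obtain ⟨s, -, h⟩ := hE.genWeight_smul_mark hσ i
        rw [h]
        exact zsmul_mem (hslot₂ i) s
  · rw [hS₂, AddSubgroup.closure_le]
    rintro _ ⟨T, hT, rfl⟩
    simp only [SetLike.mem_coe]
    have hmark₁ : ∀ i, cladeVec d (vertexClade m (m i)) ∈ S₁ := by
      intro i
      rcases hmf.mark_mem i with h | ⟨j, hj⟩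
      · obtain ⟨x, -, hx⟩ := Finset.mem_image.1 h
        have := hvert₁ x
        rwa [hx] at this
      · rw [show m i = {j} from hj, cladeVec_vertexClade_singleton hmf]
        exact zero_mem _
    rcases mem_cladeFamily.1 hT with ⟨F, hF, rfl⟩ | ⟨i, rfl⟩
    · obtain ⟨x, -, rfl⟩ := Finset.mem_image.1 hF
      exact hvert₁ x
    · rw [cladeVec_markClade hmf]
      exact add_mem (hmark₁ i) (hslot₁ i)

/-- The weight of a trivalent curve is the multiplicity of its type. -/
theorem weight_eq (hval : ∀ x, c.Γ.valence x = 3) :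
    c.weight = cladeMult d (cladeFamily (Finset.univ.image E) fun i => edgeKey σ E (c.mark i)) := by
  classical
  have hcard : Fintype.card (Fin l × Fin 2) =
      Fintype.card (c.Γ.bdd.edgeSet ⊕ Fin (l + 1)) := by
    have h1 := c.Γ.card_add_two_of_trivalent hval
    have h2 := c.Γ.isTree.card_edgeFinset
    rw [hσ.card_eq] at h1
    rw [SimpleGraph.edgeFinset_card] at h2
    rw [Fintype.card_sum, Fintype.card_prod, Fintype.card_fin, Fintype.card_fin, Fintype.card_fin]
    omega
  let e := Fintype.equivOfCardEq hcard
  have h1 := index_closure_range_eq_abs_det (markDefect σ E ∘ c.kerGen) e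
  have h2 := index_closure_range_eq_abs_det
    (fun a => (c.genWeight a : ℤ) • markDefect σ E (c.kerGen a)) e
  rw [← hE.latticeIndex_eq hσ] at h1
  rw [hE.closure_genWeight hσ] at h2
  change ((cladeMult d _ : ℕ) : ℝ) = _ at h2
  have h3 : (Matrix.of fun k j => (((c.genWeight (e k) : ℤ) •
      markDefect σ E (c.kerGen (e k))) j : ℝ)) = Matrix.of fun k j => (c.genWeight (e k) : ℝ) *
        (Matrix.of fun k j => ((markDefect σ E ∘ c.kerGen) (e k) j : ℝ)) k j := by
    ext k j
    simp
  rw [h3, Matrix.det_mul_column, abs_mul, ← h1, e.prod_comp fun a => (c.genWeight a : ℝ),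
    ← Nat.cast_prod, c.prod_genWeight, Nat.abs_cast] at h2
  rw [StopCurve.weight, Finset.prod_congr rfl fun i _ => c.markIndex_eq_one i,
    Finset.prod_const_one, mul_one]
  exact_mod_cast h2.symm

end IsModel

end Weights

/-! ### Isomorphisms and labellings -/

section Isomorphisms

variable {l : ℕ} {d : Fin (l + 1) → ZLat} {c c' : StopCurve l} {σ : Fin (l + 1) → c.Γ.U}
  {E : c.Γ.V → Finset (Fin (l + 1))}

theorem orient_mapEdgeSet (φ : c.Γ.bdd ≃g c'.Γ.bdd) (e : c.Γ.bdd.edgeSet) :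
    ((c'.Γ.orient (φ.mapEdgeSet e)).fst = φ (c.Γ.orient e).fst ∧
      (c'.Γ.orient (φ.mapEdgeSet e)).snd = φ (c.Γ.orient e).snd) ∨
    ((c'.Γ.orient (φ.mapEdgeSet e)).fst = φ (c.Γ.orient e).snd ∧
      (c'.Γ.orient (φ.mapEdgeSet e)).snd = φ (c.Γ.orient e).fst) := by
  have h1 := c'.Γ.orient_edge (φ.mapEdgeSet e)
  have h2 : (φ.mapEdgeSet e).1 = Sym2.map φ (c.Γ.orient e).edge := by
    rw [c.Γ.orient_edge]; rfl
  rw [h2] at h1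
  exact Sym2.eq_iff.1 (show s((c'.Γ.orient (φ.mapEdgeSet e)).fst,
    (c'.Γ.orient (φ.mapEdgeSet e)).snd) = s(φ (c.Γ.orient e).fst, φ (c.Γ.orient e).snd) from h1)

theorem StopCurve.Isom.matches (h : StopCurve.Isom c c') {p : Plane} {A : Fin l → Plane}
    (hm : c.Matches p A) : c'.Matches p A := by
  obtain ⟨φ, ψ, h1, -, h3, h4, h5, -, h7⟩ := h
  have himage : ∀ e, c'.image (Sum.map φ.mapEdgeSet ψ e) = c.image e := by
    rintro (e | e)
    · change segment ℝ (c'.pos (c'.Γ.orient (φ.mapEdgeSet e)).fst)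
        (c'.pos (c'.Γ.orient (φ.mapEdgeSet e)).snd) =
        segment ℝ (c.pos (c.Γ.orient e).fst) (c.pos (c.Γ.orient e).snd)
      rcases orient_mapEdgeSet φ e with ⟨h, h'⟩ | ⟨h, h'⟩
      · rw [h, h', h3, h3]
      · rw [h, h', h3, h3, segment_symm]
    · change halfLine (c'.pos (c'.Γ.foot (ψ e))) (c'.u (Sum.inr (ψ e))) =
        halfLine (c.pos (c.Γ.foot e)) (c.u (Sum.inr e))
      rw [h1, h3, h4]
  refine ⟨fun i => ?_, h7.trans hm.2⟩
  rw [h5, himage]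
  exact hm.1 i

/-- Labellings and models can be transported along isomorphisms. -/
theorem StopCurve.Isom.exists_isModel (h : StopCurve.Isom c c') (hσ : IsLabelling d c σ)
    (hE : IsModel d c σ E) : ∃ (σ' : Fin (l + 1) → c'.Γ.U)
      (E' : c'.Γ.V → Finset (Fin (l + 1))), IsLabelling d c' σ' ∧ IsModel d c' σ' E' ∧
      Set.range E' = Set.range E ∧
      ∀ i, edgeKey σ' E' (c'.mark i) = edgeKey σ E (c.mark i) := by
  obtain ⟨φ, ψ, h1, h2, h3, h4, h5, h6, -⟩ := h
  have hwu : ∀ e, c'.wu (Sum.inr (ψ e)) = c.wu (Sum.inr e) := by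
    intro e
    have hw : c'.w (Sum.inr (ψ e)) = c.w (Sum.inr e) := h2 (Sum.inr e)
    change (c'.w (Sum.inr (ψ e)) : ℤ) • c'.u (Sum.inr (ψ e)) = _
    rw [hw, h4]
    rfl
  have hφs : ∀ x, φ.symm (φ x) = x := φ.symm_apply_apply
  refine ⟨ψ ∘ σ, E ∘ φ.symm, ⟨ψ.injective.comp hσ.injective, fun j hj => ?_, fun e he => ?_,
    fun j => (hwu _).trans (hσ.dir j)⟩, ⟨hE.injective.comp φ.symm.injective, ?_, fun j x => ?_,
    fun x y => hE.nested _ _, fun x => hE.two_le _, fun x y => ?_, fun D hD => ?_, ?_⟩, ?_,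
    fun i => ?_⟩
  · rw [h6] at hj
    exact hσ.ne_stop j (ψ.injective hj)
  · obtain ⟨e, rfl⟩ := ψ.surjective e
    obtain ⟨j, hj⟩ := hσ.surj e fun h => he (by rw [h, h6])
    exact ⟨j, congrArg ψ hj⟩
  · rw [h6, h1]
    change E (φ.symm (φ _)) = _
    rw [hφs, hE.root]
  · change j ∈ E (φ.symm x) ↔ E (φ.symm (c'.Γ.foot (ψ (σ j)))) ⊆ E (φ.symm x)
    rw [h1, hφs]
    exact hE.mem_iff j _
  · have hadj : c'.Γ.bdd.Adj x y ↔ c.Γ.bdd.Adj (φ.symm x) (φ.symm y) :=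
      (φ.symm.map_adj_iff).symm
    have hall : ∀ P : c.Γ.V → Prop, (∀ z, P z) ↔ ∀ z, P (φ.symm z) := fun P =>
      ⟨fun h z => h _, fun h z => hφs z ▸ h (φ z)⟩
    rw [hadj, hE.adj_iff, hall, hall fun z => E (φ.symm y) ⊂ E z → E (φ.symm x) ⊆ E z]
    rfl
  · have hadj : c.Γ.bdd.Adj (φ.symm D.fst) (φ.symm D.snd) := φ.symm.map_adj_iff.2 D.adj
    set D₀ : c.Γ.bdd.Dart := ⟨(φ.symm D.fst, φ.symm D.snd), hadj⟩ with hD₀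
    refine Eq.trans ?_ (hE.dir D₀ hD)
    have hu : c'.u (Sum.inl D) = c.u (Sum.inl D₀) := by
      obtain ⟨t, ht, e1⟩ := c.bounded_edge D₀
      obtain ⟨t', ht', e2⟩ := c'.bounded_edge D
      refine ZLat.IsPrimitive.eq_of_proportional (c'.u_primitive _) (c.u_primitive _) ht' ht
        fun i => ?_
      have e3 : c.pos (φ.symm D.snd) = c.pos (φ.symm D.fst) + t • (c.u (Sum.inl D₀)).toPlane := e1
      rw [← h3, ← h3, φ.apply_symm_apply, φ.apply_symm_apply, e2] at e3
      have e4 := congrArg (fun v : Plane => v i) e3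
      simp only [PiLp.add_apply, smul_toPlane_apply] at e4
      linarith
    have hw : c'.w (TropGraph.Flag.edge (Γ := c'.Γ) (Sum.inl D)) =
        c.w (TropGraph.Flag.edge (Γ := c.Γ) (Sum.inl D₀)) := by
      rw [← h2]
      congr 1
      refine congrArg Sum.inl (Subtype.ext ?_)
      change s(D.fst, D.snd) = s(φ (φ.symm D.fst), φ (φ.symm D.snd))
      rw [φ.apply_symm_apply, φ.apply_symm_apply]
    rw [TropCurve.wu, TropCurve.wu, hu, hw]
  · rw [h6, hwu, hE.dir_stop]
  · exact φ.symm.surjective.range_comp E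
  · rw [h5]
    rcases c.mark i with e | e
    · change E (φ.symm (c'.Γ.orient (φ.mapEdgeSet e)).fst) ∩
        E (φ.symm (c'.Γ.orient (φ.mapEdgeSet e)).snd) = E (c.Γ.orient e).fst ∩ E (c.Γ.orient e).snd
      rcases orient_mapEdgeSet φ e with ⟨h, h'⟩ | ⟨h, h'⟩
      · rw [h, h', hφs, hφs]
      · rw [h, h', hφs, hφs, Finset.inter_comm]
    · ext j
      simp [edgeKey]

/-- Finite families of points with equally large fibres correspond to each other. -/
theorem exists_equiv_of_card_fiber {α β X : Type*} [Finite α] [Finite β] (f : α → X) (g : β → X)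
    (h : ∀ x, {a | f a = x}.ncard = {b | g b = x}.ncard) : ∃ e : α ≃ β, ∀ a, g (e a) = f a := by
  have hfib : ∀ x, Nonempty ({a // f a = x} ≃ {b // g b = x}) := fun x =>
    Finite.card_eq.1 (h x)
  let F : ∀ x, {a // f a = x} ≃ {b // g b = x} := fun x => (hfib x).some
  refine ⟨(Equiv.sigmaFiberEquiv f).symm.trans
    ((Equiv.sigmaCongrRight F).trans (Equiv.sigmaFiberEquiv g)), fun a => ?_⟩
  exact (F (f a) ⟨a, rfl⟩).2

theorem exists_isLabelling {Δ : ZLat →₀ ℕ} (hΔ : ∀ x, Δ x = {j | d j = x}.ncard)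
    (hdeg : ∀ x, c.degree x = Δ x) : ∃ σ, IsLabelling d c σ := by
  obtain ⟨e, he⟩ := exists_equiv_of_card_fiber d
    (fun e : {e : c.Γ.U // e ≠ c.stopEdge} => c.wu (Sum.inr e.1)) (fun x => by
      rw [← hΔ, ← hdeg, ← Set.ncard_image_of_injective _ Subtype.val_injective]
      refine congrArg Set.ncard (Set.ext fun e => ?_)
      constructor
      · rintro ⟨h1, h2⟩
        exact ⟨⟨e, h1⟩, h2, rfl⟩
      · rintro ⟨⟨e, h1⟩, h2, rfl⟩
        exact ⟨h1, h2⟩)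
  exact ⟨fun j => (e j).1, Subtype.val_injective.comp e.injective, fun j => (e j).2,
    fun a ha => ⟨e.symm ⟨a, ha⟩, by simp⟩, he⟩

theorem IsLabelling.degree_eq (hσ : IsLabelling d c σ) (x : ZLat) :
    c.degree x = {j | d j = x}.ncard := by
  rw [← Set.ncard_image_of_injective _ hσ.injective]
  refine congrArg Set.ncard (Set.ext fun e => ?_)
  constructor
  · rintro ⟨h1, h2⟩
    obtain ⟨j, rfl⟩ := hσ.surj e h1
    exact ⟨j, (hσ.dir j).symm.trans h2, rfl⟩
  · rintro ⟨j, hj, rfl⟩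
    exact ⟨hσ.ne_stop j, (hσ.dir j).trans hj⟩

/-- The symmetries of the list of directions. -/
abbrev EndSymmetry (d : Fin (l + 1) → ZLat) : Type :=
  {g : Equiv.Perm (Fin (l + 1)) // ∀ j, d (g j) = d j}

/-- All curves have the same number of labellings. -/
theorem IsLabelling.card_labellings (hσ : IsLabelling d c σ) :
    Nat.card {σ // IsLabelling d c σ} = Nat.card (EndSymmetry d) := by
  refine (Nat.card_eq_of_bijective (fun g : EndSymmetry d =>
    (⟨σ ∘ g.1, hσ.injective.comp g.1.injective, fun j => hσ.ne_stop _, fun e he => ?_,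
      fun j => (hσ.dir _).trans (g.2 j)⟩ : {σ // IsLabelling d c σ})) ⟨?_, ?_⟩).symm
  · obtain ⟨j, rfl⟩ := hσ.surj e he
    exact ⟨g.1.symm j, by simp⟩
  · intro g g' h
    refine Subtype.ext (Equiv.ext fun j => hσ.injective ?_)
    exact congrFun (congrArg Subtype.val h) j
  · rintro ⟨σ', hσ'⟩
    choose g hg using fun j => hσ.surj (σ' j) (hσ'.ne_stop j)
    have hginj : Function.Injective g := fun a b h => hσ'.injective (by rw [← hg, h, hg])
    refine ⟨⟨Equiv.ofBijective g (Finite.injective_iff_bijective.1 hginj), fun j => ?_⟩,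
      Subtype.ext (funext hg)⟩
    exact (hσ.dir (g j)).symm.trans
      ((congrArg (fun e => c.wu (Sum.inr e)) (hg j)).trans (hσ'.dir j))

end Isomorphisms

/-! ### Curves and types -/

section Types

variable {l : ℕ} {d : Fin (l + 1) → ZLat} {c c' : StopCurve l} {σ : Fin (l + 1) → c.Γ.U}
  {E : c.Γ.V → Finset (Fin (l + 1))} {σ' : Fin (l + 1) → c'.Γ.U}
  {E' : c'.Γ.V → Finset (Fin (l + 1))} {Δ : ZLat →₀ ℕ} {A : Fin l → Plane} {p : Plane}

/-- The type of a labelled curve with a stop, as a family of sets of leaves: the underlying tree,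
with a leaf attached at every marked point. -/
noncomputable def curveType (c : StopCurve l) (σ : Fin (l + 1) → c.Γ.U)
    (E : c.Γ.V → Finset (Fin (l + 1))) : Finset (Finset (Leaf l)) :=
  cladeFamily (Finset.univ.image E) fun i => edgeKey σ E (c.mark i)

theorem mem_treeCones {C : Finset (Finset (Leaf l))} :
    C ∈ (treeCones d).cones ↔ IsMaxLaminar C := by
  classical
  simp [treeCones]

/-- Two unbounded edges that no member of a type of nonzero multiplicity separates agree. -/
theorem eq_of_not_separated {C : Finset (Finset (Leaf l))} (hC : IsMaxLaminar C)
    (hm : cladeMult d C ≠ 0) {j k : Fin (l + 1)}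
    (h : ∀ T ∈ C, (Sum.inl j : Leaf l) ∈ T ↔ Sum.inl k ∈ T) : j = k := by
  by_contra hjk
  have hu : ({Sum.inl j} : Finset (Leaf l)) ≠ Finset.univ := by
    intro hu
    have : (Sum.inl k : Leaf l) ∈ ({Sum.inl j} : Finset (Leaf l)) := hu ▸ Finset.mem_univ _
    exact hjk (Sum.inl_injective (Finset.mem_singleton.1 this)).symm
  obtain ⟨R, hR, X, hX, hdis, hRX, -⟩ := hC.exists_parent (Or.inr ⟨Sum.inl j, rfl⟩) hu
  have hkX : (Sum.inl k : Leaf l) ∈ X := by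
    have h1 : (Sum.inl k : Leaf l) ∈ R := (h R hR).1 (by rw [hRX]; simp)
    rw [hRX, Finset.mem_union, Finset.mem_singleton] at h1
    exact h1.resolve_left fun h2 => hjk (Sum.inl_injective h2).symm
  rcases hX with hX | ⟨a, rfl⟩
  · exact Finset.disjoint_left.1 hdis (Finset.mem_singleton_self _) ((h X hX).2 hkX)
  · rw [Finset.mem_singleton] at hkX
    subst hkX
    refine cladeVecR_ne_zero hC hm hR (funext fun q => ?_)
    simp [cladeVecR, cladeVec, hRX]

/-- The properties of the type of a curve through points in general position. -/
theorem IsModel.curveType_spec (hl : 1 ≤ l) (hσ : IsLabelling d c σ) (hE : IsModel d c σ E)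
    (hd : ∀ F : Finset (Fin (l + 1)), F.Nonempty → endSum d F ≠ 0)
    (hΔ : ∀ x, Δ x = {j | d j = x}.ncard) (hsum : degreeSum Δ = endSum d Finset.univ)
    (hgen : IsGeneral Δ p A) (hmatch : c.Matches p A) :
    IsMaxLaminar (curveType c σ E) ∧ cladeMult d (curveType c σ E) ≠ 0 ∧
      InOpenCone (cladeVecR d) (curveType c σ E) (fun q => A q.1 q.2 - p q.2) ∧
      c.weight = cladeMult d (curveType c σ E) ∧
      ∀ x, c.pos x = p + ∑ F ∈ Finset.univ.image E with E x ⊆ F,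
        (∑ T ∈ curveType c σ E with T.toLeft = F,
          (treeCones d).coord (curveType c σ E) T fun q => A q.1 q.2 - p q.2) •
            (endSum d F).toPlane := by
  obtain ⟨hval, hA, -⟩ := IsModel.general hσ hE hΔ hsum hgen hmatch
  obtain ⟨len, τ, hr, hpos⟩ := IsModel.exists_isGenericRealization hσ hE hmatch hval hA
  have hmf := hE.isMarkedFamily hσ
  have hC : IsMaxLaminar (curveType c σ E) := hmf.isMaxLaminar hr.card_eq
  have hm : cladeMult d (curveType c σ E) ≠ 0 :=
    IsGenericRealization.cladeMult_ne_zero hl hmf hd hΔ hsum hgen hr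
  have hw := hr.toIsRealization.eq_sum_cladeLen hmf
  refine ⟨hC, hm, ⟨_, fun S hS => hr.cladeLen_pos hmf hS, hw⟩, hE.weight_eq hσ hval, fun x => ?_⟩
  rw [hpos]
  congr 1
  refine Finset.sum_congr rfl fun F hF => ?_
  rw [← hmf.sum_cladeLen (len := len) (τ := τ) (Finset.mem_filter.1 hF).1]
  congr 1
  refine Finset.sum_congr rfl fun T hT => ?_
  rw [hw]
  exact ((treeCones d).coord_sum (mem_treeCones.2 hC) hm (Finset.mem_filter.1 hT).1 _).symm

/-- The type and the points determine a curve through points in general position. -/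
theorem IsModel.data_eq (hl : 1 ≤ l) (hσ : IsLabelling d c σ) (hE : IsModel d c σ E)
    (hσ' : IsLabelling d c' σ') (hE' : IsModel d c' σ' E')
    (hd : ∀ F : Finset (Fin (l + 1)), F.Nonempty → endSum d F ≠ 0)
    (hΔ : ∀ x, Δ x = {j | d j = x}.ncard) (hsum : degreeSum Δ = endSum d Finset.univ)
    (hgen : IsGeneral Δ p A) (hmatch : c.Matches p A) (hmatch' : c'.Matches p A)
    (heq : curveType c σ E = curveType c' σ' E') :
    Finset.univ.image E = Finset.univ.image E' ∧
      (∀ x x', E x = E' x' → c.pos x = c'.pos x') ∧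
      ∀ i, edgeKey σ E (c.mark i) = edgeKey σ' E' (c'.mark i) := by
  obtain ⟨h1, h2⟩ := (hE.isMarkedFamily hσ).eq_of_cladeFamily_eq (hE'.isMarkedFamily hσ') heq
  refine ⟨h1, fun x x' hx => ?_, congrFun h2⟩
  rw [(IsModel.curveType_spec hl hσ hE hd hΔ hsum hgen hmatch).2.2.2.2 x,
    (IsModel.curveType_spec hl hσ' hE' hd hΔ hsum hgen hmatch').2.2.2.2 x', h1, heq, hx]

theorem IsModel.isom_of_curveType_eq (hl : 1 ≤ l) (hσ : IsLabelling d c σ) (hE : IsModel d c σ E)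
    (hσ' : IsLabelling d c' σ') (hE' : IsModel d c' σ' E')
    (hd : ∀ F : Finset (Fin (l + 1)), F.Nonempty → endSum d F ≠ 0)
    (hΔ : ∀ x, Δ x = {j | d j = x}.ncard) (hsum : degreeSum Δ = endSum d Finset.univ)
    (hgen : IsGeneral Δ p A) (hmatch : c.Matches p A) (hmatch' : c'.Matches p A)
    (heq : curveType c σ E = curveType c' σ' E') : StopCurve.Isom c c' := by
  obtain ⟨h1, h2, h3⟩ :=
    IsModel.data_eq hl hσ hE hσ' hE' hd hΔ hsum hgen hmatch hmatch' heq
  refine isom_of_models hσ hσ' hE hE' ?_ h2 h3 (hmatch.2.trans hmatch'.2.symm)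
  ext F
  simpa using Finset.ext_iff.1 h1 F

/-- Different labellings of a curve through points in general position have different types. Thus
such a curve has no symmetries. -/
theorem IsModel.labelling_eq {σ' : Fin (l + 1) → c.Γ.U} {E' : c.Γ.V → Finset (Fin (l + 1))}
    (hl : 1 ≤ l) (hσ : IsLabelling d c σ) (hE : IsModel d c σ E)
    (hσ' : IsLabelling d c σ') (hE' : IsModel d c σ' E')
    (hd : ∀ F : Finset (Fin (l + 1)), F.Nonempty → endSum d F ≠ 0)
    (hΔ : ∀ x, Δ x = {j | d j = x}.ncard) (hsum : degreeSum Δ = endSum d Finset.univ)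
    (hgen : IsGeneral Δ p A) (hmatch : c.Matches p A)
    (heq : curveType c σ E = curveType c σ' E') : σ = σ' := by
  obtain ⟨h1, h2, h3⟩ :=
    IsModel.data_eq hl hσ hE hσ' hE' hd hΔ hsum hgen hmatch hmatch heq
  have hinj := (IsModel.general hσ hE hΔ hsum hgen hmatch).2.2
  have hEE : E = E' := by
    funext x
    obtain ⟨x', -, hx'⟩ := Finset.mem_image.1 (h1 ▸ Finset.mem_image_of_mem E (Finset.mem_univ x))
    rw [← hx', hinj (h2 x x' hx'.symm)]
  subst hEE
  obtain ⟨hC, hm, -⟩ := IsModel.curveType_spec hl hσ hE hd hΔ hsum hgen hmatch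
  funext j
  by_contra hne
  obtain ⟨k, hk⟩ := hσ.surj (σ' j) (hσ'.ne_stop j)
  have hjk : j ≠ k := by rintro rfl; exact hne hk
  have hmem : ∀ x, j ∈ E x ↔ k ∈ E x := fun x => by
    rw [hE'.mem_iff j x, hE.mem_iff k x, hk]
  have hj : ∀ i, edgeKey σ E (c.mark i) ≠ {j} := by
    intro i hi
    rw [← edgeKey_end (E := E) hσ j] at hi
    have h4 := hE.edgeKey_injective hσ hi
    have h5 := h3 i
    rw [hi, h4, edgeKey_end hσ] at h5
    have h6 : j ∈ edgeKey σ' E (Sum.inr (σ j)) := h5 ▸ Finset.mem_singleton_self j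
    simp only [edgeKey, Finset.mem_filter, Finset.mem_univ, true_and] at h6
    exact hne h6.symm
  have hk' : ∀ i, edgeKey σ E (c.mark i) ≠ {k} := by
    intro i hi
    rw [← edgeKey_end (E := E) hσ k] at hi
    have h4 := hE.edgeKey_injective hσ hi
    have h5 := h3 i
    rw [hi, h4, edgeKey_end hσ, hk, edgeKey_end hσ'] at h5
    exact hjk (Finset.singleton_injective h5).symm
  refine hjk (eq_of_not_separated hC hm fun T hT => ?_)
  rcases mem_cladeFamily.1 hT with ⟨F, hF, rfl⟩ | ⟨i, rfl⟩
  · obtain ⟨x, -, rfl⟩ := Finset.mem_image.1 hF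
    rw [← Finset.mem_toLeft, ← Finset.mem_toLeft, toLeft_vertexClade]
    exact hmem x
  · rw [← Finset.mem_toLeft, ← Finset.mem_toLeft, toLeft_markClade]
    rcases (hE.isMarkedFamily hσ).mark_mem i with h | ⟨n, hn⟩
    · obtain ⟨x, -, hx⟩ := Finset.mem_image.1 h
      rw [← hx]
      exact hmem x
    · rw [hn, Finset.mem_singleton, Finset.mem_singleton]
      constructor
      · rintro rfl; exact absurd hn (hj i)
      · rintro rfl; exact absurd hn (hk' i)

/-- Every type whose cone contains the configuration is the type of a curve. -/
theorem exists_curve_of_inOpenCone (hl : 1 ≤ l) {C : Finset (Finset (Leaf l))}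
    (hC : IsMaxLaminar C) (hm : cladeMult d C ≠ 0)
    (hcone : InOpenCone (cladeVecR d) C fun q => A q.1 q.2 - p q.2)
    (hd : ∀ F : Finset (Fin (l + 1)), F.Nonempty → endSum d F ≠ 0)
    (hΔ : ∀ x, Δ x = {j | d j = x}.ncard) (hsum : degreeSum Δ = endSum d Finset.univ)
    (hgen : IsGeneral Δ p A) : ∃ (c : StopCurve l) (σ : Fin (l + 1) → c.Γ.U)
      (E : c.Γ.V → Finset (Fin (l + 1))), IsLabelling d c σ ∧ IsModel d c σ E ∧ c.Matches p A ∧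
      curveType c σ E = C := by
  obtain ⟨lam, hlam, hw⟩ := hcone
  obtain ⟨m, hmark⟩ := exists_isMarking (lam := lam) hC hm
  obtain ⟨-, hr⟩ := hmark.pos_of_isGeneral hl hC hd hΔ hsum hgen (fun S hS => (hlam S hS).le) hw
  have hmf := hmark.isMarkedFamily hl hC.laminar
  refine ⟨hmf.stopCurve hd hr.len_pos hr.root_pos p, some, Subtype.val,
    hmf.isLabelling_stopCurve hd hr.len_pos hr.root_pos p,
    hmf.isModel_stopCurve hd hr.len_pos hr.root_pos p,
    hmf.matches_stopCurve hd hr.toIsRealization hr.root_pos, ?_⟩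
  refine Eq.trans (congrArg₂ cladeFamily ?_ ?_) (hmark.cladeFamily_eq hl hC hlam hr.card_eq)
  · ext F
    constructor
    · intro h
      obtain ⟨x, -, rfl⟩ := Finset.mem_image.1 h
      exact x.2
    · intro h
      exact Finset.mem_image.2 ⟨⟨F, h⟩, Finset.mem_univ _, rfl⟩
  · exact funext fun i => hmf.edgeKey_stopCurve hd hr.len_pos hr.root_pos p i

/-- Points in general position are a regular configuration. -/
theorem IsGeneral.regular (hl : 1 ≤ l)
    (hd : ∀ F : Finset (Fin (l + 1)), F.Nonempty → endSum d F ≠ 0)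
    (hΔ : ∀ x, Δ x = {j | d j = x}.ncard) (hsum : degreeSum Δ = endSum d Finset.univ)
    (hgen : IsGeneral Δ p A) : (treeCones d).Regular fun q => A q.1 q.2 - p q.2 := by
  intro C hC hm hnn
  have hC' := mem_treeCones.1 hC
  obtain ⟨m, hmark⟩ := exists_isMarking
    (lam := fun S => (treeCones d).coord C S fun q => A q.1 q.2 - p q.2) hC' hm
  exact (hmark.pos_of_isGeneral hl hC' hd hΔ hsum hgen hnn
    ((treeCones d).sum_coord hC hm _)).1

end Types

/-! ### Counting curves by cones -/

section Counting

variable {l : ℕ} {d : Fin (l + 1) → ZLat} {Δ : ZLat →₀ ℕ} {A : Fin l → Plane} {p : Plane}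

theorem StopCurve.out_spec (hΔ : ∀ x, Δ x = {j | d j = x}.ncard)
    {q : Quotient (StopCurve.setoid l)} (hq : q ∈ StopCurve.classes Δ p A) :
    q.out.Matches p A ∧ ∃ σ, IsLabelling d q.out σ := by
  obtain ⟨c, hc, hdeg, hmatch⟩ := hq
  have hiso : StopCurve.Isom c q.out := Quotient.exact (hc.trans q.out_eq.symm)
  obtain ⟨σ, hσ⟩ := exists_isLabelling hΔ hdeg
  obtain ⟨E, hE⟩ := exists_isModel hσ
  obtain ⟨σ', -, hσ', -⟩ := hiso.exists_isModel hσ hE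
  exact ⟨hiso.matches hmatch, σ', hσ'⟩

/-- The type of a labelled curve with a stop. -/
noncomputable def labelledType {c : StopCurve l} (s : {σ // IsLabelling d c σ}) :
    Finset (Finset (Leaf l)) :=
  curveType c s.1 (exists_isModel s.2).choose

/-- Labelled curves through points in general position correspond to the types of nonzero
multiplicity whose cones contain the configuration of points. -/
theorem labelledType_bijective (hl : 1 ≤ l) {v : ZLat} (hv : ∀ j, 0 < latForm v (d j))
    (hd : ∀ F : Finset (Fin (l + 1)), F.Nonempty → endSum d F ≠ 0)
    (hΔ : ∀ x, Δ x = {j | d j = x}.ncard) (hsum : degreeSum Δ = endSum d Finset.univ)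
    (hgen : IsGeneral Δ p A) : Set.BijOn
      (fun t : (q : StopCurve.classes Δ p A) × {σ // IsLabelling d q.1.out σ} => labelledType t.2)
      Set.univ {C | C ∈ (treeCones d).cones ∧ cladeMult d C ≠ 0 ∧
        InOpenCone (cladeVecR d) C fun q => A q.1 q.2 - p q.2} := by
  refine ⟨fun t _ => ?_, fun t _ t' _ h => ?_, ?_⟩
  · have hmatch := (StopCurve.out_spec hΔ t.1.2).1
    obtain ⟨h1, h2, h3, -⟩ := IsModel.curveType_spec hl t.2.2 (exists_isModel t.2.2).choose_spec
      hd hΔ hsum hgen hmatch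
    exact ⟨mem_treeCones.2 h1, h2, h3⟩
  · obtain ⟨⟨q, hq⟩, ⟨σ, hσ⟩⟩ := t
    obtain ⟨⟨q', hq'⟩, ⟨σ', hσ'⟩⟩ := t'
    have hmatch := (StopCurve.out_spec hΔ hq).1
    have hmatch' := (StopCurve.out_spec hΔ hq').1
    have hiso := IsModel.isom_of_curveType_eq hl hσ (exists_isModel hσ).choose_spec hσ'
      (exists_isModel hσ').choose_spec hd hΔ hsum hgen hmatch hmatch' h
    have hqq : q = q' := by
      rw [← q.out_eq, ← q'.out_eq]
      exact Quotient.sound hiso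
    subst hqq
    have hσσ := IsModel.labelling_eq hl hσ (exists_isModel hσ).choose_spec hσ'
      (exists_isModel hσ').choose_spec hd hΔ hsum hgen hmatch h
    subst hσσ
    rfl
  · rintro C ⟨hC, hm, hcone⟩
    obtain ⟨c, σ, E, hσ, hE, hmatch, rfl⟩ := exists_curve_of_inOpenCone hl
      (mem_treeCones.1 hC) hm hcone hd hΔ hsum hgen
    let q : Quotient (StopCurve.setoid l) := Quotient.mk _ c
    have hq : q ∈ StopCurve.classes Δ p A :=
      ⟨c, rfl, fun x => (hσ.degree_eq x).trans (hΔ x).symm, hmatch⟩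
    have hiso : StopCurve.Isom c q.out := Quotient.exact q.out_eq.symm
    obtain ⟨σ', E', hσ', hE', hrange, hkey⟩ := hiso.exists_isModel hσ hE
    refine ⟨⟨⟨q, hq⟩, ⟨σ', hσ'⟩⟩, trivial, ?_⟩
    change curveType q.out σ' (exists_isModel hσ').choose = curveType c σ E
    rw [(exists_isModel hσ').choose_spec.unique hv hE']
    refine congrArg₂ cladeFamily ?_ (funext hkey)
    ext F
    simpa using Set.ext_iff.1 hrange F

/-- The number of curves through points in general position, multiplied by the number of
labellings of each of them, is the number of cones containing the configuration of points. -/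
theorem StopCurve.finite_classes_and_count_eq (hl : 1 ≤ l) {v : ZLat}
    (hv : ∀ j, 0 < latForm v (d j))
    (hd : ∀ F : Finset (Fin (l + 1)), F.Nonempty → endSum d F ≠ 0)
    (hΔ : ∀ x, Δ x = {j | d j = x}.ncard) (hsum : degreeSum Δ = endSum d Finset.univ)
    (hgen : IsGeneral Δ p A) : (StopCurve.classes Δ p A).Finite ∧
      (treeCones d).count (fun q => A q.1 q.2 - p q.2) =
        Nat.card (EndSymmetry d) * StopCurve.count Δ p A := by
  classical
  have hbij := labelledType_bijective hl hv hd hΔ hsum hgen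
  set X := {C | C ∈ (treeCones d).cones ∧ cladeMult d C ≠ 0 ∧
        InOpenCone (cladeVecR d) C fun q => A q.1 q.2 - p q.2} with hX
  have hfin : Finite ((q : StopCurve.classes Δ p A) × {σ // IsLabelling d q.1.out σ}) :=
    Finite.of_injective _ (Set.injOn_univ.1 hbij.injOn)
  have hcl : Finite (StopCurve.classes Δ p A) :=
    Finite.of_surjective (fun t : (q : StopCurve.classes Δ p A) ×
      {σ // IsLabelling d q.1.out σ} => t.1) fun q => by
        obtain ⟨σ, hσ⟩ := (StopCurve.out_spec hΔ q.2).2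
        exact ⟨⟨q, σ, hσ⟩, rfl⟩
  refine ⟨hcl, ?_⟩
  have := Fintype.ofFinite (StopCurve.classes Δ p A)
  have hlab : ∀ q : StopCurve.classes Δ p A, Finite {σ // IsLabelling d q.1.out σ} := fun q =>
    Finite.of_injective (Sigma.mk (β := fun q : StopCurve.classes Δ p A =>
      {σ // IsLabelling d q.1.out σ}) q) sigma_mk_injective
  have := fun q : StopCurve.classes Δ p A => Fintype.ofFinite {σ // IsLabelling d q.1.out σ}
  have h1 : (treeCones d).count (fun q => A q.1 q.2 - p q.2) =
      ∑ C ∈ X.toFinset, (cladeMult d C : ℝ) := by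
    have hXf : X.toFinset = (treeCones d).cones.filter fun C => cladeMult d C ≠ 0 ∧
        InOpenCone (cladeVecR d) C fun q => A q.1 q.2 - p q.2 := by
      ext C; simp [hX]
    rw [hXf, Finset.sum_filter]
    refine Finset.sum_congr rfl fun C hC => ?_
    by_cases hm : cladeMult d C = 0
    · simp [treeCones, hm]
    · refine if_congr ?_ rfl rfl
      simp [treeCones, hm]
  have h2 : ∑ C ∈ X.toFinset, (cladeMult d C : ℝ) =
      ∑ t : (q : StopCurve.classes Δ p A) × {σ // IsLabelling d q.1.out σ},
        (t.1.1.out.weight : ℝ) := by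
    refine (Finset.sum_bij (fun t _ => labelledType t.2) (fun t _ => ?_) (fun t _ t' _ h => ?_)
      (fun C hC => ?_) fun t _ => ?_).symm
    · exact Set.mem_toFinset.2 (hbij.mapsTo (Set.mem_univ t))
    · exact hbij.injOn (Set.mem_univ t) (Set.mem_univ t') h
    · obtain ⟨t, -, ht⟩ := hbij.surjOn (Set.mem_toFinset.1 hC)
      exact ⟨t, Finset.mem_univ t, ht⟩
    · rw [(IsModel.curveType_spec hl t.2.2 (exists_isModel t.2.2).choose_spec
        hd hΔ hsum hgen (StopCurve.out_spec hΔ t.1.2).1).2.2.2.1]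
      rfl
  have h3 : StopCurve.count Δ p A = ∑ q : StopCurve.classes Δ p A, q.1.out.weight := by
    rw [StopCurve.count, ← finsum_set_coe_eq_finsum_mem, finsum_eq_sum_of_fintype]
  rw [h1, h2, h3, Fintype.sum_sigma, Nat.cast_sum, Finset.mul_sum]
  refine Finset.sum_congr rfl fun q _ => ?_
  obtain ⟨σ, hσ⟩ := (StopCurve.out_spec hΔ q.2).2
  change ∑ _s : {σ // IsLabelling d q.1.out σ}, (q.1.out.weight : ℝ) = _
  rw [Finset.sum_const, Finset.card_univ, ← Nat.card_eq_fintype_card, hσ.card_labellings,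
    nsmul_eq_mul]

end Counting

section Degree

variable {l : ℕ}

/-- The list of the directions of the unbounded edges. -/
theorem exists_directions (Δ : ZLat →₀ ℕ) (hcard : degreeCard Δ = l + 1) :
    ∃ d : Fin (l + 1) → ZLat, (∀ x, Δ x = {j | d j = x}.ncard) ∧
      degreeSum Δ = endSum d Finset.univ ∧ ∀ j, d j ∈ Δ.support := by
  classical
  have e : Fin (l + 1) ≃ (x : Δ.support) × Fin (Δ x.1) := Fintype.equivOfCardEq (by
    rw [Fintype.card_sigma, Fintype.card_fin, ← hcard, degreeCard, Finsupp.sum,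
      ← Finset.sum_coe_sort]
    simp)
  have h1 : ∀ x, Δ x = {j | (e j).1.1 = x}.ncard := by
    intro x
    have h2 : {j | (e j).1.1 = x}.ncard =
        {t : (x : Δ.support) × Fin (Δ x.1) | t.1.1 = x}.ncard := by
      rw [← Set.ncard_image_of_injective _ e.injective]
      congr 1
      ext t
      constructor
      · rintro ⟨j, hj, rfl⟩; exact hj
      · intro ht; exact ⟨e.symm t, by simpa using ht, by simp⟩
    rw [h2]
    by_cases hx : x ∈ Δ.support
    · have h3 : {t : (x : Δ.support) × Fin (Δ x.1) | t.1.1 = x} =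
          Set.range (Sigma.mk (β := fun x : Δ.support => Fin (Δ x.1)) ⟨x, hx⟩) := by
        ext ⟨⟨y, hy⟩, i⟩
        constructor
        · rintro (rfl : y = x)
          exact ⟨i, rfl⟩
        · rintro ⟨k, hk⟩
          exact (congrArg (fun t : (x : Δ.support) × Fin (Δ x.1) => t.1.1) hk).symm
      rw [h3, ← Set.image_univ, Set.ncard_image_of_injective _ sigma_mk_injective,
        Set.ncard_univ, Nat.card_eq_fintype_card, Fintype.card_fin]
    · rw [Finsupp.notMem_support_iff.1 hx, eq_comm, Set.ncard_eq_zero,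
        Set.eq_empty_iff_forall_notMem]
      rintro t (rfl : t.1.1 = x)
      exact hx t.1.2
  refine ⟨fun j => (e j).1.1, h1, ?_, fun j => (e j).1.2⟩
  rw [endSum, degreeSum, Finsupp.sum]
  have h4 : ∑ j, (e j).1.1 = ∑ t : (x : Δ.support) × Fin (Δ x.1), t.1.1 :=
    e.sum_comp fun t => t.1.1
  rw [h4, Fintype.sum_sigma, ← Finset.sum_coe_sort]
  simp

end Degree

/-! ### Points in a sector -/

section Sector

variable {l : ℕ}

/-- Points in a sector with small opening angle, whose apex is in front of `p`, form a configuration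
in the thin cone. -/
theorem mem_thinCone_of_mem_coneY {v : ZLat} (hv : v ≠ 0) {δ θ a : ℝ} (hδ : 0 < δ)
    (hθδ : θ ≤ δ / 4) (hθ1 : θ ≤ 1 / 2) (ha : 0 < a) {p : Plane} {A : Fin l → Plane}
    (hA : ∀ i, A i ∈ coneY p v a θ) :
    (fun q : Fin l × Fin 2 => A q.1 q.2 - p q.2) ∈ thinCone l v δ := by
  intro i
  have hvv : (0 : ℝ) < v 0 ^ 2 + v 1 ^ 2 := by
    have h : (v 0 : ℝ) ≠ 0 ∨ (v 1 : ℝ) ≠ 0 := by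
      by_contra! hc
      refine hv (funext fun k => ?_)
      fin_cases k
      · exact_mod_cast hc.1
      · exact_mod_cast hc.2
    rcases h with h | h <;> positivity
  -- The displacement from the apex, and its components along `v` and across `v`.
  set y : Plane := A i - axisPoint p v a with hy
  set h : ℝ := v 0 * y 0 + v 1 * y 1 with hh
  set s : ℝ := -(v 1) * y 0 + v 0 * y 1 with hs
  have e : ∀ k, y k = A i k - (p k + a * v k) := fun k => rfl
  have h1 : markForm v (fun q : Fin l × Fin 2 => A q.1 q.2 - p q.2) i =
      h + a * (v 0 ^ 2 + v 1 ^ 2) := by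
    simp only [markForm, hh, e]; ring
  have h2 : markForm (latRot v) (fun q : Fin l × Fin 2 => A q.1 q.2 - p q.2) i = s := by
    simp only [markForm, latRot, hs, e, Matrix.cons_val_zero, Matrix.cons_val_one]
    push_cast; ring
  rw [h1, h2]
  suffices hsh : |s| ≤ δ * h by
    have := mul_pos hδ (mul_pos ha hvv)
    rw [mul_add]
    linarith
  rcases hA i with hi | hi
  · have hy0 : y = 0 := by rw [hy, hi, sub_self]
    simp [hh, hs, hy0]
  · have hax : axisPoint p v (a + 1) - axisPoint p v a = v.toPlane := by
      simp only [axisPoint, add_smul, one_smul]; abel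
    rw [EuclideanGeometry.angle, vsub_eq_sub, vsub_eq_sub, hax, ← hy] at hi
    set α := InnerProductGeometry.angle y v.toPlane with hα
    have hα0 : 0 ≤ α := InnerProductGeometry.angle_nonneg _ _
    have hcos := InnerProductGeometry.cos_angle_mul_norm_mul_norm y v.toPlane
    rw [← hα] at hcos
    set R := ‖y‖ * ‖v.toPlane‖ with hR
    have hR0 : 0 ≤ R := by positivity
    have hinner : inner ℝ y v.toPlane = h := by
      simp [PiLp.inner_apply, Fin.sum_univ_two, ZLat.toPlane_apply, hh]
    have hR2 : R ^ 2 = h ^ 2 + s ^ 2 := by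
      have h3 : ‖y‖ ^ 2 = y 0 ^ 2 + y 1 ^ 2 := by
        simp [EuclideanSpace.norm_sq_eq, Fin.sum_univ_two]
      have h4 : ‖v.toPlane‖ ^ 2 = v 0 ^ 2 + v 1 ^ 2 := by
        simp [EuclideanSpace.norm_sq_eq, Fin.sum_univ_two, ZLat.toPlane_apply]
      rw [hR, mul_pow, h3, h4, hh, hs]; ring
    rw [hinner] at hcos
    have hs' : |s| = Real.sin α * R := by
      have h5 : 0 ≤ Real.sin α := Real.sin_nonneg_of_nonneg_of_le_pi hα0
        (InnerProductGeometry.angle_le_pi _ _)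
      rw [← abs_of_nonneg (mul_nonneg h5 hR0)]
      refine (sq_eq_sq_iff_abs_eq_abs _ _).1 ?_
      rw [mul_pow, Real.sin_sq]
      have : s ^ 2 = R ^ 2 - h ^ 2 := by rw [hR2]; ring
      rw [this, ← hcos]; ring
    have hsin : Real.sin α ≤ δ / 4 := (Real.sin_le hα0).trans (hi.trans hθδ)
    have hcos2 : 1 / 2 ≤ Real.cos α := by
      have := Real.one_sub_sq_div_two_le_cos (x := α)
      nlinarith
    rw [hs', ← hcos]
    calc Real.sin α * R ≤ δ / 4 * R := by gcongr
      _ ≤ δ * (1 / 2 * R) := by nlinarith [mul_nonneg hδ.le hR0]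
      _ ≤ δ * (Real.cos α * R) := by gcongr

end Sector

/-! ### Independence of the points -/

theorem proposition9p8
    (Δ : ZLat →₀ ℕ) (hΔ : Δ 0 = 0)
    (l : ℕ) (hl : 1 ≤ l) (hcard : degreeCard Δ = l + 1)
    -- `v` is the primitive direction of the stopping edge, from the stop into the curve
    (v : ZLat) (hv : v.IsPrimitive) (hdir : ∃ m : ℕ, 0 < m ∧ degreeSum Δ = m • v)
    -- the other unbounded edges have direction `-x`, when oriented from infinity into the curve
    (hneg : ∀ x ∈ Δ.support, v ⬝ᵥ (-x) < 0)
    (p : Fin 2 → ℚ) :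
    ∃ η : ℝ, 0 < η ∧ ∃ ε : ℝ, 0 < ε ∧ ε < 1 ∧ ∃ n : ℕ,
      ∀ (a θ : ℝ), η ≤ a → 0 < θ → θ ≤ ε →
        ∀ A : Fin l → (Fin 2 → ℚ),
          IsGeneral Δ (ratPoint p) (fun i => ratPoint (A i)) →
          (∀ i, ratPoint (A i) ∈ coneY (ratPoint p) v a θ) →
          (StopCurve.classes Δ (ratPoint p) (fun i => ratPoint (A i))).Finite ∧
          StopCurve.count Δ (ratPoint p) (fun i => ratPoint (A i)) = n := by
  obtain ⟨d, hd, hsum, hsupp⟩ := exists_directions Δ hcard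
  have hpos : ∀ j, 0 < latForm v (d j) := by
    intro j
    have := hneg (d j) (hsupp j)
    simp only [dotProduct, Fin.sum_univ_two, Pi.neg_apply] at this
    simp only [latForm]
    linarith
  have hne : ∀ F : Finset (Fin (l + 1)), F.Nonempty → endSum d F ≠ 0 := by
    intro F hF h0
    have := latForm_endSum_pos hpos hF
    simp [h0, latForm] at this
  have hbal : latForm (latRot v) (endSum d Finset.univ) = 0 := by
    obtain ⟨m, -, hm⟩ := hdir
    rw [← hsum, hm]
    simp only [latForm, latRot, Pi.smul_apply, nsmul_eq_mul, Matrix.cons_val_zero,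
      Matrix.cons_val_one]
    ring
  -- The slope of the thin cone, the reciprocal of the total height of the unbounded edges; the
  -- summand `1` only avoids a case distinction.
  have hH := latForm_endSum_nonneg hpos Finset.univ
  set H : ℤ := latForm v (endSum d Finset.univ) with hHdef
  have hH' : (0 : ℝ) ≤ H := by exact_mod_cast hH
  set δ : ℝ := 1 / (H + 1) with hδdef
  have hδ : 0 < δ := by positivity
  have hδ1 : ∀ F : Finset (Fin (l + 1)), δ * latForm v (endSum d F) ≤ 1 := by
    intro F
    have h1 : latForm v (endSum d F) ≤ H := by
      rw [hHdef, endSum, endSum, latForm_sum, latForm_sum]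
      exact Finset.sum_le_sum_of_subset_of_nonneg F.subset_univ fun j _ _ => (hpos j).le
    have h2 : (latForm v (endSum d F) : ℝ) ≤ H + 1 := by
      have : (latForm v (endSum d F) : ℝ) ≤ H := by exact_mod_cast h1
      linarith
    rw [hδdef, one_div, inv_mul_le_iff₀ (by positivity), mul_one]
    exact h2
  -- A point at angle at most `θ ≤ 1 / 2` from the axis has slope at most `2 θ`.
  set ε : ℝ := min (δ / 4) (1 / 2) with hε
  have key : ∀ (a θ : ℝ), 1 ≤ a → θ ≤ ε → ∀ A : Fin l → (Fin 2 → ℚ),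
      (∀ i, ratPoint (A i) ∈ coneY (ratPoint p) v a θ) →
      (fun q : Fin l × Fin 2 => ratPoint (A q.1) q.2 - ratPoint p q.2) ∈ thinCone l v δ :=
    fun a θ ha hθ A hA => mem_thinCone_of_mem_coneY hv.ne_zero hδ (hθ.trans (min_le_left _ _))
      (hθ.trans (min_le_right _ _)) (by linarith) hA
  have hconst : ∀ A A' : Fin l → (Fin 2 → ℚ),
      IsGeneral Δ (ratPoint p) (fun i => ratPoint (A i)) →
      IsGeneral Δ (ratPoint p) (fun i => ratPoint (A' i)) →
      (fun q : Fin l × Fin 2 => ratPoint (A q.1) q.2 - ratPoint p q.2) ∈ thinCone l v δ →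
      (fun q : Fin l × Fin 2 => ratPoint (A' q.1) q.2 - ratPoint p q.2) ∈ thinCone l v δ →
      StopCurve.count Δ (ratPoint p) (fun i => ratPoint (A i)) =
        StopCurve.count Δ (ratPoint p) (fun i => ratPoint (A' i)) := by
    intro A A' hgen hgen' hA hA'
    have h1 := treeCones_count_eq hpos hbal hδ1 hA hA' (hgen.regular hl hne hd hsum)
      (hgen'.regular hl hne hd hsum)
    rw [(StopCurve.finite_classes_and_count_eq hl hpos hne hd hsum hgen).2,
      (StopCurve.finite_classes_and_count_eq hl hpos hne hd hsum hgen').2] at h1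
    have hK : (Nat.card (EndSymmetry d) : ℝ) ≠ 0 := by
      have : Nonempty (EndSymmetry d) := ⟨⟨Equiv.refl _, fun _ => rfl⟩⟩
      exact_mod_cast Nat.card_pos.ne'
    exact_mod_cast mul_left_cancel₀ hK h1
  refine ⟨1, one_pos, ε, by positivity, (min_le_right _ _).trans_lt (by norm_num), ?_⟩
  -- If no general points lie in the thin cone, then there is nothing to count.
  by_cases hex : ∃ A₀ : Fin l → (Fin 2 → ℚ),
      IsGeneral Δ (ratPoint p) (fun i => ratPoint (A₀ i)) ∧
      (fun q : Fin l × Fin 2 => ratPoint (A₀ q.1) q.2 - ratPoint p q.2) ∈ thinCone l v δ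
  · obtain ⟨A₀, hgen₀, hA₀⟩ := hex
    exact ⟨StopCurve.count Δ (ratPoint p) (fun i => ratPoint (A₀ i)),
      fun a θ ha _ hθ A hgen hA =>
        ⟨(StopCurve.finite_classes_and_count_eq hl hpos hne hd hsum hgen).1,
          hconst A A₀ hgen hgen₀ (key a θ ha hθ A hA) hA₀⟩⟩
  · exact ⟨0, fun a θ ha _ hθ A hgen hA => absurd ⟨A, hgen, key a θ ha hθ A hA⟩ hex⟩
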